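/- Let $(M,g)$ be a compact connected smooth Riemannian manifold with boundary, $G$ a compact Lie group of matrices with Lie algebra $\mathfrak g$, $\langle\cdot,\cdot\rangle$ an $\mathrm{Ad}$-invariant inner product on $\mathfrak g$, and $\mathcal O\subset\mathfrak g$ an adjoint orbit that contains a basis of $\mathfrak g$. A Yang–Mills potential is a smooth $\mathfrak g$-valued $1$-form $A$ on $M$; its curvature is $F=dA+A\wedge A$, where $(A\wedge A)(v,w)=[A(v),A(w)]$. For $\xi\in\mathfrak g$ let $\mathbb F^\xi:TM\to TM$ be given by $g(\mathbb F^\xi(v),w)=\langle F(v,w),\xi\rangle$. For $\phi=(x,v,\xi)\in SM\times\mathcal O$ consider the solution $(\gamma,\xi(\cdot))$ of Wong's equations $$\nabla_{\dot\gamma}\dot\gamma=\mathbb F^{\xi}_\gamma(\dot\gamma),\qquad \dot\xi+[A(\dot\gamma),\xi]=0$$ with initial data $\phi$, and let $\ell(\phi)\in[0,\infty]$ be the time at which it exits $M$. The lens data of $A$ on a subset of $\partial_+SM\times\mathcal O$, where $\partial_+SM=\{(x,v)\in SM: x\in\partial M,\ \langle v,\nu\rangle\le 0\}$ and $\nu$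 is the outer unit normal, are the function $\ell$ and the scattering relation $\mathcal S$ taking $\phi$ to $(\gamma,\dot\gamma,\xi)(\ell(\phi))$ when $\ell(\phi)<\infty$. The boundary is strictly YM-convex at $p\in\partial M$ with respect to $(g,A)$ if $\Lambda_p(v,v)+\langle F_p(v,\nu),\xi\rangle>0$ for all $v\in S_p\partial M$ and $\xi\in\mathcal O$, where $\Lambda$ is the second fundamental form of $\partial M$. A boundary gauge is a smooth map $u:M\to G$ with $u=e$ on $\partial M$; it transforms $A$ into $A^u=u^{-1}du+u^{-1}Au$. Let $\iota:\partial M\to M$ be the inclusion. (1) Let $p\in\partial M$ and let $z=(z^1,\dots,z^n)$ be boundary normal coordinates near $p$, so that $z(p)=0$, $\partial M=\{z^n=0\}$, $z^n\ge 0$ in $M$, and $g=\sum_{i,j<n}g_{ij}\,dz^idz^j+(dz^n)^2$. (a) For every Yang–Mills potential $A$ there is a boundary gauge $u$ such that $A'=A^u$ is in normal form near $p$, i.e. $A'_n=0$ near $p$. (b) The lens data near $S_p\partial M$ and $\iota^*A$ near $p$ determine the normal derivatives of $A'$ at $p$. That is, let $A,\tilde A$ be Yang–Mills potentials such that $\partial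 M$ is strictly YM-convex at $p$ with respect to both $(g,A)$ and $(g,\tilde A)$, and let $A'=A^u$, $\tilde A'=\tilde A^{\tilde u}$ with boundary gauges $u,\tilde u$ such that $A'_n=0$ and $\tilde A'_n=0$ near $p$. If $\iota^*A=\iota^*\tilde A$ near $p$, and if $A$ and $\tilde A$ have the same lens data at all $(z,v,\xi)$ with $\xi\in\mathcal O$ and $(z,v)\in\partial_+SM$ in some neighbourhood of $S_p\partial M$, then $$\partial_n^kA'_j(p)=\partial_n^k\tilde A'_j(p)\qquad\text{for all } k\ge 0,\ j<n.$$ (2) Let $A,\tilde A$ be Yang–Mills potentials such that $\partial M$ is strictly YM-convex (at each of its points) with respect to both $(g,A)$ and $(g,\tilde A)$, they have the same lens data on $\partial_+SM\times\mathcal O$, and $\iota^*A=\iota^*\tilde A$. Then there is a boundary gauge $u$ such that $A'=A^u$ and $\tilde A$ have the same boundary jet: at every point of $\partial M$ all their partial derivatives, of all orders, agree in every chart. -/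

import Mathlib

open Set Filter Topology Bundle
open scoped Manifold ContDiff ENNReal

noncomputable section

namespace YangMills

/-! ### Compact matrix groups, their Lie algebras and adjoint orbits -/

/-- The real algebra of complex `N × N` matrices, normed by the operator norm for the sup norm on
`ℂ^N` (all norms on this finite-dimensional space are equivalent). -/
def Mat (N : ℕ) := Matrix (Fin N) (Fin N) ℂ

section Instances

attribute [local instance] Matrix.linftyOpNormedRing Matrix.linftyOpNormedAlgebra

instance (N : ℕ) : NormedRing (Mat N) :=
  inferInstanceAs (NormedRing (Matrix (Fin N) (Fin N) ℂ))

instance (N : ℕ) : NormedAlgebra ℝ (Mat N) :=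
  inferInstanceAs (NormedAlgebra ℝ (Matrix (Fin N) (Fin N) ℂ))

end Instances

instance (N : ℕ) : FiniteDimensional ℝ (Mat N) :=
  Module.Finite.equiv (LinearEquiv.refl ℝ (Matrix (Fin N) (Fin N) ℂ) :
    Matrix (Fin N) (Fin N) ℂ ≃ₗ[ℝ] Mat N)

instance (N : ℕ) : CompleteSpace (Mat N) := FiniteDimensional.complete ℝ (Mat N)

/-- If `γ` is a curve of invertible matrices with `γ 0 = 1` and derivative `X` at `0`, then `γ⁻¹`
has derivative `-X` at `0`. -/
theorem hasDerivAt_inv_curve {N : ℕ} {γ : ℝ → (Mat N)ˣ} {X : Mat N} (h1 : γ 0 = 1)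
    (h : HasDerivAt (fun t => (γ t : Mat N)) X 0) :
    HasDerivAt (fun t => ((γ t)⁻¹ : (Mat N)ˣ).val) (-X) 0 := by
  have key := (hasFDerivAt_ringInverse (𝕜 := ℝ) (γ 0)).comp_hasDerivAt (0 : ℝ) h
  refine (key.congr_deriv ?_).congr_of_eventuallyEq (Eventually.of_forall fun t => ?_)
  · rw [h1]
    simp only [inv_one, Units.val_one, neg_apply, ContinuousLinearMap.mulLeftRight_apply]
    noncomm_ring
  · simp

/-- The Lie algebra of a group `G` of matrices: the velocities at the identity of the curves in `G`
through the identity. -/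
def lieAlg {N : ℕ} (G : Subgroup (Mat N)ˣ) : Submodule ℝ (Mat N) where
  carrier := {X | ∃ γ : ℝ → (Mat N)ˣ, (∀ t, γ t ∈ G) ∧ γ 0 = 1 ∧
    HasDerivAt (fun t => (γ t : Mat N)) X 0}
  zero_mem' := ⟨fun _ => 1, fun _ => G.one_mem, rfl, hasDerivAt_const _ _⟩
  add_mem' := by
    rintro X Y ⟨γ, hγ, h1, hX⟩ ⟨δ, hδ, k1, hY⟩
    refine ⟨fun t => γ t * δ t, fun t => G.mul_mem (hγ t) (hδ t), by simp [h1, k1], ?_⟩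
    have := hX.fun_mul hY
    simpa [h1, k1] using this
  smul_mem' := by
    rintro c X ⟨γ, hγ, h1, hX⟩
    refine ⟨fun t => γ (c * t), fun t => hγ _, by simp [h1], ?_⟩
    have hc : HasDerivAt (fun t : ℝ => c * t) c 0 := by
      simpa using (hasDerivAt_id (0 : ℝ)).const_mul c
    have hX' : HasDerivAt (fun t => (γ t : Mat N)) X (c * 0) := by simpa using hX
    exact hX'.scomp (0 : ℝ) hc

theorem conj_mem_lieAlg {N : ℕ} {G : Subgroup (Mat N)ˣ} {h : (Mat N)ˣ} (hh : h ∈ G)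
    {X : Mat N} (hX : X ∈ lieAlg G) : (h : Mat N) * X * (h⁻¹ : (Mat N)ˣ).val ∈ lieAlg G := by
  obtain ⟨γ, hγ, h1, hd⟩ := hX
  refine ⟨fun t => h * γ t * h⁻¹, fun t => G.mul_mem (G.mul_mem hh (hγ t)) (G.inv_mem hh),
    by simp [h1], ?_⟩
  simpa using (hd.const_mul (h : Mat N)).mul_const ((h⁻¹ : (Mat N)ˣ).val)

theorem commutator_mem_lieAlg {N : ℕ} {G : Subgroup (Mat N)ˣ} {X Y : Mat N}
    (hX : X ∈ lieAlg G) (hY : Y ∈ lieAlg G) : X * Y - Y * X ∈ lieAlg G := by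
  obtain ⟨γ, hγ, h1, hd⟩ := hX
  have hi := hasDerivAt_inv_curve h1 hd
  have hc : HasDerivAt (fun t => (γ t : Mat N) * Y * ((γ t)⁻¹ : (Mat N)ˣ).val)
      (X * Y - Y * X) 0 := by
    have := (hd.mul_const Y).fun_mul hi
    simpa [h1, sub_eq_add_neg] using this
  have hcl : IsClosed ((lieAlg G : Submodule ℝ (Mat N)) : Set (Mat N)) :=
    Submodule.closed_of_finiteDimensional _
  refine hcl.mem_of_tendsto hc.tendsto_slope (Eventually.of_forall fun t => ?_)
  refine Submodule.smul_mem _ _ (Submodule.sub_mem _ ?_ ?_)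
  · exact conj_mem_lieAlg (hγ t) hY
  · exact conj_mem_lieAlg (hγ 0) hY

/-- The commutator on the Lie algebra. -/
def bracket {N : ℕ} {G : Subgroup (Mat N)ˣ} (X Y : lieAlg G) : lieAlg G :=
  ⟨X.1 * Y.1 - Y.1 * X.1, commutator_mem_lieAlg X.2 Y.2⟩

/-- The adjoint action of `G` on its Lie algebra. -/
def Ad {N : ℕ} {G : Subgroup (Mat N)ˣ} (h : G) (X : lieAlg G) : lieAlg G :=
  ⟨(h.1 : Mat N) * X.1 * (h.1⁻¹ : (Mat N)ˣ).val, conj_mem_lieAlg h.2 X.2⟩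

/-- The adjoint orbit of `ξ`. -/
def adjointOrbit {N : ℕ} {G : Subgroup (Mat N)ˣ} (ξ : lieAlg G) : Set (lieAlg G) :=
  Set.range fun h : G => Ad h ξ

/-- A set of elements of the Lie algebra contains a basis of the Lie algebra. -/
def ContainsBasis {N : ℕ} {G : Subgroup (Mat N)ˣ} (O : Set (lieAlg G)) : Prop :=
  ∃ b : Module.Basis (Fin (Module.finrank ℝ (lieAlg G))) ℝ (lieAlg G), Set.range b ⊆ O

/-- An `Ad`-invariant inner product on the Lie algebra of `G`. -/
structure AdInvariantInner {N : ℕ} (G : Subgroup (Mat N)ˣ) where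
  form : lieAlg G →ₗ[ℝ] lieAlg G →ₗ[ℝ] ℝ
  symm : ∀ X Y, form X Y = form Y X
  pos : ∀ X, X ≠ 0 → 0 < form X X
  ad_invariant : ∀ (h : G) (X Y : lieAlg G), form (Ad h X) (Ad h Y) = form X Y

/-! ### Geometry in charts

Manifolds with boundary are modelled on the half space `{z | 0 ≤ z 0}`, so the index `0` is the
index of the coordinate that vanishes on the boundary. -/

/-- The coordinate space `ℝⁿ`. -/
abbrev Coord (n : ℕ) := EuclideanSpace ℝ (Fin n)

/-- The `j`-th coordinate vector. -/
def basisVec {n : ℕ} (j : Fin n) : Coord n := EuclideanSpace.single j (1 : ℝ)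

section Geometry

variable {n : ℕ} [NeZero n] {M : Type*} [TopologicalSpace M]
  [ChartedSpace (EuclideanHalfSpace n) M]

/-- A smooth Riemannian metric on `M`. -/
abbrev Metric (n : ℕ) [NeZero n] (M : Type*) [TopologicalSpace M]
    [ChartedSpace (EuclideanHalfSpace n) M] [IsManifold (𝓡∂ n) ∞ M] :=
  ContMDiffRiemannianMetric (𝓡∂ n) ∞ (Coord n) (fun x : M => TangentSpace (𝓡∂ n) x)

/-- A Yang-Mills potential: a smooth 1-form on `M` with values in the Lie algebra of `G`. -/
structure Potential (n : ℕ) [NeZero n] (M : Type*) [TopologicalSpace M]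
    [ChartedSpace (EuclideanHalfSpace n) M] [IsManifold (𝓡∂ n) ∞ M]
    {N : ℕ} (G : Subgroup (Mat N)ˣ) where
  toFun : ∀ x : M, TangentSpace (𝓡∂ n) x →L[ℝ] lieAlg G
  smooth : ContMDiff (𝓡∂ n) ((𝓡∂ n).prod 𝓘(ℝ, Coord n →L[ℝ] lieAlg G)) ∞
    (fun x => TotalSpace.mk' (Coord n →L[ℝ] lieAlg G)
      (E := fun x : M => TangentSpace (𝓡∂ n) x →L[ℝ] Bundle.Trivial M (lieAlg G) x) x (toFun x))

/-- Coordinates in the chart `φ` of a tangent vector at `x`. -/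
def coords (φ : OpenPartialHomeomorph M (EuclideanHalfSpace n)) (x : M)
    (v : TangentSpace (𝓡∂ n) x) : Coord n :=
  mfderiv (𝓡∂ n) 𝓘(ℝ, Coord n) (φ.extend (𝓡∂ n)) x v

/-- The map taking `w = (wⁱ)` to the tangent vector `wⁱ ∂ᵢ` at the point with coordinates `y`. -/
def coordVec (φ : OpenPartialHomeomorph M (EuclideanHalfSpace n)) (y : Coord n) :
    Coord n →L[ℝ] TangentSpace (𝓡∂ n) ((φ.extend (𝓡∂ n)).symm y) :=
  mfderivWithin 𝓘(ℝ, Coord n) (𝓡∂ n) (φ.extend (𝓡∂ n)).symm (range (𝓡∂ n)) y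

variable [IsManifold (𝓡∂ n) ∞ M]

/-- The metric in the chart `φ`. -/
def metricIn (g : Metric n M) (φ : OpenPartialHomeomorph M (EuclideanHalfSpace n))
    (y v w : Coord n) : ℝ :=
  g.inner ((φ.extend (𝓡∂ n)).symm y) (coordVec φ y v) (coordVec φ y w)

/-- Christoffel symbols of the first kind in the chart `φ`: this is `g(∇_v V, w)`, where `∇` is the
Levi-Civita connection, and `V` has constant coordinates `v'`. -/
def christoffel (g : Metric n M) (φ : OpenPartialHomeomorph M (EuclideanHalfSpace n))
    (y v v' w : Coord n) : ℝ :=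
  (1 / 2 : ℝ) * (fderivWithin ℝ (fun z => metricIn g φ z v' w) (range (𝓡∂ n)) y v
    + fderivWithin ℝ (fun z => metricIn g φ z v w) (range (𝓡∂ n)) y v'
    - fderivWithin ℝ (fun z => metricIn g φ z v v') (range (𝓡∂ n)) y w)

variable {N : ℕ} {G : Subgroup (Mat N)ˣ}

/-- The potential in the chart `φ`. -/
def potentialIn (A : Potential n M G) (φ : OpenPartialHomeomorph M (EuclideanHalfSpace n))
    (y : Coord n) : Coord n →L[ℝ] lieAlg G :=
  (A.toFun ((φ.extend (𝓡∂ n)).symm y)).comp (coordVec φ y)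

/-- The curvature `F = dA + A ∧ A` in the chart `φ`, where `(A ∧ A)(v, w) = [A v, A w]`. -/
def curvatureIn (A : Potential n M G) (φ : OpenPartialHomeomorph M (EuclideanHalfSpace n))
    (y v w : Coord n) : lieAlg G :=
  fderivWithin ℝ (fun z => potentialIn A φ z w) (range (𝓡∂ n)) y v
    - fderivWithin ℝ (fun z => potentialIn A φ z v) (range (𝓡∂ n)) y w
    + bracket (potentialIn A φ y v) (potentialIn A φ y w)

/-- The curvature 2-form on tangent vectors at `x`. -/
def curvature (A : Potential n M G) (x : M) (v w : TangentSpace (𝓡∂ n) x) : lieAlg G :=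
  curvatureIn A (chartAt (EuclideanHalfSpace n) x) (extChartAt (𝓡∂ n) x x)
    (coords (chartAt (EuclideanHalfSpace n) x) x v)
    (coords (chartAt (EuclideanHalfSpace n) x) x w)

/-! ### The boundary -/

/-- For `x ∈ ∂M`: the vector `v ∈ T_x M` is tangent to the boundary. -/
def IsTangentToBoundary (x : M) (v : TangentSpace (𝓡∂ n) x) : Prop :=
  coords (chartAt (EuclideanHalfSpace n) x) x v 0 = 0

/-- For `x ∈ ∂M`: `ν` is the outer unit normal vector to the boundary at `x`. -/
structure IsOuterNormal (g : Metric n M) (x : M) (ν : TangentSpace (𝓡∂ n) x) : Prop where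
  unit : g.inner x ν ν = 1
  orthogonal : ∀ w, IsTangentToBoundary x w → g.inner x ν w = 0
  outward : coords (chartAt (EuclideanHalfSpace n) x) x ν 0 < 0

/-- The second fundamental form `Λ(v, w) = -g(ν, ∇_v W)` of the boundary at `x ∈ ∂M` with respect
to the outer unit normal `ν`, for `v`, `w` tangent to the boundary: here `W` is the extension of `w`
with constant coordinates, which is tangent to the boundary. -/
def secondFundamentalForm (g : Metric n M) (x : M) (ν v w : TangentSpace (𝓡∂ n) x) : ℝ :=
  -christoffel g (chartAt (EuclideanHalfSpace n) x) (extChartAt (𝓡∂ n) x x)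
    (coords (chartAt (EuclideanHalfSpace n) x) x v)
    (coords (chartAt (EuclideanHalfSpace n) x) x w)
    (coords (chartAt (EuclideanHalfSpace n) x) x ν)

/-- The set `S_x ∂M` of unit vectors tangent to the boundary at `x`, as a subset of `TM`. -/
def unitBoundaryVectors (g : Metric n M) (x : M) : Set (TangentBundle (𝓡∂ n) M) :=
  {c | ∃ v : TangentSpace (𝓡∂ n) x, c = ⟨x, v⟩ ∧ g.inner x v v = 1 ∧ IsTangentToBoundary x v}

/-- The boundary is strictly YM-convex at `x ∈ ∂M`, with respect to `(g, A)` and the orbit `O`: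
`Λ_x(v, v) + ⟨F_x(v, ν), ξ⟩ > 0` for all `v ∈ S_x ∂M` and `ξ ∈ O`. -/
def StrictlyYMConvexAt (g : Metric n M) (κ : AdInvariantInner G) (O : Set (lieAlg G))
    (A : Potential n M G) (x : M) : Prop :=
  ∀ ν : TangentSpace (𝓡∂ n) x, IsOuterNormal g x ν →
    ∀ v : TangentSpace (𝓡∂ n) x, g.inner x v v = 1 → IsTangentToBoundary x v → ∀ ξ ∈ O,
      0 < secondFundamentalForm g x ν v v + κ.form (curvature A x v ν) ξ

/-- The set `∂₊SM` of unit vectors `v` at boundary points with `⟨v, ν⟩ ≤ 0`. -/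
def inwardBoundary (g : Metric n M) : Set (TangentBundle (𝓡∂ n) M) :=
  {c | c.1 ∈ (𝓡∂ n).boundary M ∧ g.inner c.1 c.2 c.2 = 1 ∧
    ∀ ν : TangentSpace (𝓡∂ n) c.1, IsOuterNormal g c.1 ν → g.inner c.1 c.2 ν ≤ 0}

/-- `ι^*A = ι^*B` at `x ∈ ∂M`, where `ι` is the inclusion of the boundary. -/
def SamePullbackAt (A B : Potential n M G) (x : M) : Prop :=
  ∀ v : TangentSpace (𝓡∂ n) x, IsTangentToBoundary x v → A.toFun x v = B.toFun x v

/-! ### Wong's equations and the lens data -/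

/-- `(c, ξ)`, with `c = (γ, γ')` a curve in `TM`, solves Wong's equations
`∇_γ' γ' = 𝔽^ξ(γ')`, `D_γ' ξ = 0` on `[0, T]`. As `g(𝔽^ξ(v), η) = ⟨F(v, η), ξ⟩`, the first equation
is written, in every chart, as `g(∇_γ' γ', η) = ⟨F(γ', η), ξ⟩` for all `η`. -/
structure IsWongTrajectory (g : Metric n M) (κ : AdInvariantInner G) (A : Potential n M G) (T : ℝ)
    (c : ℝ → TangentBundle (𝓡∂ n) M) (ξ : ℝ → lieAlg G) : Prop where
  continuousOn : ContinuousOn c (Icc 0 T)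
  velocity : ∀ φ ∈ IsManifold.maximalAtlas (𝓡∂ n) ∞ M, ∀ t ∈ Icc 0 T, (c t).1 ∈ φ.source →
    HasDerivWithinAt (fun s => φ.extend (𝓡∂ n) (c s).1) (coords φ (c t).1 (c t).2) (Icc 0 T) t
  acceleration : ∀ φ ∈ IsManifold.maximalAtlas (𝓡∂ n) ∞ M, ∀ t ∈ Icc 0 T, (c t).1 ∈ φ.source →
    ∃ a : Coord n, HasDerivWithinAt (fun s => coords φ (c s).1 (c s).2) a (Icc 0 T) t ∧
      ∀ η : Coord n,
        metricIn g φ (φ.extend (𝓡∂ n) (c t).1) a η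
          + christoffel g φ (φ.extend (𝓡∂ n) (c t).1)
              (coords φ (c t).1 (c t).2) (coords φ (c t).1 (c t).2) η
        = κ.form (curvatureIn A φ (φ.extend (𝓡∂ n) (c t).1) (coords φ (c t).1 (c t).2) η) (ξ t)
  charge : ∀ t ∈ Icc 0 T,
    HasDerivWithinAt ξ (-bracket (A.toFun (c t).1 (c t).2) (ξ t)) (Icc 0 T) t

/-- The trajectory starting at `θ = ((x, v), ξ)` is defined (in `M`) on `[0, T]`, and has the phase
`θ'` at time `T`. -/
def Flows (g : Metric n M) (κ : AdInvariantInner G) (A : Potential n M G) (T : ℝ)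
    (θ θ' : TangentBundle (𝓡∂ n) M × lieAlg G) : Prop :=
  ∃ c ξ, IsWongTrajectory g κ A T c ξ ∧ (c 0, ξ 0) = θ ∧ (c T, ξ T) = θ'

/-- The time at which the trajectory starting at `θ` exits `M` (possibly infinite). -/
def exitTime (g : Metric n M) (κ : AdInvariantInner G) (A : Potential n M G)
    (θ : TangentBundle (𝓡∂ n) M × lieAlg G) : ℝ≥0∞ :=
  sSup {τ | ∃ T : ℝ, 0 ≤ T ∧ τ = ENNReal.ofReal T ∧ ∃ θ', Flows g κ A T θ θ'}

/-- The graph of the scattering relation: `θ'` is the phase at the (finite) exit time of the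
trajectory starting at `θ`. -/
def Scatters (g : Metric n M) (κ : AdInvariantInner G) (A : Potential n M G)
    (θ θ' : TangentBundle (𝓡∂ n) M × lieAlg G) : Prop :=
  ∃ T : ℝ, 0 ≤ T ∧ exitTime g κ A θ = ENNReal.ofReal T ∧ Flows g κ A T θ θ'

/-- `A` and `B` have the same lens data (exit times and scattering relation) on the points
`((z, v), ξ)` with `(z, v) ∈ ∂₊SM ∩ W` and `ξ ∈ O`. -/
def SameLensDataOn (g : Metric n M) (κ : AdInvariantInner G) (O : Set (lieAlg G))
    (W : Set (TangentBundle (𝓡∂ n) M)) (A B : Potential n M G) : Prop :=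
  ∀ c ∈ inwardBoundary g ∩ W, ∀ ξ ∈ O,
    exitTime g κ A (c, ξ) = exitTime g κ B (c, ξ) ∧
    ∀ θ', Scatters g κ A (c, ξ) θ' ↔ Scatters g κ B (c, ξ) θ'

/-! ### Gauges, normal coordinates and jets -/

/-- The differential of `u : M → G`, as a matrix of 1-forms. -/
def gaugeDeriv (u : M → G) (x : M) : TangentSpace (𝓡∂ n) x →L[ℝ] Mat N :=
  mfderiv (𝓡∂ n) 𝓘(ℝ, Mat N) (fun x => ((u x).1 : Mat N)) x

/-- `u : M → G` is smooth, equals the identity on `∂M`, and `A' = u⁻¹ du + u⁻¹ A u`. -/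
structure IsBoundaryGauge (u : M → G) (A A' : Potential n M G) : Prop where
  smooth : ContMDiff (𝓡∂ n) 𝓘(ℝ, Mat N) ∞ (fun x => ((u x).1 : Mat N))
  boundary : ∀ x ∈ (𝓡∂ n).boundary M, u x = 1
  transform : ∀ (x : M) (v : TangentSpace (𝓡∂ n) x),
    (A'.toFun x v : Mat N) =
      ((u x).1⁻¹ : (Mat N)ˣ).val * gaugeDeriv u x v
        + ((u x).1⁻¹ : (Mat N)ˣ).val * (A.toFun x v : Mat N) * ((u x).1 : Mat N)

/-- `φ` is a system of boundary normal coordinates near `p ∈ ∂M`: it is centred at `p`, and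
`g = (dz⁰)² + g_ij dzⁱ dzʲ` with `i`, `j` running over the nonzero indices. -/
structure IsBoundaryNormalChart (g : Metric n M) (p : M)
    (φ : OpenPartialHomeomorph M (EuclideanHalfSpace n)) : Prop where
  mem_atlas : φ ∈ IsManifold.maximalAtlas (𝓡∂ n) ∞ M
  mem_source : p ∈ φ.source
  centred : φ.extend (𝓡∂ n) p = 0
  normal : ∀ y ∈ (φ.extend (𝓡∂ n)).target, ∀ j : Fin n,
    metricIn g φ y (basisVec 0) (basisVec j) = if j = 0 then 1 else 0

/-- The normal component of `A` in the chart `φ` vanishes near `p`. -/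
def NormalComponentVanishesNear (φ : OpenPartialHomeomorph M (EuclideanHalfSpace n)) (p : M)
    (A : Potential n M G) : Prop :=
  ∀ᶠ x in 𝓝 p, potentialIn A φ (φ.extend (𝓡∂ n) x) (basisVec 0) = 0

/-- The `k`-th normal derivative at `p` of the `j`-th component of `A` in the chart `φ`. -/
def normalDeriv (φ : OpenPartialHomeomorph M (EuclideanHalfSpace n)) (p : M)
    (A : Potential n M G) (k : ℕ) (j : Fin n) : lieAlg G :=
  iteratedDerivWithin k
    (fun s : ℝ => potentialIn A φ (φ.extend (𝓡∂ n) p + s • basisVec 0) (basisVec j)) (Ici 0) 0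

/-- `A` and `B` have the same boundary jet: at every boundary point all their derivatives, of all
orders, agree in every chart. -/
def SameBoundaryJet (A B : Potential n M G) : Prop :=
  ∀ p ∈ (𝓡∂ n).boundary M, ∀ φ ∈ IsManifold.maximalAtlas (𝓡∂ n) ∞ M, p ∈ φ.source → ∀ k : ℕ,
    iteratedFDerivWithin ℝ k (potentialIn A φ) (range (𝓡∂ n)) (φ.extend (𝓡∂ n) p) =
      iteratedFDerivWithin ℝ k (potentialIn B φ) (range (𝓡∂ n)) (φ.extend (𝓡∂ n) p)

end Geometry

end YangMills

end

noncomputable section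

set_option linter.unusedSectionVars false

namespace YangMills

/-! ### Calculus on the half space -/

-- The heart is a local argument with short rays. In a chart with height x = z⁰ ≥ 0, bring two
-- potentials a, b by boundary gauges to equal normal components near p. Suppose that the normal
-- derivatives of f = a - b of order at most r vanish on the boundary near q, and that ⟨∂₀^(r+1)
-- f(v), ξ⟩ > 0 at q for some unit tangent v and some ξ ∈ O. Send in a ray from q whose velocity is
-- close to v and has small normal component ε > 0. Strict convexity pins the normal acceleration
-- between -K and -k, so the ray returns to the boundary after a time comparable to ε. Its height is
-- O(ε²) throughout and at least ε²/(4K) on a time interval of length ε/(2K) (`exists_return_time`,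
-- `exists_short_ray`).
--
-- The two Wong vector fields differ by O(x^r), because the force contains first derivatives of the
-- potential. Paired with ∂₀, the difference is at most -β x^r. Indeed the derivative of the normal
-- component of f drops out, the bracket gains a power of x, and what remains is -⟨∂₀f(v), ξ⟩
-- (`exists_wongField_sub_estimate`). Integrated along a ray, this deflection has size at least a
-- multiple of ε^(2r+1), whereas Grönwall bounds the effect of following two different rays by a
-- multiple of ε^(2r+2). For small ε the end states therefore differ (`short_rays_ne`). Equal lens
-- data force equal exit times and equal exit phases, so the pairing cannot be positive
-- (`SameBoundaryLensDataOn.not_pos`). Using both v and -v, letting v run through normalised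
-- tangential coordinate vectors and ξ through a basis contained in O, and inducting on the order,
-- every normal derivative of f vanishes on the boundary near p
-- (`SameBoundaryLensDataOn.exists_normalD_eq_zero`). Differentiation along the boundary then gives
-- the full jet (`jetZero_of_normalD`).
--
-- The normalising gauge solves ∂₀U = U b⁰ - a⁰ U along normals, with U = 1 on the boundary, where
-- a⁰ is the given and b⁰ the desired normal component. Smoothness up to the boundary comes from a
-- Volterra equation in a Banach space of curves (`exists_normal_linear_ode`). Compactness of G
-- keeps U in the group (`exists_mem_group_of_hasDerivWithinAt`). Instead of multiplying by a
-- cutoff, which would leave the group, one slides the argument of U down to the boundary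
-- (`exists_gauge_cutoff`). A gauge that is 1 on the boundary preserves the pullback and the
-- curvature there, hence convexity. It also preserves exit times from boundary phases and all
-- scattering between boundary phases.
--
-- For the global statement, each boundary point has a neighbourhood in which some gauge makes the
-- jets agree with those of the second potential, and finitely many of these cover the boundary.
-- They are glued one at a time (`exists_gauge_union`): where two successful gauges overlap, their
-- quotient relates potentials with equal jets, hence agrees with 1 to infinite order
-- (`IsBoundaryGauge.flatGauge`), and such a flat gauge changes no jet
-- (`IsBoundaryGauge.sameJetAt`). The cut-off quotient thus improves the new region without spoiling
-- the old one.

notation "𝓗[" n "]" => Set.range (modelWithCornersEuclideanHalfSpace n)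

section HalfSpace

variable {n : ℕ} [NeZero n]
variable {F : Type*} [NormedAddCommGroup F] [NormedSpace ℝ F]
variable {F' : Type*} [NormedAddCommGroup F'] [NormedSpace ℝ F']
variable {F'' : Type*} [NormedAddCommGroup F''] [NormedSpace ℝ F'']

theorem mem_half {y : Coord n} : y ∈ 𝓗[n] ↔ 0 ≤ y 0 := by
  rw [range_modelWithCornersEuclideanHalfSpace]; rfl

theorem convex_half : Convex ℝ 𝓗[n] := (𝓡∂ n).convex_range

theorem uniqueDiffOn_half : UniqueDiffOn ℝ 𝓗[n] := (𝓡∂ n).uniqueDiffOn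

theorem isClosed_half : IsClosed 𝓗[n] := (𝓡∂ n).isClosed_range

theorem basisVec_apply (i j : Fin n) : (basisVec i : Coord n) j = if j = i then 1 else 0 := by
  simp [basisVec]

@[simp] theorem basisVec_zero_zero : (basisVec 0 : Coord n) 0 = 1 := by simp [basisVec_apply]

theorem norm_basisVec (i : Fin n) : ‖(basisVec i : Coord n)‖ = 1 := by simp [basisVec]

theorem coord_eq_sum (v : Coord n) : v = ∑ i, v i • basisVec i := by
  ext j
  simp [basisVec_apply]

theorem clm_ext_basisVec {L L' : Coord n →L[ℝ] F} (h : ∀ i, L (basisVec i) = L' (basisVec i)) :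
    L = L' := by
  ext v
  rw [coord_eq_sum v]
  simp [map_sum, h]

/-- The function is smooth, up to the boundary of the half space, at the points of `T`. -/
def SmoothOn (f : Coord n → F) (T : Set (Coord n)) : Prop :=
  ∀ y ∈ T, ContDiffWithinAt ℝ ∞ f 𝓗[n] y

/-- Relatively open subsets of the half space. -/
def RelOpen (T : Set (Coord n)) : Prop := T ⊆ 𝓗[n] ∧ ∀ y ∈ T, T ∈ 𝓝[𝓗[n]] y

theorem RelOpen.inter_open {T U : Set (Coord n)} (hT : RelOpen T) (hU : IsOpen U) :
    RelOpen (T ∩ U) :=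
  ⟨fun _ h => hT.1 h.1, fun y hy =>
    inter_mem (hT.2 y hy.1) (mem_nhdsWithin_of_mem_nhds (hU.mem_nhds hy.2))⟩

theorem relOpen_half : RelOpen 𝓗[n] := ⟨Subset.rfl, fun _ _ => self_mem_nhdsWithin⟩

theorem relOpen_ball (p : Coord n) (δ : ℝ) : RelOpen (𝓗[n] ∩ Metric.ball p δ) :=
  relOpen_half.inter_open Metric.isOpen_ball

theorem RelOpen.exists_ball {T : Set (Coord n)} (hT : RelOpen T) {p : Coord n} (hp : p ∈ T) :
    ∃ δ > 0, 𝓗[n] ∩ Metric.ball p δ ⊆ T := by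
  obtain ⟨U, hU, hUT⟩ := mem_nhdsWithin_iff_exists_mem_nhds_inter.1 (hT.2 p hp)
  obtain ⟨δ, hδ, h⟩ := Metric.mem_nhds_iff.1 hU
  exact ⟨δ, hδ, fun y hy => hUT ⟨h hy.2, hy.1⟩⟩

theorem RelOpen.uniqueDiffOn {T : Set (Coord n)} (hT : RelOpen T) : UniqueDiffOn ℝ T :=
  fun y hy => (uniqueDiffOn_half y (hT.1 hy)).mono_nhds
    (by rw [nhdsWithin_le_iff]; exact hT.2 y hy)

theorem RelOpen.nhdsWithin_eq {T : Set (Coord n)} (hT : RelOpen T) {y : Coord n} (hy : y ∈ T) :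
    𝓝[T] y = 𝓝[𝓗[n]] y :=
  le_antisymm (nhdsWithin_mono _ hT.1) (nhdsWithin_le_iff.2 (hT.2 y hy))

theorem RelOpen.eventuallyEq {T : Set (Coord n)} (hT : RelOpen T) {y : Coord n} (hy : y ∈ T) :
    T =ᶠ[𝓝 y] 𝓗[n] := nhdsWithin_eq_iff_eventuallyEq.1 (hT.nhdsWithin_eq hy)

theorem SmoothOn.contDiffOn {f : Coord n → F} {T : Set (Coord n)} (hf : SmoothOn f T)
    (hT : T ⊆ 𝓗[n]) : ContDiffOn ℝ ∞ f T := fun y hy => (hf y hy).mono hT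

theorem RelOpen.smoothOn {f : Coord n → F} {T : Set (Coord n)} (hT : RelOpen T)
    (hf : ContDiffOn ℝ ∞ f T) : SmoothOn f T :=
  fun y hy => (hf y hy).mono_of_mem_nhdsWithin (hT.2 y hy)

theorem SmoothOn.mono {f : Coord n → F} {T T' : Set (Coord n)} (hf : SmoothOn f T) (h : T' ⊆ T) :
    SmoothOn f T' := fun y hy => hf y (h hy)

theorem SmoothOn.fderivWithin {f : Coord n → F} {T : Set (Coord n)} (hf : SmoothOn f T)
    (hT : T ⊆ 𝓗[n]) : SmoothOn (fun z => fderivWithin ℝ f 𝓗[n] z) T :=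
  fun y hy => (hf y hy).fderivWithin_right uniqueDiffOn_half (by simp) (hT hy)

theorem SmoothOn.clm_apply {f : Coord n → F →L[ℝ] F'} {g : Coord n → F} {T : Set (Coord n)}
    (hf : SmoothOn f T) (hg : SmoothOn g T) : SmoothOn (fun z => f z (g z)) T :=
  fun y hy => (hf y hy).clm_apply (hg y hy)

theorem smoothOn_const (c : F) (T : Set (Coord n)) : SmoothOn (fun _ => c) T :=
  fun _ _ => contDiffWithinAt_const

theorem SmoothOn.clm_comp_left {f : Coord n → F} {T : Set (Coord n)} (L : F →L[ℝ] F')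
    (hf : SmoothOn f T) : SmoothOn (fun z => L (f z)) T :=
  fun y hy => L.contDiff.contDiffAt.comp_contDiffWithinAt y (hf y hy)

theorem SmoothOn.add {f g : Coord n → F} {T : Set (Coord n)} (hf : SmoothOn f T)
    (hg : SmoothOn g T) : SmoothOn (fun z => f z + g z) T := fun y hy => (hf y hy).add (hg y hy)

theorem SmoothOn.sub {f g : Coord n → F} {T : Set (Coord n)} (hf : SmoothOn f T)
    (hg : SmoothOn g T) : SmoothOn (fun z => f z - g z) T := fun y hy => (hf y hy).sub (hg y hy)

theorem SmoothOn.continuousOn {f : Coord n → F} {T : Set (Coord n)} (hf : SmoothOn f T)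
    (hT : T ⊆ 𝓗[n]) : ContinuousOn f T := (hf.contDiffOn hT).continuousOn

theorem SmoothOn.differentiableWithinAt {f : Coord n → F} {T : Set (Coord n)} (hf : SmoothOn f T)
    {y : Coord n} (hy : y ∈ T) : DifferentiableWithinAt ℝ f 𝓗[n] y :=
  (hf y hy).differentiableWithinAt (by simp)

theorem two_le_infty : (2 : WithTop ℕ∞) ≤ ((⊤ : ℕ∞) : WithTop ℕ∞) :=
  WithTop.coe_le_coe.2 (le_top : (2 : ℕ∞) ≤ ⊤)

/-- Symmetry survives at boundary points because every point of the half space lies in the closure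
of its interior. -/
theorem second_fderivWithin_symm {f : Coord n → F} {y : Coord n}
    (hf : ContDiffWithinAt ℝ ∞ f 𝓗[n] y) (hy : y ∈ 𝓗[n]) (v w : Coord n) :
    fderivWithin ℝ (fun z => fderivWithin ℝ f 𝓗[n] z) 𝓗[n] y v w
      = fderivWithin ℝ (fun z => fderivWithin ℝ f 𝓗[n] z) 𝓗[n] y w v :=
  hf.isSymmSndFDerivWithinAt (by simpa using two_le_infty) uniqueDiffOn_half
    ((𝓡∂ n).range_subset_closure_interior hy) hy v w

theorem fderivWithin_half_apply_const {f : Coord n → F →L[ℝ] F'} {y : Coord n}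
    (hf : DifferentiableWithinAt ℝ f 𝓗[n] y) (hy : y ∈ 𝓗[n]) (c : F) (v : Coord n) :
    fderivWithin ℝ (fun z => f z c) 𝓗[n] y v = fderivWithin ℝ f 𝓗[n] y v c := by
  rw [fderivWithin_clm_apply (uniqueDiffOn_half y hy) hf (differentiableWithinAt_const c)]
  simp

/-- The derivative in the direction normal to the boundary. -/
def normalD (f : Coord n → F) (z : Coord n) : F := fderivWithin ℝ f 𝓗[n] z (basisVec 0)

theorem SmoothOn.normalD {f : Coord n → F} {T : Set (Coord n)} (hf : SmoothOn f T)
    (hT : T ⊆ 𝓗[n]) : SmoothOn (YangMills.normalD f) T :=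
  (hf.fderivWithin hT).clm_apply (smoothOn_const _ _)

theorem SmoothOn.iterate_normalD {f : Coord n → F} {T : Set (Coord n)} (hf : SmoothOn f T)
    (hT : T ⊆ 𝓗[n]) (k : ℕ) : SmoothOn (YangMills.normalD^[k] f) T := by
  induction k generalizing f with
  | zero => exact hf
  | succ k ih => exact ih (hf.normalD hT)

theorem normalD_congr {f g : Coord n → F} {T : Set (Coord n)} (hT : RelOpen T)
    (h : EqOn f g T) : EqOn (normalD f) (normalD g) T := by
  intro y hy
  rw [normalD, normalD, Filter.EventuallyEq.fderivWithin_eq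
    (mem_of_superset (hT.2 y hy) h) (h hy)]

theorem iterate_normalD_congr {f g : Coord n → F} {T : Set (Coord n)} (hT : RelOpen T)
    (h : EqOn f g T) (k : ℕ) : EqOn (normalD^[k] f) (normalD^[k] g) T := by
  induction k generalizing f g with
  | zero => exact h
  | succ k ih => exact ih (normalD_congr hT h)

theorem normalD_clm_comp {f : Coord n → F} {y : Coord n} (L : F →L[ℝ] F')
    (hf : DifferentiableWithinAt ℝ f 𝓗[n] y) (hy : y ∈ 𝓗[n]) :
    normalD (fun z => L (f z)) y = L (normalD f y) := by
  have := (L.hasFDerivAt.comp_hasFDerivWithinAt y hf.hasFDerivWithinAt).fderivWithin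
    (uniqueDiffOn_half y hy)
  rw [normalD, normalD]
  change fderivWithin ℝ (L ∘ f) _ _ _ = _
  rw [this]; rfl

theorem iterate_normalD_clm_comp {f : Coord n → F} {T : Set (Coord n)} (hT : RelOpen T)
    (L : F →L[ℝ] F') (hf : SmoothOn f T) (k : ℕ) :
    EqOn (normalD^[k] (fun z => L (f z))) (fun z => L (normalD^[k] f z)) T := by
  induction k generalizing f with
  | zero => exact fun _ _ => rfl
  | succ k ih =>
    intro y hy
    rw [Function.iterate_succ_apply, Function.iterate_succ_apply]
    rw [iterate_normalD_congr hT (g := fun z => L (normalD f z))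
      (fun z hz => normalD_clm_comp L (hf.differentiableWithinAt hz) (hT.1 hz)) k hy]
    exact ih (hf.normalD hT.1) hy

theorem iterate_normalD_sub {f g : Coord n → F} {T : Set (Coord n)} (hT : RelOpen T)
    (hf : SmoothOn f T) (hg : SmoothOn g T) (k : ℕ) :
    EqOn (normalD^[k] (fun z => f z - g z)) (fun z => normalD^[k] f z - normalD^[k] g z) T := by
  induction k generalizing f g with
  | zero => exact fun _ _ => rfl
  | succ k ih =>
    intro y hy
    simp only [Function.iterate_succ_apply]
    rw [iterate_normalD_congr hT (g := fun z => normalD f z - normalD g z) ?_ k hy]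
    · exact ih (hf.normalD hT.1) (hg.normalD hT.1) hy
    · intro z hz
      rw [normalD, fderivWithin_fun_sub (uniqueDiffOn_half z (hT.1 hz))
        (hf.differentiableWithinAt hz) (hg.differentiableWithinAt hz)]
      rfl

/-- Normal derivatives commute with the total derivative. -/
theorem iterate_normalD_fderivWithin {f : Coord n → F} {T : Set (Coord n)} (hT : RelOpen T)
    (hf : SmoothOn f T) (k : ℕ) :
    EqOn (normalD^[k] (fun z => fderivWithin ℝ f 𝓗[n] z))
      (fun z => fderivWithin ℝ (normalD^[k] f) 𝓗[n] z) T := by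
  induction k generalizing f with
  | zero => exact fun _ _ => rfl
  | succ k ih =>
    intro y hy
    simp only [Function.iterate_succ_apply]
    rw [iterate_normalD_congr hT (g := fun z => fderivWithin ℝ (normalD f) 𝓗[n] z) ?_ k hy]
    · exact ih (hf.normalD hT.1) hy
    · intro z hz
      ext v
      rw [normalD, second_fderivWithin_symm (hf z hz) (hT.1 hz)]
      rw [show normalD f = fun z => fderivWithin ℝ f 𝓗[n] z (basisVec 0) from rfl]
      rw [fderivWithin_half_apply_const
        ((hf.fderivWithin hT.1).differentiableWithinAt hz) (hT.1 hz)]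

/-- All derivatives of order `< m` vanish. -/
def JetZero (m : ℕ) (f : Coord n → F) (q : Coord n) : Prop :=
  ∀ k < m, iteratedFDerivWithin ℝ k f 𝓗[n] q = 0

/-- Currying is an isometry between derivatives of order `k + 1` of `f` and derivatives of order `k`
of its differential, so it suffices to compare norms. Inductions on the order of a jet run through
this step. -/
theorem jetZero_succ_iff {m : ℕ} {f : Coord n → F} {q : Coord n} (hq : q ∈ 𝓗[n]) :
    JetZero (m + 1) f q ↔ f q = 0 ∧ JetZero m (fun z => fderivWithin ℝ f 𝓗[n] z) q := by
  constructor
  · intro h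
    refine ⟨?_, fun k hk => ?_⟩
    · have := h 0 (by omega)
      rw [← norm_eq_zero, norm_iteratedFDerivWithin_zero, norm_eq_zero] at this
      exact this
    · rw [← norm_eq_zero, norm_iteratedFDerivWithin_fderivWithin uniqueDiffOn_half hq,
        norm_eq_zero]
      exact h _ (by omega)
  · rintro ⟨h0, h⟩ k hk
    rcases k with _ | k
    · rw [← norm_eq_zero, norm_iteratedFDerivWithin_zero, norm_eq_zero, h0]
    · rw [← norm_eq_zero, ← norm_iteratedFDerivWithin_fderivWithin uniqueDiffOn_half hq,
        norm_eq_zero]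
      exact h _ (by omega)

theorem JetZero.congr {m : ℕ} {f g : Coord n → F} {q : Coord n} (h : JetZero m f q)
    (hfg : g =ᶠ[𝓝[𝓗[n]] q] f) (hq : q ∈ 𝓗[n]) : JetZero m g q := fun k hk => by
  rw [hfg.iteratedFDerivWithin_eq (hfg.eq_of_nhdsWithin hq) k]
  exact h k hk

theorem JetZero.clm_apply_const {m : ℕ} {f : Coord n → F →L[ℝ] F'} {q : Coord n}
    (h : JetZero m f q) (hf : ContDiffWithinAt ℝ ∞ f 𝓗[n] q) (hq : q ∈ 𝓗[n]) (c : F) :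
    JetZero m (fun z => f z c) q := fun k hk => by
  have := norm_iteratedFDerivWithin_clm_apply_const (c := c) (n := k) hf uniqueDiffOn_half hq
    (by exact_mod_cast le_top)
  rw [h k hk, norm_zero, mul_zero] at this
  exact norm_le_zero_iff.1 this

theorem JetZero.clm_comp_left {m : ℕ} {f : Coord n → F} {q : Coord n}
    (h : JetZero m f q) (hf : ContDiffWithinAt ℝ ∞ f 𝓗[n] q) (hq : q ∈ 𝓗[n]) (L : F →L[ℝ] F') :
    JetZero m (fun z => L (f z)) q := fun k hk => by
  have := L.norm_iteratedFDerivWithin_comp_left (n := k) hf uniqueDiffOn_half hq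
    (by exact_mod_cast le_top)
  rw [h k hk, norm_zero, mul_zero] at this
  exact norm_le_zero_iff.1 this

/-- A function vanishing on the boundary has no derivatives along the boundary. -/
theorem fderivWithin_tangential_eq_zero {f : Coord n → F} {T : Set (Coord n)} (hT : RelOpen T)
    {q : Coord n} (hq : q ∈ T) (hq0 : q 0 = 0) (hf : DifferentiableWithinAt ℝ f 𝓗[n] q)
    (h0 : ∀ y ∈ T, y 0 = 0 → f y = 0) {v : Coord n} (hv : v 0 = 0) :
    fderivWithin ℝ f 𝓗[n] q v = 0 := by
  have hline : HasDerivAt (fun t : ℝ => q + t • v) v 0 := by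
    simpa using ((hasDerivAt_id (0 : ℝ)).smul_const v).const_add q
  have hmaps : ∀ t : ℝ, q + t • v ∈ 𝓗[n] := fun t => by
    rw [mem_half]; simp [hq0, hv]
  have h1 : HasDerivWithinAt (f ∘ fun t : ℝ => q + t • v) (fderivWithin ℝ f 𝓗[n] q v) univ 0 := by
    have hf' : HasFDerivWithinAt f (fderivWithin ℝ f 𝓗[n] q) 𝓗[n]
        ((fun t : ℝ => q + t • v) 0) := by simpa using hf.hasFDerivWithinAt
    exact hf'.comp_hasDerivWithinAt 0 hline.hasDerivWithinAt (fun t _ => hmaps t)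
  have hcont : Tendsto (fun t : ℝ => q + t • v) (𝓝 0) (𝓝[𝓗[n]] q) := by
    refine tendsto_nhdsWithin_iff.2 ⟨?_, Eventually.of_forall hmaps⟩
    simpa using hline.continuousAt.tendsto
  have h2 : (f ∘ fun t : ℝ => q + t • v) =ᶠ[𝓝 0] fun _ => 0 := by
    filter_upwards [hcont (hT.2 q hq)] with t ht
    exact h0 _ ht (by simp [hq0, hv])
  rw [hasDerivWithinAt_univ] at h1
  exact (h1.congr_of_eventuallyEq h2.symm).unique (hasDerivAt_const (0 : ℝ) (0 : F))

/-- If the normal derivatives of order `< m` vanish on the boundary, so do all derivatives of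
order `< m`. -/
theorem jetZero_of_normalD {m : ℕ} {f : Coord n → F} {T : Set (Coord n)} (hT : RelOpen T)
    (hf : SmoothOn f T) (h : ∀ k < m, ∀ y ∈ T, y 0 = 0 → normalD^[k] f y = 0)
    {q : Coord n} (hq : q ∈ T) (hq0 : q 0 = 0) : JetZero m f q := by
  induction m generalizing F with
  | zero => intro k hk; omega
  | succ m ih =>
    rw [jetZero_succ_iff (hT.1 hq)]
    -- The induction replaces `f` by its total derivative, which is why the target space is
    -- generalised. Normal derivatives commute past the total derivative. On ∂₀ this yields one more
    -- normal derivative; on a tangential vector it differentiates, along the boundary, a function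
    -- that vanishes there.
    refine ⟨h 0 (by omega) q hq hq0, ih (hf.fderivWithin hT.1) fun k hk y hy hy0 => ?_⟩
    rw [iterate_normalD_fderivWithin hT hf k hy]
    refine clm_ext_basisVec fun i => ?_
    by_cases hi : i = 0
    · subst hi
      have := h (k + 1) (by omega) y hy hy0
      rw [Function.iterate_succ_apply'] at this
      simpa [normalD] using this
    · exact fderivWithin_tangential_eq_zero hT hy hy0
        ((hf.iterate_normalD hT.1 k).differentiableWithinAt hy) (h k (by omega))
        (by simp [basisVec_apply, Ne.symm hi])

end HalfSpace

end YangMills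

end

/-! ### Jets of products, sums and composites -/

noncomputable section

set_option linter.unusedSectionVars false

namespace YangMills

section HalfSpace

variable {n : ℕ} [NeZero n]
variable {F : Type*} [NormedAddCommGroup F] [NormedSpace ℝ F]
variable {F' : Type*} [NormedAddCommGroup F'] [NormedSpace ℝ F']
variable {F'' : Type*} [NormedAddCommGroup F''] [NormedSpace ℝ F'']

theorem RelOpen.iteratedFDerivWithin_eq {T : Set (Coord n)} (hT : RelOpen T) {q : Coord n}
    (hq : q ∈ T) (f : Coord n → F) (k : ℕ) :
    iteratedFDerivWithin ℝ k f T q = iteratedFDerivWithin ℝ k f 𝓗[n] q :=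
  iteratedFDerivWithin_congr_set (hT.eventuallyEq hq) k

/-- In the Leibniz bound every term has a factor that is a derivative of `f` of order below `m`;
nothing is asked of the other function beyond smoothness. -/
theorem JetZero.bilin_left {m : ℕ} {f : Coord n → F} {g : Coord n → F'} {T : Set (Coord n)}
    {q : Coord n} (hT : RelOpen T) (B : F →L[ℝ] F' →L[ℝ] F'') (h : JetZero m f q)
    (hf : SmoothOn f T) (hg : SmoothOn g T) (hq : q ∈ T) :
    JetZero m (fun z => B (f z) (g z)) q := by
  intro k hk
  have := B.norm_iteratedFDerivWithin_le_of_bilinear (n := k) (hf.contDiffOn hT.1)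
    (hg.contDiffOn hT.1) hT.uniqueDiffOn hq (by exact_mod_cast le_top)
  rw [Finset.sum_eq_zero, mul_zero, hT.iteratedFDerivWithin_eq hq] at this
  · exact norm_le_zero_iff.1 this
  · intro i hi
    rw [hT.iteratedFDerivWithin_eq hq, h i (by have := Finset.mem_range.1 hi; omega)]
    simp

theorem JetZero.bilin_right {m : ℕ} {f : Coord n → F} {g : Coord n → F'} {T : Set (Coord n)}
    {q : Coord n} (hT : RelOpen T) (B : F' →L[ℝ] F →L[ℝ] F'') (h : JetZero m f q)
    (hf : SmoothOn f T) (hg : SmoothOn g T) (hq : q ∈ T) :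
    JetZero m (fun z => B (g z) (f z)) q :=
  JetZero.bilin_left hT B.flip h hf hg hq

theorem JetZero.add {m : ℕ} {f g : Coord n → F} {q : Coord n} (h : JetZero m f q)
    (h' : JetZero m g q) (hf : ContDiffWithinAt ℝ ∞ f 𝓗[n] q)
    (hg : ContDiffWithinAt ℝ ∞ g 𝓗[n] q) (hq : q ∈ 𝓗[n]) :
    JetZero m (fun z => f z + g z) q := fun k hk => by
  have := iteratedFDerivWithin_add_apply (i := k) (hf.of_le (by exact_mod_cast le_top))
    (hg.of_le (by exact_mod_cast le_top)) uniqueDiffOn_half hq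
  rw [h k hk, h' k hk, add_zero] at this
  exact this

theorem JetZero.neg {m : ℕ} {f : Coord n → F} {q : Coord n} (h : JetZero m f q)
    (hq : q ∈ 𝓗[n]) :
    JetZero m (fun z => - f z) q := fun k hk => by
  have := iteratedFDerivWithin_neg_apply (i := k) (f := f) uniqueDiffOn_half hq
  rw [h k hk, neg_zero] at this
  exact this

theorem JetZero.sub {m : ℕ} {f g : Coord n → F} {q : Coord n} (h : JetZero m f q)
    (h' : JetZero m g q) (hf : ContDiffWithinAt ℝ ∞ f 𝓗[n] q)
    (hg : ContDiffWithinAt ℝ ∞ g 𝓗[n] q) (hq : q ∈ 𝓗[n]) :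
    JetZero m (fun z => f z - g z) q := by
  simp only [sub_eq_add_neg]
  exact h.add (h'.neg hq) hf hg.neg hq

theorem JetZero.comp {m : ℕ} {f : Coord n → F} {τ : Coord n → Coord n} {T T' : Set (Coord n)}
    {q : Coord n} (hT : RelOpen T) (hT' : RelOpen T') (hτ : SmoothOn τ T) (hf : SmoothOn f T')
    (hmaps : MapsTo τ T T') (hq : q ∈ T) (h : JetZero m f (τ q)) :
    JetZero m (fun z => f (τ z)) q := by
  intro k hk
  -- The Faà di Bruno bound is proportional to `C`, which is 0 here. The constant `D` only has to
  -- dominate the derivatives of `τ`; the added 1 gives `D ≤ D ^ i` for `i ≥ 1`.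
  have := norm_iteratedFDerivWithin_comp_le (n := k) (hf.contDiffOn hT'.1) (hτ.contDiffOn hT.1)
    (by exact_mod_cast le_top) hT'.uniqueDiffOn hT.uniqueDiffOn hmaps hq (C := 0)
    (D := 1 + ∑ i ∈ Finset.range (k + 1), ‖iteratedFDerivWithin ℝ i τ T q‖)
    (fun i hi => by rw [hT'.iteratedFDerivWithin_eq (hmaps hq), h i (by omega), norm_zero])
    (fun i hi hi' => by
      have h0 : 0 ≤ ∑ i ∈ Finset.range (k + 1), ‖iteratedFDerivWithin ℝ i τ T q‖ :=
        Finset.sum_nonneg fun _ _ => norm_nonneg _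
      have h1 : ‖iteratedFDerivWithin ℝ i τ T q‖ ≤
          ∑ i ∈ Finset.range (k + 1), ‖iteratedFDerivWithin ℝ i τ T q‖ :=
        Finset.single_le_sum (f := fun i => ‖iteratedFDerivWithin ℝ i τ T q‖)
          (fun _ _ => norm_nonneg _) (Finset.mem_range.2 (by omega))
      calc _ ≤ 1 + ∑ i ∈ Finset.range (k + 1), ‖iteratedFDerivWithin ℝ i τ T q‖ := by linarith
        _ ≤ _ := le_self_pow₀ (by linarith) (by omega))
  rw [mul_zero, zero_mul, hT.iteratedFDerivWithin_eq hq] at this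
  exact norm_le_zero_iff.1 this

/-! ### Behaviour at the boundary -/

/-- The projection to the boundary of the half space. -/
def bdryProj (z : Coord n) : Coord n := z - z 0 • basisVec 0

@[simp] theorem bdryProj_zero (z : Coord n) : bdryProj z 0 = 0 := by simp [bdryProj]

theorem bdryProj_apply_ne (z : Coord n) {i : Fin n} (hi : i ≠ 0) : bdryProj z i = z i := by
  simp [bdryProj, basisVec_apply, hi]

theorem bdryProj_add (z : Coord n) : bdryProj z + z 0 • basisVec 0 = z := by simp [bdryProj]

/-- With the centre on the boundary, lowering the height of a point does not take it out of a half
ball. This is what allows integration along normal segments from the boundary. -/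
theorem norm_line_sub_le {p z : Coord n} (hp : p 0 = 0) {t : ℝ} (ht : 0 ≤ t) (htz : t ≤ z 0) :
    ‖bdryProj z + t • basisVec 0 - p‖ ≤ ‖z - p‖ := by
  rw [EuclideanSpace.norm_eq, EuclideanSpace.norm_eq]
  refine Real.sqrt_le_sqrt (Finset.sum_le_sum fun i _ => ?_)
  by_cases hi : i = 0
  · subst hi
    simp only [PiLp.sub_apply, PiLp.add_apply, bdryProj_zero, PiLp.smul_apply,
      basisVec_zero_zero, hp, Real.norm_eq_abs, sq_abs, smul_eq_mul]
    nlinarith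
  · simp [bdryProj_apply_ne z hi, basisVec_apply, hi]

theorem line_mem_half (z : Coord n) {t : ℝ} (ht : 0 ≤ t) :
    bdryProj z + t • basisVec 0 ∈ 𝓗[n] := by
  rw [mem_half]; simpa using ht

theorem line_mem_ball {p z : Coord n} {δ : ℝ} (hp : p 0 = 0) (hz : z ∈ Metric.ball p δ) {t : ℝ}
    (ht : 0 ≤ t) (htz : t ≤ z 0) :
    bdryProj z + t • basisVec 0 ∈ 𝓗[n] ∩ Metric.ball p δ := by
  refine ⟨line_mem_half z ht, ?_⟩
  rw [Metric.mem_ball, dist_eq_norm] at *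
  exact (norm_line_sub_le hp ht htz).trans_lt hz

theorem hasDerivWithinAt_line {f : Coord n → F} {b : Coord n} (hb : b 0 = 0) {t : ℝ}
    (hf : DifferentiableWithinAt ℝ f 𝓗[n] (b + t • basisVec 0)) :
    HasDerivWithinAt (fun s : ℝ => f (b + s • basisVec 0)) (normalD f (b + t • basisVec 0))
      (Ici 0) t := by
  have hline : HasDerivWithinAt (fun s : ℝ => b + s • (basisVec 0 : Coord n)) (basisVec 0)
      (Ici 0) t := by
    simpa using (((hasDerivAt_id t).smul_const (basisVec 0 : Coord n)).const_add b).hasDerivWithinAt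
  exact hf.hasFDerivWithinAt.comp_hasDerivWithinAt t hline
    (fun s hs => by rw [mem_half]; simpa [hb] using hs)

/-- One integration along the normal segment from the boundary gains one power of the height. The
smaller closed half ball supplies the compactness for the initial bound. -/
theorem exists_bound_of_normalD_eq_zero {r : ℕ} {f : Coord n → F} {p : Coord n} {δ δ' : ℝ}
    (hp : p 0 = 0) (hδ : δ' < δ) (hf : SmoothOn f (𝓗[n] ∩ Metric.ball p δ))
    (h : ∀ k < r, ∀ y ∈ 𝓗[n] ∩ Metric.ball p δ, y 0 = 0 → normalD^[k] f y = 0) :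
    ∃ C, 0 ≤ C ∧ ∀ z ∈ 𝓗[n] ∩ Metric.closedBall p δ', ‖f z‖ ≤ C * z 0 ^ r := by
  have hsub : 𝓗[n] ∩ Metric.closedBall p δ' ⊆ 𝓗[n] ∩ Metric.ball p δ :=
    inter_subset_inter_right _ (Metric.closedBall_subset_ball hδ)
  induction r generalizing f with
  | zero =>
    have hc : IsCompact (𝓗[n] ∩ Metric.closedBall p δ') :=
      (isCompact_closedBall p δ').inter_left isClosed_half
    obtain ⟨C, hC⟩ := hc.exists_bound_of_continuousOn
      ((hf.continuousOn inter_subset_left).mono hsub)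
    exact ⟨max C 0, le_max_right _ _, fun z hz => by simpa using Or.inl (hC z hz)⟩
  | succ r ih =>
    obtain ⟨C, hC0, hC⟩ := ih (hf.normalD inter_subset_left) fun k hk y hy hy0 => by
      have := h (k + 1) (by omega) y hy hy0
      rwa [Function.iterate_succ_apply] at this
    refine ⟨C, hC0, fun z hz => ?_⟩
    have hz0 : 0 ≤ z 0 := mem_half.1 hz.1
    have hmem : ∀ t ∈ Icc 0 (z 0),
        bdryProj z + t • basisVec 0 ∈ 𝓗[n] ∩ Metric.closedBall p δ' := fun t ht =>
      ⟨line_mem_half z ht.1, by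
        rw [Metric.mem_closedBall, dist_eq_norm]
        exact (norm_line_sub_le hp ht.1 ht.2).trans (by simpa [dist_eq_norm] using hz.2)⟩
    have key := norm_image_sub_le_of_norm_deriv_le_segment'
      (f := fun t : ℝ => f (bdryProj z + t • basisVec 0)) (a := 0) (b := z 0)
      (C := C * z 0 ^ r) (fun t ht => (hasDerivWithinAt_line (bdryProj_zero z)
        (hf.differentiableWithinAt (hsub (hmem t ht)))).mono Icc_subset_Ici_self)
      (fun t ht => by
        refine (hC _ (hmem t ⟨ht.1, ht.2.le⟩)).trans ?_
        have : (bdryProj z + t • basisVec 0 : Coord n) 0 = t := by simp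
        rw [this]
        exact mul_le_mul_of_nonneg_left (pow_le_pow_left₀ ht.1 ht.2.le r) hC0)
      (z 0) ⟨hz0, le_rfl⟩
    have hb : f (bdryProj z) = 0 := h 0 (by omega) _ (by
      simpa using hsub (hmem 0 ⟨le_rfl, hz0⟩)) (bdryProj_zero z)
    simp only [bdryProj_add, zero_smul, add_zero, hb, sub_zero] at key
    rw [pow_succ, ← mul_assoc]
    exact key

/-- Taylor's formula at the boundary as a comparison principle: with lower normal derivatives zero
there, a lower bound on the derivative of order `r` integrates `r` times along normals, which
produces the factorial. It turns the sign of a leading coefficient into a sign on a whole half ball.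
-/
theorem le_of_normalD_le {r : ℕ} {f : Coord n → ℝ} {p : Coord n} {δ β : ℝ}
    (hp : p 0 = 0) (hf : SmoothOn f (𝓗[n] ∩ Metric.ball p δ))
    (h : ∀ k < r, ∀ y ∈ 𝓗[n] ∩ Metric.ball p δ, y 0 = 0 → normalD^[k] f y = 0)
    (hβ : ∀ y ∈ 𝓗[n] ∩ Metric.ball p δ, β ≤ normalD^[r] f y) :
    ∀ z ∈ 𝓗[n] ∩ Metric.ball p δ, β / r.factorial * z 0 ^ r ≤ f z := by
  induction r generalizing f with
  | zero => intro z hz; simpa using hβ z hz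
  | succ r ih =>
    have ih' := ih (hf.normalD inter_subset_left) (fun k hk y hy hy0 => by
      have := h (k + 1) (by omega) y hy hy0
      rwa [Function.iterate_succ_apply] at this) (fun y hy => by
        have := hβ y hy
        rwa [Function.iterate_succ_apply] at this)
    intro z hz
    have hz0 : 0 ≤ z 0 := mem_half.1 hz.1
    have hmem : ∀ t ∈ Icc 0 (z 0), bdryProj z + t • basisVec 0 ∈ 𝓗[n] ∩ Metric.ball p δ :=
      fun t ht => line_mem_ball hp hz.2 ht.1 ht.2
    have hd : ∀ t ∈ Icc 0 (z 0), HasDerivWithinAt (fun t : ℝ => f (bdryProj z + t • basisVec 0))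
        (normalD f (bdryProj z + t • basisVec 0)) (Ici 0) t := fun t ht =>
      hasDerivWithinAt_line (bdryProj_zero z) (hf.differentiableWithinAt (hmem t ht))
    have hb : f (bdryProj z) = 0 := h 0 (by omega) _ (by
      simpa using hmem 0 ⟨le_rfl, hz0⟩) (bdryProj_zero z)
    have hpoly : ∀ t : ℝ, HasDerivAt (fun t : ℝ => β / (r + 1).factorial * t ^ (r + 1))
        (β / r.factorial * t ^ r) t := fun t => by
      refine ((hasDerivAt_pow (r + 1) t).const_mul (β / (r + 1).factorial)).congr_deriv ?_
      rw [Nat.factorial_succ]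
      have : (r.factorial : ℝ) ≠ 0 := by positivity
      push_cast
      field_simp
    have key := image_le_of_deriv_right_le_deriv_boundary (a := 0) (b := z 0)
      (f := fun t : ℝ => β / (r + 1).factorial * t ^ (r + 1))
      (B := fun t : ℝ => f (bdryProj z + t • basisVec 0))
      (fun t _ => (hpoly t).continuousAt.continuousWithinAt)
      (fun t _ => (hpoly t).hasDerivWithinAt) (by simp [hb])
      (fun t ht => ((hd t ht).mono Icc_subset_Ici_self).continuousWithinAt)
      (fun t ht => (hd t ⟨ht.1, ht.2.le⟩).mono (Ici_subset_Ici.2 ht.1))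
      (fun t ht => by
        have := ih' _ (hmem t ⟨ht.1, ht.2.le⟩)
        simpa using this) (x := z 0) ⟨hz0, le_rfl⟩
    simpa only [bdryProj_add] using key

end HalfSpace

end YangMills

end

/-! ### Rescaled normal segments as points of a Banach space of curves -/

noncomputable section

set_option linter.unusedSectionVars false
set_option synthInstance.maxHeartbeats 200000

namespace YangMills

section
variable {K : Type*} [TopologicalSpace K] [CompactSpace K] {X : Type*} [NormedAddCommGroup X]
  [NormedSpace ℝ X] {X' : Type*} [NormedAddCommGroup X'] [NormedSpace ℝ X']
  {F : Type*} [NormedAddCommGroup F] [NormedSpace ℝ F]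
  {G : Type*} [NormedAddCommGroup G] [NormedSpace ℝ G]

/-- The function `t ↦ B (A t) (σ t h)`. -/
def curveEval (B : G →L[ℝ] X' →L[ℝ] F) (σ : K → X →L[ℝ] X') (hσ : Continuous σ) (A : C(K, G))
    (h : X) : C(K, F) :=
  ⟨fun t => B (A t) (σ t h),
    (B.continuous.comp A.continuous).clm_apply (hσ.clm_apply continuous_const)⟩

theorem norm_curveEval_le (B : G →L[ℝ] X' →L[ℝ] F) {σ : K → X →L[ℝ] X'} (hσ : Continuous σ) 
    {C : ℝ} (hC : 0 ≤ C) (hσC : ∀ t, ‖σ t‖ ≤ C) (A : C(K, G)) (h : X) :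
    ‖curveEval B σ hσ A h‖ ≤ (‖B‖ * C) * ‖A‖ * ‖h‖ := by
  rw [ContinuousMap.norm_le _ (by positivity)]
  intro t
  refine (B.le_opNorm₂ _ _).trans ?_
  have h1 := A.norm_coe_le_norm t
  have h2 := (σ t).le_of_opNorm_le (hσC t) h
  calc _ ≤ ‖B‖ * ‖A‖ * (C * ‖h‖) := by gcongr
    _ = _ := by ring

/-- The linear map taking `A` to `h ↦ (t ↦ B (A t) (σ t h))`. -/
def curveEvalCLM (B : G →L[ℝ] X' →L[ℝ] F) (σ : K → X →L[ℝ] X') (hσ : Continuous σ)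
    (C : ℝ) (hC : 0 ≤ C) (hσC : ∀ t, ‖σ t‖ ≤ C) : C(K, G) →L[ℝ] X →L[ℝ] C(K, F) :=
  LinearMap.mkContinuous₂
    (LinearMap.mk₂ ℝ (curveEval B σ hσ) 
      (fun a b c => ContinuousMap.ext fun t => by
        change B (a t + b t) _ = B (a t) _ + B (b t) _
        rw [map_add]; rfl)
      (fun c A h => ContinuousMap.ext fun t => by
        change B (c • A t) _ = c • B (A t) _
        rw [map_smul]; rfl)
      (fun A h h' => ContinuousMap.ext fun t => by
        change B (A t) _ = B (A t) _ + B (A t) _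
        rw [map_add, map_add])
      (fun c A h => ContinuousMap.ext fun t => by
        change B (A t) _ = c • B (A t) _
        rw [map_smul, map_smul])) (‖B‖ * C) (norm_curveEval_le B hσ hC hσC)

theorem contDiffOn_curveEvalCLM (B : G →L[ℝ] X' →L[ℝ] F) (σ : K → X →L[ℝ] X') (hσ : Continuous σ)
    (C : ℝ) (hC : 0 ≤ C) (hσC : ∀ t, ‖σ t‖ ≤ C) {m : WithTop ℕ∞} {s : Set X} {f : X → C(K, G)}
    (hf : ContDiffOn ℝ m f s) : ContDiffOn ℝ m (fun x => curveEvalCLM B σ hσ C hC hσC (f x)) s :=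
  (curveEvalCLM B σ hσ C hC hσC).contDiff.comp_contDiffOn hf

end

section LinearODE

variable {n : ℕ} [NeZero n]
variable {F : Type*} [NormedAddCommGroup F] [NormedSpace ℝ F]

/-- Multiplication of the normal coordinate by `t`. -/
def scaleNormal (t : ℝ) : Coord n →L[ℝ] Coord n :=
  ContinuousLinearMap.id ℝ _ +
    (t - 1) • (EuclideanSpace.proj (0 : Fin n) : Coord n →L[ℝ] ℝ).smulRight (basisVec 0)

theorem scaleNormal_apply (t : ℝ) (z : Coord n) :
    scaleNormal t z = bdryProj z + (t * z 0) • basisVec 0 := by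
  simp only [scaleNormal, bdryProj, add_apply, smul_apply,
    ContinuousLinearMap.smulRight_apply, ContinuousLinearMap.id_apply, PiLp.proj_apply]
  module

theorem norm_scaleNormal_le {t : ℝ} (ht : t ∈ Icc (0 : ℝ) 1) (z : Coord n) :
    ‖scaleNormal t z‖ ≤ 2 * ‖z‖ := by
  have h0 : |z 0| ≤ ‖z‖ := EuclideanSpace.norm_eq z ▸ by
    refine Real.abs_le_sqrt ?_
    rw [← sq_abs, ← Real.norm_eq_abs]
    exact Finset.single_le_sum (f := fun i => ‖z i‖ ^ 2) (fun _ _ => by positivity)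
      (Finset.mem_univ 0)
  have : scaleNormal t z = z + ((t - 1) * z 0) • basisVec 0 := by
    rw [scaleNormal_apply, bdryProj]; module
  rw [this]
  calc _ ≤ ‖z‖ + |t - 1| * |z 0| := by
        refine (norm_add_le _ _).trans ?_
        rw [norm_smul, norm_basisVec, mul_one, Real.norm_eq_abs, abs_mul]
    _ ≤ ‖z‖ + 1 * ‖z‖ := by
        gcongr
        rw [abs_le]; constructor <;> linarith [ht.1, ht.2]
    _ = _ := by ring

theorem continuous_scaleNormal (z : Coord n) : Continuous fun t : ℝ => scaleNormal t z := by
  simp only [scaleNormal_apply]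
  fun_prop

theorem scaleNormal_one (z : Coord n) : scaleNormal 1 z = z := by
  rw [scaleNormal_apply, one_mul, bdryProj_add]

@[simp] theorem scaleNormal_apply_zero (t : ℝ) (z : Coord n) : scaleNormal t z 0 = t * z 0 := by
  simp [scaleNormal_apply]

theorem scaleNormal_scaleNormal (s t : ℝ) (z : Coord n) :
    scaleNormal s (scaleNormal t z) = scaleNormal (s * t) z := by
  simp only [scaleNormal_apply, bdryProj, PiLp.add_apply, PiLp.sub_apply, PiLp.smul_apply,
    basisVec_zero_zero, smul_eq_mul]
  module

theorem scaleNormal_of_zero (t : ℝ) {z : Coord n} (hz : z 0 = 0) : scaleNormal t z = z := by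
  rw [scaleNormal_apply, bdryProj, hz]; simp

theorem scaleNormal_mem_ball {p z : Coord n} {δ : ℝ} (hp : p 0 = 0)
    (hz : z ∈ 𝓗[n] ∩ Metric.ball p δ) {t : ℝ} (ht : t ∈ Icc (0 : ℝ) 1) :
    scaleNormal t z ∈ 𝓗[n] ∩ Metric.ball p δ := by
  have h0 := mem_half.1 hz.1
  rw [scaleNormal_apply]
  exact line_mem_ball hp hz.2 (mul_nonneg ht.1 h0) (by nlinarith [ht.2])

open Classical in
/-- The function `t ↦ f (t z⁰, z')` on the unit interval. -/
def scaleCurve (f : Coord n → F) (z : Coord n) : C(unitInterval, F) :=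
  if h : Continuous (fun t : unitInterval => f (scaleNormal t z)) then ⟨_, h⟩ else 0

/-- On a half ball where `f` is continuous the default value in `scaleCurve` is never used, since
the whole rescaled segment stays in the half ball. -/
theorem scaleCurve_apply {f : Coord n → F} {p z : Coord n} {δ : ℝ} (hp : p 0 = 0)
    (hf : ContinuousOn f (𝓗[n] ∩ Metric.ball p δ)) (hz : z ∈ 𝓗[n] ∩ Metric.ball p δ)
    (t : unitInterval) : scaleCurve f z t = f (scaleNormal t z) := by
  have : Continuous (fun t : unitInterval => f (scaleNormal t z)) :=
    hf.comp_continuous ((continuous_scaleNormal z).comp continuous_subtype_val)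
      fun t => scaleNormal_mem_ball hp hz t.2
  rw [scaleCurve, dif_pos this]
  rfl

theorem continuous_scaleNormal_clm :
    Continuous fun t : unitInterval => (scaleNormal t : Coord n →L[ℝ] Coord n) := by
  unfold scaleNormal
  fun_prop

theorem opNorm_scaleNormal_le (t : unitInterval) :
    ‖(scaleNormal t : Coord n →L[ℝ] Coord n)‖ ≤ 2 :=
  ContinuousLinearMap.opNorm_le_bound _ (by norm_num) (norm_scaleNormal_le t.2)

/-- The linear map taking `A` to `h ↦ (t ↦ A t (t h⁰, h'))`. -/
def scaleCurveDeriv : C(unitInterval, Coord n →L[ℝ] F) →L[ℝ] Coord n →L[ℝ] C(unitInterval, F) :=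
  curveEvalCLM (ContinuousLinearMap.id ℝ (Coord n →L[ℝ] F)) (fun t => scaleNormal t)
    continuous_scaleNormal_clm 2 (by norm_num) opNorm_scaleNormal_le

theorem scaleCurveDeriv_apply (A : C(unitInterval, Coord n →L[ℝ] F)) (h : Coord n)
    (t : unitInterval) : scaleCurveDeriv A h t = A t (scaleNormal t h) := rfl

/-- Differentiability into the sup norm needs a remainder uniform in `t`. All rescaled points stay
in one compact half ball, on which the differential of `f` is uniformly continuous. -/
theorem hasFDerivWithinAt_scaleCurve {f : Coord n → F} {p z : Coord n} {δ : ℝ} (hp : p 0 = 0)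
    (hf : SmoothOn f (𝓗[n] ∩ Metric.ball p δ)) (hz : z ∈ 𝓗[n] ∩ Metric.ball p δ) :
    HasFDerivWithinAt (scaleCurve f)
      (scaleCurveDeriv (scaleCurve (fun w => fderivWithin ℝ f 𝓗[n] w) z)) 
      (𝓗[n] ∩ Metric.ball p δ) z := by
  set T := 𝓗[n] ∩ Metric.ball p δ with hT
  have hTo : RelOpen T := relOpen_ball p δ
  have hdf := hf.fderivWithin hTo.1
  obtain ⟨δ', hδ'z, hδ'⟩ := exists_between (Metric.mem_ball.1 hz.2)
  set K := 𝓗[n] ∩ Metric.closedBall p δ'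
  have hKT : K ⊆ T := inter_subset_inter_right _ (Metric.closedBall_subset_ball hδ')
  have hK : IsCompact K := (isCompact_closedBall p δ').inter_left isClosed_half
  have hKc : Convex ℝ K := convex_half.inter (convex_closedBall p δ')
  have huc := hK.uniformContinuousOn_of_continuous ((hdf.continuousOn hTo.1).mono hKT)
  have hKσ : ∀ w ∈ 𝓗[n], dist w p < δ' → ∀ t ∈ Icc (0 : ℝ) 1, scaleNormal t w ∈ K := by
    intro w hw hwd t ht
    have := scaleNormal_mem_ball hp ⟨hw, Metric.mem_ball.2 hwd⟩ ht
    exact ⟨this.1, Metric.ball_subset_closedBall this.2⟩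
  rw [hasFDerivWithinAt_iff_isLittleO, Asymptotics.isLittleO_iff]
  intro ε hε
  obtain ⟨η, hη, hηK⟩ := Metric.uniformContinuousOn_iff.1 huc (ε / 2) (by positivity)
  have hev : ∀ᶠ w in 𝓝 z, dist w p < δ' ∧ dist w z < η / 2 :=
    ((continuous_id.dist continuous_const).continuousAt.eventually_lt
      continuousAt_const hδ'z).and (Metric.ball_mem_nhds z (by positivity))
  filter_upwards [nhdsWithin_le_nhds hev, self_mem_nhdsWithin] with w hw hwT
  rw [ContinuousMap.norm_le _ (by positivity)]
  intro t
  have e1 := scaleCurve_apply hp (hf.continuousOn hTo.1) hz t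
  have e2 := scaleCurve_apply hp (hf.continuousOn hTo.1) hwT t
  have e3 := scaleCurve_apply hp (hdf.continuousOn hTo.1) hz t
  simp only [ContinuousMap.sub_apply, e1, e2, scaleCurveDeriv_apply, e3]
  have hzK := hKσ z hz.1 hδ'z t t.2
  have hwK := hKσ w hwT.1 hw.1 t t.2
  have hconv : Convex ℝ (K ∩ Metric.ball (scaleNormal t z) η) := hKc.inter (convex_ball _ _)
  have hdist : ‖scaleNormal (t : ℝ) w - scaleNormal t z‖ ≤ 2 * ‖w - z‖ := by
    rw [← map_sub]; exact norm_scaleNormal_le t.2 _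
  have hwη : scaleNormal (t : ℝ) w ∈ Metric.ball (scaleNormal (t : ℝ) z) η := by
    rw [Metric.mem_ball, dist_eq_norm]
    have := hw.2
    rw [dist_eq_norm] at this
    linarith
  -- Mean value inequality on a convex piece of radius `η`, where the differential is within `ε / 2`
  -- of its value at the centre. The other half of `ε` is absorbed by the factor 2 in the norm of
  -- the scaling.
  have key := hconv.norm_image_sub_le_of_norm_hasFDerivWithin_le'
    (f := f) (f' := fun y => fderivWithin ℝ f 𝓗[n] y)
    (φ := fderivWithin ℝ f 𝓗[n] (scaleNormal t z)) (C := ε / 2)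
    (fun y hy => ((hf.differentiableWithinAt (hKT hy.1)).hasFDerivWithinAt).mono
      (fun x hx => hx.1.1))
    (fun y hy => by
      rw [← dist_eq_norm]
      exact (hηK y hy.1 _ hzK hy.2).le)
    ⟨hzK, Metric.mem_ball_self hη⟩ ⟨hwK, hwη⟩
  rw [← map_sub] at key hdist
  refine key.trans ?_
  calc _ ≤ ε / 2 * (2 * ‖w - z‖) := by gcongr
    _ = _ := by ring

/-- The derivative of the curve-valued map of `f` is a fixed continuous linear map applied to the
curve-valued map of the differential of `f`. Smoothness follows by induction on the order, with a
varying target space. -/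
theorem contDiffOn_scaleCurve {f : Coord n → F} {p : Coord n} {δ : ℝ} (hp : p 0 = 0)
    (hf : SmoothOn f (𝓗[n] ∩ Metric.ball p δ)) (m : ℕ) :
    ContDiffOn ℝ m (scaleCurve f) (𝓗[n] ∩ Metric.ball p δ) := by
  induction m generalizing F with
  | zero =>
    rw [Nat.cast_zero, contDiffOn_zero]
    exact fun z hz => (hasFDerivWithinAt_scaleCurve hp hf hz).continuousWithinAt
  | succ m ih =>
    rw [Nat.cast_succ, contDiffOn_succ_iff_hasFDerivWithinAt (by simp)]
    intro z hz
    refine ⟨_, by rw [insert_eq_of_mem hz]; exact self_mem_nhdsWithin, by simp, _,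
      fun x hx => hasFDerivWithinAt_scaleCurve hp hf hx, ?_⟩
    exact contDiffOn_curveEvalCLM _ _ _ _ _ _ (ih (hf.fderivWithin inter_subset_left))

end LinearODE

end YangMills

end

/-! ### Volterra equations and the linear equation along normals -/

noncomputable section

set_option linter.unusedSectionVars false

namespace YangMills

section Resolvent

variable {Y : Type*} [NormedAddCommGroup Y] [NormedSpace ℝ Y] [CompleteSpace Y]

/-- The solution of `f = y + K f`, for small `K`. -/
def resolventSol (K : Y →L[ℝ] Y) (y : Y) : Y := Ring.inverse (1 - K) y

theorem isUnit_one_sub_clm {K : Y →L[ℝ] Y} (hK : ‖K‖ < 1) : IsUnit (1 - K) :=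
  isUnit_one_sub_of_norm_lt_one hK

theorem resolventSol_eq {K : Y →L[ℝ] Y} (hK : ‖K‖ < 1) (y : Y) :
    resolventSol K y = y + K (resolventSol K y) := by
  have h := congrArg (fun L : Y →L[ℝ] Y => L y)
    (Ring.mul_inverse_cancel _ (isUnit_one_sub_clm hK))
  change resolventSol K y - K (resolventSol K y) = y at h
  rwa [sub_eq_iff_eq_add] at h

theorem eq_resolventSol {K : Y →L[ℝ] Y} (hK : ‖K‖ < 1) {y f : Y} (hf : f = y + K f) :
    f = resolventSol K y := by
  have h := congrArg (fun L : Y →L[ℝ] Y => L f)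
    (Ring.inverse_mul_cancel _ (isUnit_one_sub_clm hK))
  change Ring.inverse (1 - K) (f - K f) = f at h
  rw [show f - K f = y from sub_eq_iff_eq_add.2 hf] at h
  exact h.symm

/-- Inversion is smooth on the units of the operator algebra, so the solution inherits the
regularity of the coefficient. This takes the place of a theorem on smooth dependence of flows on
parameters. -/
theorem contDiffOn_resolventSol {X : Type*} [NormedAddCommGroup X] [NormedSpace ℝ X]
    {Z : Type*} [NormedAddCommGroup Z] [NormedSpace ℝ Z] (K : Z →L[ℝ] Y →L[ℝ] Y)
    {c : X → Z} {s : Set X} {m : WithTop ℕ∞} (hc : ContDiffOn ℝ m c s)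
    (h1 : ∀ x ∈ s, ‖K (c x)‖ < 1) (y : Y) :
    ContDiffOn ℝ m (fun x => resolventSol (K (c x)) y) s := by
  intro x hx
  have hK := K.contDiff.comp_contDiffOn hc
  obtain ⟨u, hu⟩ := isUnit_one_sub_clm (h1 x hx)
  have hi := contDiffAt_ringInverse ℝ (n := m) u
  rw [hu] at hi
  have := hi.comp_contDiffWithinAt x (contDiffWithinAt_const.sub (hK x hx))
  exact this.clm_apply contDiffWithinAt_const

end Resolvent

section Volterra

variable {F : Type*} [NormedAddCommGroup F] [NormedSpace ℝ F] [CompleteSpace F]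
  {G : Type*} [NormedAddCommGroup G] [NormedSpace ℝ G]

/-- The integrand of the Volterra operator. -/
def volterraIntegrand (B : G →L[ℝ] F →L[ℝ] F) (c : C(unitInterval, G)) (f : C(unitInterval, F))
    (s : ℝ) : F := B (c (projIcc 0 1 zero_le_one s)) (f (projIcc 0 1 zero_le_one s))

theorem continuous_volterraIntegrand (B : G →L[ℝ] F →L[ℝ] F) (c : C(unitInterval, G))
    (f : C(unitInterval, F)) : Continuous (volterraIntegrand B c f) := by
  have hp : Continuous fun s : ℝ => projIcc (0 : ℝ) 1 zero_le_one s := continuous_projIcc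
  exact (B.continuous.comp (c.continuous.comp hp)).clm_apply (f.continuous.comp hp)

theorem volterraIntegrand_intervalIntegrable (B : G →L[ℝ] F →L[ℝ] F) (c : C(unitInterval, G))
    (f : C(unitInterval, F)) (a b : ℝ) :
    IntervalIntegrable (volterraIntegrand B c f) MeasureTheory.volume a b :=
  (continuous_volterraIntegrand B c f).intervalIntegrable _ _

/-- The function `t ↦ ∫₀ᵗ c(s) f(s) ds`. -/
def volterraFun (B : G →L[ℝ] F →L[ℝ] F) (c : C(unitInterval, G)) (f : C(unitInterval, F)) :
    C(unitInterval, F) :=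
  ⟨fun t => ∫ s in (0 : ℝ)..t, volterraIntegrand B c f s,
    (intervalIntegral.continuous_primitive
      (volterraIntegrand_intervalIntegrable B c f) 0).comp continuous_subtype_val⟩

theorem volterraFun_apply (B : G →L[ℝ] F →L[ℝ] F) (c : C(unitInterval, G))
    (f : C(unitInterval, F)) (t : unitInterval) :
    volterraFun B c f t = ∫ s in (0 : ℝ)..t, volterraIntegrand B c f s := rfl

theorem norm_volterraFun_le (B : G →L[ℝ] F →L[ℝ] F) (c : C(unitInterval, G))
    (f : C(unitInterval, F)) : ‖volterraFun B c f‖ ≤ ‖B‖ * ‖c‖ * ‖f‖ := by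
  rw [ContinuousMap.norm_le _ (by positivity)]
  intro t
  have := intervalIntegral.norm_integral_le_of_norm_le_const (a := 0) (b := (t : ℝ))
    (f := volterraIntegrand B c f) (C := ‖B‖ * ‖c‖ * ‖f‖) fun s _ => by
      refine (B.le_opNorm₂ _ _).trans ?_
      gcongr
      · exact c.norm_coe_le_norm _
      · exact f.norm_coe_le_norm _
  refine this.trans (mul_le_of_le_one_right (by positivity) ?_)
  rw [sub_zero, abs_of_nonneg t.2.1]
  exact t.2.2

/-- The Volterra operator with kernel `c`. -/
def volterra (B : G →L[ℝ] F →L[ℝ] F) :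
    C(unitInterval, G) →L[ℝ] C(unitInterval, F) →L[ℝ] C(unitInterval, F) :=
  LinearMap.mkContinuous₂
    (LinearMap.mk₂ ℝ (volterraFun B)
      (fun a b f => ContinuousMap.ext fun t => by
        change volterraFun B (a + b) f t = volterraFun B a f t + volterraFun B b f t
        simp only [volterraFun_apply]
        rw [← intervalIntegral.integral_add (volterraIntegrand_intervalIntegrable B a f 0 t)
          (volterraIntegrand_intervalIntegrable B b f 0 t)]
        refine intervalIntegral.integral_congr fun s _ => ?_
        simp [volterraIntegrand])
      (fun k a f => ContinuousMap.ext fun t => by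
        change volterraFun B (k • a) f t = k • volterraFun B a f t
        simp only [volterraFun_apply]
        rw [← intervalIntegral.integral_smul]
        refine intervalIntegral.integral_congr fun s _ => ?_
        simp [volterraIntegrand])
      (fun c f g => ContinuousMap.ext fun t => by
        change volterraFun B c (f + g) t = volterraFun B c f t + volterraFun B c g t
        simp only [volterraFun_apply]
        rw [← intervalIntegral.integral_add (volterraIntegrand_intervalIntegrable B c f 0 t)
          (volterraIntegrand_intervalIntegrable B c g 0 t)]
        refine intervalIntegral.integral_congr fun s _ => ?_
        simp [volterraIntegrand])
      (fun k c f => ContinuousMap.ext fun t => by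
        change volterraFun B c (k • f) t = k • volterraFun B c f t
        simp only [volterraFun_apply]
        rw [← intervalIntegral.integral_smul]
        refine intervalIntegral.integral_congr fun s _ => ?_
        simp [volterraIntegrand]))
    ‖B‖ (norm_volterraFun_le B)

theorem norm_volterra_le (B : G →L[ℝ] F →L[ℝ] F) (c : C(unitInterval, G)) :
    ‖volterra B c‖ ≤ ‖B‖ * ‖c‖ :=
  ContinuousLinearMap.opNorm_le_bound _ (by positivity) (norm_volterraFun_le B c)

/-- The solution of `V' = c V`, `V(0) = v`, for small coefficients `c`. -/
def volterraSol (B : G →L[ℝ] F →L[ℝ] F) (v : F) (c : C(unitInterval, G)) : C(unitInterval, F) :=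
  resolventSol (volterra B c) (ContinuousMap.const _ v)

theorem volterraSol_eq {B : G →L[ℝ] F →L[ℝ] F} (v : F) {c : C(unitInterval, G)}
    (hc : ‖volterra B c‖ < 1) :
    volterraSol B v c = ContinuousMap.const _ v + volterraFun B c (volterraSol B v c) :=
  resolventSol_eq hc _

theorem eq_volterraSol {B : G →L[ℝ] F →L[ℝ] F} {v : F} {c : C(unitInterval, G)}
    (hc : ‖volterra B c‖ < 1) {f : C(unitInterval, F)}
    (hf : f = ContinuousMap.const _ v + volterraFun B c f) : f = volterraSol B v c :=
  eq_resolventSol hc hf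

theorem contDiffOn_volterraSol {X : Type*} [NormedAddCommGroup X] [NormedSpace ℝ X]
    (B : G →L[ℝ] F →L[ℝ] F) (v : F) {c : X → C(unitInterval, G)} {s : Set X} {m : WithTop ℕ∞}
    (hc : ContDiffOn ℝ m c s) (h1 : ∀ x ∈ s, ‖volterra B (c x)‖ < 1) :
    ContDiffOn ℝ m (fun x => volterraSol B v (c x)) s :=
  contDiffOn_resolventSol (volterra B) hc h1 _

end Volterra

section LinearODE

variable {n : ℕ} [NeZero n]
variable {F : Type*} [NormedAddCommGroup F] [NormedSpace ℝ F] [CompleteSpace F]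
  {G : Type*} [NormedAddCommGroup G] [NormedSpace ℝ G]

/-- Linear ordinary differential equations in the normal direction have solutions that are smooth
up to the boundary, with prescribed constant value on the boundary. -/
theorem exists_normal_linear_ode (B : G →L[ℝ] F →L[ℝ] F) {L : Coord n → G} {T : Set (Coord n)}
    (hT : RelOpen T) (hL : SmoothOn L T) {p : Coord n} (hp : p ∈ T) (hp0 : p 0 = 0) (v : F) :
    ∃ δ > 0, 𝓗[n] ∩ Metric.ball p δ ⊆ T ∧ ∃ U : Coord n → F,
      SmoothOn U (𝓗[n] ∩ Metric.ball p δ) ∧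
      (∀ z ∈ 𝓗[n] ∩ Metric.ball p δ, z 0 = 0 → U z = v) ∧
      ∀ z ∈ 𝓗[n] ∩ Metric.ball p δ, normalD U z = B (L z) (U z) := by
  obtain ⟨δ₀, hδ₀, hsub⟩ := hT.exists_ball hp
  obtain ⟨C, hC0, hC⟩ := exists_bound_of_normalD_eq_zero (r := 0) hp0
    (half_lt_self hδ₀) (hL.mono hsub) (by simp)
  -- The first bound keeps the coefficient below `C`; the second makes the Volterra operator have
  -- norm less than 1, since heights in the half ball are below `δ`.
  obtain ⟨δ, hδ, hδ1, hδ2⟩ : ∃ δ > 0, δ < δ₀ / 2 ∧ ‖B‖ * (δ * C) < 1 := by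
    have : ∀ᶠ δ in 𝓝[>] (0 : ℝ), 0 < δ ∧ δ < δ₀ / 2 ∧ ‖B‖ * (δ * C) < 1 := by
      refine (eventually_mem_nhdsWithin).and (nhdsWithin_le_nhds (Filter.Eventually.and ?_ ?_))
      · exact eventually_lt_nhds (by positivity)
      · have : Continuous fun δ : ℝ => ‖B‖ * (δ * C) := by fun_prop
        exact this.continuousAt.eventually_lt_const (by simp)
    obtain ⟨δ, h⟩ := this.exists
    exact ⟨δ, h.1, h.2.1, h.2.2⟩
  set D := 𝓗[n] ∩ Metric.ball p δ with hD
  have hDo : RelOpen D := relOpen_ball p δ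
  have hDT : D ⊆ 𝓗[n] ∩ Metric.ball p δ₀ :=
    inter_subset_inter_right _ (Metric.ball_subset_ball (by linarith))
  have hLD : SmoothOn L D := hL.mono (hDT.trans hsub)
  have hLb : ∀ z ∈ D, ‖L z‖ ≤ C := fun z hz => by
    simpa using hC z ⟨hz.1, Metric.ball_subset_closedBall
      (Metric.ball_subset_ball hδ1.le hz.2)⟩
  have hz0 : ∀ z ∈ D, z 0 < δ := fun z hz => by
    have h1 := norm_line_sub_le hp0 (z := z) (mem_half.1 hz.1) le_rfl
    rw [bdryProj_add] at h1
    have h2 := hz.2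
    rw [Metric.mem_ball, dist_eq_norm] at h2
    have h3 : |(z - p) 0| ≤ ‖z - p‖ := by
      simpa using PiLp.norm_apply_le (z - p) 0
    simp only [PiLp.sub_apply, hp0, sub_zero] at h3
    exact (le_abs_self _).trans_lt (h3.trans_lt h2)
  -- On the segment `t ↦ (t z⁰, z')` the equation becomes one on the unit interval, with the
  -- coefficient multiplied by `z⁰`. The tangential coordinates and `z⁰` are now mere parameters.
  set c : Coord n → C(unitInterval, G) := fun z => z 0 • scaleCurve L z with hc
  have hcap : ∀ z ∈ D, ∀ t, c z t = z 0 • L (scaleNormal t z) := fun z hz t => by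
    simp only [hc, ContinuousMap.smul_apply]
    rw [scaleCurve_apply hp0 (hLD.continuousOn hDo.1) hz]
  have hcn : ∀ z ∈ D, ‖volterra B (c z)‖ < 1 := fun z hz => by
    refine (norm_volterra_le B _).trans_lt (lt_of_le_of_lt ?_ hδ2)
    refine mul_le_mul_of_nonneg_left ?_ (norm_nonneg B)
    rw [ContinuousMap.norm_le _ (by positivity)]
    intro t
    rw [hcap z hz, norm_smul, Real.norm_eq_abs, abs_of_nonneg (mem_half.1 hz.1)]
    exact mul_le_mul (hz0 z hz).le (hLb _ (scaleNormal_mem_ball hp0 hz t.2)) (norm_nonneg _) hδ.le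
  set V : Coord n → C(unitInterval, F) := fun z => volterraSol B v (c z) with hV
  set U : Coord n → F := fun z => V z 1 with hU
  have hVeq : ∀ z ∈ D, ∀ t : unitInterval,
      V z t = v + ∫ s in (0 : ℝ)..t, volterraIntegrand B (c z) (V z) s := fun z hz t =>
    congrArg (fun f : C(unitInterval, F) => f t) (volterraSol_eq v (hcn z hz))
  -- the solution at `(t z⁰, z')` is the solution at time `t`
  have hscale : ∀ z ∈ D, ∀ s : unitInterval, V z s = U (scaleNormal s z) := by
    intro z hz s
    have hsz := scaleNormal_mem_ball hp0 hz s.2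
    let f : C(unitInterval, F) := ⟨fun t => V z (s * t), by fun_prop⟩
    -- Slowing the solution down by the factor `s` gives a solution of the equation belonging to the
    -- rescaled point, so uniqueness for the Volterra equation identifies the two.
    have hf : f = volterraSol B v (c (scaleNormal s z)) := by
      refine eq_volterraSol (hcn _ hsz) (ContinuousMap.ext fun t => ?_)
      change V z (s * t) = v + ∫ r in (0 : ℝ)..t, _
      rw [hVeq z hz]
      congr 1
      change ∫ r in (0 : ℝ)..(s : ℝ) * t, _ = _
      have := intervalIntegral.smul_integral_comp_mul_left (a := 0) (b := t)
        (volterraIntegrand B (c z) (V z)) (s : ℝ)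
      rw [mul_zero] at this
      rw [← this, ← intervalIntegral.integral_smul]
      refine intervalIntegral.integral_congr fun r hr => ?_
      rw [uIcc_of_le t.2.1] at hr
      have hr' : r ∈ Icc (0 : ℝ) 1 := ⟨hr.1, hr.2.trans t.2.2⟩
      have hsr : (s : ℝ) * r ∈ Icc (0 : ℝ) 1 := unitInterval.mul_mem s.2 hr'
      simp only [volterraIntegrand]
      rw [projIcc_of_mem _ hr', projIcc_of_mem _ hsr, hcap z hz, hcap _ hsz,
        scaleNormal_scaleNormal, scaleNormal_apply_zero, mul_comm r (s : ℝ), mul_smul, map_smul,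
        map_smul, map_smul]
      rfl
    have := congrArg (fun f : C(unitInterval, F) => f 1) hf
    simpa [f] using this
  have hUsm : ContDiffOn ℝ ∞ U D := by
    rw [contDiffOn_infty]
    intro m
    have hcm : ContDiffOn ℝ m c D :=
      ((EuclideanSpace.proj (0 : Fin n) : Coord n →L[ℝ] ℝ).contDiff.contDiffOn).smul
        (contDiffOn_scaleCurve hp0 hLD m)
    exact (ContinuousMap.evalCLM ℝ (1 : unitInterval)).contDiff.comp_contDiffOn
      (contDiffOn_volterraSol B v hcm hcn)
  have hUs : SmoothOn U D := hDo.smoothOn hUsm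
  have hbd : ∀ z ∈ D, z 0 = 0 → U z = v := by
    intro z hz h0
    simp only [hU]
    rw [hVeq z hz]
    have : ∀ s, volterraIntegrand B (c z) (V z) s = 0 := fun s => by
      simp [volterraIntegrand, hcap z hz, h0]
    simp [this]
  -- Differentiate `s ↦ U (scaleNormal s z)` at `s = 1` in two ways, by the integral equation and by
  -- the chain rule. Both results carry the factor `z⁰`, which cancels when positive.
  have hpos : ∀ z ∈ D, 0 < z 0 → normalD U z = B (L z) (U z) := by
    intro z hz h0
    have hint := continuous_volterraIntegrand B (c z) (V z)
    have h1 : HasDerivWithinAt (fun s : ℝ => v + ∫ r in (0 : ℝ)..s,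
        volterraIntegrand B (c z) (V z) r) (volterraIntegrand B (c z) (V z) 1) (Icc 0 1) 1 :=
      ((intervalIntegral.integral_hasDerivAt_right (hint.intervalIntegrable _ _)
        (hint.stronglyMeasurableAtFilter _ _) hint.continuousAt).const_add v).hasDerivWithinAt
    have h2 : HasDerivWithinAt (fun s : ℝ => U (scaleNormal s z))
        (volterraIntegrand B (c z) (V z) 1) (Icc 0 1) 1 := by
      refine h1.congr (fun s hs => ?_) ?_
      · rw [← hscale z hz ⟨s, hs⟩, hVeq z hz]
      · have := hscale z hz 1
        rw [hVeq z hz] at this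
        exact this.symm
    have h3 : HasDerivWithinAt (fun s : ℝ => U (scaleNormal s z))
        (fderivWithin ℝ U 𝓗[n] z (z 0 • basisVec 0)) (Icc 0 1) 1 := by
      have hd : HasDerivAt (fun s : ℝ => scaleNormal s z) (z 0 • basisVec 0) 1 := by
        simp only [scaleNormal_apply]
        simpa using (((hasDerivAt_id (1 : ℝ)).mul_const (z 0)).smul_const
          (basisVec 0 : Coord n)).const_add (bdryProj z)
      have hUd : HasFDerivWithinAt U (fderivWithin ℝ U 𝓗[n] z) 𝓗[n] (scaleNormal 1 z) := by
        rw [scaleNormal_one]; exact (hUs.differentiableWithinAt hz).hasFDerivWithinAt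
      exact hUd.comp_hasDerivWithinAt 1 hd.hasDerivWithinAt fun s hs =>
        (scaleNormal_mem_ball hp0 hz hs).1
    have h4 := (uniqueDiffOn_Icc (zero_lt_one (α := ℝ)) 1 ⟨zero_le_one, le_rfl⟩).eq_deriv _ h3 h2
    have h5 : volterraIntegrand B (c z) (V z) 1 = z 0 • B (L z) (U z) := by
      simp only [volterraIntegrand]
      rw [projIcc_of_mem _ ⟨zero_le_one, le_rfl⟩, hcap z hz]
      simp only [hU]
      rw [scaleNormal_one, map_smul]
      rfl
    rw [h5, map_smul] at h4
    exact smul_right_injective F h0.ne' h4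
  refine ⟨δ, hδ, hDT.trans hsub, U, hUs, hbd, fun z hz => ?_⟩
  rcases (mem_half.1 hz.1).lt_or_eq with h0 | h0
  · exact hpos z hz h0
  -- On the boundary the factor `z⁰` cannot be cancelled; both sides are continuous up to the
  -- boundary, so the equation passes to the limit along the inward normal.
  · have hcont : Tendsto (fun t : ℝ => z + t • (basisVec 0 : Coord n)) (𝓝[>] 0) (𝓝[𝓗[n]] z) := by
      refine tendsto_nhdsWithin_iff.2 ⟨?_, ?_⟩
      · have : Continuous fun t : ℝ => z + t • (basisVec 0 : Coord n) := by fun_prop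
        simpa using (this.tendsto 0).mono_left nhdsWithin_le_nhds
      · filter_upwards [self_mem_nhdsWithin] with t ht
        rw [mem_half]
        simpa [← h0] using (mem_Ioi.1 ht).le
    have hL' : ContinuousWithinAt (fun z => B (L z) (U z)) 𝓗[n] z :=
      ((B.continuous.continuousAt.comp_continuousWithinAt (hLD z hz).continuousWithinAt).clm_apply
        (hUs z hz).continuousWithinAt)
    have hN := ((hUs.normalD hDo.1) z hz).continuousWithinAt
    refine tendsto_nhds_unique (hN.tendsto.comp hcont) ((hL'.tendsto.comp hcont).congr' ?_)
    filter_upwards [hcont (hDo.2 z hz), self_mem_nhdsWithin] with t ht ht'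
    exact (hpos _ ht (by simpa [← h0] using ht')).symm

end LinearODE

end YangMills

end

noncomputable section

set_option linter.unusedSectionVars false

namespace YangMills

/-! ### Charts -/

notation "ext[" φ "]" => OpenPartialHomeomorph.extend φ (modelWithCornersEuclideanHalfSpace _)

section Charts

variable {n : ℕ} [NeZero n] {M : Type*} [TopologicalSpace M]
  [ChartedSpace (EuclideanHalfSpace n) M]
variable {φ ψ : OpenPartialHomeomorph M (EuclideanHalfSpace n)}
variable {F : Type*} [NormedAddCommGroup F] [NormedSpace ℝ F]

theorem relOpen_target (φ : OpenPartialHomeomorph M (EuclideanHalfSpace n)) :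
    RelOpen (n := n) ext[φ].target := by
  refine ⟨φ.extend_target_subset_range, fun y hy => ?_⟩
  have h := φ.extend_target_mem_nhdsWithin (I := 𝓡∂ n) (y := ext[φ].symm y)
    (by simpa using ext[φ].map_target hy)
  rwa [ext[φ].right_inv hy] at h

/-- The transition map between two charts. -/
def transition (φ ψ : OpenPartialHomeomorph M (EuclideanHalfSpace n)) (y : Coord n) : Coord n :=
  ext[ψ] (ext[φ].symm y)

/-- The domain of the transition map. -/
def transDom (φ ψ : OpenPartialHomeomorph M (EuclideanHalfSpace n)) : Set (Coord n) :=
  ext[φ].target ∩ ext[φ].symm ⁻¹' ψ.source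

theorem transDom_eq (φ ψ : OpenPartialHomeomorph M (EuclideanHalfSpace n)) :
    transDom φ ψ = ((𝓡∂ n).extendCoordChange φ ψ).source := by
  rw [transDom, ModelWithCorners.extendCoordChange, PartialEquiv.trans_source,
    PartialEquiv.symm_source, ψ.extend_source]

theorem relOpen_transDom (φ ψ : OpenPartialHomeomorph M (EuclideanHalfSpace n)) :
    RelOpen (transDom φ ψ) := by
  refine ⟨fun y hy => (relOpen_target φ).1 hy.1, fun y hy => ?_⟩
  rw [transDom_eq] at *
  exact (𝓡∂ n).extendCoordChange_source_mem_nhdsWithin hy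

theorem smoothOn_transition (hφ : φ ∈ IsManifold.maximalAtlas (𝓡∂ n) ∞ M)
    (hψ : ψ ∈ IsManifold.maximalAtlas (𝓡∂ n) ∞ M) :
    SmoothOn (transition φ ψ) (transDom φ ψ) := by
  intro y hy
  rw [transDom_eq] at hy
  exact (𝓡∂ n).contDiffWithinAt_extendCoordChange hφ hψ hy

theorem transition_mem {y : Coord n} (hy : y ∈ transDom φ ψ) :
    transition φ ψ y ∈ transDom ψ φ := by
  have h : ext[φ].symm y ∈ ext[ψ].source := by rw [ψ.extend_source]; exact hy.2
  refine ⟨ext[ψ].map_source h, ?_⟩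
  simp only [mem_preimage, transition, ext[ψ].left_inv h]
  simpa using ext[φ].map_target hy.1

theorem symm_transition {y : Coord n} (hy : y ∈ transDom φ ψ) :
    ext[ψ].symm (transition φ ψ y) = ext[φ].symm y :=
  ext[ψ].left_inv (by rw [ψ.extend_source]; exact hy.2)

theorem transition_transition {y : Coord n} (hy : y ∈ transDom φ ψ) :
    transition ψ φ (transition φ ψ y) = y := by
  rw [transition, symm_transition hy, ext[φ].right_inv hy.1]

theorem mem_transDom {x : M} (hx : x ∈ φ.source) (hx' : x ∈ ψ.source) :
    ext[φ] x ∈ transDom φ ψ := by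
  have h : x ∈ ext[φ].source := by rwa [φ.extend_source]
  refine ⟨ext[φ].map_source h, ?_⟩
  rwa [mem_preimage, ext[φ].left_inv h]

theorem transition_apply {x : M} (hx : x ∈ φ.source) :
    transition φ ψ (ext[φ] x) = ext[ψ] x := by
  rw [transition, φ.extend_left_inv hx]

theorem exists_coord_of_mem_source {x : M} (hx : x ∈ φ.source) :
    ∃ y ∈ ext[φ].target, ext[φ].symm y = x :=
  ⟨ext[φ] x, ext[φ].map_source (by rwa [φ.extend_source]), φ.extend_left_inv hx⟩

theorem symm_mem_source {y : Coord n} (hy : y ∈ ext[φ].target) : ext[φ].symm y ∈ φ.source := by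
  simpa using ext[φ].map_target hy

theorem contMDiffWithinAt_symm (hφ : φ ∈ IsManifold.maximalAtlas (𝓡∂ n) ∞ M) {y : Coord n}
    (hy : y ∈ ext[φ].target) :
    ContMDiffWithinAt 𝓘(ℝ, Coord n) (𝓡∂ n) ∞ ext[φ].symm 𝓗[n] y := by
  have h := contMDiffOn_extend_symm hφ
  rw [← φ.extend_target'] at h
  exact (h y hy).mono_of_mem_nhdsWithin ((relOpen_target φ).2 y hy)

theorem mdifferentiableWithinAt_symm (hφ : φ ∈ IsManifold.maximalAtlas (𝓡∂ n) ∞ M) {y : Coord n}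
    (hy : y ∈ ext[φ].target) :
    MDifferentiableWithinAt 𝓘(ℝ, Coord n) (𝓡∂ n) ext[φ].symm 𝓗[n] y :=
  (contMDiffWithinAt_symm hφ hy).mdifferentiableWithinAt (by simp)

theorem mdifferentiableAt_ext (hφ : φ ∈ IsManifold.maximalAtlas (𝓡∂ n) ∞ M) {x : M}
    (hx : x ∈ φ.source) : MDifferentiableAt (𝓡∂ n) 𝓘(ℝ, Coord n) ext[φ] x :=
  (φ.contMDiffAt_extend hφ hx).mdifferentiableAt (by simp)

theorem uniqueMDiffWithinAt_half {y : Coord n} (hy : y ∈ 𝓗[n]) :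
    UniqueMDiffWithinAt 𝓘(ℝ, Coord n) 𝓗[n] y := (uniqueDiffOn_half y hy).uniqueMDiffWithinAt

theorem coords_coordVec (hφ : φ ∈ IsManifold.maximalAtlas (𝓡∂ n) ∞ M) {y : Coord n}
    (hy : y ∈ ext[φ].target) (w : Coord n) :
    coords φ (ext[φ].symm y) (coordVec φ y w) = w := by
  have hyH := (relOpen_target φ).1 hy
  have U := uniqueMDiffWithinAt_half hyH
  have h1 := mfderiv_comp_mfderivWithin (x := y) (s := 𝓗[n])
    (mdifferentiableAt_ext hφ (symm_mem_source hy)) (mdifferentiableWithinAt_symm hφ hy) U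
  have h2 : mfderivWithin 𝓘(ℝ, Coord n) 𝓘(ℝ, Coord n) (ext[φ] ∘ ext[φ].symm) 𝓗[n] y =
      mfderivWithin 𝓘(ℝ, Coord n) 𝓘(ℝ, Coord n) id 𝓗[n] y := by
    apply Filter.EventuallyEq.mfderivWithin_eq
    · filter_upwards [(relOpen_target φ).2 y hy] with z hz
      exact ext[φ].right_inv hz
    · exact ext[φ].right_inv hy
  rw [mfderivWithin_id U] at h2
  have h3 := congrArg (fun L : Coord n →L[ℝ] Coord n => L w) (h1.symm.trans h2)
  exact h3

theorem coordVec_coords (hφ : φ ∈ IsManifold.maximalAtlas (𝓡∂ n) ∞ M) {y : Coord n}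
    (hy : y ∈ ext[φ].target) (v : TangentSpace (𝓡∂ n) (ext[φ].symm y)) :
    coordVec φ y (coords φ (ext[φ].symm y) v) = v := by
  have hinj : Function.Injective (coords φ (ext[φ].symm y)) := by
    -- The chain rule has given a right inverse of this endomorphism; in finite dimension
    -- surjectivity implies injectivity, so it is two-sided.
    let L : Coord n →L[ℝ] Coord n := mfderiv (𝓡∂ n) 𝓘(ℝ, Coord n) ext[φ] (ext[φ].symm y)
    have hs : Function.Surjective L.toLinearMap := fun w => ⟨coordVec φ y w,
      coords_coordVec hφ hy w⟩
    have hi : Function.Injective L.toLinearMap := LinearMap.injective_iff_surjective.2 hs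
    exact hi
  exact hinj (coords_coordVec hφ hy _)

/-- The derivative of a function on `M`, in coordinates. -/
theorem fderivWithin_comp_symm (hφ : φ ∈ IsManifold.maximalAtlas (𝓡∂ n) ∞ M) {y : Coord n}
    (hy : y ∈ ext[φ].target) {f : M → F}
    (hf : MDifferentiableAt (𝓡∂ n) 𝓘(ℝ, F) f (ext[φ].symm y)) (w : Coord n) :
    fderivWithin ℝ (fun z => f (ext[φ].symm z)) 𝓗[n] y w =
      mfderiv (𝓡∂ n) 𝓘(ℝ, F) f (ext[φ].symm y) (coordVec φ y w) := by
  have U := uniqueMDiffWithinAt_half ((relOpen_target φ).1 hy)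
  have h1 := mfderiv_comp_mfderivWithin (x := y) (s := 𝓗[n]) hf
    (mdifferentiableWithinAt_symm hφ hy) U
  rw [mfderivWithin_eq_fderivWithin] at h1
  exact congrArg (fun L : Coord n →L[ℝ] F => L w) h1

theorem mfderiv_eq_coords (hφ : φ ∈ IsManifold.maximalAtlas (𝓡∂ n) ∞ M) {x : M}
    (hx : x ∈ φ.source) {f : M → F} (hf : MDifferentiableAt (𝓡∂ n) 𝓘(ℝ, F) f x)
    (v : TangentSpace (𝓡∂ n) x) :
    mfderiv (𝓡∂ n) 𝓘(ℝ, F) f x v =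
      fderivWithin ℝ (fun z => f (ext[φ].symm z)) 𝓗[n] (ext[φ] x) (coords φ x v) := by
  obtain ⟨y, hy, rfl⟩ := exists_coord_of_mem_source hx
  rw [ext[φ].right_inv hy, fderivWithin_comp_symm hφ hy hf, coordVec_coords hφ hy]

/-- The law of transformation of the coordinates of a tangent vector. -/
theorem coords_transition (hφ : φ ∈ IsManifold.maximalAtlas (𝓡∂ n) ∞ M)
    (hψ : ψ ∈ IsManifold.maximalAtlas (𝓡∂ n) ∞ M) {x : M} (hx : x ∈ φ.source)
    (hx' : x ∈ ψ.source) (v : TangentSpace (𝓡∂ n) x) :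
    coords ψ x v = fderivWithin ℝ (transition φ ψ) 𝓗[n] (ext[φ] x) (coords φ x v) :=
  mfderiv_eq_coords hφ hx (mdifferentiableAt_ext hψ hx') v

theorem coordVec_transition (hφ : φ ∈ IsManifold.maximalAtlas (𝓡∂ n) ∞ M)
    (hψ : ψ ∈ IsManifold.maximalAtlas (𝓡∂ n) ∞ M) {y : Coord n} (hy : y ∈ transDom φ ψ)
    (w : Coord n) :
    coords ψ (ext[φ].symm y) (coordVec φ y w) = fderivWithin ℝ (transition φ ψ) 𝓗[n] y w := by
  rw [coords_transition hφ hψ (symm_mem_source hy.1) hy.2, ext[φ].right_inv hy.1,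
    coords_coordVec hφ hy.1]

theorem fderivWithin_transition_comp (hφ : φ ∈ IsManifold.maximalAtlas (𝓡∂ n) ∞ M)
    (hψ : ψ ∈ IsManifold.maximalAtlas (𝓡∂ n) ∞ M) {y : Coord n} (hy : y ∈ transDom φ ψ)
    (w : Coord n) :
    fderivWithin ℝ (transition ψ φ) 𝓗[n] (transition φ ψ y)
      (fderivWithin ℝ (transition φ ψ) 𝓗[n] y w) = w := by
  rw [← coordVec_transition hφ hψ hy]
  have h := coords_transition hψ hφ hy.2 (symm_mem_source hy.1) (coordVec φ y w)
  rw [coords_coordVec hφ hy.1] at h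
  exact h.symm

/-! ### The boundary in charts -/

/-- If a boundary point were sent to the interior, the height pulled back by the inverse transition
would have an interior minimum there. Its differential would vanish, contradicting invertibility of
the Jacobian. -/
theorem transition_zero_eq_zero (hφ : φ ∈ IsManifold.maximalAtlas (𝓡∂ n) ∞ M)
    (hψ : ψ ∈ IsManifold.maximalAtlas (𝓡∂ n) ∞ M) {y : Coord n} (hy : y ∈ transDom φ ψ)
    (hy0 : y 0 = 0) : transition φ ψ y 0 = 0 := by
  by_contra hne
  set q := transition φ ψ y with hq
  have hqd := transition_mem hy
  have hqpos : 0 < q 0 := lt_of_le_of_ne (mem_half.1 ((relOpen_transDom ψ φ).1 hqd)) (Ne.symm hne)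
  have hHn : 𝓗[n] ∈ 𝓝 q := by
    have : {z : Coord n | 0 < z 0} ∈ 𝓝 q :=
      (isOpen_lt continuous_const
        (EuclideanSpace.proj (0 : Fin n) : Coord n →L[ℝ] ℝ).continuous).mem_nhds hqpos
    exact mem_of_superset this fun z hz => mem_half.2 (le_of_lt hz)
  have hmin : IsLocalMin (fun z => transition ψ φ z 0) q := by
    have hT := (relOpen_transDom ψ φ).2 q hqd
    rw [nhdsWithin_eq_nhds.2 hHn] at hT
    filter_upwards [hT] with z hz
    rw [hq, transition_transition hy, hy0]
    exact mem_half.1 ((relOpen_transDom φ ψ).1 (transition_mem hz))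
  have hd : HasFDerivAt (transition ψ φ) (fderivWithin ℝ (transition ψ φ) 𝓗[n] q) q :=
    ((smoothOn_transition hψ hφ).differentiableWithinAt hqd).hasFDerivWithinAt.hasFDerivAt hHn
  have h0 := hmin.hasFDerivAt_eq_zero
    ((EuclideanSpace.proj (0 : Fin n) : Coord n →L[ℝ] ℝ).hasFDerivAt.comp q hd)
  have h1 := congrArg (fun L : Coord n →L[ℝ] ℝ =>
    L (fderivWithin ℝ (transition φ ψ) 𝓗[n] y (basisVec 0))) h0
  simp only [ContinuousLinearMap.comp_apply] at h1
  rw [hq, fderivWithin_transition_comp hφ hψ hy] at h1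
  simp at h1

/-- The boundary is defined through the preferred chart at each point; invariance under transition
maps frees the criterion from that choice. -/
theorem mem_boundary_iff [IsManifold (𝓡∂ n) ∞ M] (hφ : φ ∈ IsManifold.maximalAtlas (𝓡∂ n) ∞ M)
    {x : M} (hx : x ∈ φ.source) : x ∈ (𝓡∂ n).boundary M ↔ ext[φ] x 0 = 0 := by
  have hc := IsManifold.chart_mem_maximalAtlas (I := 𝓡∂ n) (n := ∞) x
  have h0 : x ∈ (𝓡∂ n).boundary M ↔ ext[chartAt (EuclideanHalfSpace n) x] x 0 = 0 := by
    change extChartAt (𝓡∂ n) x x ∈ frontier 𝓗[n] ↔ _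
    rw [frontier_range_modelWithCornersEuclideanHalfSpace]
    exact eq_comm
  rw [h0]
  have hxc := mem_chart_source (EuclideanHalfSpace n) x
  constructor
  · intro h
    have := transition_zero_eq_zero hc hφ (mem_transDom hxc hx) h
    rwa [transition_apply hxc] at this
  · intro h
    have := transition_zero_eq_zero hφ hc (mem_transDom hx hxc) h
    rwa [transition_apply hx] at this

/-- Only the ray `q + t v` with `t ≥ 0` is known to stay in the half space, so the sign is read from
right-hand slopes. -/
theorem half_inward_deriv_nonneg {f : Coord n → ℝ} {T : Set (Coord n)} (hT : RelOpen T)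
    {q : Coord n} (hq : q ∈ T) (hf : DifferentiableWithinAt ℝ f 𝓗[n] q)
    (h0 : f q = 0) (h : ∀ z ∈ T, 0 ≤ f z) {v : Coord n} (hv : 0 ≤ v 0) :
    0 ≤ fderivWithin ℝ f 𝓗[n] q v := by
  have hqH := hT.1 hq
  have hline : HasDerivWithinAt (fun t : ℝ => q + t • v) v (Ici 0) 0 := by
    simpa using (((hasDerivAt_id (0 : ℝ)).smul_const v).const_add q).hasDerivWithinAt
  have hmaps : MapsTo (fun t : ℝ => q + t • v) (Ici 0) 𝓗[n] := fun t ht => by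
    rw [mem_half]
    have := mul_nonneg (mem_Ici.1 ht) hv
    have := mem_half.1 hqH
    simp
    positivity
  have h1 : HasDerivWithinAt (f ∘ fun t : ℝ => q + t • v) (fderivWithin ℝ f 𝓗[n] q v) (Ici 0) 0 := by
    have hf' : HasFDerivWithinAt f (fderivWithin ℝ f 𝓗[n] q) 𝓗[n]
        ((fun t : ℝ => q + t • v) 0) := by simpa using hf.hasFDerivWithinAt
    exact hf'.comp_hasDerivWithinAt 0 hline hmaps
  have hcont : Tendsto (fun t : ℝ => q + t • v) (𝓝[Ici 0] 0) (𝓝[𝓗[n]] q) := by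
    refine tendsto_nhdsWithin_iff.2 ⟨?_, eventually_mem_nhdsWithin.mono hmaps⟩
    simpa using hline.continuousWithinAt.tendsto
  have h2 := hasDerivWithinAt_iff_tendsto_slope.1 h1
  have hle : Ici (0 : ℝ) \ {0} = Ioi 0 := by
    ext t; simp [lt_iff_le_and_ne, eq_comm]
  rw [hle] at h2
  refine ge_of_tendsto h2 ?_
  filter_upwards [nhdsWithin_mono _ Ioi_subset_Ici_self (hcont (hT.2 q hq)),
    self_mem_nhdsWithin] with t ht ht'
  rw [slope_def_field]
  have : f (q + t • v) ≥ 0 := h _ ht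
  simp only [Function.comp_apply, zero_smul, add_zero, h0, sub_zero]
  exact div_nonneg this (le_of_lt ht')

/-- Transition maps preserve the tangent spaces of the boundary, and inward vectors. -/
theorem exists_transition_normal (hφ : φ ∈ IsManifold.maximalAtlas (𝓡∂ n) ∞ M)
    (hψ : ψ ∈ IsManifold.maximalAtlas (𝓡∂ n) ∞ M) {y : Coord n} (hy : y ∈ transDom φ ψ)
    (hy0 : y 0 = 0) :
    ∃ c : ℝ, 0 < c ∧ ∀ w, fderivWithin ℝ (transition φ ψ) 𝓗[n] y w 0 = c * w 0 := by
  set T := fderivWithin ℝ (transition φ ψ) 𝓗[n] y with hT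
  have hyH := (relOpen_transDom φ ψ).1 hy
  have hd := (smoothOn_transition hφ hψ).differentiableWithinAt hy
  have hfd : fderivWithin ℝ (fun z => transition φ ψ z 0) 𝓗[n] y =
      (EuclideanSpace.proj (0 : Fin n) : Coord n →L[ℝ] ℝ).comp T :=
    ((EuclideanSpace.proj (0 : Fin n) : Coord n →L[ℝ] ℝ).hasFDerivAt.comp_hasFDerivWithinAt y
      hd.hasFDerivWithinAt).fderivWithin (uniqueDiffOn_half y hyH)
  have hd0 : DifferentiableWithinAt ℝ (fun z => transition φ ψ z 0) 𝓗[n] y :=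
    ((EuclideanSpace.proj (0 : Fin n) : Coord n →L[ℝ] ℝ).hasFDerivAt.comp_hasFDerivWithinAt y
      hd.hasFDerivWithinAt).differentiableWithinAt
  have hnn : ∀ v : Coord n, 0 ≤ v 0 → 0 ≤ T v 0 := fun v hv => by
    have := half_inward_deriv_nonneg (relOpen_transDom φ ψ) hy hd0
      (transition_zero_eq_zero hφ hψ hy hy0)
      (fun z hz => mem_half.1 ((relOpen_transDom ψ φ).1 (transition_mem hz))) hv
    rw [hfd] at this
    exact this
  -- Tangential vectors are inward together with their negatives, which gives both inequalities.
  have htan : ∀ v : Coord n, v 0 = 0 → T v 0 = 0 := fun v hv => by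
    refine le_antisymm ?_ (hnn v hv.ge)
    have := hnn (-v) (by simp [hv])
    rw [map_neg] at this
    simpa using this
  have hform : ∀ w, T w 0 = T (basisVec 0) 0 * w 0 := fun w => by
    have h1 : T (bdryProj w) 0 = 0 := htan _ (bdryProj_zero w)
    conv_lhs => rw [← bdryProj_add w]
    rw [map_add, map_smul]
    simp [h1, mul_comm]
  -- If the constant vanished, every image under the Jacobian would be tangential, yet ∂₀ lies in
  -- the image because the Jacobian is invertible.
  refine ⟨T (basisVec 0) 0, lt_of_le_of_ne (hnn _ (by simp)) fun h0 => ?_, hform⟩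
  have hy' : transition φ ψ y 0 = 0 := transition_zero_eq_zero hφ hψ hy hy0
  have hinv := fderivWithin_transition_comp hψ hφ (transition_mem hy) (basisVec 0)
  rw [transition_transition hy, ← hT] at hinv
  have := hform (fderivWithin ℝ (transition ψ φ) 𝓗[n] (transition φ ψ y) (basisVec 0))
  rw [hinv, ← h0] at this
  simp at this

variable [IsManifold (𝓡∂ n) ∞ M]

theorem exists_coords_chartAt (hφ : φ ∈ IsManifold.maximalAtlas (𝓡∂ n) ∞ M) {x : M}
    (hx : x ∈ φ.source) (hxb : x ∈ (𝓡∂ n).boundary M) :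
    ∃ c : ℝ, 0 < c ∧ ∀ v : TangentSpace (𝓡∂ n) x,
      coords (chartAt (EuclideanHalfSpace n) x) x v 0 = c * coords φ x v 0 := by
  have hc := IsManifold.chart_mem_maximalAtlas (I := 𝓡∂ n) (n := ∞) x
  have hxc := mem_chart_source (EuclideanHalfSpace n) x
  obtain ⟨c, hc0, h⟩ := exists_transition_normal hφ hc (mem_transDom hx hxc)
    ((mem_boundary_iff hφ hx).1 hxb)
  exact ⟨c, hc0, fun v => by rw [coords_transition hφ hc hx hxc, h]⟩

theorem isTangentToBoundary_iff (hφ : φ ∈ IsManifold.maximalAtlas (𝓡∂ n) ∞ M) {x : M}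
    (hx : x ∈ φ.source) (hxb : x ∈ (𝓡∂ n).boundary M) (v : TangentSpace (𝓡∂ n) x) :
    IsTangentToBoundary x v ↔ coords φ x v 0 = 0 := by
  obtain ⟨c, hc0, h⟩ := exists_coords_chartAt hφ hx hxb
  rw [IsTangentToBoundary, h]
  simp [hc0.ne']

end Charts

end YangMills

end

/-! ### Potential, curvature, metric and Christoffel symbols under change of chart -/

noncomputable section

set_option linter.unusedSectionVars false

namespace YangMills

section Algebra

variable {N : ℕ} {G : Subgroup (Mat N)ˣ}

/-- The commutator as a continuous bilinear map. -/
def bracketL (G : Subgroup (Mat N)ˣ) : lieAlg G →L[ℝ] lieAlg G →L[ℝ] lieAlg G :=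
  LinearMap.mkContinuous₂
    (LinearMap.mk₂ ℝ (bracket (G := G))
      (fun _ _ _ => Subtype.ext (by simp [bracket]; noncomm_ring))
      (fun c _ _ => Subtype.ext (by simp [bracket, smul_sub]))
      (fun _ _ _ => Subtype.ext (by simp [bracket]; noncomm_ring))
      (fun c _ _ => Subtype.ext (by simp [bracket, smul_sub])))
    2 (fun X Y => by
      change ‖(X : Mat N) * Y - Y * X‖ ≤ 2 * ‖(X : Mat N)‖ * ‖(Y : Mat N)‖
      calc _ ≤ ‖(X : Mat N) * Y‖ + ‖(Y : Mat N) * X‖ := norm_sub_le _ _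
        _ ≤ ‖(X : Mat N)‖ * ‖(Y : Mat N)‖ + ‖(Y : Mat N)‖ * ‖(X : Mat N)‖ :=
          add_le_add (norm_mul_le _ _) (norm_mul_le _ _)
        _ = _ := by ring)

theorem bracketL_apply (X Y : lieAlg G) : bracketL G X Y = bracket X Y := rfl

/-- The inner product as a continuous bilinear map. -/
def AdInvariantInner.formL (κ : AdInvariantInner G) : lieAlg G →L[ℝ] lieAlg G →L[ℝ] ℝ :=
  LinearMap.toContinuousLinearMap
    ((LinearMap.toContinuousLinearMap : (lieAlg G →ₗ[ℝ] ℝ) ≃ₗ[ℝ] _).toLinearMap ∘ₗ κ.form)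

end Algebra

section Calculus

variable {n : ℕ} [NeZero n] {N : ℕ} {G : Subgroup (Mat N)ˣ}
variable {F : Type*} [NormedAddCommGroup F] [NormedSpace ℝ F]

theorem hasFDerivWithinAt_comp_half {f : Coord n → F} {f' : Coord n →L[ℝ] F}
    {τ : Coord n → Coord n} {T : Coord n →L[ℝ] Coord n} {y : Coord n}
    (hf : HasFDerivWithinAt f f' 𝓗[n] (τ y))
    (hτ : HasFDerivWithinAt τ T 𝓗[n] y) (hmaps : ∀ᶠ z in 𝓝[𝓗[n]] y, τ z ∈ 𝓗[n]) :
    HasFDerivWithinAt (fun z => f (τ z)) (f'.comp T) 𝓗[n] y := by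
  have hS : {z | τ z ∈ 𝓗[n]} ∩ 𝓗[n] ∈ 𝓝[𝓗[n]] y := inter_mem hmaps self_mem_nhdsWithin
  have h := hf.comp y (hτ.mono (inter_subset_right (s := {z | τ z ∈ 𝓗[n]}))) (fun z hz => hz.1)
  exact h.mono_of_mem_nhdsWithin hS

theorem exists_hasFDerivWithinAt_clm_comp {E X : Type*} [NormedAddCommGroup E] [NormedSpace ℝ E]
    [NormedAddCommGroup X] [NormedSpace ℝ X] {a b : X → E →L[ℝ] F} {T : X → E →L[ℝ] E}
    {b' : X →L[ℝ] E →L[ℝ] F} {T' : X →L[ℝ] E →L[ℝ] E} {s : Set X} {x : X} (hx : x ∈ s)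
    (hb : HasFDerivWithinAt b b' s x) (hT : HasFDerivWithinAt T T' s x)
    (hab : ∀ᶠ z in 𝓝[s] x, a z = (b z).comp (T z)) :
    ∃ a' : X →L[ℝ] E →L[ℝ] F, HasFDerivWithinAt a a' s x ∧
      ∀ v w, a' v w = b' v (T x w) + b x (T' v w) :=
  ⟨_, (hb.clm_comp hT).congr_of_eventuallyEq hab (hab.self_of_nhdsWithin hx), fun v w => by
    simp [add_comm]⟩

theorem fderivWithin_half_apply_const₂ {E : Type*} [NormedAddCommGroup E] [NormedSpace ℝ E]
    {m : Coord n → E →L[ℝ] E →L[ℝ] F} {y : Coord n} (hy : y ∈ 𝓗[n])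
    (hm : DifferentiableWithinAt ℝ m 𝓗[n] y) (a : Coord n) (b c : E) :
    fderivWithin ℝ (fun z => m z b c) 𝓗[n] y a = fderivWithin ℝ m 𝓗[n] y a b c := by
  have h1 : DifferentiableWithinAt ℝ (fun z => m z b) 𝓗[n] y :=
    hm.clm_apply (differentiableWithinAt_const b)
  rw [← fderivWithin_half_apply_const hm hy, ← fderivWithin_half_apply_const h1 hy]

theorem fderivWithin_bilinear_comp {E : Type*} [NormedAddCommGroup E]
    [NormedSpace ℝ E] {k : Coord n → E →L[ℝ] E →L[ℝ] F}
    {T : Coord n → E →L[ℝ] E} {k' : Coord n →L[ℝ] E →L[ℝ] E →L[ℝ] F}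
    {T' : Coord n →L[ℝ] E →L[ℝ] E} {x : Coord n} (hx : x ∈ 𝓗[n])
    (hk : HasFDerivWithinAt k k' 𝓗[n] x) (hT : HasFDerivWithinAt T T' 𝓗[n] x) (a : Coord n)
    (b c : E) : fderivWithin ℝ (fun z => k z (T z b) (T z c)) 𝓗[n] x a =
      k' a (T x b) (T x c) + k x (T' a b) (T x c) + k x (T x b) (T' a c) := by
  have h1 := hk.clm_apply (hT.clm_apply (hasFDerivWithinAt_const b x 𝓗[n]))
  have h2 := h1.clm_apply (hT.clm_apply (hasFDerivWithinAt_const c x 𝓗[n]))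
  rw [h2.fderivWithin (uniqueDiffOn_half x hx)]
  simp
  abel

/-- The curvature of a matrix of one-forms on the half space. -/
def curv (a : Coord n → Coord n →L[ℝ] lieAlg G) (y v w : Coord n) : lieAlg G :=
  fderivWithin ℝ (fun z => a z w) 𝓗[n] y v - fderivWithin ℝ (fun z => a z v) 𝓗[n] y w
    + bracket (a y v) (a y w)

theorem curv_eq {a : Coord n → Coord n →L[ℝ] lieAlg G} {y : Coord n} (hy : y ∈ 𝓗[n])
    (ha : DifferentiableWithinAt ℝ a 𝓗[n] y) (v w : Coord n) :
    curv a y v w = fderivWithin ℝ a 𝓗[n] y v w - fderivWithin ℝ a 𝓗[n] y w v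
      + bracketL G (a y v) (a y w) := by
  rw [curv, fderivWithin_half_apply_const ha hy, fderivWithin_half_apply_const ha hy,
    bracketL_apply]

/-- Only the exterior derivative sees second derivatives of `τ`, and they cancel by symmetry. -/
theorem curv_transition {a b : Coord n → Coord n →L[ℝ] lieAlg G} {τ : Coord n → Coord n}
    {S : Set (Coord n)} (hS : RelOpen S) (hτ : SmoothOn τ S) (hmaps : ∀ z ∈ S, τ z ∈ 𝓗[n])
    {y : Coord n} (hy : y ∈ S) (hb : DifferentiableWithinAt ℝ b 𝓗[n] (τ y))
    (hab : ∀ z ∈ S, a z = (b (τ z)).comp (fderivWithin ℝ τ 𝓗[n] z)) (v w : Coord n) :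
    curv a y v w = curv b (τ y) (fderivWithin ℝ τ 𝓗[n] y v) (fderivWithin ℝ τ 𝓗[n] y w) := by
  have hyH := hS.1 hy
  obtain ⟨a', ha', h⟩ := exists_hasFDerivWithinAt_clm_comp hyH
    (hasFDerivWithinAt_comp_half (F := Coord n →L[ℝ] lieAlg G) hb.hasFDerivWithinAt
      (hτ.differentiableWithinAt hy).hasFDerivWithinAt (mem_of_superset (hS.2 y hy) hmaps))
    ((hτ.fderivWithin hS.1).differentiableWithinAt hy).hasFDerivWithinAt
    (mem_of_superset (hS.2 y hy) hab)
  rw [curv_eq hyH ha'.differentiableWithinAt, curv_eq (hmaps y hy) hb,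
    ha'.fderivWithin (uniqueDiffOn_half y hyH), hab y hy, h, h]
  simp only [ContinuousLinearMap.comp_apply, second_fderivWithin_symm (hτ y hy) hyH w v]
  abel

/-- The Christoffel symbols of the first kind of a metric on the half space. -/
def christ (m : Coord n → Coord n →L[ℝ] Coord n →L[ℝ] ℝ) (y v v' w : Coord n) : ℝ :=
  (1 / 2 : ℝ) * (fderivWithin ℝ m 𝓗[n] y v v' w + fderivWithin ℝ m 𝓗[n] y v' v w
    - fderivWithin ℝ m 𝓗[n] y w v v')

/-- Differentiating the pulled-back metric produces six terms with second derivatives of `τ`.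
Symmetry of the metric and of second derivatives cancels all but one pair, which is the
inhomogeneous term. It later cancels against the second derivative in the acceleration. -/
theorem christ_transition {m k : Coord n → Coord n →L[ℝ] Coord n →L[ℝ] ℝ} {τ : Coord n → Coord n}
    {S : Set (Coord n)} (hS : RelOpen S) (hτ : SmoothOn τ S) (hmaps : ∀ z ∈ S, τ z ∈ 𝓗[n])
    {y : Coord n} (hy : y ∈ S) (hm : DifferentiableWithinAt ℝ m 𝓗[n] y)
    (hk : DifferentiableWithinAt ℝ k 𝓗[n] (τ y)) (hsymm : ∀ v w, k (τ y) v w = k (τ y) w v)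
    (hmk : ∀ z ∈ S, m z = (k (τ z)).bilinearComp (fderivWithin ℝ τ 𝓗[n] z)
      (fderivWithin ℝ τ 𝓗[n] z)) (v v' w : Coord n) :
    christ m y v v' w = christ k (τ y) (fderivWithin ℝ τ 𝓗[n] y v) (fderivWithin ℝ τ 𝓗[n] y v')
        (fderivWithin ℝ τ 𝓗[n] y w)
      + k (τ y) (fderivWithin ℝ (fun z => fderivWithin ℝ τ 𝓗[n] z) 𝓗[n] y v v')
        (fderivWithin ℝ τ 𝓗[n] y w) := by
  have hyH := hS.1 hy
  have h : ∀ a b c : Coord n, fderivWithin ℝ m 𝓗[n] y a b c =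
      fderivWithin ℝ k 𝓗[n] (τ y) (fderivWithin ℝ τ 𝓗[n] y a) (fderivWithin ℝ τ 𝓗[n] y b)
        (fderivWithin ℝ τ 𝓗[n] y c)
      + k (τ y) (fderivWithin ℝ (fun z => fderivWithin ℝ τ 𝓗[n] z) 𝓗[n] y a b)
          (fderivWithin ℝ τ 𝓗[n] y c)
      + k (τ y) (fderivWithin ℝ τ 𝓗[n] y b)
          (fderivWithin ℝ (fun z => fderivWithin ℝ τ 𝓗[n] z) 𝓗[n] y a c) := fun a b c => by
    have hb := fderivWithin_bilinear_comp hyH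
      (hasFDerivWithinAt_comp_half (F := Coord n →L[ℝ] Coord n →L[ℝ] ℝ) hk.hasFDerivWithinAt
        (hτ.differentiableWithinAt hy).hasFDerivWithinAt (mem_of_superset (hS.2 y hy) hmaps))
      ((hτ.fderivWithin hS.1).differentiableWithinAt hy).hasFDerivWithinAt a b c
    rw [← fderivWithin_half_apply_const₂ hyH hm, Filter.EventuallyEq.fderivWithin_eq
      (mem_of_superset (hS.2 y hy) fun z hz => congrArg (fun L : Coord n →L[ℝ] Coord n →L[ℝ] ℝ =>
        L b c) (hmk z hz)) (congrArg (fun L : Coord n →L[ℝ] Coord n →L[ℝ] ℝ => L b c) (hmk y hy))]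
    exact hb
  simp only [christ, h,
    second_fderivWithin_symm (hτ y hy) hyH v' v,
    second_fderivWithin_symm (hτ y hy) hyH w v, second_fderivWithin_symm (hτ y hy) hyH w v',
    hsymm (fderivWithin ℝ τ 𝓗[n] y v), hsymm (fderivWithin ℝ τ 𝓗[n] y v')]
  ring

end Calculus

section Tensors

variable {n : ℕ} [NeZero n] {M : Type*} [TopologicalSpace M]
  [ChartedSpace (EuclideanHalfSpace n) M] [IsManifold (𝓡∂ n) ∞ M]
variable {φ ψ : OpenPartialHomeomorph M (EuclideanHalfSpace n)}
variable {N : ℕ} {G : Subgroup (Mat N)ˣ}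

theorem mfderivWithin_target (y : Coord n) (hy : y ∈ ext[φ].target) :
    mfderivWithin 𝓘(ℝ, Coord n) (𝓡∂ n) ext[φ].symm ext[φ].target y = coordVec φ y :=
  mfderivWithin_congr_set ((relOpen_target φ).eventuallyEq hy)

theorem uniqueMDiffOn_target (φ : OpenPartialHomeomorph M (EuclideanHalfSpace n)) :
    UniqueMDiffOn 𝓘(ℝ, Coord n) ext[φ].target := (relOpen_target φ).uniqueDiffOn.uniqueMDiffOn

theorem contMDiffOn_symm_target (hφ : φ ∈ IsManifold.maximalAtlas (𝓡∂ n) ∞ M) :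
    ContMDiffOn 𝓘(ℝ, Coord n) (𝓡∂ n) ∞ ext[φ].symm ext[φ].target := by
  have h := contMDiffOn_extend_symm hφ
  rwa [← φ.extend_target'] at h

/-- The coordinate vector fields are smooth. -/
theorem contMDiffOn_coordVec (hφ : φ ∈ IsManifold.maximalAtlas (𝓡∂ n) ∞ M) (w : Coord n) :
    ContMDiffOn 𝓘(ℝ, Coord n) ((𝓡∂ n).prod 𝓘(ℝ, Coord n)) ∞
      (fun y => TotalSpace.mk' (Coord n) (E := fun x : M => TangentSpace (𝓡∂ n) x)
        (ext[φ].symm y) (coordVec φ y w)) ext[φ].target := by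
  have h1 := (contMDiffOn_symm_target hφ).contMDiffOn_tangentMapWithin (m := ∞) (by simp)
    (uniqueMDiffOn_target φ)
  have h2 : ContMDiffOn 𝓘(ℝ, Coord n) (𝓘(ℝ, Coord n)).tangent ∞
      (fun y => (⟨y, w⟩ : TangentBundle 𝓘(ℝ, Coord n) (Coord n))) ext[φ].target := fun y hy =>
    contMDiffWithinAt_vectorSpace_iff_contDiffWithinAt (V := fun _ => w)|>.2 contDiffWithinAt_const
  refine (h1.comp h2 fun y hy => hy).congr fun y hy => ?_
  simp only [Function.comp_apply, tangentMapWithin]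
  rw [mfderivWithin_target y hy]
  rfl

theorem smoothOn_potentialIn (hφ : φ ∈ IsManifold.maximalAtlas (𝓡∂ n) ∞ M)
    (A : Potential n M G) : SmoothOn (potentialIn A φ) ext[φ].target := by
  refine (relOpen_target φ).smoothOn (contDiffOn_clm_apply.2 fun w y hy => ?_)
  have h1 : ContMDiffWithinAt 𝓘(ℝ, Coord n) ((𝓡∂ n).prod 𝓘(ℝ, Coord n →L[ℝ] lieAlg G)) ∞
      (fun y => TotalSpace.mk' (Coord n →L[ℝ] lieAlg G)
        (E := fun x : M => TangentSpace (𝓡∂ n) x →L[ℝ] Bundle.Trivial M (lieAlg G) x)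
        (ext[φ].symm y) (A.toFun (ext[φ].symm y))) ext[φ].target y :=
    (A.smooth _).comp_contMDiffWithinAt y (contMDiffOn_symm_target hφ y hy)
  have h2 : ContMDiffWithinAt 𝓘(ℝ, Coord n) ((𝓡∂ n).prod 𝓘(ℝ, lieAlg G)) ∞
      (fun y => TotalSpace.mk' (lieAlg G) (E := Bundle.Trivial M (lieAlg G)) (ext[φ].symm y)
        (potentialIn A φ y w)) ext[φ].target y :=
    ContMDiffWithinAt.clm_bundle_apply (F₁ := Coord n) (F₂ := lieAlg G)
      (E₁ := fun x : M => TangentSpace (𝓡∂ n) x) (E₂ := Bundle.Trivial M (lieAlg G))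
      (ϕ := fun y => A.toFun (ext[φ].symm y)) (v := fun y => coordVec φ y w) h1
      (contMDiffOn_coordVec hφ w y hy)
  have h3 := (contMDiffWithinAt_totalSpace.1 h2).2
  exact h3.contDiffWithinAt

theorem potentialIn_coords (hφ : φ ∈ IsManifold.maximalAtlas (𝓡∂ n) ∞ M) (A : Potential n M G)
    {x : M} (hx : x ∈ φ.source) (v : TangentSpace (𝓡∂ n) x) :
    potentialIn A φ (ext[φ] x) (coords φ x v) = A.toFun x v := by
  obtain ⟨y, hy, rfl⟩ := exists_coord_of_mem_source hx
  rw [ext[φ].right_inv hy, potentialIn, ContinuousLinearMap.comp_apply, coordVec_coords hφ hy]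

theorem potentialIn_transition (hφ : φ ∈ IsManifold.maximalAtlas (𝓡∂ n) ∞ M)
    (hψ : ψ ∈ IsManifold.maximalAtlas (𝓡∂ n) ∞ M) (A : Potential n M G) {y : Coord n}
    (hy : y ∈ transDom φ ψ) :
    potentialIn A φ y =
      (potentialIn A ψ (transition φ ψ y)).comp (fderivWithin ℝ (transition φ ψ) 𝓗[n] y) := by
  ext1 w
  rw [ContinuousLinearMap.comp_apply, ← coordVec_transition hφ hψ hy]
  exact (potentialIn_coords hψ A hy.2 (coordVec φ y w)).symm

theorem curvatureIn_eq (A : Potential n M G) (y v w : Coord n) :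
    curvatureIn A φ y v w = curv (potentialIn A φ) y v w := rfl

theorem curvatureIn_transition (hφ : φ ∈ IsManifold.maximalAtlas (𝓡∂ n) ∞ M)
    (hψ : ψ ∈ IsManifold.maximalAtlas (𝓡∂ n) ∞ M) (A : Potential n M G) {y : Coord n}
    (hy : y ∈ transDom φ ψ) (v w : Coord n) :
    curvatureIn A φ y v w = curvatureIn A ψ (transition φ ψ y)
      (fderivWithin ℝ (transition φ ψ) 𝓗[n] y v) (fderivWithin ℝ (transition φ ψ) 𝓗[n] y w) :=
  curv_transition (relOpen_transDom φ ψ) (smoothOn_transition hφ hψ)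
    (fun _ hz => (relOpen_transDom ψ φ).1 (transition_mem hz)) hy
    ((smoothOn_potentialIn hψ A).differentiableWithinAt (transition_mem hy).1)
    (fun _ hz => potentialIn_transition hφ hψ A hz) v w

/-- The metric in the chart `φ`, as a continuous bilinear form. -/
def metricL (g : Metric n M) (φ : OpenPartialHomeomorph M (EuclideanHalfSpace n)) (y : Coord n) :
    Coord n →L[ℝ] Coord n →L[ℝ] ℝ :=
  let T : Coord n →L[ℝ] Coord n := coordVec φ y
  let B : Coord n →L[ℝ] Coord n →L[ℝ] ℝ := g.inner (ext[φ].symm y)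
  B.bilinearComp T T

theorem metricL_apply (g : Metric n M) (φ : OpenPartialHomeomorph M (EuclideanHalfSpace n))
    (y v w : Coord n) : metricL g φ y v w = metricIn g φ y v w := rfl

theorem metricL_symm (g : Metric n M) (φ : OpenPartialHomeomorph M (EuclideanHalfSpace n))
    (y v w : Coord n) : metricL g φ y v w = metricL g φ y w v := g.symm _ _ _

theorem metricL_pos (hφ : φ ∈ IsManifold.maximalAtlas (𝓡∂ n) ∞ M) (g : Metric n M) {y : Coord n}
    (hy : y ∈ ext[φ].target) {v : Coord n} (hv : v ≠ 0) : 0 < metricL g φ y v v := by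
  refine g.pos _ _ fun h => hv ?_
  rw [← coords_coordVec hφ hy v]
  exact (congrArg (coords φ _) h).trans (map_zero _)

theorem smoothOn_metricL (hφ : φ ∈ IsManifold.maximalAtlas (𝓡∂ n) ∞ M) (g : Metric n M) :
    SmoothOn (metricL g φ) ext[φ].target := by
  refine (relOpen_target φ).smoothOn
    (contDiffOn_clm_apply.2 fun v => contDiffOn_clm_apply.2 fun w y hy => ?_)
  have h1 := (g.contMDiff _).comp_contMDiffWithinAt y (contMDiffOn_symm_target hφ y hy)
  have h2 : ContMDiffWithinAt 𝓘(ℝ, Coord n) ((𝓡∂ n).prod 𝓘(ℝ)) ∞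
      (fun y => TotalSpace.mk' ℝ (E := Bundle.Trivial M ℝ) (ext[φ].symm y)
        (metricL g φ y v w)) ext[φ].target y :=
    ContMDiffWithinAt.clm_bundle_apply₂ (F₁ := Coord n) (F₂ := Coord n) h1
      (contMDiffOn_coordVec hφ v y hy) (contMDiffOn_coordVec hφ w y hy)
  exact ((contMDiffWithinAt_totalSpace.1 h2).2).contDiffWithinAt

theorem metricL_coords (hφ : φ ∈ IsManifold.maximalAtlas (𝓡∂ n) ∞ M) (g : Metric n M)
    {x : M} (hx : x ∈ φ.source) (v w : TangentSpace (𝓡∂ n) x) :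
    metricL g φ (ext[φ] x) (coords φ x v) (coords φ x w) = g.inner x v w := by
  obtain ⟨y, hy, rfl⟩ := exists_coord_of_mem_source hx
  rw [ext[φ].right_inv hy, metricL_apply, metricIn, coordVec_coords hφ hy, coordVec_coords hφ hy]

theorem metricL_transition (hφ : φ ∈ IsManifold.maximalAtlas (𝓡∂ n) ∞ M)
    (hψ : ψ ∈ IsManifold.maximalAtlas (𝓡∂ n) ∞ M) (g : Metric n M) {y : Coord n}
    (hy : y ∈ transDom φ ψ) :
    metricL g φ y = (metricL g ψ (transition φ ψ y)).bilinearComp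
      (fderivWithin ℝ (transition φ ψ) 𝓗[n] y) (fderivWithin ℝ (transition φ ψ) 𝓗[n] y) := by
  ext1 v; ext1 w
  rw [ContinuousLinearMap.bilinearComp_apply, ← coordVec_transition hφ hψ hy,
    ← coordVec_transition hφ hψ hy]
  exact (metricL_coords hψ g hy.2 (coordVec φ y v) (coordVec φ y w)).symm

theorem christoffel_eq (hφ : φ ∈ IsManifold.maximalAtlas (𝓡∂ n) ∞ M) (g : Metric n M)
    {y : Coord n} (hy : y ∈ ext[φ].target) (v v' w : Coord n) :
    christoffel g φ y v v' w = christ (metricL g φ) y v v' w := by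
  have hyH := (relOpen_target φ).1 hy
  have hd := (smoothOn_metricL hφ g).differentiableWithinAt hy
  have key : ∀ a b c : Coord n, fderivWithin ℝ (fun z => metricIn g φ z b c) 𝓗[n] y a =
      fderivWithin ℝ (metricL g φ) 𝓗[n] y a b c := fun a b c => by
    rw [← fderivWithin_half_apply_const₂ hyH hd]
    rfl
  rw [christoffel, christ, key, key, key]

theorem christoffel_transition (hφ : φ ∈ IsManifold.maximalAtlas (𝓡∂ n) ∞ M)
    (hψ : ψ ∈ IsManifold.maximalAtlas (𝓡∂ n) ∞ M) (g : Metric n M) {y : Coord n}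
    (hy : y ∈ transDom φ ψ) (v v' w : Coord n) :
    christoffel g φ y v v' w = christoffel g ψ (transition φ ψ y)
        (fderivWithin ℝ (transition φ ψ) 𝓗[n] y v) (fderivWithin ℝ (transition φ ψ) 𝓗[n] y v')
        (fderivWithin ℝ (transition φ ψ) 𝓗[n] y w)
      + metricL g ψ (transition φ ψ y)
        (fderivWithin ℝ (fun z => fderivWithin ℝ (transition φ ψ) 𝓗[n] z) 𝓗[n] y v v')
        (fderivWithin ℝ (transition φ ψ) 𝓗[n] y w) := by
  rw [christoffel_eq hφ g hy.1, christoffel_eq hψ g (transition_mem hy).1]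
  exact christ_transition (relOpen_transDom φ ψ) (smoothOn_transition hφ hψ)
    (fun _ hz => (relOpen_transDom ψ φ).1 (transition_mem hz)) hy
    ((smoothOn_metricL hφ g).differentiableWithinAt hy.1)
    ((smoothOn_metricL hψ g).differentiableWithinAt (transition_mem hy).1)
    (metricL_symm g ψ _) (fun _ hz => metricL_transition hφ hψ g hz) v v' w

end Tensors

end YangMills

end

/-! ### Gauge transformations of potentials and curvature -/

noncomputable section

set_option linter.unusedSectionVars false

namespace YangMills

section MatrixCurves

variable {N : ℕ} {G : Subgroup (Mat N)ˣ}

/-- A linear retraction lets derivatives and smoothness be established in the ambient matrix algebra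
and then carried back to the Lie algebra. -/
theorem exists_projection_lieAlg (G : Subgroup (Mat N)ˣ) :
    ∃ P : Mat N →L[ℝ] lieAlg G, ∀ X : lieAlg G, P X = X := by
  obtain ⟨P, hP⟩ := (lieAlg G).subtype.exists_leftInverse_of_injective
    (Submodule.ker_subtype (lieAlg G))
  exact ⟨LinearMap.toContinuousLinearMap P, fun X => congrArg (fun L => L X) hP⟩

theorem hasDerivWithinAt_units_inv {R : Type*} [NormedRing R] [NormedAlgebra ℝ R]
    [HasSummableGeomSeries R] {γ : ℝ → Rˣ} {X : R} {s : Set ℝ} {t : ℝ}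
    (h : HasDerivWithinAt (fun r => (γ r : R)) X s t) :
    HasDerivWithinAt (fun r => ((γ r)⁻¹ : Rˣ).val)
      (-(((γ t)⁻¹ : Rˣ).val * X * ((γ t)⁻¹ : Rˣ).val)) s t := by
  have key := (hasFDerivAt_ringInverse (𝕜 := ℝ) (γ t)).comp_hasDerivWithinAt t h
  refine (key.congr_deriv ?_).congr_of_eventuallyEq (Eventually.of_forall fun t => ?_) ?_
  · simp only [neg_apply, ContinuousLinearMap.mulLeftRight_apply]
  · simp
  · simp

/-- A one-sided velocity at the identity lies in the Lie algebra. -/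
theorem mem_lieAlg_of_hasDerivWithinAt {γ : ℝ → (Mat N)ˣ} {X : Mat N}
    (hγ : ∀ t, γ t ∈ G) (h1 : γ 0 = 1)
    (h : HasDerivWithinAt (fun t => (γ t : Mat N)) X (Ici 0) 0) : X ∈ lieAlg G := by
  -- A one-sided curve is completed by `t ↦ (γ (-t))⁻¹` for negative times; inversion reverses the
  -- velocity and so does `t ↦ -t`, hence the two halves fit.
  refine ⟨fun t => if 0 ≤ t then γ t else (γ (-t))⁻¹, fun t => ?_, by simp [h1], ?_⟩
  · dsimp only; split_ifs
    exacts [hγ t, G.inv_mem (hγ _)]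
  have hr : HasDerivWithinAt (fun t => ((if 0 ≤ t then γ t else (γ (-t))⁻¹ : (Mat N)ˣ) : Mat N)) X
      (Ici 0) 0 := h.congr (fun t ht => by rw [if_pos (mem_Ici.1 ht)]) (by simp)
  have hl : HasDerivWithinAt (fun t => ((if 0 ≤ t then γ t else (γ (-t))⁻¹ : (Mat N)ˣ) : Mat N)) X
      (Iic 0) 0 := by
    have h2 := hasDerivWithinAt_units_inv h
    have hn : HasDerivWithinAt (fun t : ℝ => -t) (-1) (Iic 0) 0 := (hasDerivAt_neg _).hasDerivWithinAt
    have h4 := h2.scomp_of_eq (0 : ℝ) hn (fun t ht => by simpa using ht) (by simp)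
    refine (h4.congr (fun t ht => ?_) ?_).congr_deriv ?_
    · rcases (mem_Iic.1 ht).eq_or_lt with rfl | ht'
      · simp [h1]
      · rw [if_neg (not_le.2 ht')]; rfl
    · simp [h1]
    · simp [h1]
  have := hr.union hl
  rwa [union_comm, Iic_union_Ici, hasDerivWithinAt_univ] at this

end MatrixCurves

section CoordinateGauge

variable {n : ℕ} [NeZero n] {N : ℕ} {G : Subgroup (Mat N)ˣ}

theorem coe_bracket (X Y : lieAlg G) :
    ((bracket X Y : lieAlg G) : Mat N) = (X : Mat N) * Y - Y * X := rfl

theorem fderivWithin_coe_lieAlg {a : Coord n → lieAlg G} {y : Coord n} (hy : y ∈ 𝓗[n])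
    (ha : DifferentiableWithinAt ℝ a 𝓗[n] y) (v : Coord n) :
    fderivWithin ℝ (fun z => (a z : Mat N)) 𝓗[n] y v = (fderivWithin ℝ a 𝓗[n] y v : Mat N) := by
  have := ((lieAlg G).subtypeL.hasFDerivAt.comp_hasFDerivWithinAt y
    ha.hasFDerivWithinAt).fderivWithin (uniqueDiffOn_half y hy)
  exact congrArg (fun L : Coord n →L[ℝ] Mat N => L v) this

/-- The law of transformation of the curvature under a gauge. -/
theorem curv_gauge {a a' : Coord n → Coord n →L[ℝ] lieAlg G} {U : Coord n → Mat N} {y : Coord n}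
    (hy : y ∈ 𝓗[n]) (hU : ContDiffWithinAt ℝ ∞ U 𝓗[n] y)
    (ha : DifferentiableWithinAt ℝ a 𝓗[n] y) (ha' : DifferentiableWithinAt ℝ a' 𝓗[n] y)
    (heq : ∀ᶠ z in 𝓝[𝓗[n]] y, ∀ w,
      U z * (a' z w : Mat N) = fderivWithin ℝ U 𝓗[n] z w + (a z w : Mat N) * U z)
    (v w : Coord n) :
    U y * (curv a' y v w : Mat N) = (curv a y v w : Mat N) * U y := by
  have hUd : DifferentiableWithinAt ℝ U 𝓗[n] y := hU.differentiableWithinAt (by simp)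
  have hU' : DifferentiableWithinAt ℝ (fun z => fderivWithin ℝ U 𝓗[n] z) 𝓗[n] y :=
    (hU.fderivWithin_right (m := ∞) uniqueDiffOn_half (by simp) hy).differentiableWithinAt
      (by simp)
  have hunique := uniqueDiffOn_half y hy
  have hc : ∀ {b : Coord n → Coord n →L[ℝ] lieAlg G}, DifferentiableWithinAt ℝ b 𝓗[n] y →
      ∀ w : Coord n, HasFDerivWithinAt (fun z => (b z w : Mat N))
        (fderivWithin ℝ (fun z => (b z w : Mat N)) 𝓗[n] y) 𝓗[n] y := fun {b} hb w =>
    ((lieAlg G).subtypeL.hasFDerivAt.comp_hasFDerivWithinAt y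
      (hb.clm_apply (differentiableWithinAt_const w)).hasFDerivWithinAt
      ).differentiableWithinAt.hasFDerivWithinAt
  -- Differentiate the product form `U a' = dU + a U`, in which no inverse occurs. Antisymmetrising
  -- removes the second derivative of `U`, and the remaining first derivatives combine with the
  -- brackets through the same relation.
  have key : ∀ v w : Coord n,
      U y * (fderivWithin ℝ (fun z => a' z w) 𝓗[n] y v : Mat N)
        + fderivWithin ℝ U 𝓗[n] y v * (a' y w : Mat N) =
      fderivWithin ℝ (fun z => fderivWithin ℝ U 𝓗[n] z) 𝓗[n] y v w
        + ((a y w : Mat N) * fderivWithin ℝ U 𝓗[n] y v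
          + (fderivWithin ℝ (fun z => a z w) 𝓗[n] y v : Mat N) * U y) := fun v w => by
    have h1 := hUd.hasFDerivWithinAt.mul' (hc ha' w)
    have h2 := (hU'.hasFDerivWithinAt.clm_apply (hasFDerivWithinAt_const w y 𝓗[n])).add
      ((hc ha w).mul' hUd.hasFDerivWithinAt)
    have h3 := h1.congr_of_eventuallyEq (heq.mono fun z hz => (hz w).symm)
      (heq.self_of_nhdsWithin hy w).symm
    have h4 := congrArg (fun L : Coord n →L[ℝ] Mat N => L v) (hunique.eq h3 h2)
    rw [← fderivWithin_coe_lieAlg hy (ha.clm_apply (differentiableWithinAt_const w)),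
      ← fderivWithin_coe_lieAlg hy (ha'.clm_apply (differentiableWithinAt_const w))]
    simpa using h4
  have hs := second_fderivWithin_symm hU hy v w
  have k1 := key v w
  have k2 := key w v
  have e1 := heq.self_of_nhdsWithin hy v
  have e2 := heq.self_of_nhdsWithin hy w
  simp only [curv, Submodule.coe_add, Submodule.coe_sub, coe_bracket]
  rw [hs] at k1
  have i1 : U y * ((a' y v : Mat N) * (a' y w : Mat N)) = fderivWithin ℝ U 𝓗[n] y v * (a' y w : Mat N) +
      (a y v : Mat N) * (fderivWithin ℝ U 𝓗[n] y w + (a y w : Mat N) * U y) := by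
    rw [← mul_assoc, e1, add_mul, mul_assoc, e2]
  have i2 : U y * ((a' y w : Mat N) * (a' y v : Mat N)) = fderivWithin ℝ U 𝓗[n] y w * (a' y v : Mat N) +
      (a y w : Mat N) * (fderivWithin ℝ U 𝓗[n] y v + (a y v : Mat N) * U y) := by
    rw [← mul_assoc, e2, add_mul, mul_assoc, e1]
  rw [mul_add, mul_sub, mul_sub, i1, i2, eq_sub_of_add_eq k1, eq_sub_of_add_eq k2]
  noncomm_ring

end CoordinateGauge

section Gauge

variable {n : ℕ} [NeZero n] {M : Type*} [TopologicalSpace M]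
  [ChartedSpace (EuclideanHalfSpace n) M] [IsManifold (𝓡∂ n) ∞ M]
variable {φ : OpenPartialHomeomorph M (EuclideanHalfSpace n)}
variable {N : ℕ} {G : Subgroup (Mat N)ˣ}

/-- A gauge in the chart `φ`. -/
def gaugeIn (u : M → G) (φ : OpenPartialHomeomorph M (EuclideanHalfSpace n)) (y : Coord n) :
    Mat N := ((u (ext[φ].symm y)).1 : Mat N)

/-- A smooth map into the group, as a map into matrices. -/
def SmoothGauge (u : M → G) : Prop :=
  ContMDiff (𝓡∂ n) 𝓘(ℝ, Mat N) ∞ (fun x => ((u x).1 : Mat N))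

theorem smoothOn_gaugeIn (hφ : φ ∈ IsManifold.maximalAtlas (𝓡∂ n) ∞ M) {u : M → G}
    (hu : SmoothGauge (n := n) u) : SmoothOn (gaugeIn u φ) ext[φ].target := fun y hy =>
  ((hu _).comp_contMDiffWithinAt y (contMDiffWithinAt_symm hφ hy)).contDiffWithinAt

theorem fderivWithin_gaugeIn (hφ : φ ∈ IsManifold.maximalAtlas (𝓡∂ n) ∞ M) {u : M → G}
    (hu : SmoothGauge (n := n) u) {y : Coord n} (hy : y ∈ ext[φ].target) (w : Coord n) :
    fderivWithin ℝ (gaugeIn u φ) 𝓗[n] y w = gaugeDeriv u (ext[φ].symm y) (coordVec φ y w) :=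
  fderivWithin_comp_symm hφ hy ((hu _).mdifferentiableAt (by simp)) w

variable {u w : M → G} {A A' A'' : Potential n M G}

/-- The transformation law with the inverse cleared: it is polynomial in `u`, which makes
differentiating and composing gauges easy. -/
theorem IsBoundaryGauge.mul_toFun (h : IsBoundaryGauge u A A') (x : M)
    (v : TangentSpace (𝓡∂ n) x) :
    ((u x).1 : Mat N) * (A'.toFun x v : Mat N) =
      gaugeDeriv u x v + (A.toFun x v : Mat N) * ((u x).1 : Mat N) := by
  rw [h.transform, mul_add, ← mul_assoc, ← mul_assoc, ← mul_assoc]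
  simp

theorem IsBoundaryGauge.of_mul_toFun (hu : SmoothGauge (n := n) u)
    (hb : ∀ x ∈ (𝓡∂ n).boundary M, u x = 1)
    (h : ∀ (x : M) (v : TangentSpace (𝓡∂ n) x), ((u x).1 : Mat N) * (A'.toFun x v : Mat N) =
      gaugeDeriv u x v + (A.toFun x v : Mat N) * ((u x).1 : Mat N)) : IsBoundaryGauge u A A' :=
  ⟨hu, hb, fun x v => by
    rw [mul_assoc, ← mul_add, ← h, ← mul_assoc]
    simp⟩

theorem IsBoundaryGauge.smoothGauge (h : IsBoundaryGauge u A A') : SmoothGauge (n := n) u :=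
  h.smooth

/-- The action of a gauge in a chart. -/
theorem IsBoundaryGauge.mul_potentialIn (h : IsBoundaryGauge u A A')
    (hφ : φ ∈ IsManifold.maximalAtlas (𝓡∂ n) ∞ M) {y : Coord n} (hy : y ∈ ext[φ].target)
    (v : Coord n) :
    gaugeIn u φ y * (potentialIn A' φ y v : Mat N) =
      fderivWithin ℝ (gaugeIn u φ) 𝓗[n] y v + (potentialIn A φ y v : Mat N) * gaugeIn u φ y := by
  rw [fderivWithin_gaugeIn hφ h.smoothGauge hy]
  exact h.mul_toFun _ _

theorem IsBoundaryGauge.symm (h : IsBoundaryGauge u A A') : IsBoundaryGauge (fun x => (u x)⁻¹) A' A := by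
  have hd : ∀ x, HasMFDerivAt (𝓡∂ n) 𝓘(ℝ, Mat N) (fun x => (((u x)⁻¹).1 : Mat N)) x
      ((-ContinuousLinearMap.mulLeftRight ℝ (Mat N) ((u x).1⁻¹ : (Mat N)ˣ)
        ((u x).1⁻¹ : (Mat N)ˣ)).comp (gaugeDeriv u x)) := fun x => by
    have h1 := (hasFDerivAt_ringInverse (𝕜 := ℝ) (u x).1).hasMFDerivAt.comp x
      ((h.smooth x).mdifferentiableAt (by simp)).hasMFDerivAt
    refine h1.congr_of_eventuallyEq (Eventually.of_forall fun z => ?_)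
    simp
  refine IsBoundaryGauge.of_mul_toFun (fun x => ?_) (fun x hx => by simp [h.boundary x hx])
    fun x v => ?_
  · have h1 := (contDiffAt_ringInverse ℝ (n := ∞) (u x).1).contMDiffAt.comp x (h.smooth x)
    refine h1.congr_of_eventuallyEq (Eventually.of_forall fun z => ?_)
    simp
  · rw [gaugeDeriv, (hd x).mfderiv]
    have h2 := h.mul_toFun x v
    have h3 : (A'.toFun x v : Mat N) = ((u x).1⁻¹ : (Mat N)ˣ).val * (gaugeDeriv u x v +
        (A.toFun x v : Mat N) * ((u x).1 : Mat N)) := by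
      rw [← h2, ← mul_assoc]; simp
    rw [h3]
    change ((u x).1⁻¹ : (Mat N)ˣ).val * _ = -(((u x).1⁻¹ : (Mat N)ˣ).val * gaugeDeriv u x v *
      ((u x).1⁻¹ : (Mat N)ˣ).val) + _ * ((u x).1⁻¹ : (Mat N)ˣ).val
    simp [mul_add, add_mul, mul_assoc]

theorem IsBoundaryGauge.trans (h : IsBoundaryGauge u A A') (h' : IsBoundaryGauge w A' A'') :
    IsBoundaryGauge (fun x => u x * w x) A A'' := by
  refine IsBoundaryGauge.of_mul_toFun (fun x =>
    (contDiff_mul (𝕜 := ℝ) (n := ∞) (𝔸 := Mat N)).contMDiff.contMDiffAt.comp x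
      ((h.smooth x).prodMk_space (h'.smooth x)))
    (fun x hx => by simp [h.boundary x hx, h'.boundary x hx]) fun x v => ?_
  have hm := ((h.smooth x).mdifferentiableAt (by simp)).hasMFDerivAt.mul'
    ((h'.smooth x).mdifferentiableAt (by simp)).hasMFDerivAt
  have hd : gaugeDeriv (fun x => u x * w x) x v = ((u x).1 : Mat N) * gaugeDeriv w x v
      + gaugeDeriv u x v * ((w x).1 : Mat N) := by
    have := congrArg (fun L : Coord n →L[ℝ] Mat N => L v) hm.mfderiv
    exact this
  rw [hd]
  have h1 := h.mul_toFun x v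
  have h2 := h'.mul_toFun x v
  change (((u x).1 : Mat N) * ((w x).1 : Mat N)) * _ = _ + _ * (((u x).1 : Mat N) * ((w x).1 : Mat N))
  rw [mul_assoc, h2, mul_add, ← mul_assoc, h1]
  noncomm_ring

theorem isBoundaryGauge_one (A : Potential n M G) : IsBoundaryGauge (fun _ => (1 : G)) A A := by
  refine IsBoundaryGauge.of_mul_toFun (fun x => contMDiffAt_const) (fun _ _ => rfl) fun x v => ?_
  have : gaugeDeriv (n := n) (fun _ : M => (1 : G)) x = 0 := mfderiv_const
  rw [this]
  simp

theorem IsBoundaryGauge.curvatureIn_eq (h : IsBoundaryGauge u A A')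
    (hφ : φ ∈ IsManifold.maximalAtlas (𝓡∂ n) ∞ M) {y : Coord n} (hy : y ∈ ext[φ].target)
    (v w : Coord n) :
    curvatureIn A' φ y v w = Ad (u (ext[φ].symm y))⁻¹ (curvatureIn A φ y v w) := by
  have h1 := curv_gauge ((relOpen_target φ).1 hy) (smoothOn_gaugeIn hφ h.smoothGauge y hy)
    ((smoothOn_potentialIn hφ A).differentiableWithinAt hy)
    ((smoothOn_potentialIn hφ A').differentiableWithinAt hy)
    (mem_of_superset ((relOpen_target φ).2 y hy) fun z hz w => h.mul_potentialIn hφ hz w) v w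
  apply Subtype.ext
  change (curv (potentialIn A' φ) y v w : Mat N) = ((u (ext[φ].symm y)).1⁻¹ : (Mat N)ˣ).val *
    (curv (potentialIn A φ) y v w : Mat N) * ((u (ext[φ].symm y)).1⁻¹⁻¹ : (Mat N)ˣ).val
  rw [inv_inv, mul_assoc, ← gaugeIn, ← h1, gaugeIn, ← mul_assoc]
  simp

theorem IsBoundaryGauge.curvature_eq (h : IsBoundaryGauge u A A') (x : M)
    (v w : TangentSpace (𝓡∂ n) x) : curvature A' x v w = Ad (u x)⁻¹ (curvature A x v w) := by
  have hc := IsManifold.chart_mem_maximalAtlas (I := 𝓡∂ n) (n := ∞) x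
  have := h.curvatureIn_eq hc ((extChartAt (𝓡∂ n) x).map_source (mem_extChartAt_source x))
    (coords (chartAt (EuclideanHalfSpace n) x) x v) (coords (chartAt (EuclideanHalfSpace n) x) x w)
  have hl : ext[chartAt (EuclideanHalfSpace n) x].symm (extChartAt (𝓡∂ n) x x) = x :=
    extChartAt_to_inv x
  rw [hl] at this
  exact this

theorem Ad_one (X : lieAlg G) : Ad (1 : G) X = X := Subtype.ext (by simp [Ad])

theorem IsBoundaryGauge.strictlyYMConvexAt (h : IsBoundaryGauge u A A') {g : Metric n M}
    {κ : AdInvariantInner G} {O : Set (lieAlg G)} {x : M} (hx : x ∈ (𝓡∂ n).boundary M)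
    (hA : StrictlyYMConvexAt g κ O A x) : StrictlyYMConvexAt g κ O A' x :=
  fun ν hν v hv hvt ξ hξ => by
    rw [h.curvature_eq, h.boundary x hx, inv_one, Ad_one]
    exact hA ν hν v hv hvt ξ hξ

/-- Since `u` is constantly 1 on the boundary, its differential kills tangential vectors, and
conjugation by `u` is trivial there. -/
theorem IsBoundaryGauge.toFun_eq (h : IsBoundaryGauge u A A') {x : M}
    (hx : x ∈ (𝓡∂ n).boundary M) {v : TangentSpace (𝓡∂ n) x} (hv : IsTangentToBoundary x v) :
    A'.toFun x v = A.toFun x v := by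
  have hc := IsManifold.chart_mem_maximalAtlas (I := 𝓡∂ n) (n := ∞) x
  have hxs := mem_chart_source (EuclideanHalfSpace n) x
  have h1 := h.mul_toFun x v
  set ψ := chartAt (EuclideanHalfSpace n) x with hψ
  have hz : gaugeDeriv u x v = 0 := by
    have h2 := mfderiv_eq_coords hc hxs ((h.smooth x).mdifferentiableAt (by simp)) v
    have h3 : fderivWithin ℝ (fun z => gaugeIn u ψ z - 1) 𝓗[n] (ext[ψ] x) (coords ψ x v) = 0 := by
      have hxt := ext[ψ].map_source (x := x) (by rwa [ψ.extend_source])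
      refine fderivWithin_tangential_eq_zero (relOpen_target ψ) hxt
        ((mem_boundary_iff hc hxs).1 hx)
        (((smoothOn_gaugeIn hc h.smoothGauge).differentiableWithinAt hxt).sub
          (differentiableWithinAt_const _)) (fun y hy hy0 => ?_) hv
      have : ext[ψ].symm y ∈ (𝓡∂ n).boundary M := by
        rw [mem_boundary_iff hc (symm_mem_source hy), ext[ψ].right_inv hy, hy0]
      change ((u (ext[ψ].symm y)).1 : Mat N) - 1 = 0
      rw [h.boundary _ this]
      simp
    rw [fderivWithin_sub_const] at h3
    exact h2.trans h3
  rw [hz, h.boundary x hx] at h1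
  apply Subtype.ext
  simpa using h1

end Gauge

end YangMills

end

/-! ### Trajectories and lens data under gauges; existence of the transformed potential -/

noncomputable section

set_option linter.unusedSectionVars false

namespace YangMills

section WongGauge

variable {n : ℕ} [NeZero n] {M : Type*} [TopologicalSpace M]
  [ChartedSpace (EuclideanHalfSpace n) M] [IsManifold (𝓡∂ n) ∞ M]
variable {φ : OpenPartialHomeomorph M (EuclideanHalfSpace n)}
variable {N : ℕ} {G : Subgroup (Mat N)ˣ} {u : M → G} {A A' : Potential n M G}
variable {g : Metric n M} {κ : AdInvariantInner G}

theorem hasDerivWithinAt_lieAlg {ξ : ℝ → lieAlg G} {X : lieAlg G} {s : Set ℝ} {t : ℝ}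
    (h : HasDerivWithinAt (fun r => (ξ r : Mat N)) X s t) : HasDerivWithinAt ξ X s t := by
  obtain ⟨P, hP⟩ := exists_projection_lieAlg G
  have := P.hasFDerivAt.comp_hasDerivWithinAt t h
  rw [hP] at this
  exact this.congr (fun r _ => (hP (ξ r)).symm) (hP (ξ t)).symm

/-- The velocity condition is given for chart maps only; this is the chain rule for an arbitrary
smooth function of position, needed for `u` along the trajectory. -/
theorem IsWongTrajectory.hasDerivWithinAt_comp {T : ℝ} {c : ℝ → TangentBundle (𝓡∂ n) M}
    {ξ : ℝ → lieAlg G} (h : IsWongTrajectory g κ A T c ξ) {F : Type*} [NormedAddCommGroup F]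
    [NormedSpace ℝ F] {f : M → F} {t : ℝ} (ht : t ∈ Icc 0 T)
    (hf : ContMDiffAt (𝓡∂ n) 𝓘(ℝ, F) ∞ f (c t).1) :
    HasDerivWithinAt (fun s => f (c s).1) (mfderiv (𝓡∂ n) 𝓘(ℝ, F) f (c t).1 (c t).2)
      (Icc 0 T) t := by
  set φ := chartAt (EuclideanHalfSpace n) (c t).1
  have hc := IsManifold.chart_mem_maximalAtlas (I := 𝓡∂ n) (n := ∞) (c t).1
  have hx : (c t).1 ∈ φ.source := mem_chart_source (EuclideanHalfSpace n) (c t).1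
  have hxt : ext[φ] (c t).1 ∈ ext[φ].target := ext[φ].map_source (by rwa [φ.extend_source])
  have hv := h.velocity φ hc t ht hx
  have hev : ∀ᶠ s in 𝓝[Icc 0 T] t, (c s).1 ∈ φ.source := by
    have h1 : ContinuousWithinAt (fun s => (c s).1) (Icc 0 T) t :=
      (FiberBundle.continuous_proj (Coord n) (fun x : M => TangentSpace (𝓡∂ n) x)
        ).continuousAt.comp_continuousWithinAt (h.continuousOn t ht)
    exact h1.eventually (φ.open_source.mem_nhds hx)
  have hF : DifferentiableWithinAt ℝ (fun z => f (ext[φ].symm z)) 𝓗[n] (ext[φ] (c t).1) := by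
    have hl : ext[φ].symm (ext[φ] (c t).1) = (c t).1 := φ.extend_left_inv hx
    have : ContMDiffAt (𝓡∂ n) 𝓘(ℝ, F) ∞ f (ext[φ].symm (ext[φ] (c t).1)) := by rwa [hl]
    exact (this.comp_contMDiffWithinAt _ (contMDiffWithinAt_symm hc hxt)
      ).contDiffWithinAt.differentiableWithinAt (by simp)
  have hS : {s | (c s).1 ∈ φ.source} ∩ Icc 0 T ∈ 𝓝[Icc 0 T] t :=
    inter_mem hev self_mem_nhdsWithin
  have h1 := hF.hasFDerivWithinAt.comp_hasDerivWithinAt t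
    (hv.mono (inter_subset_right (s := {s | (c s).1 ∈ φ.source})))
    (fun s hs => (relOpen_target φ).1 (ext[φ].map_source (by rw [φ.extend_source]; exact hs.1)))
  rw [mfderiv_eq_coords hc hx (hf.mdifferentiableAt (by simp))]
  refine (h1.congr (fun s hs => ?_) ?_).mono_of_mem_nhdsWithin hS
  · simp only [Function.comp_apply]
    rw [φ.extend_left_inv hs.1]
  · simp only [Function.comp_apply]
    rw [φ.extend_left_inv hx]

/-- Charge and curvature are both rotated by `Ad` of the inverse gauge, so the force is unchanged by
invariance of the inner product. The derivative of the rotation supplies the extra term in the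
transport equation. -/
theorem IsBoundaryGauge.isWongTrajectory (h : IsBoundaryGauge u A A') {T : ℝ}
    {c : ℝ → TangentBundle (𝓡∂ n) M} {ξ : ℝ → lieAlg G} (hc : IsWongTrajectory g κ A T c ξ) :
    IsWongTrajectory g κ A' T c (fun t => Ad (u (c t).1)⁻¹ (ξ t)) := by
  refine ⟨hc.continuousOn, hc.velocity, fun φ hφ t ht hx => ?_, fun t ht => ?_⟩
  · obtain ⟨a, ha, h2⟩ := hc.acceleration φ hφ t ht hx
    refine ⟨a, ha, fun η => ?_⟩
    have hxt : ext[φ] (c t).1 ∈ ext[φ].target := ext[φ].map_source (by rwa [φ.extend_source])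
    rw [h2, h.curvatureIn_eq hφ hxt, φ.extend_left_inv hx, κ.ad_invariant]
  · apply hasDerivWithinAt_lieAlg
    have hu : HasDerivWithinAt (fun s => ((u (c s).1).1 : Mat N)) (gaugeDeriv u (c t).1 (c t).2)
      (Icc 0 T) t := hc.hasDerivWithinAt_comp ht (h.smooth _)
    have hi := hasDerivWithinAt_units_inv hu
    have hξ : HasDerivWithinAt (fun s => (ξ s : Mat N))
        (-bracket (A.toFun (c t).1 (c t).2) (ξ t) : lieAlg G) (Icc 0 T) t :=
      (lieAlg G).subtypeL.hasFDerivAt.comp_hasDerivWithinAt t (hc.charge t ht)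
    have hp := (hi.fun_mul hξ).fun_mul hu
    refine (hp.congr (fun s _ => ?_) ?_).congr_deriv ?_
    · change _ * _ * ((((u (c s).1)⁻¹⁻¹ : G)).1 : Mat N) = _
      rw [inv_inv]; rfl
    · change _ * _ * ((((u (c t).1)⁻¹⁻¹ : G)).1 : Mat N) = _
      rw [inv_inv]; rfl
    · have e1 := h.transform (c t).1 (c t).2
      change _ = -((A'.toFun (c t).1 (c t).2 : Mat N) *
        (((u (c t).1).1⁻¹ : (Mat N)ˣ).val * (ξ t : Mat N) * ((u (c t).1)⁻¹⁻¹ : G).1)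
        - (((u (c t).1).1⁻¹ : (Mat N)ˣ).val * (ξ t : Mat N) * ((u (c t).1)⁻¹⁻¹ : G).1)
          * (A'.toFun (c t).1 (c t).2 : Mat N))
      rw [inv_inv, e1]
      simp only [NegMemClass.coe_neg, coe_bracket]
      set U : Mat N := ((u (c t).1).1 : Mat N) with hU
      set V : Mat N := ((u (c t).1).1⁻¹ : (Mat N)ˣ).val with hV
      have hUV : ∀ X : Mat N, U * (V * X) = X := fun X => by rw [← mul_assoc]; simp [U, V]
      simp only [mul_add, add_mul, mul_sub, sub_mul, mul_assoc, neg_mul, mul_neg, hUV]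
      abel

theorem IsBoundaryGauge.flows (h : IsBoundaryGauge u A A') {T : ℝ}
    {θ θ' : TangentBundle (𝓡∂ n) M × lieAlg G} (hf : Flows g κ A T θ θ') :
    Flows g κ A' T (θ.1, Ad (u θ.1.1)⁻¹ θ.2) (θ'.1, Ad (u θ'.1.1)⁻¹ θ'.2) := by
  obtain ⟨c, ξ, hw, rfl, rfl⟩ := hf
  exact ⟨c, _, h.isWongTrajectory hw, rfl, rfl⟩

/-- At both ends the gauge is 1, so the rotation of the charge disappears. For an interior final
phase it would not, hence lens data are compared only at boundary phases. -/
theorem IsBoundaryGauge.flows_of_boundary (h : IsBoundaryGauge u A A') {T : ℝ}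
    {θ θ' : TangentBundle (𝓡∂ n) M × lieAlg G} (hθ : θ.1.1 ∈ (𝓡∂ n).boundary M)
    (hθ' : θ'.1.1 ∈ (𝓡∂ n).boundary M) (hf : Flows g κ A T θ θ') : Flows g κ A' T θ θ' := by
  have := h.flows hf
  rwa [h.boundary _ hθ, h.boundary _ hθ', inv_one, Ad_one, Ad_one] at this

theorem IsBoundaryGauge.exitTime_le (h : IsBoundaryGauge u A A')
    {θ : TangentBundle (𝓡∂ n) M × lieAlg G} (hθ : θ.1.1 ∈ (𝓡∂ n).boundary M) :
    exitTime g κ A θ ≤ exitTime g κ A' θ := by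
  refine sSup_le_sSup ?_
  rintro τ ⟨T, hT, rfl, θ', hf⟩
  have := h.flows hf
  rw [h.boundary _ hθ, inv_one, Ad_one] at this
  exact ⟨T, hT, rfl, _, this⟩

theorem IsBoundaryGauge.exitTime_eq (h : IsBoundaryGauge u A A')
    {θ : TangentBundle (𝓡∂ n) M × lieAlg G} (hθ : θ.1.1 ∈ (𝓡∂ n).boundary M) :
    exitTime g κ A θ = exitTime g κ A' θ :=
  le_antisymm (h.exitTime_le hθ) (h.symm.exitTime_le hθ)

theorem IsBoundaryGauge.scatters (h : IsBoundaryGauge u A A')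
    {θ θ' : TangentBundle (𝓡∂ n) M × lieAlg G} (hθ : θ.1.1 ∈ (𝓡∂ n).boundary M)
    (hθ' : θ'.1.1 ∈ (𝓡∂ n).boundary M) (hs : Scatters g κ A θ θ') : Scatters g κ A' θ θ' := by
  obtain ⟨T, hT, he, hf⟩ := hs
  exact ⟨T, hT, (h.exitTime_eq hθ).symm.trans he, h.flows_of_boundary hθ hθ' hf⟩

/-- Agreement of the lens data, as far as phases at the boundary are concerned. -/
def SameBoundaryLensDataOn (g : Metric n M) (κ : AdInvariantInner G) (O : Set (lieAlg G))
    (W : Set (TangentBundle (𝓡∂ n) M)) (A B : Potential n M G) : Prop :=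
  ∀ c ∈ inwardBoundary g ∩ W, ∀ ξ ∈ O,
    exitTime g κ A (c, ξ) = exitTime g κ B (c, ξ) ∧
    ∀ θ' : TangentBundle (𝓡∂ n) M × lieAlg G, θ'.1.1 ∈ (𝓡∂ n).boundary M →
      (Scatters g κ A (c, ξ) θ' ↔ Scatters g κ B (c, ξ) θ')

theorem SameLensDataOn.boundary {O : Set (lieAlg G)} {W : Set (TangentBundle (𝓡∂ n) M)}
    {B : Potential n M G} (h : SameLensDataOn g κ O W A B) : SameBoundaryLensDataOn g κ O W A B :=
  fun c hc ξ hξ => ⟨(h c hc ξ hξ).1, fun θ' _ => (h c hc ξ hξ).2 θ'⟩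

theorem SameBoundaryLensDataOn.gauge {O : Set (lieAlg G)} {W : Set (TangentBundle (𝓡∂ n) M)}
    {B B' : Potential n M G} {w : M → G} (h : SameBoundaryLensDataOn g κ O W A B)
    (hu : IsBoundaryGauge u A A') (hw : IsBoundaryGauge w B B') :
    SameBoundaryLensDataOn g κ O W A' B' := fun c hc ξ hξ => by
  obtain ⟨h1, h2⟩ := h c hc ξ hξ
  have hb := hc.1.1
  refine ⟨?_, fun θ' hθ' => ?_⟩
  · rw [← hu.exitTime_eq (θ := (c, ξ)) hb, ← hw.exitTime_eq (θ := (c, ξ)) hb, h1]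
  · exact ⟨fun hs => hw.scatters hb hθ' ((h2 θ' hθ').1 (hu.symm.scatters hb hθ' hs)),
      fun hs => hu.scatters hb hθ' ((h2 θ' hθ').2 (hw.symm.scatters hb hθ' hs))⟩

theorem SamePullbackAt.gauge {B B' : Potential n M G} {w : M → G} {x : M}
    (hx : x ∈ (𝓡∂ n).boundary M) (h : SamePullbackAt A B x)
    (hu : IsBoundaryGauge u A A') (hw : IsBoundaryGauge w B B') : SamePullbackAt A' B' x :=
  fun v hv => by rw [hu.toFun_eq hx hv, hw.toFun_eq hx hv, h v hv]

end WongGauge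

section Existence

variable {n : ℕ} [NeZero n] {M : Type*} [TopologicalSpace M]
  [ChartedSpace (EuclideanHalfSpace n) M] [IsManifold (𝓡∂ n) ∞ M]
variable {φ : OpenPartialHomeomorph M (EuclideanHalfSpace n)}
variable {N : ℕ} {G : Subgroup (Mat N)ˣ} {u : M → G}

/-- A one-form that is smooth in the preferred charts is smooth. -/
theorem contMDiff_oneForm {a : ∀ x : M, TangentSpace (𝓡∂ n) x →L[ℝ] lieAlg G}
    (h : ∀ x₀ : M, SmoothOn (F := Coord n →L[ℝ] lieAlg G)
      (fun y => (a (ext[chartAt (EuclideanHalfSpace n) x₀].symm y)).comp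
        (coordVec (chartAt (EuclideanHalfSpace n) x₀) y))
      ext[chartAt (EuclideanHalfSpace n) x₀].target) :
    ContMDiff (𝓡∂ n) ((𝓡∂ n).prod 𝓘(ℝ, Coord n →L[ℝ] lieAlg G)) ∞
      (fun x => TotalSpace.mk' (Coord n →L[ℝ] lieAlg G)
        (E := fun x : M => TangentSpace (𝓡∂ n) x →L[ℝ] Bundle.Trivial M (lieAlg G) x) x (a x)) := by
  intro x₀
  rw [contMDiffAt_hom_bundle]
  refine ⟨contMDiffAt_id, ?_⟩
  set ψ := chartAt (EuclideanHalfSpace n) x₀ with hψ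
  have hc := IsManifold.chart_mem_maximalAtlas (I := 𝓡∂ n) (n := ∞) x₀
  have hx := mem_chart_source (EuclideanHalfSpace n) x₀
  have hxt : ext[ψ] x₀ ∈ ext[ψ].target := ext[ψ].map_source (by rwa [ψ.extend_source])
  have h1 : ContMDiffAt (𝓡∂ n) 𝓘(ℝ, Coord n →L[ℝ] lieAlg G) ∞
      (fun x => (a (ext[ψ].symm (ext[ψ] x))).comp (coordVec ψ (ext[ψ] x))) x₀ := by
    have h2 := (h x₀ (ext[ψ] x₀) hxt).contMDiffWithinAt
    refine ContMDiffWithinAt.contMDiffAt (s := univ) (ContMDiffWithinAt.comp x₀ h2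
      (ψ.contMDiffAt_extend hc hx).contMDiffWithinAt fun x _ => ?_) univ_mem
    exact mem_range_self _
  refine h1.congr_of_eventuallyEq ?_
  filter_upwards [ψ.open_source.mem_nhds hx] with x hxs
  ext1 w
  rw [ContinuousLinearMap.inCoordinates_eq hxs (mem_univ _)]
  have e2 : ((trivializationAt (Coord n) (TangentSpace (𝓡∂ n)) x₀).symmL ℝ x : _) w =
      mfderivWithin 𝓘(ℝ, Coord n) (𝓡∂ n) ext[ψ].symm 𝓗[n] (ext[ψ] x) w :=
    congrArg (fun L : Coord n →L[ℝ] Coord n => L w)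
      (TangentBundle.symmL_trivializationAt (I := 𝓡∂ n) hxs)
  have e3 : ∀ X : lieAlg G, (Trivialization.continuousLinearEquivAt ℝ
      (trivializationAt (lieAlg G) (Bundle.Trivial M (lieAlg G)) x₀) x (mem_univ x)) X = X :=
    fun X => rfl
  have e4 : (Trivialization.continuousLinearEquivAt ℝ
      (trivializationAt (Coord n) (TangentSpace (𝓡∂ n)) x₀) x hxs).symm w =
      (trivializationAt (Coord n) (TangentSpace (𝓡∂ n)) x₀).symmL ℝ x w :=
    congrFun (Trivialization.symm_continuousLinearEquivAt_eq (R := ℝ)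
      (trivializationAt (Coord n) (TangentSpace (𝓡∂ n)) x₀) hxs) w
  refine (e3 _).trans ((congrArg (a x) (e4.trans e2)).trans ?_)
  obtain ⟨y, hy, rfl⟩ := exists_coord_of_mem_source hxs
  rw [ext[ψ].right_inv hy]
  rfl

/-- The vector is the velocity at the identity of a curve in the group obtained by moving the base
point. At the boundary such curves exist only in inward directions. -/
theorem inv_mul_gaugeDeriv_mem (hu : SmoothGauge (n := n) u) (x : M) (v : TangentSpace (𝓡∂ n) x) :
    ((u x).1⁻¹ : (Mat N)ˣ).val * gaugeDeriv u x v ∈ lieAlg G := by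
  obtain ⟨ψ, hc, hx⟩ : ∃ ψ ∈ IsManifold.maximalAtlas (𝓡∂ n) ∞ M, x ∈ ψ.source :=
    ⟨_, IsManifold.chart_mem_maximalAtlas x, mem_chart_source (EuclideanHalfSpace n) x⟩
  obtain ⟨y, hy, rfl⟩ := exists_coord_of_mem_source hx
  rw [← coordVec_coords hc hy v, ← fderivWithin_gaugeIn hc hu hy]
  generalize coords _ _ v = w
  have key : ∀ w : Coord n, 0 ≤ w 0 → ((u (ext[ψ].symm y)).1⁻¹ : (Mat N)ˣ).val *
      fderivWithin ℝ (gaugeIn u ψ) 𝓗[n] y w ∈ lieAlg G := fun w hw => by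
    have hyH := (relOpen_target ψ).1 hy
    have hline : HasDerivWithinAt (fun t : ℝ => y + t • w) w (Ici 0) 0 := by
      simpa using (((hasDerivAt_id (0 : ℝ)).smul_const w).const_add y).hasDerivWithinAt
    have hmaps : MapsTo (fun t : ℝ => y + t • w) (Ici 0) 𝓗[n] := fun t ht => by
      rw [mem_half]
      have := mul_nonneg (mem_Ici.1 ht) hw
      have := mem_half.1 hyH
      simp
      positivity
    have h1 := ((smoothOn_gaugeIn hc hu).differentiableWithinAt hy).hasFDerivWithinAt
    have h2 : HasDerivWithinAt (fun t : ℝ => gaugeIn u ψ (y + t • w))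
        (fderivWithin ℝ (gaugeIn u ψ) 𝓗[n] y w) (Ici 0) 0 := by
      have h3 : HasFDerivWithinAt (gaugeIn u ψ) (fderivWithin ℝ (gaugeIn u ψ) 𝓗[n] y) 𝓗[n]
          ((fun t : ℝ => y + t • w) 0) := by simpa using h1
      exact h3.comp_hasDerivWithinAt 0 hline hmaps
    refine mem_lieAlg_of_hasDerivWithinAt
      (γ := fun t => (u (ext[ψ].symm y)).1⁻¹ * (u (ext[ψ].symm (y + t • w))).1)
      (fun t => G.mul_mem (G.inv_mem (u _).2) (u _).2) (by simp) (h2.const_mul _)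
  -- Either `w` or `-w` is inward, and the Lie algebra is closed under negation.
  rcases le_total 0 (w 0) with h | h
  · exact key w h
  · have := (lieAlg G).neg_mem (key (-w) (by simpa using h))
    simpa using this

/-- The transform of a potential by a gauge exists. -/
theorem exists_isBoundaryGauge (A : Potential n M G) (hu : SmoothGauge (n := n) u)
    (hb : ∀ x ∈ (𝓡∂ n).boundary M, u x = 1) : ∃ A' : Potential n M G, IsBoundaryGauge u A A' := by
  obtain ⟨P, hP⟩ := exists_projection_lieAlg G
  -- The transformed form is built with matrix values; they already lie in the Lie algebra, so
  -- composing with the projection changes only the type.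
  let T : ∀ x : M, TangentSpace (𝓡∂ n) x →L[ℝ] Mat N := fun x =>
    (ContinuousLinearMap.mul ℝ (Mat N) ((u x).1⁻¹ : (Mat N)ˣ).val).comp (gaugeDeriv u x +
      ((ContinuousLinearMap.mul ℝ (Mat N)).flip ((u x).1 : Mat N)).comp
        ((lieAlg G).subtypeL.comp (A.toFun x)))
  have hT : ∀ x v, T x v = ((u x).1⁻¹ : (Mat N)ˣ).val * gaugeDeriv u x v
      + ((u x).1⁻¹ : (Mat N)ˣ).val * (A.toFun x v : Mat N) * ((u x).1 : Mat N) := fun x v => by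
    rw [mul_assoc, ← mul_add]; rfl
  have hmem : ∀ x v, T x v ∈ lieAlg G := fun x v => by
    rw [hT]
    refine (lieAlg G).add_mem (inv_mul_gaugeDeriv_mem hu x v) ?_
    have := conj_mem_lieAlg (G.inv_mem (u x).2) (A.toFun x v).2
    rwa [inv_inv] at this
  refine ⟨⟨fun x => P.comp (T x), contMDiff_oneForm fun x₀ => ?_⟩, hu, hb, fun x v => ?_⟩
  · set ψ := chartAt (EuclideanHalfSpace n) x₀ with hψ
    have hc := IsManifold.chart_mem_maximalAtlas (I := 𝓡∂ n) (n := ∞) x₀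
    refine (relOpen_target ψ).smoothOn (contDiffOn_clm_apply.2 fun w => ?_)
    have hU := smoothOn_gaugeIn hc hu
    have hV : ContDiffOn ℝ ∞ (fun y => Ring.inverse (gaugeIn u ψ y)) ext[ψ].target := fun y hy =>
      ContDiffAt.comp_contDiffWithinAt (g := Ring.inverse) (f := gaugeIn u ψ) y
        (contDiffAt_ringInverse ℝ (u (ext[ψ].symm y)).1) (hU.contDiffOn (relOpen_target ψ).1 y hy)
    have hD : ContDiffOn ℝ ∞ (fun y => fderivWithin ℝ (gaugeIn u ψ) 𝓗[n] y w) ext[ψ].target :=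
      ((hU.fderivWithin (relOpen_target ψ).1).contDiffOn (relOpen_target ψ).1).clm_apply
        contDiffOn_const
    have hA : ContDiffOn ℝ ∞ (fun y => (potentialIn A ψ y w : Mat N)) ext[ψ].target :=
      (lieAlg G).subtypeL.contDiff.comp_contDiffOn
        (((smoothOn_potentialIn hc A).contDiffOn (relOpen_target ψ).1).clm_apply contDiffOn_const)
    refine (P.contDiff.comp_contDiffOn (hV.mul (hD.add (hA.mul
      (hU.contDiffOn (relOpen_target ψ).1))))).congr fun y hy => ?_
    change P (T _ (coordVec ψ y w)) = P _
    rw [hT, mul_assoc, ← mul_add, ← fderivWithin_gaugeIn hc hu hy]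
    simp only [gaugeIn, Ring.inverse_unit]
    rfl
  · change ((P (T x v) : lieAlg G) : Mat N) = _
    rw [← hT, show P (T x v) = ⟨T x v, hmem x v⟩ from hP ⟨_, hmem x v⟩]

end Existence

end YangMills

end

/-! ### Group-valued solutions of the gauge equation -/

noncomputable section

set_option linter.unusedSectionVars false

namespace YangMills

section MatrixODE

variable {N : ℕ} {G : Subgroup (Mat N)ˣ}

/-- Solutions of `γ' = γ b - a γ`, with `a` and `b` in the Lie algebra of a compact group, stay in
the group. -/
theorem exists_mem_group_of_hasDerivWithinAt (hG : IsCompact (G : Set (Mat N)ˣ)) {γ : ℝ → Mat N}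
    {a b : ℝ → lieAlg G} {T K : ℝ} (hγ : ContinuousOn γ (Icc 0 T))
    (ha : ∀ t ∈ Icc 0 T, ‖a t‖ + ‖b t‖ ≤ K)
    (h : ∀ t ∈ Ico 0 T, HasDerivWithinAt γ (γ t * (b t : Mat N) - (a t : Mat N) * γ t) (Ici t) t)
    (h0 : γ 0 = 1) : ∀ t ∈ Icc 0 T, ∃ V ∈ G, (V : Mat N) = γ t := by
  set S : Set (Mat N) := (fun V : (Mat N)ˣ => (V : Mat N)) '' (G : Set (Mat N)ˣ) with hS
  have hSc : IsCompact S := hG.image Units.continuous_val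
  have hSne : S.Nonempty := ⟨1, 1, G.one_mem, rfl⟩
  -- Grönwall for the distance to the compact group: it starts at 0 and its upper growth rate is at
  -- most `K` times itself, hence it stays 0.
  have hbound := le_gronwallBound_of_liminf_deriv_right_le (f := fun t => Metric.infDist (γ t) S)
    (f' := fun t => K * Metric.infDist (γ t) S) (δ := 0) (K := K) (ε := 0) (a := 0) (b := T)
    ((Metric.continuous_infDist_pt S).comp_continuousOn hγ) (fun x hx r hr => ?_)
    (by
      simp only [h0]
      exact (Metric.infDist_zero_of_mem (s := S) ⟨1, G.one_mem, rfl⟩).le) (fun x _ => by simp)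
  · intro t ht
    have h1 := hbound t ht
    rw [gronwallBound_ε0_δ0] at h1
    have h2 : Metric.infDist (γ t) S = 0 := le_antisymm h1 Metric.infDist_nonneg
    obtain ⟨V, hV, hVt⟩ := (hSc.isClosed.mem_iff_infDist_zero hSne).2 h2
    exact ⟨V, hV, hVt⟩
  -- Take a nearest group element `V` and compare `γ` with the curve `α(-(z - x)) V β(z - x)` in the
  -- group, where `α`, `β` realise the velocities `a x`, `b x`. The velocities of the two curves at
  -- `x` differ by an expression linear in `γ x - V`.
  · obtain ⟨_, ⟨V, hV, rfl⟩, hd⟩ := hSc.exists_infDist_eq_dist hSne (γ x)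
    obtain ⟨α, hα, hα1, hαd⟩ := (a x).2
    obtain ⟨β, hβ, hβ1, hβd⟩ := (b x).2
    have hsub : HasDerivAt (fun z : ℝ => z - x) 1 x := (hasDerivAt_id x).sub_const x
    have hnsub : HasDerivAt (fun z : ℝ => -(z - x)) (-1) x := hsub.neg
    have hα' := hαd.scomp_of_eq x hnsub (by simp)
    have hβ' := hβd.scomp_of_eq x hsub (by simp)
    have hW := (hα'.mul_const (V : Mat N)).fun_mul hβ'
    have hD := (h x hx).sub hW.hasDerivWithinAt
    have hnorm : ‖γ x * (b x : Mat N) - (a x : Mat N) * γ x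
        - ((-1 : ℝ) • (a x : Mat N) * (V : Mat N) * (β (x - x) : Mat N)
          + (α (-(x - x)) : Mat N) * V * ((1 : ℝ) • (b x : Mat N)))‖ < r := by
      refine lt_of_le_of_lt ?_ hr
      have e : γ x * (b x : Mat N) - (a x : Mat N) * γ x
        - ((-1 : ℝ) • (a x : Mat N) * (V : Mat N) * (β (x - x) : Mat N)
          + (α (-(x - x)) : Mat N) * V * ((1 : ℝ) • (b x : Mat N))) =
          (γ x - V) * (b x : Mat N) - (a x : Mat N) * (γ x - V) := by
        simp [hα1, hβ1]
        noncomm_ring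
      rw [e, hd, dist_eq_norm]
      calc _ ≤ ‖(γ x - V) * (b x : Mat N)‖ + ‖(a x : Mat N) * (γ x - V)‖ := norm_sub_le _ _
        _ ≤ ‖γ x - V‖ * ‖(b x : Mat N)‖ + ‖(a x : Mat N)‖ * ‖γ x - V‖ :=
          add_le_add (norm_mul_le _ _) (norm_mul_le _ _)
        _ = (‖a x‖ + ‖b x‖) * ‖γ x - V‖ := by
          change _ = (‖(a x : Mat N)‖ + ‖(b x : Mat N)‖) * _
          ring
        _ ≤ _ := mul_le_mul_of_nonneg_right (ha x ⟨hx.1, hx.2.le⟩) (norm_nonneg _)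
    refine ((hD.liminf_right_slope_norm_le hnorm).and_eventually self_mem_nhdsWithin).mono
      fun z hz => ?_
    obtain ⟨hz1, hz2⟩ := hz
    have hzx : 0 < (z - x)⁻¹ := inv_pos.2 (sub_pos.2 hz2)
    refine lt_of_le_of_lt (mul_le_mul_of_nonneg_left (sub_le_sub ?_ ?_) hzx.le) hz1
    · change _ ≤ ‖γ z - (α (-(z - x)) : Mat N) * V * (β (z - x) : Mat N)‖
      rw [← dist_eq_norm]
      exact Metric.infDist_le_dist_of_mem
        ⟨α (-(z - x)) * V * β (z - x), G.mul_mem (G.mul_mem (hα _) hV) (hβ _), rfl⟩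
    · change ‖γ x - (α (-(x - x)) : Mat N) * V * (β (x - x) : Mat N)‖ ≤ _
      rw [hd, dist_eq_norm]
      simp [hα1, hβ1]

end MatrixODE

section LocalGauge

variable {n : ℕ} [NeZero n] {N : ℕ} {G : Subgroup (Mat N)ˣ}

/-- The map `(α, β) ↦ (U ↦ U β - α U)`. -/
def leftRight (N : ℕ) : (Mat N × Mat N) →L[ℝ] Mat N →L[ℝ] Mat N :=
  (ContinuousLinearMap.mul ℝ (Mat N)).flip.comp (ContinuousLinearMap.snd ℝ (Mat N) (Mat N)) -
    (ContinuousLinearMap.mul ℝ (Mat N)).comp (ContinuousLinearMap.fst ℝ (Mat N) (Mat N))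

theorem leftRight_apply (α β U : Mat N) : leftRight N (α, β) U = U * β - α * U := rfl

/-- The equation `∂₀ U = U b - a U` has group-valued solutions. -/
theorem exists_local_gauge (hG : IsCompact (G : Set (Mat N)ˣ)) {a b : Coord n → lieAlg G}
    {T : Set (Coord n)} (hT : RelOpen T) (ha : SmoothOn a T) (hb : SmoothOn b T) {p : Coord n}
    (hp : p ∈ T) (hp0 : p 0 = 0) :
    ∃ δ > 0, 𝓗[n] ∩ Metric.ball p δ ⊆ T ∧ ∃ U : Coord n → Mat N,
      SmoothOn U (𝓗[n] ∩ Metric.ball p δ) ∧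
      (∀ z ∈ 𝓗[n] ∩ Metric.ball p δ, z 0 = 0 → U z = 1) ∧
      (∀ z ∈ 𝓗[n] ∩ Metric.ball p δ, normalD U z = U z * (b z : Mat N) - (a z : Mat N) * U z) ∧
      ∀ z ∈ 𝓗[n] ∩ Metric.ball p δ, ∃ V ∈ G, (V : Mat N) = U z := by
  have hL : SmoothOn (fun z => ((a z : Mat N), (b z : Mat N))) T := fun y hy =>
    ((lieAlg G).subtypeL.contDiff.contDiffAt.comp_contDiffWithinAt y (ha y hy)).prodMk
      ((lieAlg G).subtypeL.contDiff.contDiffAt.comp_contDiffWithinAt y (hb y hy))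
  obtain ⟨δ, hδ, hδT, U, hU, hU1, hUd⟩ := exists_normal_linear_ode (leftRight N) hT hL hp hp0 1
  refine ⟨δ, hδ, hδT, U, hU, hU1, hUd, fun z hz => ?_⟩
  have hline : ∀ t ∈ Icc 0 (z 0), bdryProj z + t • basisVec 0 ∈ 𝓗[n] ∩ Metric.ball p δ :=
    fun t ht => line_mem_ball hp0 hz.2 ht.1 ht.2
  have hcl : Continuous fun t : ℝ => bdryProj z + t • (basisVec 0 : Coord n) := by fun_prop
  have hcont : ∀ {F : Type} [NormedAddCommGroup F] [NormedSpace ℝ F] {f : Coord n → F},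
      SmoothOn f (𝓗[n] ∩ Metric.ball p δ) →
      ContinuousOn (fun t : ℝ => f (bdryProj z + t • basisVec 0)) (Icc 0 (z 0)) :=
    fun {F} _ _ {f} hf => (hf.continuousOn inter_subset_left).comp hcl.continuousOn hline
  obtain ⟨K, hK⟩ := isCompact_Icc.exists_bound_of_continuousOn
    ((hcont (ha.mono hδT)).norm.add (hcont (hb.mono hδT)).norm)
  have hz0 : z 0 ∈ Icc 0 (z 0) := ⟨mem_half.1 hz.1, le_rfl⟩
  have := exists_mem_group_of_hasDerivWithinAt hG (γ := fun t => U (bdryProj z + t • basisVec 0))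
    (a := fun t => a (bdryProj z + t • basisVec 0)) (b := fun t => b (bdryProj z + t • basisVec 0))
    (T := z 0) (K := K) (hcont hU) (fun t ht => (le_abs_self _).trans (hK t ht))
    (fun t ht => by
      have hm := hline t ⟨ht.1, ht.2.le⟩
      have h1 := hasDerivWithinAt_line (bdryProj_zero z) (hU.differentiableWithinAt hm)
      rw [hUd _ hm, leftRight_apply] at h1
      exact h1.mono (Ici_subset_Ici.2 ht.1))
    (hU1 _ (hline 0 ⟨le_rfl, hz0.1⟩) (by simp)) (z 0) hz0
  simpa only [bdryProj_add] using this

end LocalGauge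

end YangMills

end

/-! ### Flat gauges and cutting off a local gauge -/

noncomputable section

set_option linter.unusedSectionVars false

namespace YangMills

section Flat

variable {n : ℕ} [NeZero n] {F : Type*} [NormedAddCommGroup F] [NormedSpace ℝ F]

theorem jetZero_zero (m : ℕ) (q : Coord n) : JetZero m (fun _ : Coord n => (0 : F)) q :=
  fun k _ => by simp

end Flat

section GlobalGauge

variable {n : ℕ} [NeZero n] {M : Type*} [TopologicalSpace M]
  [ChartedSpace (EuclideanHalfSpace n) M]
variable {φ ψ : OpenPartialHomeomorph M (EuclideanHalfSpace n)}
variable {N : ℕ} {G : Subgroup (Mat N)ˣ} {u : M → G}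

theorem tendsto_symm_half {x : M} (hx : x ∈ φ.source) :
    Tendsto ext[φ].symm (𝓝[𝓗[n]] (ext[φ] x)) (𝓝 x) := by
  have h := (φ.continuousAt_extend_symm (I := 𝓡∂ n) hx).tendsto
  rw [φ.extend_left_inv hx] at h
  exact h.mono_left nhdsWithin_le_nhds

theorem tendsto_ext_half {x : M} (hx : x ∈ φ.source) :
    Tendsto ext[φ] (𝓝 x) (𝓝[𝓗[n]] (ext[φ] x)) :=
  tendsto_nhdsWithin_iff.2 ⟨φ.continuousAt_extend hx,
    Eventually.of_forall fun _ => mem_range_self _⟩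

theorem ext_mem_target {x : M} (hx : x ∈ φ.source) : ext[φ] x ∈ ext[φ].target :=
  ext[φ].map_source (by rwa [φ.extend_source])

variable [IsManifold (𝓡∂ n) ∞ M]

/-- All derivatives of `u` at `x` agree with those of the constant map `1`. -/
def FlatGauge (n : ℕ) [NeZero n] {M : Type*} [TopologicalSpace M]
    [ChartedSpace (EuclideanHalfSpace n) M] [IsManifold (𝓡∂ n) ∞ M] (u : M → G) (x : M) : Prop :=
  ∀ ψ ∈ IsManifold.maximalAtlas (𝓡∂ n) ∞ M, x ∈ ψ.source → ∀ m,
    JetZero m (fun y => gaugeIn u ψ y - 1) (ext[ψ] x)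

/-- Vanishing of jets does not depend on the chart. -/
theorem JetZero.transition {F : Type*} [NormedAddCommGroup F] [NormedSpace ℝ F]
    (hφ : φ ∈ IsManifold.maximalAtlas (𝓡∂ n) ∞ M) (hψ : ψ ∈ IsManifold.maximalAtlas (𝓡∂ n) ∞ M)
    {x : M} (hx : x ∈ φ.source) (hx' : x ∈ ψ.source) {m : ℕ} {f : Coord n → F}
    (hf : SmoothOn f (transDom φ ψ)) (h : JetZero m f (ext[φ] x)) :
    JetZero m (fun y => f (transition ψ φ y)) (ext[ψ] x) := by
  refine JetZero.comp (relOpen_transDom ψ φ) (relOpen_transDom φ ψ) (smoothOn_transition hψ hφ) hf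
    (fun y hy => transition_mem hy) (mem_transDom hx' hx) ?_
  rwa [transition_apply hx']

theorem flatGauge_of_chart (hφ : φ ∈ IsManifold.maximalAtlas (𝓡∂ n) ∞ M)
    (hu : SmoothGauge (n := n) u) {x : M} (hx : x ∈ φ.source)
    (h : ∀ m, JetZero m (fun y => gaugeIn u φ y - 1) (ext[φ] x)) : FlatGauge n u x := by
  intro ψ hψ hx' m
  have h1 := JetZero.transition hφ hψ hx hx' (((smoothOn_gaugeIn hφ hu).sub
    (smoothOn_const 1 _)).mono inter_subset_left) (h m)
  refine h1.congr ?_ (mem_range_self _)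
  filter_upwards [(relOpen_transDom ψ φ).2 _ (mem_transDom hx' hx)] with y hy
  rw [gaugeIn, gaugeIn, symm_transition hy]

theorem flatGauge_of_eventually {x : M} (h : ∀ᶠ y in 𝓝 x, u y = 1) : FlatGauge n u x := by
  intro ψ hψ hx m
  refine (jetZero_zero m _).congr ?_ (mem_range_self _)
  filter_upwards [(tendsto_symm_half hx).eventually h] with y hy
  rw [gaugeIn, hy]
  simp

/-- A local gauge in a chart can be cut off to a gauge on `M`, which is flat wherever the local
gauge is. -/
theorem exists_gauge_cutoff [T2Space M] (hφ : φ ∈ IsManifold.maximalAtlas (𝓡∂ n) ∞ M) {p₀ : Coord n}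
    (hp00 : p₀ 0 = 0) {δ : ℝ} (hδ : 0 < δ) (hδT : 𝓗[n] ∩ Metric.ball p₀ δ ⊆ ext[φ].target)
    {U : Coord n → Mat N} (hU : SmoothOn U (𝓗[n] ∩ Metric.ball p₀ δ))
    (hU1 : ∀ z ∈ 𝓗[n] ∩ Metric.ball p₀ δ, z 0 = 0 → U z = 1)
    (hUG : ∀ z ∈ 𝓗[n] ∩ Metric.ball p₀ δ, ∃ V ∈ G, (V : Mat N) = U z) :
    ∃ u : M → G, SmoothGauge (n := n) u ∧ (∀ x ∈ (𝓡∂ n).boundary M, u x = 1) ∧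
      (∀ z ∈ 𝓗[n] ∩ Metric.ball p₀ (δ / 4), gaugeIn u φ z = U z) ∧
      ∀ x ∈ (𝓡∂ n).boundary M, (x ∈ φ.source → ext[φ] x ∈ Metric.ball p₀ δ →
        ∀ m, JetZero m (fun y => U y - 1) (ext[φ] x)) → FlatGauge n u x := by
  set B := 𝓗[n] ∩ Metric.ball p₀ δ with hB
  have hBo : RelOpen B := relOpen_ball p₀ δ
  let χ : ContDiffBump p₀ := ⟨δ / 4, δ / 2, by positivity, by linarith⟩
  -- The cutoff acts on the argument: where `χ` is 1 the point is kept, where `χ` is 0 it is dropped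
  -- onto the boundary, where `U` is 1. All values of `U ∘ s` therefore remain in the group.
  let s : Coord n → Coord n := fun z => scaleNormal (χ z) z
  have hsB : ∀ z ∈ B, s z ∈ B := fun z hz => scaleNormal_mem_ball hp00 hz ⟨χ.nonneg, χ.le_one⟩
  have hs0 : ∀ z : Coord n, z 0 = 0 → s z = z := fun z hz => scaleNormal_of_zero _ hz
  have hsd : ContDiff ℝ ∞ s := by
    have e : s = fun z => z + ((χ z - 1) * z 0) • (basisVec 0 : Coord n) := by
      funext z
      simp only [s, scaleNormal_apply, bdryProj]
      module
    rw [e]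
    have h0 : ContDiff ℝ ∞ fun z : Coord n => z 0 :=
      (EuclideanSpace.proj (0 : Fin n) : Coord n →L[ℝ] ℝ).contDiff
    exact contDiff_id.add (((χ.contDiff.sub contDiff_const).mul h0).smul contDiff_const)
  have hUs : SmoothOn (fun z => U (s z)) B := fun z hz =>
    ((hU (s z) (hsB z hz)).mono (inter_subset_left (t := Metric.ball p₀ δ))).comp
      (t := B) z (hsd.contDiffAt.contDiffWithinAt (s := B)) hsB |>.mono_of_mem_nhdsWithin
      (hBo.2 z hz)
  set D : Set M := φ.source ∩ ext[φ] ⁻¹' Metric.ball p₀ δ with hD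
  have hDo : IsOpen D := φ.isOpen_extend_preimage Metric.isOpen_ball
  have hDB : ∀ x ∈ D, ext[φ] x ∈ B := fun x hx => ⟨mem_range_self _, hx.2⟩
  choose! V hVG hV using hUG
  classical
  let u : M → G := fun x => if h : x ∈ D then ⟨V (s (ext[φ] x)), hVG _ (hsB _ (hDB x h))⟩ else 1
  have huD : ∀ x ∈ D, ((u x).1 : Mat N) = U (s (ext[φ] x)) := fun x hx => by
    simp only [u, dif_pos hx]
    exact hV _ (hsB _ (hDB x hx))
  have huD' : ∀ x ∉ D, u x = 1 := fun x hx => by simp only [u, dif_neg hx]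
  have hGext : ∀ {x : M}, ((u x).1 : Mat N) = 1 → u x = 1 := fun {x} h =>
    Subtype.ext (Units.ext h)
  set K : Set M := ext[φ].symm '' (𝓗[n] ∩ Metric.closedBall p₀ (δ / 2)) with hK
  have hKB : 𝓗[n] ∩ Metric.closedBall p₀ (δ / 2) ⊆ B :=
    inter_subset_inter_right _ (Metric.closedBall_subset_ball (by linarith))
  have hKc : IsClosed K := by
    refine IsCompact.isClosed (((isCompact_closedBall p₀ (δ / 2)).inter_left isClosed_half
      ).image_of_continuousOn ?_)
    exact (φ.continuousOn_extend_symm).mono (hKB.trans hδT)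
  -- Outside the support of the bump the argument has been dropped to the boundary. Since `K` is
  -- closed in `M`, the extension by 1 is smooth across the edge of the chart region.
  have hKu : ∀ x ∉ K, u x = 1 := fun x hx => by
    by_cases hxD : x ∈ D
    · apply hGext
      rw [huD x hxD]
      have hχ : χ (ext[φ] x) = 0 := by
        apply χ.zero_of_le_dist
        by_contra hlt
        refine hx ⟨ext[φ] x, ⟨mem_range_self _, ?_⟩, φ.extend_left_inv hxD.1⟩
        exact Metric.mem_closedBall.2 (not_le.1 hlt).le
      refine hU1 _ (hsB _ (hDB x hxD)) ?_
      change scaleNormal (χ (ext[φ] x)) (ext[φ] x) 0 = 0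
      rw [hχ, scaleNormal_apply]
      simp
    · exact huD' x hxD
  have hsmooth : SmoothGauge (n := n) u := fun x => by
    by_cases hx : x ∈ D
    · have h1 : ContMDiffAt (𝓡∂ n) 𝓘(ℝ, Mat N) ∞ (fun y => U (s (ext[φ] y))) x :=
        (ContMDiffWithinAt.comp (t := 𝓗[n]) x (hUs _ (hDB x hx)).contMDiffWithinAt
          (φ.contMDiffAt_extend hφ hx.1).contMDiffWithinAt (s := univ)
          fun y _ => mem_range_self _).contMDiffAt univ_mem
      refine h1.congr_of_eventuallyEq ?_
      filter_upwards [hDo.mem_nhds hx] with y hy using huD y hy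
    · have hxK : x ∉ K := by
        rintro ⟨z, hz, rfl⟩
        refine hx ⟨symm_mem_source (hδT (hKB hz)), ?_⟩
        rw [mem_preimage, ext[φ].right_inv (hδT (hKB hz))]
        exact (hKB hz).2
      refine (contMDiffAt_const (c := (1 : Mat N))).congr_of_eventuallyEq ?_
      filter_upwards [hKc.isOpen_compl.mem_nhds hxK] with y hy
      rw [hKu y hy]
      rfl
  have hgauge : EqOn (gaugeIn u φ) (fun z => U (s z)) B := fun z hz => by
    have hz' := hδT hz
    have hzD : ext[φ].symm z ∈ D := ⟨symm_mem_source hz', by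
      rw [mem_preimage, ext[φ].right_inv hz']; exact hz.2⟩
    rw [gaugeIn, huD _ hzD, ext[φ].right_inv hz']
  refine ⟨u, hsmooth, fun x hx => ?_, ?_, fun x hx hab => ?_⟩
  · by_cases hxD : x ∈ D
    · apply hGext
      have h0 := (mem_boundary_iff hφ hxD.1).1 hx
      rw [huD x hxD, hs0 _ h0, hU1 _ (hDB x hxD) h0]
    · exact huD' x hxD
  · intro z hz
    rw [hgauge ⟨hz.1, Metric.ball_subset_ball (by linarith) hz.2⟩]
    have : χ z = 1 := χ.one_of_mem_closedBall (Metric.ball_subset_closedBall hz.2)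
    simp only [s, this, scaleNormal_one]
  · by_cases hxD : x ∈ D
    · refine flatGauge_of_chart hφ hsmooth hxD.1 fun m => ?_
      have h0 := (mem_boundary_iff hφ hxD.1).1 hx
      -- The map `s` fixes boundary points, so vanishing of the jet of `U - 1` at such a point
      -- passes to the composite at the same point.
      have h2 : JetZero m (fun z => U (s z) - 1) (ext[φ] x) :=
        JetZero.comp (f := fun y => U y - 1) (τ := s) hBo hBo
          (fun z _ => hsd.contDiffAt.contDiffWithinAt)
          (hU.sub (smoothOn_const 1 B)) hsB (hDB x hxD)
          (by rw [hs0 _ h0]; exact hab hxD.1 hxD.2 m)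
      refine h2.congr ?_ (mem_range_self _)
      filter_upwards [hBo.2 _ (hDB x hxD)] with z hz
      rw [hgauge hz]
    · refine flatGauge_of_eventually ?_
      have hxK : x ∉ K := by
        rintro ⟨z, hz, rfl⟩
        refine hxD ⟨symm_mem_source (hδT (hKB hz)), ?_⟩
        rw [mem_preimage, ext[φ].right_inv (hδT (hKB hz))]
        exact (hKB hz).2
      filter_upwards [hKc.isOpen_compl.mem_nhds hxK] with y hy using hKu y hy

/-- The equation `∂₀ u = u b - a u` near `p ∈ ∂M` is solved by a gauge on `M`. -/
theorem exists_gauge_normal_ode [T2Space M] (hG : IsCompact (G : Set (Mat N)ˣ))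
    (hφ : φ ∈ IsManifold.maximalAtlas (𝓡∂ n) ∞ M) {p : M} (hp : p ∈ φ.source)
    (hpb : p ∈ (𝓡∂ n).boundary M) {a b : Coord n → lieAlg G} (ha : SmoothOn a ext[φ].target)
    (hb : SmoothOn b ext[φ].target) :
    ∃ u : M → G, SmoothGauge (n := n) u ∧ (∀ x ∈ (𝓡∂ n).boundary M, u x = 1) ∧
      ∀ᶠ z in 𝓝[𝓗[n]] (ext[φ] p), normalD (gaugeIn u φ) z =
        gaugeIn u φ z * (b z : Mat N) - (a z : Mat N) * gaugeIn u φ z := by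
  have hp00 : ext[φ] p 0 = 0 := (mem_boundary_iff hφ hp).1 hpb
  obtain ⟨δ, hδ, hδT, U, hU, hU1, hUd, hUG⟩ := exists_local_gauge hG (relOpen_target φ) ha hb
    (ext_mem_target hp) hp00
  obtain ⟨u, hu, hu1, heq, -⟩ := exists_gauge_cutoff hφ hp00 hδ hδT hU hU1 hUG
  have hin : RelOpen (𝓗[n] ∩ Metric.ball (ext[φ] p) (δ / 4)) := relOpen_ball _ _
  refine ⟨u, hu, hu1, ?_⟩
  filter_upwards [hin.2 _ ⟨mem_range_self _, Metric.mem_ball_self (by positivity)⟩] with z hz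
  rw [normalD_congr hin heq hz, heq z hz,
    hUd z ⟨hz.1, Metric.ball_subset_ball (by linarith) hz.2⟩]

end GlobalGauge

end YangMills

end

/-! ### Strictly concave motion and short rays -/

noncomputable section

set_option linter.unusedSectionVars false

namespace YangMills

section RealODE

theorem sub_le_mul_of_hasDerivWithinAt {f f' : ℝ → ℝ} {a b c d C : ℝ}
    (h : ∀ t ∈ Icc c d, HasDerivWithinAt f (f' t) (Icc c d) t) (hca : c ≤ a) (hab : a ≤ b)
    (hbd : b ≤ d) (hC : ∀ t ∈ Icc a b, f' t ≤ C) : f b - f a ≤ C * (b - a) := by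
  have hsub : Icc a b ⊆ Icc c d := Icc_subset_Icc hca hbd
  have hB : ∀ x : ℝ, HasDerivAt (fun t => f a + C * (t - a)) C x := fun x => by
    simpa using (((hasDerivAt_id x).sub_const a).const_mul C).const_add (f a)
  have := image_le_of_deriv_right_le_deriv_boundary (f := f) (f' := f') (a := a) (b := b)
    (fun t ht => ((h t (hsub ht)).continuousWithinAt).mono hsub)
    (fun t ht => (h t (hsub ⟨ht.1, ht.2.le⟩)).mono_of_mem_nhdsWithin
      (Icc_mem_nhdsGE_of_mem ⟨hca.trans ht.1, ht.2.trans_le hbd⟩))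
    (B := fun t => f a + C * (t - a)) (B' := fun _ => C) (by simp)
    (fun t _ => (hB t).continuousAt.continuousWithinAt) (fun t _ => (hB t).hasDerivWithinAt)
    (fun t ht => hC t ⟨ht.1, ht.2.le⟩) ⟨hab, le_rfl⟩
  linarith

variable {x y v : ℝ → ℝ} {T k K : ℝ}

/-- Two integrations of the bound on the acceleration place the motion below a parabola; changing
signs gives the companion lower bound. -/
theorem add_le_of_second_deriv_le (hx : ∀ t ∈ Icc 0 T, HasDerivWithinAt x (y t) (Icc 0 T) t)
    (hy : ∀ t ∈ Icc 0 T, HasDerivWithinAt y (v t) (Icc 0 T) t) (hv : ∀ t ∈ Icc 0 T, v t ≤ -k) :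
    ∀ t ∈ Icc 0 T, y t ≤ y 0 - k * t ∧ x t ≤ x 0 + y 0 * t - k * t ^ 2 / 2 := by
  have h1 : ∀ t ∈ Icc 0 T, y t ≤ y 0 - k * t := fun t ht => by
    have := sub_le_mul_of_hasDerivWithinAt hy le_rfl ht.1 ht.2
      (fun s hs => hv s ⟨hs.1, hs.2.trans ht.2⟩)
    linarith
  refine fun t ht => ⟨h1 t ht, ?_⟩
  have hd : ∀ s ∈ Icc 0 T, HasDerivWithinAt (fun s => x s - (y 0 * s - k * s ^ 2 / 2))
      (y s - (y 0 - k * s)) (Icc 0 T) s := fun s hs => by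
    have h2 : HasDerivAt (fun s : ℝ => y 0 * s - k * s ^ 2 / 2) (y 0 - k * s) s := by
      have := ((hasDerivAt_id s).const_mul (y 0)).sub
        ((((hasDerivAt_id s).pow 2).const_mul k).div_const 2)
      refine this.congr_deriv ?_
      simp
      ring
    exact (hx s hs).sub h2.hasDerivWithinAt
  have := sub_le_mul_of_hasDerivWithinAt (C := 0) hd le_rfl ht.1 ht.2
    (fun s hs => by linarith [h1 s ⟨hs.1, hs.2.trans ht.2⟩])
  simp at this
  linarith

theorem le_of_le_second_deriv (hx : ∀ t ∈ Icc 0 T, HasDerivWithinAt x (y t) (Icc 0 T) t)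
    (hy : ∀ t ∈ Icc 0 T, HasDerivWithinAt y (v t) (Icc 0 T) t) (hv : ∀ t ∈ Icc 0 T, -K ≤ v t) :
    ∀ t ∈ Icc 0 T, x 0 + y 0 * t - K * t ^ 2 / 2 ≤ x t := by
  intro t ht
  have := (add_le_of_second_deriv_le (x := fun t => -x t) (y := fun t => -y t)
    (v := fun t => -v t) (k := -K) (fun s hs => (hx s hs).neg) (fun s hs => (hy s hs).neg)
    (fun s hs => by linarith [hv s hs]) t ht).2
  linarith

/-- A strictly concave function starting at zero with positive velocity returns to zero. -/
theorem exists_return_time (hx : ∀ t ∈ Icc 0 T, HasDerivWithinAt x (y t) (Icc 0 T) t)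
    (hy : ∀ t ∈ Icc 0 T, HasDerivWithinAt y (v t) (Icc 0 T) t)
    (hv : ∀ t ∈ Icc 0 T, -K ≤ v t ∧ v t ≤ -k) (hk : 0 < k) (hx0 : x 0 = 0) (hy0 : 0 < y 0)
    (hT : 2 * y 0 / k ≤ T) :
    ∃ τ, y 0 / K ≤ τ ∧ τ ≤ 2 * y 0 / k ∧ x τ = 0 ∧ y τ < 0 ∧ ∀ t ∈ Icc 0 τ, 0 ≤ x t := by
  have hT0 : 0 ≤ T := le_trans (by positivity) hT
  have hkK : k ≤ K := by linarith [(hv 0 ⟨le_rfl, hT0⟩).1, (hv 0 ⟨le_rfl, hT0⟩).2]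
  have hK : 0 < K := hk.trans_le hkK
  have up := add_le_of_second_deriv_le hx hy fun t ht => (hv t ht).2
  have lo := le_of_le_second_deriv hx hy fun t ht => (hv t ht).1
  have h1 : y 0 / K ≤ 2 * y 0 / k := by
    rw [div_le_div_iff₀ hK hk]
    nlinarith
  have h1' : 0 ≤ y 0 / K := by positivity
  have hsub : Icc (y 0 / K) (2 * y 0 / k) ⊆ Icc 0 T := Icc_subset_Icc h1' hT
  -- At time `y 0 / K` the lower parabola is still nonnegative, while the upper one reaches 0 at `2
  -- * y 0 / k`. A zero must occur between them, which bounds the return time on both sides.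
  have e1 : 0 ≤ x (y 0 / K) := by
    have := lo (y 0 / K) (hsub ⟨le_rfl, h1⟩)
    have e : x 0 + y 0 * (y 0 / K) - K * (y 0 / K) ^ 2 / 2 = y 0 ^ 2 / (2 * K) := by
      rw [hx0]; field_simp; ring
    rw [e] at this
    exact le_trans (by positivity) this
  have e2 : x (2 * y 0 / k) ≤ 0 := by
    have := (up (2 * y 0 / k) (hsub ⟨h1, le_rfl⟩)).2
    have e : x 0 + y 0 * (2 * y 0 / k) - k * (2 * y 0 / k) ^ 2 / 2 = 0 := by
      rw [hx0]; field_simp; ring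
    linarith
  obtain ⟨τ, hτ, hxτ⟩ := intermediate_value_Icc' h1
    (fun t ht => ((hx t (hsub ht)).continuousWithinAt).mono hsub) (⟨e2, e1⟩ : (0 : ℝ) ∈ Icc _ _)
  have hτ0 : 0 < τ := lt_of_lt_of_le (by positivity) hτ.1
  have hτT := hsub hτ
  have hanti : ∀ s t, 0 ≤ s → s ≤ t → t ≤ T → y t ≤ y s - k * (t - s) := fun s t hs hst ht => by
    have := sub_le_mul_of_hasDerivWithinAt hy hs hst ht
      (fun r hr => (hv r ⟨hs.trans hr.1, hr.2.trans ht⟩).2)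
    linarith
  have mvt : ∀ a b, 0 ≤ a → a < b → b ≤ T → ∃ s ∈ Ioo a b, y s = (x b - x a) / (b - a) :=
    fun a b ha hab hb => exists_hasDerivAt_eq_slope x y hab
      (fun t ht => ((hx t ⟨ha.trans ht.1, ht.2.trans hb⟩).continuousWithinAt).mono
        (Icc_subset_Icc ha hb))
      (fun t ht => (hx t ⟨ha.trans ht.1.le, ht.2.le.trans hb⟩).hasDerivAt
        (Icc_mem_nhds (ha.trans_lt ht.1) (ht.2.trans_le hb)))
  refine ⟨τ, hτ.1, hτ.2, hxτ, ?_, fun t ht => ?_⟩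
  -- The height is 0 at both ends, so the velocity vanishes somewhere in between, and from there it
  -- decreases at rate at least `k`.
  · obtain ⟨s, hs, hys⟩ := mvt 0 τ le_rfl hτ0 hτT.2
    rw [hxτ, hx0] at hys
    simp at hys
    have := hanti s τ hs.1.le hs.2.le hτT.2
    rw [hys] at this
    nlinarith [mul_pos hk (sub_pos.2 hs.2)]
  -- A dip below 0 before the return would require a negative velocity followed by a positive one,
  -- whereas the velocity decreases.
  · by_contra hneg
    push Not at hneg
    have ht0 : 0 < t := lt_of_le_of_ne ht.1 fun h => by rw [← h, hx0] at hneg; exact lt_irrefl _ hneg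
    have htτ : t < τ := lt_of_le_of_ne ht.2 fun h => by rw [h, hxτ] at hneg; exact lt_irrefl _ hneg
    obtain ⟨s, hs, hys⟩ := mvt 0 t le_rfl ht0 (htτ.le.trans hτT.2)
    obtain ⟨s', hs', hys'⟩ := mvt t τ ht0.le htτ hτT.2
    have c1 : y s < 0 := by
      rw [hys, hx0]; exact div_neg_of_neg_of_pos (by linarith) (by linarith)
    have c2 : 0 < y s' := by
      rw [hys', hxτ]; exact div_pos (by linarith) (by linarith)
    have hss : s ≤ s' := hs.2.le.trans hs'.1.le
    have := hanti s s' hs.1.le hss (hs'.2.le.trans hτT.2)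
    nlinarith [mul_nonneg hk.le (sub_nonneg.2 hss)]

end RealODE

section Shooting

variable {Y : Type*} [NormedAddCommGroup Y] [NormedSpace ℝ Y]

/-- The retraction onto the half space `{0 ≤ x}` along `e`. -/
def halfRetract (x : Y →L[ℝ] ℝ) (e : Y) (Z : Y) : Y := Z + max 0 (-x Z) • e

theorem halfRetract_of_nonneg {x : Y →L[ℝ] ℝ} {e Z : Y} (h : 0 ≤ x Z) : halfRetract x e Z = Z := by
  simp [halfRetract, h]

theorem apply_halfRetract_nonneg {x : Y →L[ℝ] ℝ} {e : Y} (he : x e = 1) (Z : Y) :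
    0 ≤ x (halfRetract x e Z) := by
  simp only [halfRetract, map_add, map_smul, he, smul_eq_mul, mul_one]
  linarith [le_max_right 0 (-x Z)]

theorem lipschitzWith_halfRetract (x : Y →L[ℝ] ℝ) (e : Y) :
    LipschitzWith (1 + ‖x‖₊ * ‖e‖₊) (halfRetract x e) := by
  refine LipschitzWith.of_dist_le_mul fun Z Z' => ?_
  rw [dist_eq_norm, dist_eq_norm]
  have e1 : halfRetract x e Z - halfRetract x e Z' =
      (Z - Z') + (max 0 (-x Z) - max 0 (-x Z')) • e := by
    simp only [halfRetract]; module
  have e2 : |max 0 (-x Z) - max 0 (-x Z')| ≤ ‖x‖ * ‖Z - Z'‖ := by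
    have h1 := abs_max_sub_max_le_abs (-x Z) (-x Z') 0
    rw [max_comm, max_comm 0 (-x Z')]
    refine h1.trans ?_
    have : -x Z - -x Z' = -(x (Z - Z')) := by rw [map_sub]; ring
    rw [this, abs_neg]
    exact x.le_opNorm _
  rw [e1]
  calc _ ≤ ‖Z - Z'‖ + |max 0 (-x Z) - max 0 (-x Z')| * ‖e‖ := by
        refine (norm_add_le _ _).trans ?_
        rw [norm_smul, Real.norm_eq_abs]
    _ ≤ ‖Z - Z'‖ + ‖x‖ * ‖Z - Z'‖ * ‖e‖ := by gcongr
    _ = _ := by push_cast; ring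

/-- The Picard-Lindelöf theorem, with values in the ball. -/
theorem exists_solution_mem_closedBall [CompleteSpace Y] {f : Y → Y} {Z₀ : Y} {L : NNReal} {ρ : ℝ}
    (hρ : 0 < ρ) (hf : LipschitzOnWith L f (Metric.closedBall Z₀ ρ)) :
    ∃ T > 0, ∀ Z₁ ∈ Metric.closedBall Z₀ (ρ / 2), ∃ Z : ℝ → Y, Z 0 = Z₁ ∧
      (∀ t ∈ Icc 0 T, HasDerivWithinAt Z (f (Z t)) (Icc 0 T) t) ∧
      ∀ t, Z t ∈ Metric.closedBall Z₀ ρ := by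
  lift ρ to NNReal using hρ.le
  have hρ' : 0 < ρ := by exact_mod_cast hρ
  set C : NNReal := L * ρ + ‖f Z₀‖₊ + 1 with hC
  have hCpos : 0 < C := by positivity
  have hb : ∀ Z ∈ Metric.closedBall Z₀ (ρ : ℝ), ‖f Z‖ ≤ C := fun Z hZ => by
    have h1 := hf.dist_le_mul Z hZ Z₀ (Metric.mem_closedBall_self ρ.2)
    have h2 : ‖f Z‖ ≤ ‖f Z - f Z₀‖ + ‖f Z₀‖ := norm_le_norm_sub_add _ _
    rw [dist_eq_norm] at h1
    have h3 : (L : ℝ) * dist Z Z₀ ≤ L * ρ := mul_le_mul_of_nonneg_left hZ L.2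
    rw [hC]
    push_cast
    linarith
  -- Starting points leave a margin `ρ / 2` and the speed is at most `C`; hence one existence time
  -- serves them all.
  have hT : (0 : ℝ) < ρ / (2 * C) := by positivity
  have hpl : IsPicardLindelof (fun _ => f) (tmin := 0) (tmax := ρ / (2 * C)) ⟨0, le_rfl, hT.le⟩ Z₀ ρ
      (ρ / 2) C L := by
    refine IsPicardLindelof.of_time_independent hb hf ?_
    have hC0 : (C : ℝ) ≠ 0 := by exact_mod_cast hCpos.ne'
    simp only [sub_zero, sub_self]
    rw [max_eq_left hT.le]
    push_cast
    field_simp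
    norm_num
  refine ⟨ρ / (2 * C), hT, fun Z₁ hZ₁ => ?_⟩
  obtain ⟨α, hα⟩ := ODE.FunSpace.exists_isFixedPt_next hpl (x := Z₁) (by simpa using hZ₁)
  refine ⟨α.compProj, ?_, fun t ht => ?_, fun t => α.compProj_mem_closedBall hpl.mul_max_le⟩
  · have h0 : α.compProj ((⟨0, le_rfl, hT.le⟩ : Icc (0 : ℝ) (ρ / (2 * C))) : ℝ) = Z₁ := by
      rw [ODE.FunSpace.compProj_val, ← hα, ODE.FunSpace.next_apply₀]
    exact h0
  · apply ODE.hasDerivWithinAt_picard_Icc (⟨le_rfl, hT.le⟩ : (0 : ℝ) ∈ Icc 0 (ρ / (2 * C) : ℝ))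
      (hpl.continuousOn_uncurry)
      α.continuous_compProj.continuousOn (fun _ _ => α.compProj_mem_closedBall hpl.mul_max_le)
      Z₁ ht |>.congr_of_mem _ ht
    intro t' ht'
    nth_rw 1 [← hα]
    rw [ODE.FunSpace.compProj_of_mem ht', ODE.FunSpace.next_apply]

/-- Short rays through a strictly concave boundary. -/
theorem exists_short_ray [CompleteSpace Y] {x y : Y →L[ℝ] ℝ} {e Z₀ : Y} {V : Y → Y} {ρ k K : ℝ}
    {L : NNReal} (hxe : x e = 1) (hye : y e = 0) (hρ : 0 < ρ) (hk : 0 < k) (hxZ : x Z₀ = 0)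
    (hlip : LipschitzOnWith L V ({Z | 0 ≤ x Z} ∩ Metric.closedBall Z₀ ρ))
    (hxV : ∀ Z ∈ {Z | 0 ≤ x Z} ∩ Metric.closedBall Z₀ ρ, x (V Z) = y Z)
    (hyV : ∀ Z ∈ {Z | 0 ≤ x Z} ∩ Metric.closedBall Z₀ ρ, -K ≤ y (V Z) ∧ y (V Z) ≤ -k) :
    ∃ r > 0, ∃ ε₀ > 0, ∀ Z₁ ∈ Metric.closedBall Z₀ r, x Z₁ = 0 → 0 < y Z₁ → y Z₁ < ε₀ →
      ∃ (τ : ℝ) (Z : ℝ → Y), Z 0 = Z₁ ∧ y Z₁ / K ≤ τ ∧ τ ≤ 2 * y Z₁ / k ∧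
        x (Z τ) = 0 ∧ y (Z τ) < 0 ∧
        ∀ t ∈ Icc 0 τ, Z t ∈ {Z | 0 ≤ x Z} ∩ Metric.closedBall Z₀ ρ ∧
          HasDerivWithinAt Z (V (Z t)) (Icc 0 τ) t ∧ x (Z t) ≤ y Z₁ * t ∧
          y Z₁ * t - K * t ^ 2 / 2 ≤ x (Z t) := by
  set c : NNReal := 1 + ‖x‖₊ * ‖e‖₊ with hc
  have hc1 : (1 : ℝ) ≤ c := by rw [hc]; push_cast; nlinarith [norm_nonneg x, norm_nonneg e, mul_nonneg (norm_nonneg x) (norm_nonneg e)]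
  have hc0 : (0 : ℝ) < c := by linarith
  have hR := lipschitzWith_halfRetract x e
  have hR0 : halfRetract x e Z₀ = Z₀ := halfRetract_of_nonneg hxZ.ge
  have hρc : 0 < ρ / c := by positivity
  have hmaps : MapsTo (halfRetract x e) (Metric.closedBall Z₀ (ρ / c))
      ({Z | 0 ≤ x Z} ∩ Metric.closedBall Z₀ ρ) := fun Z hZ => by
    refine ⟨apply_halfRetract_nonneg hxe Z, ?_⟩
    have := hR.dist_le_mul Z Z₀
    rw [hR0] at this
    refine this.trans ?_
    calc (c : ℝ) * dist Z Z₀ ≤ c * (ρ / c) := by gcongr; exact hZ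
      _ = ρ := by field_simp
  -- The field is controlled only at nonnegative height, so it is precomposed with the retraction to
  -- obtain a field on a full ball. Dividing the radius by the Lipschitz constant `c` keeps
  -- retracted points within distance `ρ`.
  have hlipR : LipschitzOnWith (L * c) (V ∘ halfRetract x e) (Metric.closedBall Z₀ (ρ / c)) :=
    hlip.comp hR.lipschitzOnWith hmaps
  obtain ⟨T, hT, hsol⟩ := exists_solution_mem_closedBall hρc hlipR
  -- With initial normal speed below `k * T / 2` the latest possible return time `2 * y / k` stays
  -- within the existence time `T`.
  refine ⟨ρ / c / 2, by positivity, k * T / 2, by positivity, fun Z₁ hZ₁ hx1 hy1 hyε => ?_⟩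
  obtain ⟨Z, hZ0, hZd, hZm⟩ := hsol Z₁ hZ₁
  -- The retraction moves along `e`, which has zero normal velocity component; the derivative of the
  -- height is thus the normal velocity even where the retraction acts.
  have hxd : ∀ t ∈ Icc 0 T, HasDerivWithinAt (fun s => x (Z s)) (y (Z t)) (Icc 0 T) t :=
    fun t ht => by
    have h1 := x.hasFDerivAt.comp_hasDerivWithinAt t (hZd t ht)
    refine h1.congr_deriv ?_
    simp only [Function.comp_apply]
    rw [hxV _ (hmaps (hZm t)), halfRetract]
    simp [hye]
  have hyd : ∀ t ∈ Icc 0 T, HasDerivWithinAt (fun s => y (Z s)) (y (V (halfRetract x e (Z t))))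
      (Icc 0 T) t := fun t ht => y.hasFDerivAt.comp_hasDerivWithinAt t (hZd t ht)
  have hv : ∀ t ∈ Icc 0 T, -K ≤ y (V (halfRetract x e (Z t))) ∧
      y (V (halfRetract x e (Z t))) ≤ -k := fun t _ => hyV _ (hmaps (hZm t))
  have hle : 2 * y (Z 0) / k ≤ T := by
    rw [hZ0, div_le_iff₀ hk]
    linarith
  obtain ⟨τ, h1, h2, h3, h4, h5⟩ := exists_return_time hxd hyd hv hk (by rw [hZ0, hx1])
    (by rw [hZ0]; exact hy1) hle
  have lo := le_of_le_second_deriv hxd hyd fun t ht => (hv t ht).1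
  have up := add_le_of_second_deriv_le hxd hyd fun t ht => (hv t ht).2
  have hsub : Icc 0 τ ⊆ Icc 0 T := Icc_subset_Icc_right (h2.trans hle)
  rw [hZ0] at h1 h2
  refine ⟨τ, Z, hZ0, h1, h2, h3, h4, fun t ht => ?_⟩
  -- Until the return time the height is nonnegative, so the retraction is the identity and `Z`
  -- solves the original equation.
  have hRt : halfRetract x e (Z t) = Z t := halfRetract_of_nonneg (h5 t ht)
  have hmem := hmaps (hZm t)
  have hder := (hZd t (hsub ht)).mono hsub
  have lo' := lo t (hsub ht)
  have up' := (up t (hsub ht)).2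
  rw [hRt] at hmem
  simp only [Function.comp_apply, hRt] at hder
  rw [hZ0, hx1] at lo' up'
  refine ⟨hmem, hder, ?_, by linarith⟩
  nlinarith [mul_nonneg hk.le (sq_nonneg t)]

set_option maxHeartbeats 1000000 in
/-- Two vector fields whose difference has a definite sign do not have the same short rays. -/
theorem short_rays_ne {x ℓ : Y →L[ℝ] ℝ} {VA VB : Y → Y} {Ω : Set Y} {L : NNReal} {C β k K : ℝ}
    {r : ℕ} (hC : 0 ≤ C) (hβ : 0 < β) (hk : 0 < k) (hK : 0 < K)
    (hxΩ : ∀ Z ∈ Ω, 0 ≤ x Z)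
    (hlip : LipschitzOnWith L VB Ω) (hdiff : ∀ Z ∈ Ω, ‖VA Z - VB Z‖ ≤ C * x Z ^ r)
    (hℓ : ∀ Z ∈ Ω, ℓ (VA Z - VB Z) ≤ -β * x Z ^ r) :
    ∃ ε₁ > 0, ∀ ε, 0 < ε → ε < ε₁ → ∀ (τ : ℝ) (ZA ZB : ℝ → Y), ε / K ≤ τ → τ ≤ 2 * ε / k →
      ZA 0 = ZB 0 →
      (∀ t ∈ Icc 0 τ, ZA t ∈ Ω ∧ HasDerivWithinAt ZA (VA (ZA t)) (Icc 0 τ) t ∧ x (ZA t) ≤ ε * t ∧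
        ε * t - K * t ^ 2 / 2 ≤ x (ZA t)) →
      (∀ t ∈ Icc 0 τ, ZB t ∈ Ω ∧ HasDerivWithinAt ZB (VB (ZB t)) (Icc 0 τ) t) →
      ZA τ ≠ ZB τ := by
  -- The constant in the lower bound for the deflection: a height of at least `ε² / (4K)`, raised to
  -- the power `r`, during a time `ε / (2K)`.
  set c₁ : ℝ := β * (1 / (4 * K)) ^ r / (2 * K) with hc₁
  have hc₁0 : 0 < c₁ := by positivity
  -- The constant in the upper bound for the error, with every occurrence of the travel time
  -- replaced by `(2 / k) ε`, and by `2 / k` in the exponential.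
  set D : ℝ := ‖ℓ‖ * (L * (C * (2 / k) ^ r * (2 / k) * Real.exp (L * (2 / k)))) * (2 / k) with hD
  have hD0 : 0 ≤ D := by positivity
  -- The bound 1 on `ε` controls the exponential; the `+ 1` avoids division by 0.
  refine ⟨min 1 (c₁ / (D + 1)), by positivity, fun ε hε hεlt τ ZA ZB hτ1 hτ2 h0 hA hB hend => ?_⟩
  have hε1 : ε < 1 := hεlt.trans_le (min_le_left _ _)
  have hε2 : ε * (D + 1) < c₁ := by
    have := hεlt.trans_le (min_le_right _ _)
    rwa [lt_div_iff₀ (by positivity)] at this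
  have hτ0 : 0 < τ := lt_of_lt_of_le (by positivity) hτ1
  have hmem : ∀ t ∈ Ico 0 τ, t ∈ Icc 0 τ := fun t ht => ⟨ht.1, ht.2.le⟩
  have hIci : ∀ {f : ℝ → Y} {f' : Y} {t : ℝ}, t ∈ Ico 0 τ → HasDerivWithinAt f f' (Icc 0 τ) t →
      HasDerivWithinAt f f' (Ici t) t := fun {f f' t} ht h =>
    h.mono_of_mem_nhdsWithin (Icc_mem_nhdsGE_of_mem ht)
  set M : ℝ := C * (ε * τ) ^ r with hM
  have hM0 : 0 ≤ M := by positivity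
  have hxb : ∀ t ∈ Icc 0 τ, x (ZA t) ^ r ≤ (ε * τ) ^ r := fun t ht =>
    pow_le_pow_left₀ (hxΩ _ (hA t ht).1) ((hA t ht).2.2.1.trans (by nlinarith [ht.2])) r
  have hAB : ∀ t ∈ Icc 0 τ, ‖VA (ZA t) - VB (ZA t)‖ ≤ M := fun t ht =>
    (hdiff _ (hA t ht).1).trans (mul_le_mul_of_nonneg_left (hxb t ht) hC)
  -- The ray of `VA` is an approximate solution for `VB` with defect at most `M`, so Grönwall makes
  -- the two rays differ by O(ε^(2r+1)).
  have hgr := dist_le_of_approx_trajectories_ODE_of_mem (v := fun _ => VB) (s := fun _ => Ω)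
    (K := L) (f := ZA) (g := ZB) (f' := fun t => VA (ZA t)) (g' := fun t => VB (ZB t)) (a := 0)
    (b := τ) (εf := M) (εg := 0) (δ := 0) (fun _ _ => hlip)
    (fun t ht => (hA t ht).2.1.continuousWithinAt) (fun t ht => hIci ht (hA t (hmem t ht)).2.1)
    (fun t ht => by rw [dist_eq_norm]; exact hAB t (hmem t ht)) (fun t ht => (hA t (hmem t ht)).1)
    (fun t ht => (hB t ht).2.continuousWithinAt) (fun t ht => hIci ht (hB t (hmem t ht)).2)
    (fun t ht => by simp) (fun t ht => (hB t (hmem t ht)).1) (by simp [h0])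
  have hexp : ∀ t ∈ Icc 0 τ, ‖ZA t - ZB t‖ ≤ M * τ * Real.exp (L * τ) := fun t ht => by
    have h1 := hgr t ht
    rw [add_zero, sub_zero, dist_eq_norm] at h1
    refine h1.trans ?_
    have hmono : M * t * Real.exp (L * t) ≤ M * τ * Real.exp (L * τ) := by
      have := ht.2
      have := ht.1
      gcongr
    refine le_trans ?_ hmono
    by_cases hL : (L : ℝ) = 0
    · rw [hL, gronwallBound_K0]; simp
    · have hLpos : (0 : ℝ) < L := lt_of_le_of_ne L.2 (Ne.symm hL)
      rw [gronwallBound_of_K_ne_0 hL]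
      simp only [zero_mul, zero_add]
      -- This removes the division by `L` in the Grönwall bound, giving one estimate that also
      -- covers `L = 0`.
      have h2 : Real.exp (L * t) - 1 ≤ L * t * Real.exp (L * t) := by
        have h3 := Real.add_one_le_exp (-(L * t))
        have h4 : Real.exp (L * t) * Real.exp (-(L * t)) = 1 := by rw [← Real.exp_add]; simp
        nlinarith [Real.exp_pos (L * t)]
      calc M / L * (Real.exp (L * t) - 1) ≤ M / L * (L * t * Real.exp (L * t)) := by gcongr
        _ = M * t * Real.exp (L * t) := by field_simp
  set M₂ : ℝ := ‖ℓ‖ * (L * (M * τ * Real.exp (L * τ))) with hM₂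
  have hM₂0 : 0 ≤ M₂ := by positivity
  set h : ℝ → ℝ := fun t => ℓ (ZA t - ZB t) with hh
  have hd : ∀ t ∈ Icc 0 τ, HasDerivWithinAt h (ℓ (VA (ZA t) - VB (ZB t))) (Icc 0 τ) t :=
    fun t ht => ℓ.hasFDerivAt.comp_hasDerivWithinAt t ((hA t ht).2.1.sub (hB t ht).2)
  have hd' : ∀ t ∈ Icc 0 τ, ℓ (VA (ZA t) - VB (ZB t)) ≤ -β * x (ZA t) ^ r + M₂ := fun t ht => by
    have e1 : VA (ZA t) - VB (ZB t) = (VA (ZA t) - VB (ZA t)) + (VB (ZA t) - VB (ZB t)) := by abel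
    rw [e1, map_add]
    refine add_le_add (hℓ _ (hA t ht).1) ((le_abs_self _).trans ?_)
    refine (ℓ.le_opNorm _).trans (mul_le_mul_of_nonneg_left ?_ (norm_nonneg _))
    have h1 := hlip.dist_le_mul _ (hA t ht).1 _ (hB t ht).1
    rw [dist_eq_norm, dist_eq_norm] at h1
    exact h1.trans (mul_le_mul_of_nonneg_left (hexp t ht) L.2)
  have hd0 : ∀ t ∈ Icc 0 τ, ℓ (VA (ZA t) - VB (ZB t)) ≤ M₂ := fun t ht => by
    have := hd' t ht
    have h2 := pow_nonneg (hxΩ _ (hA t ht).1) r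
    nlinarith [mul_nonneg hβ.le h2]
  -- On the middle interval from `a` to `b` the ray is provably high and the sign of the field
  -- difference gives a definite decrease. On the two outer intervals only the error `M₂` is kept.
  set a := ε / (2 * K) with ha
  set b := ε / K with hb
  have hab : b - a = ε / (2 * K) := by rw [ha, hb]; field_simp; norm_num
  have ha0 : 0 ≤ a := by positivity
  have hab' : a ≤ b := by linarith [hab, ha0]
  have i1 := sub_le_mul_of_hasDerivWithinAt hd le_rfl ha0 (hab'.trans hτ1)
    (fun t ht => hd0 t ⟨ht.1, ht.2.trans (hab'.trans hτ1)⟩)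
  have i3 := sub_le_mul_of_hasDerivWithinAt hd (ha0.trans hab') hτ1 le_rfl
    (fun t ht => hd0 t ⟨(ha0.trans hab').trans ht.1, ht.2⟩)
  have i2 := sub_le_mul_of_hasDerivWithinAt hd ha0 hab' hτ1
    (C := -β * (ε ^ 2 * (1 / (4 * K))) ^ r + M₂) (fun t ht => by
      have ht' : t ∈ Icc 0 τ := ⟨ha0.trans ht.1, ht.2.trans hτ1⟩
      refine (hd' t ht').trans ?_
      have hlow : ε ^ 2 * (1 / (4 * K)) ≤ x (ZA t) := by
        refine le_trans ?_ (hA t ht').2.2.2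
        have k1 : ε ≤ 2 * K * t := by
          have := (div_le_iff₀ (by positivity)).1 ht.1; linarith
        have k2 : K * t ≤ ε := by
          have := (le_div_iff₀ hK).1 ht.2; linarith
        have e : ε ^ 2 * (1 / (4 * K)) = ε ^ 2 / (4 * K) := by ring
        rw [e, div_le_iff₀ (by positivity)]
        nlinarith [mul_nonneg (sub_nonneg.2 k1) (sub_nonneg.2 k2), mul_pos hε hK, sq_nonneg (K * t)]
      have := mul_le_mul_of_nonneg_left (pow_le_pow_left₀ (by positivity) hlow r) hβ.le
      linarith)
  have h00 : h 0 = 0 := by simp [hh, h0]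
  have hτ' : h τ = 0 := by simp [hh, hend]
  -- If the end points agreed, `h` would start and end at 0, so the definite decrease would have to
  -- be paid for by the accumulated error.
  have hsum : β * (ε ^ 2 * (1 / (4 * K))) ^ r * (b - a) ≤ M₂ * τ := by
    rw [h00] at i1
    rw [hτ'] at i3
    generalize (ε ^ 2 * (1 / (4 * K))) ^ r = P at i2 ⊢
    clear_value M₂ a b h
    linarith
  have hlhs : β * (ε ^ 2 * (1 / (4 * K))) ^ r * (b - a) = c₁ * ε ^ (2 * r + 1) := by
    rw [hab, hc₁, mul_pow, ← pow_mul]; ring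
  have hrhs : M₂ * τ ≤ D * ε ^ (2 * r + 2) := by
    have hLτ : (L : ℝ) * τ ≤ L * (2 / k) := by
      refine mul_le_mul_of_nonneg_left (hτ2.trans ?_) L.2
      gcongr
      linarith
    have hτ3 : τ ≤ (2 / k) * ε := by rw [div_mul_eq_mul_div]; exact hτ2
    calc M₂ * τ = ‖ℓ‖ * (L * (C * (ε * τ) ^ r * τ * Real.exp (L * τ))) * τ := rfl
      _ ≤ ‖ℓ‖ * (L * (C * (ε * ((2 / k) * ε)) ^ r * ((2 / k) * ε) * Real.exp (L * (2 / k)))) *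
          ((2 / k) * ε) := by gcongr
      _ = D * ε ^ (2 * r + 2) := by
        rw [hD, show ε * (2 / k * ε) = (2 / k) * ε ^ 2 by ring, mul_pow, ← pow_mul]; ring
  have hfin : c₁ * ε ^ (2 * r + 1) ≤ D * ε * ε ^ (2 * r + 1) := by
    calc _ ≤ D * ε ^ (2 * r + 2) := by rw [← hlhs]; exact hsum.trans hrhs
      _ = _ := by ring
  have := le_of_mul_le_mul_right hfin (by positivity)
  clear_value D c₁
  linarith

end Shooting

end YangMills

end

/-! ### Wong's equations as a smooth vector field in coordinates -/

noncomputable section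

set_option linter.unusedSectionVars false

namespace YangMills

section Inverse

variable {E : Type*} [NormedAddCommGroup E] [NormedSpace ℝ E] [FiniteDimensional ℝ E]

/-- Positivity gives injectivity, and `E` and its dual have equal dimension. This ensures that the
total function `ContinuousLinearMap.inverse` is evaluated only where it is a genuine inverse. -/
theorem exists_equiv_of_pos (b : E →L[ℝ] E →L[ℝ] ℝ) (hb : ∀ v, v ≠ 0 → 0 < b v v) :
    ∃ e : E ≃L[ℝ] (E →L[ℝ] ℝ), (e : E →L[ℝ] E →L[ℝ] ℝ) = b := by
  have hinj : Function.Injective (b : E →ₗ[ℝ] (E →L[ℝ] ℝ)) := by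
    rw [← LinearMap.ker_eq_bot, LinearMap.ker_eq_bot']
    intro v hv
    by_contra h
    have h1 := hb v h
    have h2 : b v = 0 := hv
    rw [h2] at h1
    exact lt_irrefl _ h1
  have hdim : Module.finrank ℝ E = Module.finrank ℝ (E →L[ℝ] ℝ) := by
    rw [← (LinearMap.toContinuousLinearMap : (E →ₗ[ℝ] ℝ) ≃ₗ[ℝ] E →L[ℝ] ℝ).finrank_eq]
    exact Subspace.dual_finrank_eq.symm
  refine ⟨((b : E →ₗ[ℝ] (E →L[ℝ] ℝ)).linearEquivOfInjective hinj hdim).toContinuousLinearEquiv, ?_⟩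
  ext v w
  rfl

theorem apply_inverse_of_pos {b : E →L[ℝ] E →L[ℝ] ℝ} (hb : ∀ v, v ≠ 0 → 0 < b v v)
    (μ : E →L[ℝ] ℝ) : b (b.inverse μ) = μ := by
  obtain ⟨e, rfl⟩ := exists_equiv_of_pos b hb
  rw [ContinuousLinearMap.inverse_equiv]
  exact e.apply_symm_apply μ

theorem eq_inverse_of_pos {b : E →L[ℝ] E →L[ℝ] ℝ} (hb : ∀ v, v ≠ 0 → 0 < b v v)
    {μ : E →L[ℝ] ℝ} {v : E} (hv : b v = μ) : v = b.inverse μ := by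
  obtain ⟨e, rfl⟩ := exists_equiv_of_pos b hb
  rw [ContinuousLinearMap.inverse_equiv, ← hv]
  exact (e.symm_apply_apply v).symm

theorem contDiffOn_inverse_of_pos {X : Type*} [NormedAddCommGroup X] [NormedSpace ℝ X]
    {b : X → E →L[ℝ] E →L[ℝ] ℝ} {s : Set X} {m : WithTop ℕ∞} (h : ContDiffOn ℝ m b s)
    (hb : ∀ x ∈ s, ∀ v, v ≠ 0 → 0 < b x v v) : ContDiffOn ℝ m (fun x => (b x).inverse) s :=
  fun x hx => by
    obtain ⟨e, he⟩ := exists_equiv_of_pos (b x) (hb x hx)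
    refine ContDiffAt.comp_contDiffWithinAt (g := ContinuousLinearMap.inverse) x ?_ (h x hx)
    rw [← he]
    exact contDiffAt_map_inverse e

end Inverse

section Field

set_option maxSynthPendingDepth 3

variable {E : Type*} [NormedAddCommGroup E] [NormedSpace ℝ E]
  {𝔤 : Type*} [NormedAddCommGroup 𝔤] [NormedSpace ℝ 𝔤]
  {X : Type*} [NormedAddCommGroup X] [NormedSpace ℝ X]

/-- The covector `⟨F(w, ·), ξ⟩ - g(∇_w w, ·)`, where `w` has constant coordinates, in terms of the
values `a₀` of the potential, `a₁` of its differential and `m₁` of the differential of the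
metric. -/
def force (B : 𝔤 →L[ℝ] 𝔤 →L[ℝ] 𝔤) (K : 𝔤 →L[ℝ] 𝔤 →L[ℝ] ℝ) (a₀ : E →L[ℝ] 𝔤)
    (a₁ : E →L[ℝ] E →L[ℝ] 𝔤) (m₁ : E →L[ℝ] E →L[ℝ] E →L[ℝ] ℝ) (w : E) (ξ : 𝔤) : E →L[ℝ] ℝ :=
  (K.flip ξ).comp (a₁ w - a₁.flip w + (B (a₀ w)).comp a₀)
    - (1 / 2 : ℝ) • (m₁ w w + m₁ w w - (m₁.flip w).flip w)

theorem force_apply (B : 𝔤 →L[ℝ] 𝔤 →L[ℝ] 𝔤) (K : 𝔤 →L[ℝ] 𝔤 →L[ℝ] ℝ) (a₀ : E →L[ℝ] 𝔤)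
    (a₁ : E →L[ℝ] E →L[ℝ] 𝔤) (m₁ : E →L[ℝ] E →L[ℝ] E →L[ℝ] ℝ) (w : E) (ξ : 𝔤) (η : E) :
    force B K a₀ a₁ m₁ w ξ η = K (a₁ w η - a₁ η w + B (a₀ w) (a₀ η)) ξ
      - (1 / 2 : ℝ) * (m₁ w w η + m₁ w w η - m₁ η w w) := rfl

theorem contDiffOn_force [FiniteDimensional ℝ E] (B : 𝔤 →L[ℝ] 𝔤 →L[ℝ] 𝔤) (K : 𝔤 →L[ℝ] 𝔤 →L[ℝ] ℝ)
    {a₀ : X → E →L[ℝ] 𝔤} {a₁ : X → E →L[ℝ] E →L[ℝ] 𝔤} {m₁ : X → E →L[ℝ] E →L[ℝ] E →L[ℝ] ℝ}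
    {w : X → E} {ξ : X → 𝔤} {s : Set X} {m : WithTop ℕ∞} (ha : ContDiffOn ℝ m a₀ s)
    (ha₁ : ContDiffOn ℝ m a₁ s) (hm₁ : ContDiffOn ℝ m m₁ s) (hw : ContDiffOn ℝ m w s)
    (hξ : ContDiffOn ℝ m ξ s) :
    ContDiffOn ℝ m (fun x => force B K (a₀ x) (a₁ x) (m₁ x) (w x) (ξ x)) s := by
  refine contDiffOn_clm_apply.2 fun η => ?_
  have hη : ContDiffOn ℝ m (fun _ : X => η) s := contDiffOn_const
  have hF := (((ha₁.clm_apply hw).clm_apply hη).sub ((ha₁.clm_apply hη).clm_apply hw)).add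
    ((B.contDiff.comp_contDiffOn (ha.clm_apply hw)).clm_apply (ha.clm_apply hη))
  have hκ := (K.contDiff.comp_contDiffOn hF).clm_apply hξ
  have hm2 := ((hm₁.clm_apply hw).clm_apply hw).clm_apply hη
  have hm3 := ((hm₁.clm_apply hη).clm_apply hw).clm_apply hw
  exact hκ.sub (contDiffOn_const.mul ((hm2.add hm2).sub hm3))

variable {n : ℕ} [NeZero n]

/-- The vector field of Wong's equations in coordinates, on the space of positions, velocities and
charges. -/
def wongField (B : 𝔤 →L[ℝ] 𝔤 →L[ℝ] 𝔤) (K : 𝔤 →L[ℝ] 𝔤 →L[ℝ] ℝ) (a : Coord n → Coord n →L[ℝ] 𝔤)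
    (m : Coord n → Coord n →L[ℝ] Coord n →L[ℝ] ℝ) (Z : Coord n × Coord n × 𝔤) :
    Coord n × Coord n × 𝔤 :=
  (Z.2.1, (m Z.1).inverse (force B K (a Z.1) (fderivWithin ℝ a 𝓗[n] Z.1)
    (fderivWithin ℝ m 𝓗[n] Z.1) Z.2.1 Z.2.2), -B (a Z.1 Z.2.1) Z.2.2)

variable {B : 𝔤 →L[ℝ] 𝔤 →L[ℝ] 𝔤} {K : 𝔤 →L[ℝ] 𝔤 →L[ℝ] ℝ} {a : Coord n → Coord n →L[ℝ] 𝔤}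
  {m : Coord n → Coord n →L[ℝ] Coord n →L[ℝ] ℝ} {T : Set (Coord n)}

theorem SmoothOn.comp_fst {f : Coord n → X} (hf : SmoothOn f T) (hT : T ⊆ 𝓗[n]) :
    ContDiffOn ℝ ∞ (fun Z : Coord n × E => f Z.1) (T ×ˢ univ) :=
  (hf.contDiffOn hT).comp contDiffOn_fst fun _ h => h.1

theorem contDiffOn_wongField (hT : RelOpen T) (ha : SmoothOn a T) (hm : SmoothOn m T)
    (hpos : ∀ z ∈ T, ∀ v, v ≠ 0 → 0 < m z v v) :
    ContDiffOn ℝ ∞ (wongField B K a m) (T ×ˢ univ) := by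
  have hw : ContDiffOn ℝ ∞ (fun Z : Coord n × Coord n × 𝔤 => Z.2.1) (T ×ˢ univ) :=
    contDiff_snd.fst.contDiffOn
  have hξ : ContDiffOn ℝ ∞ (fun Z : Coord n × Coord n × 𝔤 => Z.2.2) (T ×ˢ univ) :=
    contDiff_snd.snd.contDiffOn
  have ha0 : ContDiffOn ℝ ∞ (fun Z : Coord n × Coord n × 𝔤 => a Z.1) (T ×ˢ univ) :=
    ha.comp_fst hT.1
  have hm0 : ContDiffOn ℝ ∞ (fun Z : Coord n × Coord n × 𝔤 => m Z.1) (T ×ˢ univ) :=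
    hm.comp_fst hT.1
  have ha1 : ContDiffOn ℝ ∞ (fun Z : Coord n × Coord n × 𝔤 => fderivWithin ℝ a 𝓗[n] Z.1)
    (T ×ˢ univ) := SmoothOn.comp_fst (hf := ha.fderivWithin hT.1) hT.1
  have hm1 : ContDiffOn ℝ ∞ (fun Z : Coord n × Coord n × 𝔤 => fderivWithin ℝ m 𝓗[n] Z.1)
    (T ×ˢ univ) := SmoothOn.comp_fst (hf := hm.fderivWithin hT.1) hT.1
  exact hw.prodMk (((contDiffOn_inverse_of_pos hm0 fun Z hZ => hpos _ hZ.1).clm_apply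
    (contDiffOn_force B K ha0 ha1 hm1 hw hξ)).prodMk
    ((B.contDiff.comp_contDiffOn (ha0.clm_apply hw)).clm_apply hξ).neg)

/-- The coordinate that vanishes on the boundary, as a function of the state. -/
def heightL (n : ℕ) [NeZero n] (𝔤 : Type*) [NormedAddCommGroup 𝔤] [NormedSpace ℝ 𝔤] :
    Coord n × Coord n × 𝔤 →L[ℝ] ℝ :=
  (EuclideanSpace.proj (0 : Fin n) : Coord n →L[ℝ] ℝ).comp
    (ContinuousLinearMap.fst ℝ (Coord n) (Coord n × 𝔤))

/-- The normal velocity, as a function of the state. -/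
def speedL (n : ℕ) [NeZero n] (𝔤 : Type*) [NormedAddCommGroup 𝔤] [NormedSpace ℝ 𝔤] :
    Coord n × Coord n × 𝔤 →L[ℝ] ℝ :=
  (EuclideanSpace.proj (0 : Fin n) : Coord n →L[ℝ] ℝ).comp
    ((ContinuousLinearMap.fst ℝ (Coord n) (𝔤)).comp
      (ContinuousLinearMap.snd ℝ (Coord n) (Coord n × 𝔤)))

theorem heightL_apply (Z : Coord n × Coord n × 𝔤) : heightL n 𝔤 Z = Z.1 0 := rfl

/-- The states at height `≥ 0` near `Z₀`. -/
def stateBall (Z₀ : Coord n × Coord n × 𝔤) (ρ : ℝ) : Set (Coord n × Coord n × 𝔤) :=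
  {Z | 0 ≤ heightL n 𝔤 Z} ∩ Metric.closedBall Z₀ ρ

/-- Near a state at the boundary at which the normal acceleration is negative, Wong's equations
are Lipschitz and the normal acceleration is bounded away from zero. -/
theorem exists_stateBall (hT : RelOpen T) (ha : SmoothOn a T) (hm : SmoothOn m T)
    (hpos : ∀ z ∈ T, ∀ v, v ≠ 0 → 0 < m z v v) {Z₀ : Coord n × Coord n × 𝔤} (hZ : Z₀.1 ∈ T)
    (hacc : (wongField B K a m Z₀).2.1 0 < 0) :
    ∃ ρ > 0, ∃ k > 0, ∃ (C : ℝ) (L : NNReal), (∀ Z ∈ stateBall Z₀ ρ, Z.1 ∈ T) ∧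
      LipschitzOnWith L (wongField B K a m) (stateBall Z₀ ρ) ∧
      ∀ Z ∈ stateBall Z₀ ρ, -C ≤ (wongField B K a m Z).2.1 0 ∧ (wongField B K a m Z).2.1 0 ≤ -k := by
  have hsm := contDiffOn_wongField (B := B) (K := K) hT ha hm hpos
  set S : Set (Coord n × Coord n × 𝔤) := {Z | 0 ≤ heightL n 𝔤 Z} with hS
  have hTS : T ×ˢ univ ∈ 𝓝[S] Z₀ := by
    have h1 : Tendsto (fun Z : Coord n × Coord n × 𝔤 => Z.1) (𝓝[S] Z₀) (𝓝[𝓗[n]] Z₀.1) :=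
      tendsto_nhdsWithin_iff.2 ⟨continuous_fst.continuousAt.mono_left nhdsWithin_le_nhds,
        eventually_mem_nhdsWithin.mono fun Z hZ => mem_half.2 hZ⟩
    filter_upwards [h1 (hT.2 _ hZ)] with Z hZ using ⟨hZ, mem_univ _⟩
  have hcd : ContDiffWithinAt ℝ 1 (wongField B K a m) S Z₀ :=
    ((hsm Z₀ ⟨hZ, mem_univ _⟩).of_le (by simp)).mono_of_mem_nhdsWithin hTS
  -- The field is C¹ relative to the half space of states, and convexity of that half space turns
  -- this into a local Lipschitz bound up to the boundary.
  obtain ⟨L, t, ht, hL⟩ := hcd.exists_lipschitzOnWith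
    (convex_halfSpace_ge (heightL n 𝔤).toLinearMap.isLinear 0)
  have hc : ContinuousWithinAt (fun Z => (wongField B K a m Z).2.1 0) S Z₀ :=
    (speedL n 𝔤).continuous.continuousAt.comp_continuousWithinAt hcd.continuousWithinAt
  set q := (wongField B K a m Z₀).2.1 0 with hq
  -- The acceleration at the centre is `q < 0`; by continuity it stays between `q - 1` and `q / 2`,
  -- which yields the two constants.
  have hev := hc.eventually (Ioo_mem_nhds (show q - 1 < q by linarith) (show q < q / 2 by linarith))
  obtain ⟨ρ, hρ, hsub⟩ := Metric.mem_nhdsWithin_iff.1 (inter_mem (inter_mem ht hTS) hev)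
  have hsub' : stateBall Z₀ (ρ / 2) ⊆ (t ∩ T ×ˢ univ) ∩
      {Z | (wongField B K a m Z).2.1 0 ∈ Ioo (q - 1) (q / 2)} := fun Z hZ =>
    hsub ⟨Metric.closedBall_subset_ball (by linarith) hZ.2, hZ.1⟩
  refine ⟨ρ / 2, by positivity, -(q / 2), by linarith, -(q - 1), L, fun Z hZ => (hsub' hZ).1.2.1,
    hL.mono fun Z hZ => (hsub' hZ).1.1, fun Z hZ => ?_⟩
  have := (hsub' hZ).2
  exact ⟨by linarith [this.1], by linarith [this.2]⟩

end Field

end YangMills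

end

/-! ### Trajectories in a chart: existence, uniqueness and exit -/

noncomputable section

set_option linter.unusedSectionVars false
set_option maxSynthPendingDepth 3

namespace YangMills

/-- Local uniqueness for autonomous ordinary differential equations. -/
theorem exists_eqOn_Icc_of_hasDerivWithinAt {Y : Type*} [NormedAddCommGroup Y] [NormedSpace ℝ Y]
    {f : Y → Y} {S : Set Y} (hS : Convex ℝ S) {ζ Z : ℝ → Y} {a b : ℝ} (hab : a < b)
    (hζ : ∀ᶠ s in 𝓝[Icc a b] a, ζ s ∈ S ∧ HasDerivWithinAt ζ (f (ζ s)) (Icc a b) s)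
    (hZ : ∀ᶠ s in 𝓝[Icc a b] a, Z s ∈ S ∧ HasDerivWithinAt Z (f (Z s)) (Icc a b) s)
    (h : ζ a = Z a) (hf : ContDiffWithinAt ℝ 1 f S (Z a)) :
    ∃ c ∈ Ioc a b, EqOn ζ Z (Icc a c) := by
  obtain ⟨L, t, ht, hL⟩ := hf.exists_lipschitzOnWith hS
  have ha : a ∈ Icc a b := ⟨le_rfl, hab.le⟩
  have key : ∀ W : ℝ → Y, W a = Z a →
      (∀ᶠ s in 𝓝[Icc a b] a, W s ∈ S ∧ HasDerivWithinAt W (f (W s)) (Icc a b) s) →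
      ∀ᶠ s in 𝓝[Icc a b] a, W s ∈ t ∧ HasDerivWithinAt W (f (W s)) (Icc a b) s := fun W hW h => by
    have hc := (h.self_of_nhdsWithin ha).2.continuousWithinAt
    have h1 : Tendsto W (𝓝[Icc a b] a) (𝓝[S] (Z a)) := by
      rw [← hW]
      exact tendsto_nhdsWithin_iff.2 ⟨hc, h.mono fun _ hs => hs.1⟩
    filter_upwards [h, h1 ht] with s hs hs' using ⟨hs', hs.2⟩
  have hev := (key ζ h hζ).and (key Z rfl hZ)
  rw [nhdsWithin_Icc_eq_nhdsGE hab] at hev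
  obtain ⟨u, hu, hsub⟩ := mem_nhdsGE_iff_exists_Icc_subset.1 hev
  have hu : a < u := hu
  refine ⟨min u b, ⟨lt_min hu hab, min_le_right _ _⟩, ?_⟩
  have hsub' : ∀ s ∈ Icc a (min u b), _ := fun s hs =>
    hsub (show s ∈ Icc a u from ⟨hs.1, hs.2.trans (min_le_left _ _)⟩)
  have hIcc : Icc a (min u b) ⊆ Icc a b := Icc_subset_Icc le_rfl (min_le_right _ _)
  have hright : ∀ s ∈ Ico a (min u b), Icc a b ∈ 𝓝[Ici s] s := fun s hs =>
    Icc_mem_nhdsGE_of_mem ⟨hs.1, hs.2.trans_le (min_le_right _ _)⟩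
  exact ODE_solution_unique_of_mem_Icc_right (v := fun _ => f) (s := fun _ => t) (fun _ _ => hL)
    (fun s hs => (hsub' s hs).1.2.continuousWithinAt.mono hIcc)
    (fun s hs => (hsub' s ⟨hs.1, hs.2.le⟩).1.2.mono_of_mem_nhdsWithin (hright s hs))
    (fun s hs => (hsub' s ⟨hs.1, hs.2.le⟩).1.1)
    (fun s hs => (hsub' s hs).2.2.continuousWithinAt.mono hIcc)
    (fun s hs => (hsub' s ⟨hs.1, hs.2.le⟩).2.2.mono_of_mem_nhdsWithin (hright s hs))
    (fun s hs => (hsub' s ⟨hs.1, hs.2.le⟩).2.1) h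

theorem hasDerivWithinAt_clm_comp_apply {E F F' : Type*} [NormedAddCommGroup E] [NormedSpace ℝ E]
    [NormedAddCommGroup F] [NormedSpace ℝ F] [NormedAddCommGroup F'] [NormedSpace ℝ F']
    {f : E → F →L[ℝ] F'} {S : Set E} {x : ℝ → E} {v : ℝ → F} {x' : E} {v' : F} {I : Set ℝ} {t : ℝ}
    (hf : DifferentiableWithinAt ℝ f S (x t)) (hx : HasDerivWithinAt x x' I t) (h : MapsTo x I S)
    (hv : HasDerivWithinAt v v' I t) :
    HasDerivWithinAt (fun s => f (x s) (v s)) (fderivWithin ℝ f S (x t) x' (v t) + f (x t) v') I t :=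
  (hf.hasFDerivWithinAt.comp_hasDerivWithinAt t hx h).clm_apply hv

variable {n : ℕ} [NeZero n] {M : Type*} [TopologicalSpace M]
  [ChartedSpace (EuclideanHalfSpace n) M] [IsManifold (𝓡∂ n) ∞ M]
variable {φ ψ : OpenPartialHomeomorph M (EuclideanHalfSpace n)}
variable {N : ℕ} {G : Subgroup (Mat N)ˣ} {A : Potential n M G}
variable {g : Metric n M} {κ : AdInvariantInner G}

/-- The tangent vector at the point with coordinates `Z.1` with components `Z.2`. -/
def tangentIn (φ : OpenPartialHomeomorph M (EuclideanHalfSpace n)) (Z : Coord n × Coord n) :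
    TangentBundle (𝓡∂ n) M := ⟨ext[φ].symm Z.1, coordVec φ Z.1 Z.2⟩

/-- The phase with coordinates `Z`. -/
def phase (φ : OpenPartialHomeomorph M (EuclideanHalfSpace n)) (Z : Coord n × Coord n × lieAlg G) :
    TangentBundle (𝓡∂ n) M × lieAlg G := (tangentIn φ (Z.1, Z.2.1), Z.2.2)

/-- The vector field of Wong's equations in the chart `φ`. -/
def wongIn (g : Metric n M) (κ : AdInvariantInner G) (A : Potential n M G)
    (φ : OpenPartialHomeomorph M (EuclideanHalfSpace n)) :
    Coord n × Coord n × lieAlg G → Coord n × Coord n × lieAlg G :=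
  wongField (bracketL G) κ.formL (potentialIn A φ) (metricL g φ)

theorem continuousOn_tangentIn (hφ : φ ∈ IsManifold.maximalAtlas (𝓡∂ n) ∞ M) :
    ContinuousOn (tangentIn φ) (ext[φ].target ×ˢ univ) := by
  have h1 := ((contMDiffOn_symm_target hφ).contMDiffOn_tangentMapWithin (m := ∞) (by simp)
    (uniqueMDiffOn_target φ)).continuousOn
  have h2 : Continuous (fun Z : Coord n × Coord n =>
      (⟨Z.1, Z.2⟩ : TangentBundle 𝓘(ℝ, Coord n) (Coord n))) :=
    (tangentBundleModelSpaceHomeomorph 𝓘(ℝ, Coord n)).symm.continuous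
  refine (h1.comp h2.continuousOn fun Z hZ => hZ.1).congr fun Z hZ => ?_
  simp only [Function.comp_apply, tangentMapWithin, tangentIn]
  rw [mfderivWithin_target Z.1 hZ.1]
  rfl

theorem contDiffOn_wongIn (hφ : φ ∈ IsManifold.maximalAtlas (𝓡∂ n) ∞ M) :
    ContDiffOn ℝ ∞ (wongIn g κ A φ) (ext[φ].target ×ˢ univ) :=
  contDiffOn_wongField (relOpen_target φ) (smoothOn_potentialIn hφ A) (smoothOn_metricL hφ g)
    fun _ hz _ => metricL_pos hφ g hz

theorem force_eq (hφ : φ ∈ IsManifold.maximalAtlas (𝓡∂ n) ∞ M) {y : Coord n}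
    (hy : y ∈ ext[φ].target) (w : Coord n) (ξ : lieAlg G) (η : Coord n) :
    force (bracketL G) κ.formL (potentialIn A φ y) (fderivWithin ℝ (potentialIn A φ) 𝓗[n] y)
      (fderivWithin ℝ (metricL g φ) 𝓗[n] y) w ξ η =
    κ.form (curvatureIn A φ y w η) ξ - christoffel g φ y w w η := by
  have hyH := (relOpen_target φ).1 hy
  rw [force_apply, curvatureIn_eq,
    curv_eq hyH ((smoothOn_potentialIn hφ A).differentiableWithinAt hy), christoffel_eq hφ g hy,
    christ]
  rfl

theorem wongIn_equation (hφ : φ ∈ IsManifold.maximalAtlas (𝓡∂ n) ∞ M)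
    {Z : Coord n × Coord n × lieAlg G} (hZ : Z.1 ∈ ext[φ].target) (η : Coord n) :
    metricIn g φ Z.1 (wongIn g κ A φ Z).2.1 η + christoffel g φ Z.1 Z.2.1 Z.2.1 η =
      κ.form (curvatureIn A φ Z.1 Z.2.1 η) Z.2.2 := by
  have h := congrArg (fun L : Coord n →L[ℝ] ℝ => L η)
    (apply_inverse_of_pos (b := metricL g φ Z.1) (fun v hv => metricL_pos hφ g hZ hv)
      (force (bracketL G) κ.formL (potentialIn A φ Z.1) (fderivWithin ℝ (potentialIn A φ) 𝓗[n] Z.1)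
      (fderivWithin ℝ (metricL g φ) 𝓗[n] Z.1) Z.2.1 Z.2.2))
  simp only [force_eq hφ hZ] at h
  change metricIn g φ Z.1 _ η = _ at h
  rw [wongIn, wongField, h]
  ring

/-- Nondegeneracy of the metric recovers the acceleration from its pairings with all vectors `η`. -/
theorem eq_wongIn (hφ : φ ∈ IsManifold.maximalAtlas (𝓡∂ n) ∞ M)
    {Z : Coord n × Coord n × lieAlg G} (hZ : Z.1 ∈ ext[φ].target) {b : Coord n}
    (hb : ∀ η, metricIn g φ Z.1 b η + christoffel g φ Z.1 Z.2.1 Z.2.1 η =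
      κ.form (curvatureIn A φ Z.1 Z.2.1 η) Z.2.2) : b = (wongIn g κ A φ Z).2.1 := by
  refine eq_inverse_of_pos (b := metricL g φ Z.1) (fun v hv => metricL_pos hφ g hZ hv) ?_
  ext1 η
  rw [force_eq hφ hZ, ← hb η, metricL_apply]
  ring

/-- Wong's equation of motion is independent of the chart. -/
theorem wong_equation_transition (hφ : φ ∈ IsManifold.maximalAtlas (𝓡∂ n) ∞ M)
    (hψ : ψ ∈ IsManifold.maximalAtlas (𝓡∂ n) ∞ M) {y : Coord n} (hy : y ∈ transDom φ ψ)
    {w b : Coord n} {ξ : lieAlg G}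
    (hb : ∀ η, metricIn g φ y b η + christoffel g φ y w w η =
      κ.form (curvatureIn A φ y w η) ξ) (η : Coord n) :
    metricIn g ψ (transition φ ψ y)
        (fderivWithin ℝ (fun z => fderivWithin ℝ (transition φ ψ) 𝓗[n] z) 𝓗[n] y w w
          + fderivWithin ℝ (transition φ ψ) 𝓗[n] y b) η
      + christoffel g ψ (transition φ ψ y) (fderivWithin ℝ (transition φ ψ) 𝓗[n] y w)
        (fderivWithin ℝ (transition φ ψ) 𝓗[n] y w) η
    = κ.form (curvatureIn A ψ (transition φ ψ y)
        (fderivWithin ℝ (transition φ ψ) 𝓗[n] y w) η) ξ := by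
  -- The Jacobian is invertible, so test vectors may be taken from the first chart. The
  -- inhomogeneous Christoffel term then cancels the second derivative of the transition in the
  -- acceleration.
  obtain ⟨η, rfl⟩ : ∃ η', fderivWithin ℝ (transition φ ψ) 𝓗[n] y η' = η := by
    refine ⟨fderivWithin ℝ (transition ψ φ) 𝓗[n] (transition φ ψ y) η, ?_⟩
    have := fderivWithin_transition_comp hψ hφ (transition_mem hy) η
    rwa [transition_transition hy] at this
  rw [← curvatureIn_transition hφ hψ A hy, ← hb η, christoffel_transition hφ hψ g hy,
    ← metricL_apply, ← metricL_apply, metricL_transition hφ hψ g hy,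
    ContinuousLinearMap.map_add₂, ContinuousLinearMap.bilinearComp_apply]
  ring

/-- A solution of Wong's equations in a chart is a trajectory. -/
theorem isWongTrajectory_of_chart (hφ : φ ∈ IsManifold.maximalAtlas (𝓡∂ n) ∞ M) {T : ℝ}
    {Z : ℝ → Coord n × Coord n × lieAlg G} (hZ : ∀ t ∈ Icc 0 T, (Z t).1 ∈ ext[φ].target)
    (hd : ∀ t ∈ Icc 0 T, HasDerivWithinAt Z (wongIn g κ A φ (Z t)) (Icc 0 T) t) :
    IsWongTrajectory g κ A T (fun t => (phase φ (Z t)).1) (fun t => (Z t).2.2) := by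
  have hcont : ContinuousOn Z (Icc 0 T) := fun t ht => (hd t ht).continuousWithinAt
  have h1 : ∀ t ∈ Icc 0 T, HasDerivWithinAt (fun s => (Z s).1) (Z t).2.1 (Icc 0 T) t :=
    fun t ht => (hd t ht).fst
  have h2 : ∀ t ∈ Icc 0 T, HasDerivWithinAt (fun s => (Z s).2.1) (wongIn g κ A φ (Z t)).2.1
    (Icc 0 T) t := fun t ht => (hd t ht).snd.fst
  have hmaps : MapsTo (fun s => (Z s).1) (Icc 0 T) 𝓗[n] := fun s hs =>
    (relOpen_target φ).1 (hZ s hs)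
  refine ⟨?_, fun ψ hψ t ht hx => ?_, fun ψ hψ t ht hx => ?_, fun t ht => (hd t ht).snd.snd⟩
  · exact (continuousOn_tangentIn hφ).comp (hcont.fst.prodMk hcont.snd.fst)
      fun t ht => ⟨hZ t ht, mem_univ _⟩
  · have hy : (Z t).1 ∈ transDom φ ψ := ⟨hZ t ht, hx⟩
    have hτ := ((smoothOn_transition hφ hψ).differentiableWithinAt hy).hasFDerivWithinAt
    refine (hτ.comp_hasDerivWithinAt t (h1 t ht) hmaps).congr_deriv ?_
    exact (coordVec_transition hφ hψ hy _).symm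
  · have hy : (Z t).1 ∈ transDom φ ψ := ⟨hZ t ht, hx⟩
    have hτ := (((smoothOn_transition hφ hψ).fderivWithin
      (relOpen_transDom φ ψ).1).differentiableWithinAt hy)
    have hc := hasDerivWithinAt_clm_comp_apply hτ (h1 t ht) hmaps (h2 t ht)
    have hev : ∀ᶠ s in 𝓝[Icc 0 T] t, (Z s).1 ∈ transDom φ ψ := by
      have : Tendsto (fun s => (Z s).1) (𝓝[Icc 0 T] t) (𝓝[𝓗[n]] (Z t).1) :=
        tendsto_nhdsWithin_iff.2 ⟨(h1 t ht).continuousWithinAt,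
          eventually_mem_nhdsWithin.mono hmaps⟩
      exact this ((relOpen_transDom φ ψ).2 _ hy)
    refine ⟨_, hc.congr_of_eventuallyEq (hev.mono fun s hs => coordVec_transition hφ hψ hs _)
      (coordVec_transition hφ hψ hy _), fun η => ?_⟩
    have := wong_equation_transition hφ hψ hy
      (fun η => wongIn_equation (g := g) (κ := κ) (A := A) hφ (hZ t ht) η) η
    rw [← coordVec_transition hφ hψ hy (Z t).2.1] at this
    exact this

/-- The coordinates of a phase. -/
def stateIn (φ : OpenPartialHomeomorph M (EuclideanHalfSpace n))
    (θ : TangentBundle (𝓡∂ n) M × lieAlg G) : Coord n × Coord n × lieAlg G :=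
  (ext[φ] θ.1.1, coords φ θ.1.1 θ.1.2, θ.2)

theorem stateIn_phase (hφ : φ ∈ IsManifold.maximalAtlas (𝓡∂ n) ∞ M)
    {Z : Coord n × Coord n × lieAlg G} (hZ : Z.1 ∈ ext[φ].target) : stateIn φ (phase φ Z) = Z :=
  Prod.ext (ext[φ].right_inv hZ) (Prod.ext (coords_coordVec hφ hZ _) rfl)

theorem tangentIn_coords (hφ : φ ∈ IsManifold.maximalAtlas (𝓡∂ n) ∞ M)
    {c : TangentBundle (𝓡∂ n) M} (hc : c.1 ∈ φ.source) :
    tangentIn φ (ext[φ] c.1, coords φ c.1 c.2) = c := by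
  obtain ⟨x, v⟩ := c
  obtain ⟨y, hy, rfl⟩ := exists_coord_of_mem_source hc
  change tangentIn φ (ext[φ] (ext[φ].symm y), coords φ (ext[φ].symm y) v) = ⟨ext[φ].symm y, v⟩
  rw [ext[φ].right_inv hy, tangentIn, coordVec_coords hφ hy]

theorem phase_stateIn (hφ : φ ∈ IsManifold.maximalAtlas (𝓡∂ n) ∞ M)
    {θ : TangentBundle (𝓡∂ n) M × lieAlg G} (hθ : θ.1.1 ∈ φ.source) :
    phase φ (stateIn φ θ) = θ := Prod.ext (tangentIn_coords hφ hθ) rfl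

/-- The coordinates of a trajectory solve Wong's equations. -/
theorem IsWongTrajectory.hasDerivWithinAt_stateIn (hφ : φ ∈ IsManifold.maximalAtlas (𝓡∂ n) ∞ M)
    {T : ℝ} {c : ℝ → TangentBundle (𝓡∂ n) M} {ξ : ℝ → lieAlg G}
    (h : IsWongTrajectory g κ A T c ξ) {t : ℝ} (ht : t ∈ Icc 0 T) (hx : (c t).1 ∈ φ.source) :
    HasDerivWithinAt (fun s => stateIn φ (c s, ξ s)) (wongIn g κ A φ (stateIn φ (c t, ξ t)))
      (Icc 0 T) t := by
  obtain ⟨b, hb, hbη⟩ := h.acceleration φ hφ t ht hx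
  have hZ : (stateIn φ (c t, ξ t)).1 ∈ ext[φ].target := ext_mem_target hx
  refine ((h.velocity φ hφ t ht hx).prodMk (hb.prodMk (h.charge t ht))).congr_deriv ?_
  refine Prod.ext rfl (Prod.ext (eq_wongIn hφ hZ hbη) ?_)
  change _ = -bracket (potentialIn A φ (ext[φ] (c t).1) (coords φ (c t).1 (c t).2)) (ξ t)
  rw [potentialIn_coords hφ A hx]

variable [T2Space M]

/-- Trajectories are determined by their initial phase as long as they stay in a chart. -/
theorem IsWongTrajectory.eq_phase (hφ : φ ∈ IsManifold.maximalAtlas (𝓡∂ n) ∞ M)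
    {T T' m : ℝ} {c : ℝ → TangentBundle (𝓡∂ n) M} {ξ : ℝ → lieAlg G}
    (h : IsWongTrajectory g κ A T' c ξ)
    {Z : ℝ → Coord n × Coord n × lieAlg G} (hZ : ∀ t ∈ Icc 0 T, (Z t).1 ∈ ext[φ].target)
    (hd : ∀ t ∈ Icc 0 T, HasDerivWithinAt Z (wongIn g κ A φ (Z t)) (Icc 0 T) t)
    (h0 : (c 0, ξ 0) = phase φ (Z 0)) (hmT : m ≤ T) (hmT' : m ≤ T') :
    ∀ t ∈ Icc 0 m, (c t, ξ t) = phase φ (Z t) := by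
  have hsub : Icc 0 m ⊆ Icc 0 T := Icc_subset_Icc le_rfl hmT
  have hsub' : Icc 0 m ⊆ Icc 0 T' := Icc_subset_Icc le_rfl hmT'
  have hZc : ContinuousOn Z (Icc 0 m) := fun t ht => (hd t (hsub ht)).continuousWithinAt.mono hsub
  have hproj : Continuous (fun c : TangentBundle (𝓡∂ n) M => c.1) :=
    FiberBundle.continuous_proj (Coord n) (fun x : M => TangentSpace (𝓡∂ n) x)
  have hcc : ContinuousOn (fun t => (c t).1) (Icc 0 m) :=
    (hproj.comp_continuousOn h.continuousOn).mono hsub'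
  have hsymm : ContinuousOn (fun t => ext[φ].symm (Z t).1) (Icc 0 m) :=
    (φ.continuousOn_extend_symm).comp hZc.fst fun t ht => hZ t (hsub ht)
  have hst : ∀ t ∈ Icc 0 m, (c t).1 ∈ φ.source →
      HasDerivWithinAt (fun s => stateIn φ (c s, ξ s)) (wongIn g κ A φ (stateIn φ (c t, ξ t)))
        (Icc 0 m) t := fun t ht hx =>
    (h.hasDerivWithinAt_stateIn hφ (hsub' ht) hx).mono hsub'
  have hsrc : ∀ t ∈ Icc 0 m, (c t).1 ∈ φ.source → ∀ᶠ s in 𝓝[Icc 0 m] t, (c s).1 ∈ φ.source :=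
    fun t ht hx => (hcc t ht).eventually (φ.open_source.mem_nhds hx)
  -- Continuity method: agreement is closed and can always be continued a little to the right. A
  -- priori the trajectory might leave the chart, so agreement must first be used to know that it is
  -- still there.
  set S : Set ℝ := {t | (c t, ξ t) = phase φ (Z t)} with hS
  have hclosed : IsClosed (S ∩ Icc 0 m) := by
    refine isClosed_of_closure_subset fun t ht => ?_
    have htm : t ∈ Icc 0 m := closure_minimal inter_subset_right isClosed_Icc ht
    have hbot : (𝓝[S ∩ Icc 0 m] t).NeBot :=
      mem_closure_iff_nhdsWithin_neBot.1 ht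
    -- The base points are compared first, by the Hausdorff property of `M`; only then are
    -- coordinates at the limiting time available for comparing velocity and charge.
    have e1 : (c t).1 = ext[φ].symm (Z t).1 :=
      tendsto_nhds_unique_of_eventuallyEq ((hcc t htm).mono inter_subset_right)
        ((hsymm t htm).mono inter_subset_right)
        (eventually_mem_nhdsWithin (s := S ∩ Icc 0 m) |>.mono fun s hs => by
          have : (c s, ξ s) = phase φ (Z s) := hs.1
          exact congrArg (fun θ => θ.1.1) this)
    have hx : (c t).1 ∈ φ.source := by rw [e1]; exact symm_mem_source (hZ t (hsub htm))
    have e2 : stateIn φ (c t, ξ t) = Z t :=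
      tendsto_nhds_unique_of_eventuallyEq
        ((hst t htm hx).continuousWithinAt.mono inter_subset_right)
        ((hZc t htm).mono inter_subset_right)
        (eventually_mem_nhdsWithin (s := S ∩ Icc 0 m) |>.mono fun s hs => by
          have : (c s, ξ s) = phase φ (Z s) := hs.1
          change stateIn φ (c s, ξ s) = _
          rw [this, stateIn_phase hφ (hZ s (hsub hs.2))])
    refine ⟨?_, htm⟩
    change (c t, ξ t) = _
    rw [← e2, phase_stateIn hφ hx]
  refine hclosed.Icc_subset_of_forall_exists_gt h0 fun t ht u hu => ?_
  obtain ⟨ht1 : (c t, ξ t) = phase φ (Z t), ht2⟩ := ht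
  have htm : t ∈ Icc 0 m := ⟨ht2.1, ht2.2.le⟩
  have htZ := hZ t (hsub htm)
  have hx : (c t).1 ∈ φ.source := by
    rw [show (c t).1 = ext[φ].symm (Z t).1 from congrArg (fun θ => θ.1.1) ht1]
    exact symm_mem_source htZ
  have hIcc : Icc t m ⊆ Icc 0 m := Icc_subset_Icc ht2.1 le_rfl
  have hsrc' : ∀ᶠ s in 𝓝[Icc t m] t, (c s).1 ∈ φ.source :=
    (hsrc t htm hx).filter_mono (nhdsWithin_mono _ hIcc)
  have hconv := convex_halfSpace_ge (heightL n (lieAlg G)).toLinearMap.isLinear 0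
  have hcd : ContDiffWithinAt ℝ 1 (wongIn g κ A φ) {Z | 0 ≤ heightL n (lieAlg G) Z} (Z t) := by
    refine ((contDiffOn_wongIn hφ (Z t) ⟨htZ, mem_univ _⟩).of_le
      (by simp)).mono_of_mem_nhdsWithin ?_
    have h1 : Tendsto (fun Z : Coord n × Coord n × lieAlg G => Z.1)
        (𝓝[{Z | 0 ≤ heightL n (lieAlg G) Z}] (Z t)) (𝓝[𝓗[n]] (Z t).1) :=
      tendsto_nhdsWithin_iff.2 ⟨continuous_fst.continuousAt.mono_left nhdsWithin_le_nhds,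
        eventually_mem_nhdsWithin.mono fun Z hZ => mem_half.2 hZ⟩
    filter_upwards [h1 ((relOpen_target φ).2 _ htZ)] with Z hZ using ⟨hZ, mem_univ _⟩
  obtain ⟨b, hb, heq⟩ := exists_eqOn_Icc_of_hasDerivWithinAt (f := wongIn g κ A φ)
    (ζ := fun s => stateIn φ (c s, ξ s)) (Z := Z) hconv ht2.2
    (by
      filter_upwards [hsrc', self_mem_nhdsWithin] with s hs hs'
      exact ⟨mem_half.1 ((relOpen_target φ).1 (ext_mem_target hs)),
        (hst s (hIcc hs') hs).mono hIcc⟩)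
    (by
      filter_upwards [self_mem_nhdsWithin] with s hs'
      exact ⟨mem_half.1 ((relOpen_target φ).1 (hZ s (hsub (hIcc hs')))),
        (hd s (hsub (hIcc hs'))).mono (hIcc.trans hsub)⟩)
    (by simp only [ht1]; exact stateIn_phase hφ htZ) hcd
  rw [nhdsWithin_Icc_eq_nhdsGE ht2.2] at hsrc'
  obtain ⟨d, hd', hdsub⟩ := mem_nhdsGE_iff_exists_Icc_subset.1 hsrc'
  have hd' : t < d := hd'
  -- Three restrictions: the requested bound `u`, the interval of local uniqueness up to `b`, and
  -- the time `d` until which the trajectory stays in the chart domain.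
  refine ⟨min u (min b d), ?_, lt_min hu (lt_min hb.1 hd'), min_le_left _ _⟩
  have hle : t ≤ min u (min b d) := (lt_min hu (lt_min hb.1 hd')).le
  have hs : (c (min u (min b d))).1 ∈ φ.source :=
    hdsub ⟨hle, (min_le_right _ _).trans (min_le_right _ _)⟩
  change (c _, ξ _) = _
  rw [← heq ⟨hle, (min_le_right _ _).trans (min_le_left _ _)⟩]
  exact (phase_stateIn hφ (θ := (c _, ξ _)) hs).symm

/-- A trajectory that hits the boundary transversally in a chart exits there. -/
theorem le_of_exits (hφ : φ ∈ IsManifold.maximalAtlas (𝓡∂ n) ∞ M)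
    {T T' : ℝ} (hT : 0 ≤ T) {Z : ℝ → Coord n × Coord n × lieAlg G}
    (hZ : ∀ t ∈ Icc 0 T, (Z t).1 ∈ ext[φ].target)
    (hd : ∀ t ∈ Icc 0 T, HasDerivWithinAt Z (wongIn g κ A φ (Z t)) (Icc 0 T) t)
    (hx : (Z T).1 0 = 0) (hy : (Z T).2.1 0 < 0) {c : ℝ → TangentBundle (𝓡∂ n) M}
    {ξ : ℝ → lieAlg G} (h : IsWongTrajectory g κ A T' c ξ) (h0 : (c 0, ξ 0) = phase φ (Z 0)) :
    T' ≤ T := by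
  by_contra hlt
  push Not at hlt
  have hTm : T ∈ Icc 0 T := ⟨hT, le_rfl⟩
  have e := h.eq_phase hφ hZ hd h0 le_rfl hlt.le T hTm
  have hsrc : (c T).1 ∈ φ.source := by
    rw [show (c T).1 = ext[φ].symm (Z T).1 from congrArg (fun θ => θ.1.1) e]
    exact symm_mem_source (hZ T hTm)
  have hT' : T ∈ Icc 0 T' := ⟨hT, hlt.le⟩
  have est : stateIn φ (c T, ξ T) = Z T := by rw [e, stateIn_phase hφ (hZ T hTm)]
  have hder : HasDerivWithinAt (fun s => ext[φ] (c s).1 0) ((Z T).2.1 0) (Ici T) T := by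
    have h1 := (EuclideanSpace.proj (0 : Fin n) : Coord n →L[ℝ] ℝ).hasFDerivAt.comp_hasDerivWithinAt
      T (h.velocity φ hφ T hT' hsrc)
    have h2 : (stateIn φ (c T, ξ T)).2.1 0 = (Z T).2.1 0 := by rw [est]
    rw [← h2]
    exact h1.mono_of_mem_nhdsWithin (Icc_mem_nhdsGE_of_mem ⟨hT, hlt⟩)
  have hv0 : ext[φ] (c T).1 0 = 0 := by
    have h2 : (stateIn φ (c T, ξ T)).1 0 = (Z T).1 0 := by rw [est]
    exact h2.trans hx
  have hlim := hder.Ioi_of_Ici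
  rw [hasDerivWithinAt_iff_tendsto_slope' (by simp)] at hlim
  -- A continuation beyond `T` would have nonnegative height, hence nonnegative right-hand slopes
  -- from height 0, against the outward velocity.
  have hnn : ∀ᶠ s in 𝓝[>] T, 0 ≤ slope (fun s => ext[φ] (c s).1 0) T s := by
    filter_upwards [self_mem_nhdsWithin] with s hs
    have hs : T < s := hs
    rw [slope_def_field, hv0, sub_zero]
    refine div_nonneg ?_ (by linarith)
    exact mem_half.1 (mem_range_self _)
  have := ge_of_tendsto hlim hnn
  linarith

/-- The chart solution shows that time `T` is attained and `le_of_exits` that no trajectory lasts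
longer, so the supremum is computed without constructing a maximal solution. -/
theorem exitTime_eq_of_exits (hφ : φ ∈ IsManifold.maximalAtlas (𝓡∂ n) ∞ M)
    {T : ℝ} (hT : 0 ≤ T) {Z : ℝ → Coord n × Coord n × lieAlg G}
    (hZ : ∀ t ∈ Icc 0 T, (Z t).1 ∈ ext[φ].target)
    (hd : ∀ t ∈ Icc 0 T, HasDerivWithinAt Z (wongIn g κ A φ (Z t)) (Icc 0 T) t)
    (hx : (Z T).1 0 = 0) (hy : (Z T).2.1 0 < 0) :
    exitTime g κ A (phase φ (Z 0)) = ENNReal.ofReal T := by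
  refine le_antisymm (sSup_le ?_) (le_sSup ⟨T, hT, rfl, _, _, _,
    isWongTrajectory_of_chart hφ hZ hd, rfl, rfl⟩)
  rintro _ ⟨T', -, rfl, θ', c, ξ, h, h0, -⟩
  exact ENNReal.ofReal_le_ofReal (le_of_exits hφ hT hZ hd hx hy h h0)

theorem scatters_of_exits (hφ : φ ∈ IsManifold.maximalAtlas (𝓡∂ n) ∞ M)
    {T : ℝ} (hT : 0 ≤ T) {Z : ℝ → Coord n × Coord n × lieAlg G}
    (hZ : ∀ t ∈ Icc 0 T, (Z t).1 ∈ ext[φ].target)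
    (hd : ∀ t ∈ Icc 0 T, HasDerivWithinAt Z (wongIn g κ A φ (Z t)) (Icc 0 T) t)
    (hx : (Z T).1 0 = 0) (hy : (Z T).2.1 0 < 0) :
    Scatters g κ A (phase φ (Z 0)) (phase φ (Z T)) :=
  ⟨T, hT, exitTime_eq_of_exits hφ hT hZ hd hx hy, _, _, isWongTrajectory_of_chart hφ hZ hd,
    rfl, rfl⟩

theorem eq_of_scatters (hφ : φ ∈ IsManifold.maximalAtlas (𝓡∂ n) ∞ M)
    {T : ℝ} (hT : 0 ≤ T) {Z : ℝ → Coord n × Coord n × lieAlg G}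
    (hZ : ∀ t ∈ Icc 0 T, (Z t).1 ∈ ext[φ].target)
    (hd : ∀ t ∈ Icc 0 T, HasDerivWithinAt Z (wongIn g κ A φ (Z t)) (Icc 0 T) t)
    (hx : (Z T).1 0 = 0) (hy : (Z T).2.1 0 < 0) {θ' : TangentBundle (𝓡∂ n) M × lieAlg G}
    (h : Scatters g κ A (phase φ (Z 0)) θ') : θ' = phase φ (Z T) := by
  obtain ⟨T', hT', he, c, ξ, hw, h0, rfl⟩ := h
  rw [exitTime_eq_of_exits hφ hT hZ hd hx hy, ENNReal.ofReal_eq_ofReal_iff hT hT'] at he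
  subst he
  exact hw.eq_phase hφ hZ hd h0 le_rfl le_rfl T ⟨hT, le_rfl⟩

end YangMills

end

/-! ### Strict convexity as outward normal acceleration -/

noncomputable section

set_option linter.unusedSectionVars false
set_option maxSynthPendingDepth 3

namespace YangMills

variable {n : ℕ} [NeZero n] {M : Type*} [TopologicalSpace M]
  [ChartedSpace (EuclideanHalfSpace n) M] [IsManifold (𝓡∂ n) ∞ M]
variable {φ ψ : OpenPartialHomeomorph M (EuclideanHalfSpace n)}
variable {N : ℕ} {G : Subgroup (Mat N)ˣ} {A : Potential n M G}
variable {g : Metric n M} {κ : AdInvariantInner G}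

/-- An outer normal in coordinates: a vector orthogonal to the boundary pointing out of `M`. -/
theorem exists_normal_coord (hφ : φ ∈ IsManifold.maximalAtlas (𝓡∂ n) ∞ M) (g : Metric n M)
    {y : Coord n} (hy : y ∈ ext[φ].target) :
    ∃ (b : Coord n) (c : ℝ), 0 < c ∧ metricL g φ y b b = 1 ∧ b 0 < 0 ∧
      ∀ w, metricL g φ y w b = -(c * w 0) := by
  have hpos : ∀ v, v ≠ 0 → 0 < metricL g φ y v v := fun v hv => metricL_pos hφ g hy hv
  set ϖ : Coord n →L[ℝ] ℝ := EuclideanSpace.proj (0 : Fin n) with hϖ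
  -- The gradient of the height points inward; normalising it and changing its sign gives the outer
  -- normal. The charts are arbitrary, so ∂₀ need not be orthogonal to the boundary.
  set b := (metricL g φ y).inverse ϖ with hb
  have h1 : ∀ w, metricL g φ y b w = w 0 := fun w =>
    congrArg (fun L : Coord n →L[ℝ] ℝ => L w) (apply_inverse_of_pos hpos ϖ)
  have hb0 : b ≠ 0 := fun h0 => by
    have := h1 (basisVec 0)
    rw [h0, map_zero, zero_apply, basisVec_apply] at this
    simp at this
  have h2 : 0 < b 0 := by rw [← h1]; exact hpos b hb0
  set s := √(b 0) with hs
  have hs0 : 0 < s := Real.sqrt_pos.2 h2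
  have hss : s * s = b 0 := Real.mul_self_sqrt h2.le
  refine ⟨-(s⁻¹ • b), s⁻¹, inv_pos.2 hs0, ?_, ?_, fun w => ?_⟩
  · simp only [map_neg, map_smul, neg_apply, smul_apply, h1, smul_eq_mul, ← hss]
    field_simp
  · have : (-(s⁻¹ • b)) 0 = -(s⁻¹ * b 0) := rfl
    rw [this]
    have := mul_pos (inv_pos.2 hs0) h2
    linarith
  · rw [map_neg, map_smul, metricL_symm, h1]
    rfl

theorem isOuterNormal_coordVec (hφ : φ ∈ IsManifold.maximalAtlas (𝓡∂ n) ∞ M) {y : Coord n}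
    (hy : y ∈ ext[φ].target) (hy0 : y 0 = 0) {b : Coord n} {c : ℝ}
    (h1 : metricL g φ y b b = 1) (hb : b 0 < 0) (hc : ∀ w, metricL g φ y w b = -(c * w 0)) :
    IsOuterNormal g (ext[φ].symm y) (coordVec φ y b) := by
  have hx := symm_mem_source hy
  have hxb : ext[φ].symm y ∈ (𝓡∂ n).boundary M := by
    rw [mem_boundary_iff hφ hx, ext[φ].right_inv hy, hy0]
  refine ⟨h1, fun w hw => ?_, ?_⟩
  · rw [isTangentToBoundary_iff hφ hx hxb] at hw
    have h2 := metricL_coords hφ g hx w (coordVec φ y b)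
    rw [ext[φ].right_inv hy, coords_coordVec hφ hy, hc, hw] at h2
    rw [g.symm, ← h2]
    simp
  · obtain ⟨c', hc', h⟩ := exists_coords_chartAt hφ hx hxb
    rw [h, coords_coordVec hφ hy]
    exact mul_neg_of_pos_of_neg hc' hb

/-- Unit vectors at the boundary with nonnegative normal component are in `∂₊SM`. -/
theorem tangentIn_mem_inwardBoundary (hφ : φ ∈ IsManifold.maximalAtlas (𝓡∂ n) ∞ M) {y w : Coord n}
    (hy : y ∈ ext[φ].target) (hy0 : y 0 = 0) (hw : metricL g φ y w w = 1) (hw0 : 0 ≤ w 0) :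
    tangentIn φ (y, w) ∈ inwardBoundary g := by
  have hx := symm_mem_source hy
  have hxb : ext[φ].symm y ∈ (𝓡∂ n).boundary M := by
    rw [mem_boundary_iff hφ hx, ext[φ].right_inv hy, hy0]
  refine ⟨hxb, hw, fun ν hν => ?_⟩
  change TangentSpace (𝓡∂ n) (ext[φ].symm y) at ν
  have e : ∀ u : TangentSpace (𝓡∂ n) (ext[φ].symm y), g.inner (ext[φ].symm y) u ν =
      metricL g φ y (coords φ (ext[φ].symm y) u) (coords φ (ext[φ].symm y) ν) := fun u => by
    have := metricL_coords hφ g hx u ν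
    rw [ext[φ].right_inv hy] at this
    exact this.symm
  set b := coords φ (ext[φ].symm y) ν with hb
  have hortho : ∀ w : Coord n, w 0 = 0 → metricL g φ y w b = 0 := fun w hw => by
    have h1 := hν.orthogonal (coordVec φ y w) (by
      change IsTangentToBoundary (ext[φ].symm y) _
      rw [isTangentToBoundary_iff hφ hx hxb, coords_coordVec hφ hy, hw])
    have h2 := e (coordVec φ y w)
    rw [coords_coordVec hφ hy] at h2
    rw [← h2, g.symm]
    exact h1
  have hlin : ∀ w : Coord n, metricL g φ y w b = w 0 * metricL g φ y (basisVec 0) b := fun w => by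
    conv_lhs => rw [← bdryProj_add w]
    rw [map_add, add_apply, hortho _ (bdryProj_zero w), map_smul, smul_apply,
      zero_add, smul_eq_mul]
  have hbb : metricL g φ y b b = 1 := by
    rw [← e ν]; exact hν.unit
  have hb0 : b 0 < 0 := by
    obtain ⟨c', hc', h⟩ := exists_coords_chartAt hφ hx hxb
    have h3 : coords (chartAt (EuclideanHalfSpace n) (ext[φ].symm y)) (ext[φ].symm y) ν 0 < 0 :=
      hν.outward
    rw [h] at h3
    by_contra hcon
    push Not at hcon
    have := mul_nonneg hc'.le hcon
    linarith
  have h4 := e (coordVec φ y w)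
  rw [coords_coordVec hφ hy, hlin] at h4
  change g.inner (ext[φ].symm y) (coordVec φ y w) ν ≤ 0
  rw [h4]
  rw [hlin] at hbb
  -- The product of `b 0 < 0` with this number is the squared length 1 of the normal, so the number
  -- is negative.
  have : metricL g φ y (basisVec 0) b ≤ 0 := by nlinarith
  exact mul_nonpos_of_nonneg_of_nonpos hw0 this

/-- Second derivatives of transition maps along the boundary are tangent to the boundary. -/
theorem second_fderivWithin_transition_zero (hφ : φ ∈ IsManifold.maximalAtlas (𝓡∂ n) ∞ M)
    (hψ : ψ ∈ IsManifold.maximalAtlas (𝓡∂ n) ∞ M) {y : Coord n} (hy : y ∈ transDom φ ψ)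
    (hy0 : y 0 = 0) {w : Coord n} (hw : w 0 = 0) :
    fderivWithin ℝ (fun z => fderivWithin ℝ (transition φ ψ) 𝓗[n] z) 𝓗[n] y w w 0 = 0 := by
  have hT := relOpen_transDom φ ψ
  have hsm := (smoothOn_transition hφ hψ).fderivWithin hT.1
  have hd := hsm.differentiableWithinAt hy
  set L : (Coord n →L[ℝ] Coord n) →L[ℝ] ℝ :=
    (EuclideanSpace.proj (0 : Fin n) : Coord n →L[ℝ] ℝ).comp
      (ContinuousLinearMap.apply ℝ (Coord n) w) with hL
  have hsmL := SmoothOn.clm_comp_left L hsm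
  have h0 := fderivWithin_tangential_eq_zero hT hy hy0 (hsmL.differentiableWithinAt hy)
    -- Along the boundary the Jacobian keeps the tangential vector `w` tangential, so the function
    -- being differentiated vanishes there.
    (fun z hz hz0 => by
      obtain ⟨c, -, hc⟩ := exists_transition_normal hφ hψ hz hz0
      change fderivWithin ℝ (transition φ ψ) 𝓗[n] z w 0 = 0
      rw [hc, hw, mul_zero]) hw
  have h1 := (L.hasFDerivAt.comp_hasFDerivWithinAt y hd.hasFDerivWithinAt).fderivWithin
    (uniqueDiffOn_half y (hT.1 hy))
  have h2 : fderivWithin ℝ (fun z => L (fderivWithin ℝ (transition φ ψ) 𝓗[n] z)) 𝓗[n] y w =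
      L (fderivWithin ℝ (fun z => fderivWithin ℝ (transition φ ψ) 𝓗[n] z) 𝓗[n] y w) :=
    congrArg (fun T : Coord n →L[ℝ] ℝ => T w) h1
  rw [h0] at h2
  exact h2.symm

/-- At a strictly convex boundary point, rays tangent to the boundary accelerate out of `M`. -/
theorem StrictlyYMConvexAt.wongIn_neg {O : Set (lieAlg G)}
    (hφ : φ ∈ IsManifold.maximalAtlas (𝓡∂ n) ∞ M) {y w : Coord n} (hy : y ∈ ext[φ].target)
    (hy0 : y 0 = 0) (h : StrictlyYMConvexAt g κ O A (ext[φ].symm y)) (hw : metricL g φ y w w = 1)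
    (hw0 : w 0 = 0) {ξ : lieAlg G} (hξ : ξ ∈ O) : (wongIn g κ A φ (y, w, ξ)).2.1 0 < 0 := by
  have hx := symm_mem_source hy
  have hxb : ext[φ].symm y ∈ (𝓡∂ n).boundary M := by
    rw [mem_boundary_iff hφ hx, ext[φ].right_inv hy, hy0]
  obtain ⟨b, c, hc, hbb, hb0, hbc⟩ := exists_normal_coord hφ g hy
  have hν := isOuterNormal_coordVec hφ hy hy0 hbb hb0 hbc
  have hconv := h _ hν (coordVec φ y w) hw
    ((isTangentToBoundary_iff hφ hx hxb _).2 (by rw [coords_coordVec hφ hy, hw0])) ξ hξ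
  set ψ := chartAt (EuclideanHalfSpace n) (ext[φ].symm y) with hψdef
  have hψ : ψ ∈ IsManifold.maximalAtlas (𝓡∂ n) ∞ M := IsManifold.chart_mem_maximalAtlas _
  have hyt : y ∈ transDom φ ψ := ⟨hy, mem_chart_source _ _⟩
  rw [secondFundamentalForm, curvature, ← hψdef, coordVec_transition hφ hψ hyt,
    coordVec_transition hφ hψ hyt] at hconv
  change 0 < -christoffel g ψ (transition φ ψ y) _ _ _ +
    κ.form (curvatureIn A ψ (transition φ ψ y) _ _) ξ at hconv
  rw [← curvatureIn_transition hφ hψ A hyt] at hconv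
  have hch := christoffel_transition hφ hψ g hyt w w b
  -- The second fundamental form is defined in the preferred chart. Passing to `φ` costs the metric
  -- pairing of the normal with a second derivative of the transition, which is tangential and
  -- therefore contributes 0.
  obtain ⟨u, hu⟩ : ∃ u, fderivWithin ℝ (transition φ ψ) 𝓗[n] y u =
      fderivWithin ℝ (fun z => fderivWithin ℝ (transition φ ψ) 𝓗[n] z) 𝓗[n] y w w := by
    refine ⟨fderivWithin ℝ (transition ψ φ) 𝓗[n] (transition φ ψ y)
      (fderivWithin ℝ (fun z => fderivWithin ℝ (transition φ ψ) 𝓗[n] z) 𝓗[n] y w w), ?_⟩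
    have := fderivWithin_transition_comp hψ hφ (transition_mem hyt)
      (fderivWithin ℝ (fun z => fderivWithin ℝ (transition φ ψ) 𝓗[n] z) 𝓗[n] y w w)
    rwa [transition_transition hyt] at this
  have hu0 : u 0 = 0 := by
    obtain ⟨c', hc', h'⟩ := exists_transition_normal hφ hψ hyt hy0
    have h1 := h' u
    rw [hu, second_fderivWithin_transition_zero hφ hψ hyt hy0 hw0] at h1
    exact (mul_eq_zero.1 h1.symm).resolve_left hc'.ne'
  have hm := congrArg (fun L : Coord n →L[ℝ] Coord n →L[ℝ] ℝ => L u b)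
    (metricL_transition hφ hψ g hyt)
  simp only [ContinuousLinearMap.bilinearComp_apply, hbc, hu0, hu] at hm
  rw [← hm] at hch
  -- Testing the equation of motion against the outer normal turns the metric term into a negative
  -- multiple of the normal acceleration, whose sign is then that demanded by convexity.
  have heq := wongIn_equation (g := g) (κ := κ) (A := A) hφ (Z := (y, w, ξ)) hy b
  simp only at heq
  rw [hch, ← metricL_apply, hbc] at heq
  nlinarith

/-- The coordinate vector `± ∂ᵢ`, normalized. -/
def unitVec (g : Metric n M) (φ : OpenPartialHomeomorph M (EuclideanHalfSpace n)) (σ : ℝ)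
    (i : Fin n) (y : Coord n) : Coord n :=
  (σ * (√(metricL g φ y (basisVec i) (basisVec i)))⁻¹) • basisVec i

theorem basisVec_ne_zero (i : Fin n) : (basisVec i : Coord n) ≠ 0 := fun h => by
  have := norm_basisVec i
  rw [h, norm_zero] at this
  exact zero_ne_one this

theorem unitVec_zero (g : Metric n M) (φ : OpenPartialHomeomorph M (EuclideanHalfSpace n)) (σ : ℝ)
    {i : Fin n} (hi : i ≠ 0) (y : Coord n) : unitVec g φ σ i y 0 = 0 := by
  change _ * (basisVec i : Coord n) 0 = 0
  rw [basisVec_apply, if_neg hi.symm, mul_zero]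

theorem metricL_unitVec (hφ : φ ∈ IsManifold.maximalAtlas (𝓡∂ n) ∞ M) (g : Metric n M) {σ : ℝ}
    (hσ : σ * σ = 1) (i : Fin n) {y : Coord n} (hy : y ∈ ext[φ].target) :
    metricL g φ y (unitVec g φ σ i y) (unitVec g φ σ i y) = 1 := by
  have h := metricL_pos hφ g hy (basisVec_ne_zero i)
  rw [unitVec, map_smul, map_smul, smul_apply, smul_eq_mul, smul_eq_mul]
  set s := √(metricL g φ y (basisVec i) (basisVec i)) with hs
  have hs0 : 0 < s := Real.sqrt_pos.2 h
  rw [← Real.mul_self_sqrt h.le, ← hs]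
  field_simp
  linarith

theorem continuousWithinAt_unitVec (hφ : φ ∈ IsManifold.maximalAtlas (𝓡∂ n) ∞ M) (g : Metric n M)
    (σ : ℝ) (i : Fin n) {y : Coord n} (hy : y ∈ ext[φ].target) :
    ContinuousWithinAt (unitVec g φ σ i) 𝓗[n] y := by
  have h := metricL_pos hφ g hy (basisVec_ne_zero i)
  have h1 : ContinuousWithinAt (metricL g φ) 𝓗[n] y := (smoothOn_metricL hφ g y hy).continuousWithinAt
  have h2 := ((h1.clm_apply continuousWithinAt_const).clm_apply continuousWithinAt_const).sqrt
    (f := fun z => metricL g φ z (basisVec i) (basisVec i))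
  exact (continuousWithinAt_const.mul (h2.inv₀ (Real.sqrt_pos.2 h).ne')).smul
    continuousWithinAt_const

/-- Strict convexity persists at nearby boundary points for the normalized coordinate vectors. -/
theorem eventually_wongIn_neg {O : Set (lieAlg G)}
    (hφ : φ ∈ IsManifold.maximalAtlas (𝓡∂ n) ∞ M) {y : Coord n} (hy : y ∈ ext[φ].target)
    (hy0 : y 0 = 0) (h : StrictlyYMConvexAt g κ O A (ext[φ].symm y)) {σ : ℝ} (hσ : σ * σ = 1)
    {i : Fin n} (hi : i ≠ 0) {ξ : lieAlg G} (hξ : ξ ∈ O) :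
    ∀ᶠ z in 𝓝[𝓗[n]] y, (wongIn g κ A φ (z, unitVec g φ σ i z, ξ)).2.1 0 < 0 := by
  have h0 := h.wongIn_neg hφ hy hy0 (metricL_unitVec hφ g hσ i hy) (unitVec_zero g φ σ hi y) hξ
  have h1 : Tendsto (fun z => (z, unitVec g φ σ i z, ξ)) (𝓝[𝓗[n]] y)
      (𝓝[ext[φ].target ×ˢ univ] (y, unitVec g φ σ i y, ξ)) := by
    refine tendsto_nhdsWithin_iff.2 ⟨continuousWithinAt_id.prodMk
      ((continuousWithinAt_unitVec hφ g σ i hy).prodMk continuousWithinAt_const), ?_⟩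
    filter_upwards [(relOpen_target φ).2 _ hy] with z hz using ⟨hz, mem_univ _⟩
  have h2 := ((contDiffOn_wongIn (g := g) (κ := κ) (A := A) hφ).continuousOn
    (y, unitVec g φ σ i y, ξ) ⟨hy, mem_univ _⟩).tendsto.comp h1
  have h3 := ((speedL n (lieAlg G)).continuous.tendsto _).comp h2
  exact h3.eventually (gt_mem_nhds h0)

theorem eventually_tangentIn_unitVec_mem (hφ : φ ∈ IsManifold.maximalAtlas (𝓡∂ n) ∞ M)
    {y : Coord n} (hy : y ∈ ext[φ].target) {W : Set (TangentBundle (𝓡∂ n) M)} (hW : IsOpen W)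
    {σ : ℝ} {i : Fin n} (h : tangentIn φ (y, unitVec g φ σ i y) ∈ W) :
    ∀ᶠ z in 𝓝[𝓗[n]] y, tangentIn φ (z, unitVec g φ σ i z) ∈ W := by
  have h1 : Tendsto (fun z => (z, unitVec g φ σ i z)) (𝓝[𝓗[n]] y)
      (𝓝[ext[φ].target ×ˢ univ] (y, unitVec g φ σ i y)) := by
    refine tendsto_nhdsWithin_iff.2 ⟨continuousWithinAt_id.prodMk
      (continuousWithinAt_unitVec hφ g σ i hy), ?_⟩
    filter_upwards [(relOpen_target φ).2 _ hy] with z hz using ⟨hz, mem_univ _⟩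
  exact ((continuousOn_tangentIn hφ (y, unitVec g φ σ i y) ⟨hy, mem_univ _⟩).tendsto.comp
    h1).eventually (hW.mem_nhds h)

theorem tangentIn_mem_unitBoundaryVectors (hφ : φ ∈ IsManifold.maximalAtlas (𝓡∂ n) ∞ M)
    {y w : Coord n} (hy : y ∈ ext[φ].target) (hy0 : y 0 = 0) (hw : metricL g φ y w w = 1)
    (hw0 : w 0 = 0) : tangentIn φ (y, w) ∈ unitBoundaryVectors g (ext[φ].symm y) := by
  have hx := symm_mem_source hy
  have hxb : ext[φ].symm y ∈ (𝓡∂ n).boundary M := by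
    rw [mem_boundary_iff hφ hx, ext[φ].right_inv hy, hy0]
  exact ⟨_, rfl, hw, (isTangentToBoundary_iff hφ hx hxb _).2 (by rw [coords_coordVec hφ hy, hw0])⟩

end YangMills

end

/-! ### The sign of the difference of two Wong fields -/

noncomputable section

set_option linter.unusedSectionVars false
set_option maxSynthPendingDepth 3

namespace YangMills

section Force

variable {E : Type*} [NormedAddCommGroup E] [NormedSpace ℝ E]
  {𝔤 : Type*} [NormedAddCommGroup 𝔤] [NormedSpace ℝ 𝔤]
variable (B : 𝔤 →L[ℝ] 𝔤 →L[ℝ] 𝔤) (K : 𝔤 →L[ℝ] 𝔤 →L[ℝ] ℝ) {a b : E →L[ℝ] 𝔤}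
  {a' b' : E →L[ℝ] E →L[ℝ] 𝔤} (m' : E →L[ℝ] E →L[ℝ] E →L[ℝ] ℝ) (w v : E) (ξ ξ₀ : 𝔤)

/-- The metric terms cancel, and the difference of brackets is telescoped so that each term contains
`a - b` once. -/
theorem force_sub_apply (η : E) : (force B K a a' m' w ξ - force B K b b' m' w ξ) η =
    K ((a' - b') w η - (a' - b') η w + (B ((a - b) w) (a η) + B (b w) ((a - b) η))) ξ := by
  rw [sub_apply, force_apply, force_apply]
  simp only [sub_apply, map_sub, map_add, add_apply]
  ring

theorem norm_force_sub_le {s : ℝ} (h : ‖a - b‖ ≤ s) (h' : ‖a' - b'‖ ≤ s) :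
    ‖force B K a a' m' w ξ - force B K b b' m' w ξ‖ ≤
      s * (‖K‖ * ‖ξ‖ * ‖w‖ * (2 + ‖B‖ * (‖a‖ + ‖b‖))) := by
  have hs : 0 ≤ s := (norm_nonneg _).trans h
  refine ContinuousLinearMap.opNorm_le_bound _ (by positivity) fun η => ?_
  rw [force_sub_apply]
  refine (K.le_opNorm₂ _ _).trans ?_
  have e1 : ‖(a' - b') w η‖ ≤ s * ‖w‖ * ‖η‖ := ((a' - b').le_opNorm₂ w η).trans (by gcongr)
  have e2 : ‖(a' - b') η w‖ ≤ s * ‖η‖ * ‖w‖ := ((a' - b').le_opNorm₂ η w).trans (by gcongr)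
  have e3 : ‖B ((a - b) w) (a η)‖ ≤ ‖B‖ * (s * ‖w‖) * (‖a‖ * ‖η‖) :=
    (B.le_opNorm₂ _ _).trans (by
      gcongr
      · exact ((a - b).le_opNorm w).trans (by gcongr)
      · exact a.le_opNorm η)
  have e4 : ‖B (b w) ((a - b) η)‖ ≤ ‖B‖ * (‖b‖ * ‖w‖) * (s * ‖η‖) :=
    (B.le_opNorm₂ _ _).trans (by
      gcongr
      · exact b.le_opNorm w
      · exact ((a - b).le_opNorm η).trans (by gcongr))
  have e5 := (norm_add_le ((a' - b') w η - (a' - b') η w)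
    (B ((a - b) w) (a η) + B (b w) ((a - b) η))).trans
    (add_le_add (norm_sub_le _ _) (norm_add_le _ _))
  calc _ ≤ ‖K‖ * (s * ‖w‖ * ‖η‖ + s * ‖η‖ * ‖w‖ + (‖B‖ * (s * ‖w‖) * (‖a‖ * ‖η‖) +
        ‖B‖ * (‖b‖ * ‖w‖) * (s * ‖η‖))) * ‖ξ‖ := by
        gcongr
        linarith
    _ = _ := by ring

/-- The normal component of the difference of two forces, for potentials with the same normal
component. -/
theorem force_sub_apply_normal_le {e : E} {s t : ℝ} (he : (a - b) e = 0) (he' : (a' - b') w e = 0)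
    (h : ‖a - b‖ ≤ t) (h' : ‖(a' - b') e‖ ≤ s) :
    (force B K a a' m' w ξ - force B K b b' m' w ξ) e ≤ -K ((a' - b') e v) ξ₀ +
      s * (‖K‖ * (‖w - v‖ * ‖ξ‖ + ‖v‖ * ‖ξ - ξ₀‖)) + t * (‖K‖ * ‖B‖ * ‖w‖ * ‖a‖ * ‖e‖ * ‖ξ‖) := by
  have ht : 0 ≤ t := (norm_nonneg _).trans h
  rw [force_sub_apply, he, he', map_zero, add_zero, zero_sub]
  -- Velocity and charge are frozen at `v` and `ξ₀` in the leading term; the price is two errors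
  -- proportional to `w - v` and `ξ - ξ₀`, besides the bracket term.
  have hsplit : K (-((a' - b') e w) + B ((a - b) w) (a e)) ξ = -K ((a' - b') e v) ξ₀ -
      K ((a' - b') e (w - v)) ξ - K ((a' - b') e v) (ξ - ξ₀) + K (B ((a - b) w) (a e)) ξ := by
    simp only [map_sub, map_add, map_neg, add_apply, sub_apply, neg_apply]
    ring
  rw [hsplit]
  have e1 : -K ((a' - b') e (w - v)) ξ ≤ ‖K‖ * (s * ‖w - v‖) * ‖ξ‖ :=
    (neg_le_abs _).trans ((K.le_opNorm₂ _ _).trans (by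
      gcongr
      exact (((a' - b') e).le_opNorm _).trans (by gcongr)))
  have e2 : -K ((a' - b') e v) (ξ - ξ₀) ≤ ‖K‖ * (s * ‖v‖) * ‖ξ - ξ₀‖ :=
    (neg_le_abs _).trans ((K.le_opNorm₂ _ _).trans (by
      gcongr
      exact (((a' - b') e).le_opNorm _).trans (by gcongr)))
  have e3 : K (B ((a - b) w) (a e)) ξ ≤ ‖K‖ * (‖B‖ * (t * ‖w‖) * (‖a‖ * ‖e‖)) * ‖ξ‖ :=
    (le_abs_self _).trans ((K.le_opNorm₂ _ _).trans (by
      gcongr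
      refine (B.le_opNorm₂ _ _).trans ?_
      gcongr
      · exact ((a - b).le_opNorm _).trans (by gcongr)
      · exact a.le_opNorm e))
  nlinarith

end Force

section Estimate

variable {n : ℕ} [NeZero n] {𝔤 : Type*} [NormedAddCommGroup 𝔤] [NormedSpace ℝ 𝔤]
variable {B : 𝔤 →L[ℝ] 𝔤 →L[ℝ] 𝔤} {K : 𝔤 →L[ℝ] 𝔤 →L[ℝ] ℝ} {a b : Coord n → Coord n →L[ℝ] 𝔤}
  {m : Coord n → Coord n →L[ℝ] Coord n →L[ℝ] ℝ} {T : Set (Coord n)}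

/-- The differential of a function vanishing to order `r + 1` at the boundary vanishes to
order `r`. -/
theorem iterate_normalD_fderivWithin_eq_zero {F : Type*} [NormedAddCommGroup F] [NormedSpace ℝ F]
    {f : Coord n → F} {r : ℕ} (hT : RelOpen T) (hf : SmoothOn f T)
    (h : ∀ k < r + 1, ∀ y ∈ T, y 0 = 0 → normalD^[k] f y = 0) :
    ∀ k < r, ∀ y ∈ T, y 0 = 0 → normalD^[k] (fun z => fderivWithin ℝ f 𝓗[n] z) y = 0 := by
  intro k hk y hy hy0
  rw [iterate_normalD_fderivWithin hT hf k hy]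
  have hsm := hf.iterate_normalD hT.1 k
  ext1 v
  have h1 : fderivWithin ℝ (normalD^[k] f) 𝓗[n] y (basisVec 0) = 0 := by
    have := h (k + 1) (by omega) y hy hy0
    rwa [Function.iterate_succ_apply'] at this
  change fderivWithin ℝ (normalD^[k] f) 𝓗[n] y v = 0
  rw [← bdryProj_add v, map_add, map_smul, h1, smul_zero, add_zero]
  exact fderivWithin_tangential_eq_zero hT hy hy0 (hsm.differentiableWithinAt hy)
    (fun z hz hz0 => h k (by omega) z hz hz0) (bdryProj_zero v)

set_option maxHeartbeats 1600000 in
/-- The main estimate: near a state at which the first nonzero normal derivative of the difference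
of two potentials has a sign, the difference of the vector fields of Wong's equations has a
sign. -/
theorem exists_wongField_sub_estimate (hT : RelOpen T) (ha : SmoothOn a T) (hb : SmoothOn b T)
    (hm : SmoothOn m T) (hpos : ∀ z ∈ T, ∀ v, v ≠ 0 → 0 < m z v v) {q v : Coord n} {ξ₀ : 𝔤}
    (hq : q ∈ T) (hq0 : q 0 = 0) {r : ℕ}
    (hab : ∀ z ∈ T, a z (basisVec 0) = b z (basisVec 0))
    (hr : ∀ k < r + 1, ∀ y ∈ T, y 0 = 0 → normalD^[k] (fun z => a z - b z) y = 0)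
    (hsign : 0 < K (normalD^[r + 1] (fun z => a z - b z) q v) ξ₀) :
    ∃ ρ > 0, ∃ β > 0, ∃ C, 0 ≤ C ∧ ∀ Z ∈ stateBall (q, v, ξ₀) ρ,
      ‖wongField B K a m Z - wongField B K b m Z‖ ≤ C * Z.1 0 ^ r ∧
      m q (wongField B K a m Z - wongField B K b m Z).2.1 (basisVec 0) ≤ -β * Z.1 0 ^ r := by
  set f : Coord n → Coord n →L[ℝ] 𝔤 := fun z => a z - b z with hf
  have hfs : SmoothOn f T := ha.sub hb
  obtain ⟨δ, hδ, hsub⟩ := hT.exists_ball hq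
  have hfs' := hfs.mono hsub
  obtain ⟨C₁, hC₁, hf1⟩ := exists_bound_of_normalD_eq_zero hq0 (half_lt_self hδ) hfs'
    fun k hk y hy => hr k hk y (hsub hy)
  obtain ⟨C₂, hC₂, hf2⟩ := exists_bound_of_normalD_eq_zero hq0 (half_lt_self hδ)
    ((hfs.fderivWithin hT.1).mono hsub)
    fun k hk y hy => iterate_normalD_fderivWithin_eq_zero hT hfs hr k hk y (hsub hy)
  set C₀ := max C₁ C₂ with hC₀
  have hC₀0 : 0 ≤ C₀ := hC₁.trans (le_max_left _ _)
  -- the leading term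
  set L : (Coord n →L[ℝ] 𝔤) →L[ℝ] ℝ := (K.flip ξ₀).comp (ContinuousLinearMap.apply ℝ 𝔤 v) with hL
  have hns := hfs.normalD hT.1
  have hLs : SmoothOn (fun z => L (normalD f z)) T := SmoothOn.clm_comp_left L hns
  -- Half of the leading coefficient, so that the bound persists by continuity near `q`.
  set β := K (normalD^[r + 1] f q v) ξ₀ / 2 with hβ
  have hβ0 : 0 < β := half_pos hsign
  have hLcont : ContinuousWithinAt (normalD^[r] (fun z => L (normalD f z))) 𝓗[n] q :=
    (hLs.iterate_normalD hT.1 r q hq).continuousWithinAt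
  have hLq : normalD^[r] (fun z => L (normalD f z)) q = 2 * β := by
    rw [iterate_normalD_clm_comp hT L hns r hq, ← Function.iterate_succ_apply, hβ]
    change K (normalD^[r + 1] f q v) ξ₀ = _
    ring
  have hLev : ∀ᶠ z in 𝓝[𝓗[n]] q, β < normalD^[r] (fun z => L (normalD f z)) z :=
    hLcont.eventually (lt_mem_nhds (by rw [hLq]; linarith))
  obtain ⟨δ₁, hδ₁, hsub₁⟩ := Metric.mem_nhdsWithin_iff.1 (inter_mem hLev (hT.2 q hq))
  have hball₁ : 𝓗[n] ∩ Metric.ball q δ₁ ⊆ T := fun z hz => (hsub₁ ⟨hz.2, hz.1⟩).2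
  -- The force involves one derivative of `f`, so its leading term vanishes to order `r` although
  -- `f` vanishes to order `r + 1`.
  have hlead := le_of_normalD_le (r := r) hq0 (hLs.mono hball₁)
    (fun k hk y hy hy0 => by
      rw [iterate_normalD_clm_comp hT L hns k (hball₁ hy), ← Function.iterate_succ_apply]
      change L (normalD^[k + 1] f y) = 0
      rw [hr (k + 1) (by omega) y (hball₁ hy) hy0, map_zero])
    (fun y hy => (hsub₁ ⟨hy.2, hy.1⟩).1.le)
  set β₁ := β / r.factorial with hβ₁
  have hβ₁0 : 0 < β₁ := by positivity
  -- continuity of the error terms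
  set S : Set (Coord n × Coord n × 𝔤) := {Z | 0 ≤ heightL n 𝔤 Z} with hS
  set Z₀ : Coord n × Coord n × 𝔤 := (q, v, ξ₀) with hZ₀
  have hfst : Tendsto (fun Z : Coord n × Coord n × 𝔤 => Z.1) (𝓝[S] Z₀) (𝓝[𝓗[n]] q) :=
    tendsto_nhdsWithin_iff.2 ⟨continuous_fst.continuousAt.mono_left nhdsWithin_le_nhds,
      eventually_mem_nhdsWithin.mono fun Z hZ => mem_half.2 hZ⟩
  have hw : ContinuousWithinAt (fun Z : Coord n × Coord n × 𝔤 => Z.2.1) S Z₀ :=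
    continuous_snd.fst.continuousWithinAt
  have hξ : ContinuousWithinAt (fun Z : Coord n × Coord n × 𝔤 => Z.2.2) S Z₀ :=
    continuous_snd.snd.continuousWithinAt
  have hx : ContinuousWithinAt (fun Z : Coord n × Coord n × 𝔤 => Z.1 0) S Z₀ :=
    (heightL n 𝔤).continuous.continuousWithinAt
  have hac : ContinuousWithinAt (fun Z : Coord n × Coord n × 𝔤 => a Z.1) S Z₀ :=
    ((ha q hq).continuousWithinAt).tendsto.comp hfst
  have hbc : ContinuousWithinAt (fun Z : Coord n × Coord n × 𝔤 => b Z.1) S Z₀ :=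
    ((hb q hq).continuousWithinAt).tendsto.comp hfst
  have hmc : ContinuousWithinAt (fun Z : Coord n × Coord n × 𝔤 => m Z.1) S Z₀ :=
    ((hm q hq).continuousWithinAt).tendsto.comp hfst
  have hic : ContinuousWithinAt (fun Z : Coord n × Coord n × 𝔤 => (m Z.1).inverse) S Z₀ :=
    ((hT.smoothOn (contDiffOn_inverse_of_pos (hm.contDiffOn hT.1) hpos) q
      hq).continuousWithinAt).tendsto.comp hfst
  set Λ : Coord n × Coord n × 𝔤 → ℝ := fun Z =>
    C₀ * (‖K‖ * ‖Z.2.2‖ * ‖Z.2.1‖ * (2 + ‖B‖ * (‖a Z.1‖ + ‖b Z.1‖))) with hΛ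
  have hΛc : ContinuousWithinAt Λ S Z₀ := continuousWithinAt_const.mul
    (((continuousWithinAt_const.mul hξ.norm).mul hw.norm).mul
      (continuousWithinAt_const.add (continuousWithinAt_const.mul (hac.norm.add hbc.norm))))
  -- All errors divided by `x ^ r`: freezing velocity and charge, the bracket (which has an extra
  -- factor `x`), and replacing the metric at `Z.1` by the metric at `q`. Each vanishes at the
  -- central state, so near it they cost at most half of `β₁`.
  set err : Coord n × Coord n × 𝔤 → ℝ := fun Z =>
    C₀ * (‖K‖ * (‖Z.2.1 - v‖ * ‖Z.2.2‖ + ‖v‖ * ‖Z.2.2 - ξ₀‖)) +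
    C₀ * Z.1 0 * (‖K‖ * ‖B‖ * ‖Z.2.1‖ * ‖a Z.1‖ * ‖(basisVec 0 : Coord n)‖ * ‖Z.2.2‖) +
    ‖m q - m Z.1‖ * (‖(m Z.1).inverse‖ * Λ Z) * ‖(basisVec 0 : Coord n)‖ with herr
  have herrc : ContinuousWithinAt err S Z₀ := by
    refine ContinuousWithinAt.add (ContinuousWithinAt.add ?_ ?_) ?_
    · exact continuousWithinAt_const.mul (continuousWithinAt_const.mul
        (((hw.sub continuousWithinAt_const).norm.mul hξ.norm).add
          (continuousWithinAt_const.mul (hξ.sub continuousWithinAt_const).norm)))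
    · exact (continuousWithinAt_const.mul hx).mul (((((continuousWithinAt_const.mul hw.norm).mul
        hac.norm).mul continuousWithinAt_const)).mul hξ.norm)
    · exact ((continuousWithinAt_const.sub hmc).norm.mul (hic.norm.mul hΛc)).mul
        continuousWithinAt_const
  have herr0 : err Z₀ = 0 := by
    simp [herr, hZ₀, hq0]
  set bd : Coord n × Coord n × 𝔤 → ℝ := fun Z =>
    max (‖(m Z.1).inverse‖ * Λ Z) (‖B‖ * (C₀ * ‖Z.2.1‖) * ‖Z.2.2‖) with hbd
  have hbdc : ContinuousWithinAt bd S Z₀ := (hic.norm.mul hΛc).max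
    ((continuousWithinAt_const.mul (continuousWithinAt_const.mul hw.norm)).mul hξ.norm)
  have hbd0 : 0 ≤ bd Z₀ := le_max_of_le_right (by positivity)
  have hev : ∀ᶠ Z in 𝓝[S] Z₀, err Z < β₁ / 2 ∧ bd Z < bd Z₀ + 1 ∧ Z.1 0 < 1 ∧
      Z.1 ∈ Metric.closedBall q (δ / 2) ∧ Z.1 ∈ Metric.ball q δ₁ ∧ Z.1 ∈ T := by
    refine (herrc.eventually (gt_mem_nhds (by rw [herr0]; positivity))).and
      ((hbdc.eventually (gt_mem_nhds (by linarith))).and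
      ((hx.eventually (gt_mem_nhds (by simp [hZ₀, hq0]))).and ?_))
    exact ((hfst.mono_right nhdsWithin_le_nhds).eventually
      (Metric.closedBall_mem_nhds q (half_pos hδ))).and
      (((hfst.mono_right nhdsWithin_le_nhds).eventually (Metric.ball_mem_nhds q hδ₁)).and
      (hfst (hT.2 q hq)))
  obtain ⟨ρ, hρ, hρsub⟩ := Metric.mem_nhdsWithin_iff.1 hev
  refine ⟨ρ / 2, half_pos hρ, β₁ / 2, half_pos hβ₁0, bd Z₀ + 1, by linarith, fun Z hZ => ?_⟩
  obtain ⟨k1, k2, k3, k4, k5, k6⟩ :=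
    hρsub ⟨Metric.closedBall_subset_ball (half_lt_self hρ) hZ.2, hZ.1⟩
  have hZH : Z.1 ∈ 𝓗[n] := hT.1 k6
  have hx0 : 0 ≤ Z.1 0 := mem_half.1 hZH
  set x := Z.1 0 with hxdef
  have hxr : 0 ≤ x ^ r := pow_nonneg hx0 r
  have hfd : fderivWithin ℝ f 𝓗[n] Z.1 =
      fderivWithin ℝ a 𝓗[n] Z.1 - fderivWithin ℝ b 𝓗[n] Z.1 :=
    fderivWithin_fun_sub (uniqueDiffOn_half _ hZH) (ha.differentiableWithinAt k6)
      (hb.differentiableWithinAt k6)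
  have n1 : ‖a Z.1 - b Z.1‖ ≤ C₀ * x * x ^ r := by
    refine (hf1 Z.1 ⟨hZH, k4⟩).trans ?_
    rw [pow_succ', mul_assoc]
    gcongr
    exact le_max_left _ _
  have n1' : ‖a Z.1 - b Z.1‖ ≤ C₀ * x ^ r := n1.trans (by
    have : C₀ * x ≤ C₀ := by nlinarith
    gcongr)
  have n2 : ‖fderivWithin ℝ a 𝓗[n] Z.1 - fderivWithin ℝ b 𝓗[n] Z.1‖ ≤ C₀ * x ^ r := by
    rw [← hfd]
    refine (hf2 Z.1 ⟨hZH, k4⟩).trans ?_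
    gcongr
    exact le_max_right _ _
  set FA := force B K (a Z.1) (fderivWithin ℝ a 𝓗[n] Z.1) (fderivWithin ℝ m 𝓗[n] Z.1) Z.2.1 Z.2.2
    with hFA
  set FB := force B K (b Z.1) (fderivWithin ℝ b 𝓗[n] Z.1) (fderivWithin ℝ m 𝓗[n] Z.1) Z.2.1 Z.2.2
    with hFB
  have n3 : ‖FA - FB‖ ≤ x ^ r * Λ Z := (norm_force_sub_le B K _ Z.2.1 Z.2.2 n1' n2).trans
    (by rw [hΛ]; apply le_of_eq; ring)
  have hdiff : wongField B K a m Z - wongField B K b m Z =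
      (0, (m Z.1).inverse (FA - FB), -B ((a Z.1 - b Z.1) Z.2.1) Z.2.2) := by
    refine Prod.ext (sub_self _) (Prod.ext (map_sub _ _ _).symm ?_)
    change -B (a Z.1 Z.2.1) Z.2.2 - -B (b Z.1 Z.2.1) Z.2.2 = _
    simp only [sub_apply, map_sub]
    abel
  have n4 : ‖(m Z.1).inverse (FA - FB)‖ ≤ ‖(m Z.1).inverse‖ * Λ Z * x ^ r :=
    (ContinuousLinearMap.le_opNorm _ _).trans (by
      rw [mul_assoc]
      refine mul_le_mul_of_nonneg_left (n3.trans (le_of_eq (mul_comm _ _))) (norm_nonneg _))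
  rw [hdiff]
  constructor
  · rw [Prod.norm_mk, Prod.norm_mk, norm_zero, norm_neg]
    refine max_le (by positivity) (max_le ?_ ?_)
    · refine n4.trans ?_
      gcongr
      exact (le_max_left _ _).trans k2.le
    · refine (B.le_opNorm₂ _ _).trans ?_
      have e1 : ‖(a Z.1 - b Z.1) Z.2.1‖ ≤ C₀ * x ^ r * ‖Z.2.1‖ :=
        ((a Z.1 - b Z.1).le_opNorm _).trans (by gcongr)
      calc _ ≤ ‖B‖ * (C₀ * x ^ r * ‖Z.2.1‖) * ‖Z.2.2‖ := by gcongr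
        _ = ‖B‖ * (C₀ * ‖Z.2.1‖) * ‖Z.2.2‖ * x ^ r := by ring
        _ ≤ _ := by
          gcongr
          exact (le_max_right _ _).trans k2.le
  -- Equality of the normal components on the whole of `T` also kills the derivative of the normal
  -- component of the difference, leaving only the derivative in the normal direction.
  · have hfe : (a Z.1 - b Z.1) (basisVec 0) = 0 := by rw [sub_apply, hab _ k6, sub_self]
    have hfe' : (fderivWithin ℝ a 𝓗[n] Z.1 - fderivWithin ℝ b 𝓗[n] Z.1) Z.2.1 (basisVec 0) = 0 := by
      rw [← hfd, ← fderivWithin_half_apply_const (hfs.differentiableWithinAt k6) hZH]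
      have : fderivWithin ℝ (fun z => f z (basisVec 0)) 𝓗[n] Z.1 =
          fderivWithin ℝ (fun _ => (0 : 𝔤)) 𝓗[n] Z.1 := by
        refine Filter.EventuallyEq.fderivWithin_eq ?_ ?_
        · filter_upwards [hT.2 _ k6] with z hz
          rw [hf]; simp only [sub_apply, hab _ hz, sub_self]
        · rw [hf]; simp only [sub_apply, hab _ k6, sub_self]
      rw [this, fderivWithin_const_apply, zero_apply]
    have n5 := force_sub_apply_normal_le B K (fderivWithin ℝ m 𝓗[n] Z.1) Z.2.1 v Z.2.2 ξ₀ hfe hfe' n1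
      (s := C₀ * x ^ r * ‖(basisVec 0 : Coord n)‖)
      ((ContinuousLinearMap.le_opNorm _ _).trans (by gcongr))
    rw [norm_basisVec, mul_one, mul_one] at n5
    have n6 : β₁ * x ^ r ≤ K ((fderivWithin ℝ a 𝓗[n] Z.1 - fderivWithin ℝ b 𝓗[n] Z.1)
        (basisVec 0) v) ξ₀ := by
      rw [← hfd]
      exact hlead Z.1 ⟨hZH, k5⟩
    have n7 : m Z.1 ((m Z.1).inverse (FA - FB)) (basisVec 0) = (FA - FB) (basisVec 0) :=
      congrArg (fun L : Coord n →L[ℝ] ℝ => L (basisVec 0))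
        (apply_inverse_of_pos (hpos _ k6) (FA - FB))
    have n8 : (m q - m Z.1) ((m Z.1).inverse (FA - FB)) (basisVec 0) ≤
        ‖m q - m Z.1‖ * (‖(m Z.1).inverse‖ * Λ Z * x ^ r) * ‖(basisVec 0 : Coord n)‖ := by
      refine ((le_abs_self _).trans ((m q - m Z.1).le_opNorm₂ ((m Z.1).inverse (FA - FB))
        (basisVec 0))).trans ?_
      gcongr
    -- The test functional must be the same for all states, hence the metric at `q`; the metric at
    -- `Z.1` would return the force exactly, and the discrepancy is one of the errors.
    have n9 : m q ((m Z.1).inverse (FA - FB)) (basisVec 0) =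
        (m q - m Z.1) ((m Z.1).inverse (FA - FB)) (basisVec 0) + (FA - FB) (basisVec 0) := by
      rw [← n7, sub_apply, sub_apply]; ring
    change m q ((m Z.1).inverse (FA - FB)) (basisVec 0) ≤ _
    rw [n9]
    have n10 : err Z * x ^ r ≤ β₁ / 2 * x ^ r := by gcongr
    rw [herr] at n10
    simp only [norm_basisVec, mul_one] at n10 n8
    nlinarith

end Estimate

end YangMills

end

/-! ### Equal lens data force the normal derivatives to agree -/

noncomputable section

set_option linter.unusedSectionVars false
set_option maxSynthPendingDepth 3

namespace YangMills

variable {n : ℕ} [NeZero n] {M : Type*} [TopologicalSpace M] [T2Space M]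
  [ChartedSpace (EuclideanHalfSpace n) M] [IsManifold (𝓡∂ n) ∞ M]
variable {φ ψ : OpenPartialHomeomorph M (EuclideanHalfSpace n)}
variable {N : ℕ} {G : Subgroup (Mat N)ˣ} {A B : Potential n M G}
variable {g : Metric n M} {κ : AdInvariantInner G} {O : Set (lieAlg G)}
  {W : Set (TangentBundle (𝓡∂ n) M)} {T : Set (Coord n)}

/-- Near the phase of a unit vector tangent to the boundary there are phases of unit vectors
pointing into `M`. -/
theorem exists_inward_states (hφ : φ ∈ IsManifold.maximalAtlas (𝓡∂ n) ∞ M) {q v : Coord n}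
    (hq : q ∈ ext[φ].target) (hv : metricL g φ q v v = 1) (hv0 : v 0 = 0)
    {P : Coord n → Prop} (hP : ∀ᶠ w in 𝓝 v, P w) {ε : ℝ} (hε : 0 < ε) :
    ∃ w, P w ∧ metricL g φ q w w = 1 ∧ 0 < w 0 ∧ w 0 < ε := by
  set e : Coord n := basisVec 0
  -- Tilt `v` slightly towards ∂₀ and renormalise, since lens data are given for unit vectors only.
  set w : ℝ → Coord n := fun s =>
    (√(metricL g φ q (v + s • e) (v + s • e)))⁻¹ • (v + s • e) with hw
  have hne : ∀ s : ℝ, 0 < s → v + s • e ≠ 0 := fun s hs h => by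
    have := congrArg (fun u : Coord n => u 0) h
    simp [hv0, e, basisVec] at this
    exact hs.ne' this
  have hc : ContinuousAt w 0 := by
    have h1 : Continuous (fun s : ℝ => v + s • e) := by fun_prop
    have h2 : Continuous (fun s : ℝ => metricL g φ q (v + s • e) (v + s • e)) :=
      ((metricL g φ q).continuous.comp h1).clm_apply h1
    refine (h2.sqrt.continuousAt.inv₀ ?_).smul h1.continuousAt
    simp [hv]
  have hw0 : w 0 = v := by simp [hw, hv]
  have hc' : Tendsto w (𝓝[>] 0) (𝓝 v) := by
    rw [← hw0]; exact hc.tendsto.mono_left nhdsWithin_le_nhds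
  have h3 : Tendsto (fun s => w s 0) (𝓝[>] 0) (𝓝 (v 0)) :=
    ((EuclideanSpace.proj (0 : Fin n) : Coord n →L[ℝ] ℝ).continuous.tendsto v).comp hc'
  rw [hv0] at h3
  obtain ⟨s, ⟨h4, h5⟩, hs⟩ := ((hc'.eventually hP).and (h3.eventually (gt_mem_nhds hε))).and
    self_mem_nhdsWithin |>.exists
  have hs : 0 < s := hs
  have hpos := metricL_pos hφ g hq (hne s hs)
  refine ⟨w s, h4, ?_, ?_, h5⟩
  · simp only [hw, map_smul, smul_apply, smul_eq_mul]
    set c := √(metricL g φ q (v + s • e) (v + s • e)) with hcdef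
    have hc0 : 0 < c := Real.sqrt_pos.2 hpos
    rw [← Real.mul_self_sqrt hpos.le, ← hcdef]
    field_simp
  · have : w s 0 = (√(metricL g φ q (v + s • e) (v + s • e)))⁻¹ * s := by
      simp [hw, hv0, e, basisVec]
    rw [this]
    exact mul_pos (inv_pos.2 (Real.sqrt_pos.2 hpos)) hs

/-- If the lens data agree, the first nonzero normal derivative of the difference of the potentials
has no sign. -/
theorem SameBoundaryLensDataOn.not_pos (hφ : φ ∈ IsManifold.maximalAtlas (𝓡∂ n) ∞ M)
    (hlens : SameBoundaryLensDataOn g κ O W A B) (hW : IsOpen W) {q v : Coord n} {ξ : lieAlg G}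
    (hT : RelOpen T) (hTφ : T ⊆ ext[φ].target) (hq : q ∈ T) (hq0 : q 0 = 0)
    (hv : metricL g φ q v v = 1) (hv0 : v 0 = 0) (hqW : tangentIn φ (q, v) ∈ W) (hξ : ξ ∈ O)
    (hA : (wongIn g κ A φ (q, v, ξ)).2.1 0 < 0) (hB : (wongIn g κ B φ (q, v, ξ)).2.1 0 < 0)
    (hab : ∀ z ∈ T, potentialIn A φ z (basisVec 0) = potentialIn B φ z (basisVec 0)) {r : ℕ}
    (hr : ∀ k < r + 1, ∀ y ∈ T, y 0 = 0 →
      normalD^[k] (fun z => potentialIn A φ z - potentialIn B φ z) y = 0) :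
    ¬ 0 < κ.form (normalD^[r + 1] (fun z => potentialIn A φ z - potentialIn B φ z) q v) ξ := by
  intro hsign
  have ha := (smoothOn_potentialIn hφ A).mono hTφ
  have hb := (smoothOn_potentialIn hφ B).mono hTφ
  have hm := (smoothOn_metricL hφ g).mono hTφ
  have hpos : ∀ z ∈ T, ∀ v, v ≠ 0 → 0 < metricL g φ z v v := fun z hz v hv =>
    metricL_pos hφ g (hTφ hz) hv
  obtain ⟨ρA, hρA, kA, hkA, KA, LA, hTA, hlipA, haccA⟩ := exists_stateBall hT ha hm hpos
    (Z₀ := (q, v, ξ)) hq hA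
  obtain ⟨ρB, hρB, kB, hkB, KB, LB, hTB, hlipB, haccB⟩ := exists_stateBall hT hb hm hpos
    (Z₀ := (q, v, ξ)) hq hB
  obtain ⟨ρE, hρE, β, hβ, C, hC, hE⟩ := exists_wongField_sub_estimate (B := bracketL G)
    (K := κ.formL) hT ha hb hm hpos hq hq0 hab hr hsign
  -- One radius for both ray constructions and for the field estimate.
  set ρ := min ρA (min ρB ρE) with hρ
  have hρ0 : 0 < ρ := lt_min hρA (lt_min hρB hρE)
  have sA : stateBall (q, v, ξ) ρ ⊆ stateBall (q, v, ξ) ρA :=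
    inter_subset_inter_right _ (Metric.closedBall_subset_closedBall (min_le_left _ _))
  have sB : stateBall (q, v, ξ) ρ ⊆ stateBall (q, v, ξ) ρB :=
    inter_subset_inter_right _ (Metric.closedBall_subset_closedBall
      ((min_le_right _ _).trans (min_le_left _ _)))
  have sE : stateBall (q, v, ξ) ρ ⊆ stateBall (q, v, ξ) ρE :=
    inter_subset_inter_right _ (Metric.closedBall_subset_closedBall
      ((min_le_right _ _).trans (min_le_right _ _)))
  set Z₀ : Coord n × Coord n × lieAlg G := (q, v, ξ) with hZ₀
  have hmem : Z₀ ∈ stateBall Z₀ ρA := ⟨hq0.ge, Metric.mem_closedBall_self hρA.le⟩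
  have hKA : 0 < KA := by have := haccA _ hmem; linarith
  set e : Coord n × Coord n × lieAlg G := (basisVec 0, 0, 0) with he
  have hxe : heightL n (lieAlg G) e = 1 := by
    rw [heightL_apply]; simp [he, basisVec]
  have hye : speedL n (lieAlg G) e = 0 := rfl
  obtain ⟨rA, hrA, εA, hεA, rayA⟩ := exists_short_ray hxe hye hρ0 hkA (Z₀ := Z₀) hq0
    (hlipA.mono sA) (fun Z _ => rfl) (fun Z hZ => haccA Z (sA hZ))
  obtain ⟨rB, hrB, εB, hεB, rayB⟩ := exists_short_ray hxe hye hρ0 hkB (Z₀ := Z₀) hq0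
    (hlipB.mono sB) (fun Z _ => rfl) (fun Z hZ => haccB Z (sB hZ))
  -- The functional pairs the velocity component of a state with ∂₀ in the fixed metric at `q`, as
  -- in the field estimate.
  set ℓ : Coord n × Coord n × lieAlg G →L[ℝ] ℝ := ((metricL g φ q).flip (basisVec 0)).comp
    ((ContinuousLinearMap.fst ℝ (Coord n) (lieAlg G)).comp
      (ContinuousLinearMap.snd ℝ (Coord n) (Coord n × lieAlg G))) with hℓ
  obtain ⟨ε₁, hε₁, hne⟩ := short_rays_ne (x := heightL n (lieAlg G)) (ℓ := ℓ) hC hβ hkA hKA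
    (fun Z hZ => hZ.1) (hlipB.mono sB) (fun Z hZ => (hE Z (sE hZ)).1)
    (fun Z hZ => (hE Z (sE hZ)).2)
  have hcont : ContinuousAt (fun w : Coord n => (q, w, ξ)) v := by fun_prop
  have hWev : ∀ᶠ w in 𝓝 v, tangentIn φ (q, w) ∈ W := by
    have h1 : Tendsto (fun w : Coord n => (q, w)) (𝓝 v) (𝓝[ext[φ].target ×ˢ univ] (q, v)) :=
      tendsto_nhdsWithin_iff.2 ⟨(by fun_prop : ContinuousAt (fun w : Coord n => (q, w)) v),
        Eventually.of_forall fun w => ⟨hTφ hq, mem_univ _⟩⟩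
    exact ((continuousOn_tangentIn hφ (q, v) ⟨hTφ hq, mem_univ _⟩).tendsto.comp h1).eventually
      (hW.mem_nhds hqW)
  obtain ⟨w, ⟨hwA, hwB, hwW⟩, hw1, hw2, hw3⟩ := exists_inward_states (g := g) hφ (hTφ hq) hv hv0
    ((hcont.eventually (Metric.closedBall_mem_nhds Z₀ hrA)).and
      ((hcont.eventually (Metric.closedBall_mem_nhds Z₀ hrB)).and hWev))
    (lt_min hεA (lt_min hεB hε₁))
  obtain ⟨τA, ZA, hA0, hτ1, hτ2, hA1, hA2, hA3⟩ := rayA (q, w, ξ) hwA hq0 hw2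
    (hw3.trans_le (min_le_left _ _))
  obtain ⟨τB, ZB, hB0, hτ1', -, hB1, hB2, hB3⟩ := rayB (q, w, ξ) hwB hq0 hw2
    (hw3.trans_le ((min_le_right _ _).trans (min_le_left _ _)))
  have hKB : 0 < KB := by
    have := haccB _ (sB ⟨hq0.ge, Metric.mem_closedBall_self hρ0.le⟩ : Z₀ ∈ _)
    linarith
  have hτA : 0 ≤ τA := le_trans (div_nonneg hw2.le hKA.le) hτ1
  have hτB : 0 ≤ τB := le_trans (div_nonneg hw2.le hKB.le) hτ1'
  have tA : ∀ t ∈ Icc 0 τA, (ZA t).1 ∈ ext[φ].target := fun t ht =>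
    hTφ (hTA _ (sA (hA3 t ht).1))
  have tB : ∀ t ∈ Icc 0 τB, (ZB t).1 ∈ ext[φ].target := fun t ht =>
    hTφ (hTB _ (sB (hB3 t ht).1))
  have dA : ∀ t ∈ Icc 0 τA, HasDerivWithinAt ZA (wongIn g κ A φ (ZA t)) (Icc 0 τA) t :=
    fun t ht => (hA3 t ht).2.1
  have dB : ∀ t ∈ Icc 0 τB, HasDerivWithinAt ZB (wongIn g κ B φ (ZB t)) (Icc 0 τB) t :=
    fun t ht => (hB3 t ht).2.1
  have eA := exitTime_eq_of_exits hφ hτA tA dA hA1 hA2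
  have eB := exitTime_eq_of_exits hφ hτB tB dB hB1 hB2
  have sc := scatters_of_exits hφ hτA tA dA hA1 hA2
  have hl := hlens (tangentIn φ (q, w))
    ⟨tangentIn_mem_inwardBoundary hφ (hTφ hq) hq0 hw1 hw2.le, hwW⟩ ξ hξ
  rw [hA0] at eA sc
  rw [hB0] at eB
  have hτ : τA = τB := by
    have h1 : exitTime g κ A (phase φ (q, w, ξ)) = exitTime g κ B (phase φ (q, w, ξ)) := hl.1
    rw [eA, eB] at h1
    exact (ENNReal.ofReal_eq_ofReal_iff hτA hτB).1 h1
  subst hτ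
  -- The end of the ray lies on the boundary, which is where the scattering relations may be
  -- compared.
  have hxb : (phase φ (ZA τA)).1.1 ∈ (𝓡∂ n).boundary M := by
    have ht := tA τA ⟨hτA, le_rfl⟩
    change ext[φ].symm (ZA τA).1 ∈ _
    rw [mem_boundary_iff hφ (symm_mem_source ht), ext[φ].right_inv ht]
    exact hA1
  have sc' : Scatters g κ B (phase φ (ZB 0)) (phase φ (ZA τA)) := by
    rw [hB0]; exact (hl.2 _ hxb).1 sc
  have hend := eq_of_scatters hφ hτB tB dB hB1 hB2 sc'
  have hend' : ZA τA = ZB τA := by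
    rw [← stateIn_phase hφ (tA τA ⟨hτA, le_rfl⟩), hend,
      stateIn_phase hφ (tB τA ⟨hτA, le_rfl⟩)]
  exact hne _ hw2 (hw3.trans_le ((min_le_right _ _).trans (min_le_right _ _))) τA ZA ZB hτ1 hτ2
    (hA0.trans hB0.symm) (fun t ht => hA3 t ht)
    (fun t ht => ⟨(hB3 t ht).1, (hB3 t ht).2.1⟩) hend'

/-- Vanishing against basis elements suffices by definiteness; this is where an orbit containing a
basis is enough to detect a whole Lie algebra element. -/
theorem AdInvariantInner.eq_zero_of_basis (κ : AdInvariantInner G)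
    {ι : Type*} (b : Module.Basis ι ℝ (lieAlg G)) {X : lieAlg G}
    (h : ∀ j, κ.form X (b j) = 0) : X = 0 := by
  by_contra hX
  have h1 : κ.form X = 0 := b.ext h
  have h2 := κ.pos X hX
  rw [h1] at h2
  exact lt_irrefl _ h2

/-- Potentials with the same normal component and the same lens data have the same normal
derivatives. -/
theorem SameBoundaryLensDataOn.exists_normalD_eq_zero
    (hφ : φ ∈ IsManifold.maximalAtlas (𝓡∂ n) ∞ M)
    (hlens : SameBoundaryLensDataOn g κ O W A B) (hW : IsOpen W) (hO : ContainsBasis O)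
    {p : Coord n} (hp : p ∈ ext[φ].target) (hp0 : p 0 = 0)
    (hA : StrictlyYMConvexAt g κ O A (ext[φ].symm p))
    (hB : StrictlyYMConvexAt g κ O B (ext[φ].symm p))
    (hpW : unitBoundaryVectors g (ext[φ].symm p) ⊆ W)
    (hab : ∀ᶠ z in 𝓝[𝓗[n]] p,
      potentialIn A φ z (basisVec 0) = potentialIn B φ z (basisVec 0))
    (htan : ∀ᶠ z in 𝓝[𝓗[n]] p, z 0 = 0 → ∀ v : Coord n, v 0 = 0 →
      potentialIn A φ z v = potentialIn B φ z v) :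
    ∃ T : Set (Coord n), RelOpen T ∧ T ⊆ ext[φ].target ∧ p ∈ T ∧ ∀ k, ∀ z ∈ T, z 0 = 0 →
      normalD^[k] (fun z => potentialIn A φ z - potentialIn B φ z) z = 0 := by
  obtain ⟨b, hb⟩ := hO
  have hbO : ∀ j, b j ∈ O := fun j => hb (mem_range_self j)
  -- Only finitely many directions and charges are tested (signs, coordinate vectors, basis
  -- elements), so convexity at `p` alone gives outward acceleration and membership in `W` for all
  -- of them near `p`.
  have hev : ∀ σ : ℝ, σ * σ = 1 → ∀ᶠ z in 𝓝[𝓗[n]] p, ∀ i : Fin n, i ≠ 0 →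
      tangentIn φ (z, unitVec g φ σ i z) ∈ W ∧ ∀ j,
        (wongIn g κ A φ (z, unitVec g φ σ i z, b j)).2.1 0 < 0 ∧
        (wongIn g κ B φ (z, unitVec g φ σ i z, b j)).2.1 0 < 0 := fun σ hσ => by
    rw [eventually_all]
    intro i
    by_cases hi : i = 0
    · exact Eventually.of_forall fun z h => absurd hi h
    have h1 := eventually_tangentIn_unitVec_mem (g := g) hφ hp hW (hpW
      (tangentIn_mem_unitBoundaryVectors hφ hp hp0 (metricL_unitVec hφ g hσ i hp)
        (unitVec_zero g φ σ hi p)))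
    have h2 : ∀ᶠ z in 𝓝[𝓗[n]] p, ∀ j,
        (wongIn g κ A φ (z, unitVec g φ σ i z, b j)).2.1 0 < 0 ∧
        (wongIn g κ B φ (z, unitVec g φ σ i z, b j)).2.1 0 < 0 := by
      rw [eventually_all]
      exact fun j => (eventually_wongIn_neg hφ hp hp0 hA hσ hi (hbO j)).and
        (eventually_wongIn_neg hφ hp hp0 hB hσ hi (hbO j))
    filter_upwards [h1, h2] with z hz hz' _ using ⟨hz, hz'⟩
  have hall := (hev 1 (by norm_num)).and ((hev (-1) (by norm_num)).and (hab.and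
    (htan.and ((relOpen_target φ).2 p hp))))
  obtain ⟨δ, hδ, hsub⟩ := Metric.mem_nhdsWithin_iff.1 hall
  set T := 𝓗[n] ∩ Metric.ball p δ with hTdef
  have hT : RelOpen T := relOpen_ball p δ
  have hT' : ∀ z ∈ T, _ := fun z hz => hsub (⟨hz.2, hz.1⟩ : z ∈ Metric.ball p δ ∩ 𝓗[n])
  have hTφ : T ⊆ ext[φ].target := fun z hz => (hT' z hz).2.2.2.2
  set f : Coord n → Coord n →L[ℝ] lieAlg G := fun z => potentialIn A φ z - potentialIn B φ z with hf
  have hfs : SmoothOn f T := ((smoothOn_potentialIn hφ A).mono hTφ).sub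
    ((smoothOn_potentialIn hφ B).mono hTφ)
  have hf0 : ∀ z ∈ T, f z (basisVec 0) = 0 := fun z hz => by
    rw [hf]; simp only [sub_apply]; rw [(hT' z hz).2.2.1, sub_self]
  refine ⟨T, hT, hTφ, ⟨(relOpen_target φ).1 hp, Metric.mem_ball_self hδ⟩, fun k => ?_⟩
  -- The neighbourhood `T` was fixed before the order `k`, so the lower orders are known to vanish
  -- at all its boundary points, as the sign argument requires.
  induction k using Nat.strong_induction_on with
  | _ k ih =>
  intro z hz hz0
  rcases k with _ | r
  · change f z = 0
    refine ContinuousLinearMap.ext fun v => ?_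
    rw [← bdryProj_add v, map_add, map_smul, hf0 z hz, smul_zero, add_zero]
    change potentialIn A φ z (bdryProj v) - potentialIn B φ z (bdryProj v) = 0
    rw [(hT' z hz).2.2.2.1 hz0 _ (bdryProj_zero v), sub_self]
  refine clm_ext_basisVec fun i => ?_
  rw [zero_apply]
  by_cases hi : i = 0
  · subst hi
    have h1 := iterate_normalD_clm_comp hT
      (ContinuousLinearMap.apply ℝ (lieAlg G) (basisVec 0 : Coord n)) hfs (r + 1) hz
    have h2 := iterate_normalD_congr hT (f := fun z => f z (basisVec 0))
      (g := fun _ => (0 : lieAlg G)) hf0 (r + 1) hz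
    have h3 : ∀ k, normalD^[k] (fun _ : Coord n => (0 : lieAlg G)) = fun _ => 0 := fun k => by
      induction k with
      | zero => rfl
      | succ k ih =>
        rw [Function.iterate_succ_apply', ih]
        funext y
        change fderivWithin ℝ (fun _ : Coord n => (0 : lieAlg G)) 𝓗[n] y (basisVec 0) = 0
        rw [fderivWithin_const_apply, zero_apply]
    rw [h3] at h2
    exact h1.symm.trans h2
  · refine κ.eq_zero_of_basis b fun j => ?_
    have hs : 0 < (√(metricL g φ z (basisVec i) (basisVec i)))⁻¹ :=
      inv_pos.2 (Real.sqrt_pos.2 (metricL_pos hφ g (hTφ hz) (basisVec_ne_zero i)))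
    have key : ∀ σ : ℝ, σ * σ = 1 → (∀ i : Fin n, i ≠ 0 →
        tangentIn φ (z, unitVec g φ σ i z) ∈ W ∧ ∀ j,
          (wongIn g κ A φ (z, unitVec g φ σ i z, b j)).2.1 0 < 0 ∧
          (wongIn g κ B φ (z, unitVec g φ σ i z, b j)).2.1 0 < 0) →
        σ * κ.form (normalD^[r + 1] f z (basisVec i)) (b j) ≤ 0 := fun σ hσ h => by
      have h1 := SameBoundaryLensDataOn.not_pos hφ hlens hW hT hTφ hz hz0
        (metricL_unitVec hφ g hσ i (hTφ hz)) (unitVec_zero g φ σ hi z) (h i hi).1 (hbO j)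
        ((h i hi).2 j).1 ((h i hi).2 j).2 (fun y hy => (hT' y hy).2.2.1)
        (fun k hk y hy hy0 => ih k hk y hy hy0)
      rw [unitVec, map_smul, map_smul, LinearMap.smul_apply, smul_eq_mul] at h1
      push Not at h1
      by_contra hcon
      push Not at hcon
      have := mul_pos hs hcon
      have e : σ * (√(metricL g φ z (basisVec i) (basisVec i)))⁻¹ *
          κ.form (normalD^[r + 1] f z (basisVec i)) (b j) =
          (√(metricL g φ z (basisVec i) (basisVec i)))⁻¹ *
            (σ * κ.form (normalD^[r + 1] f z (basisVec i)) (b j)) := by ring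
      rw [e] at h1
      linarith
    have k1 := key 1 (by norm_num) (hT' z hz).1
    have k2 := key (-1) (by norm_num) (hT' z hz).2.1
    linarith

end YangMills

end

/-! ### Jets of potentials, flat gauges and gluing -/

noncomputable section

set_option linter.unusedSectionVars false
set_option maxSynthPendingDepth 3

namespace YangMills

section Jets

variable {n : ℕ} [NeZero n] {F : Type*} [NormedAddCommGroup F] [NormedSpace ℝ F]

theorem JetZero.sum {ι : Type*} {m : ℕ} {f : ι → Coord n → F} {q : Coord n} (hq : q ∈ 𝓗[n])
    (t : Finset ι) (hf : ∀ i, ContDiffWithinAt ℝ ∞ (f i) 𝓗[n] q) (h : ∀ i, JetZero m (f i) q) :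
    JetZero m (fun z => ∑ i ∈ t, f i z) q := by
  classical
  induction t using Finset.induction_on with
  | empty => simpa using jetZero_zero m q
  | insert i t hi ih =>
    simp only [Finset.sum_insert hi]
    exact (h i).add ih (hf i) (ContDiffWithinAt.sum fun j _ => hf j) hq

/-- A function with values in linear maps vanishes to order `m` if its components do. -/
theorem jetZero_of_components {m : ℕ} {f : Coord n → Coord n →L[ℝ] F} {q : Coord n}
    (hf : ContDiffWithinAt ℝ ∞ f 𝓗[n] q) (hq : q ∈ 𝓗[n])
    (h : ∀ j, JetZero m (fun z => f z (basisVec j)) q) : JetZero m f q := by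
  set L : Fin n → F →L[ℝ] Coord n →L[ℝ] F := fun j =>
    ContinuousLinearMap.smulRightL ℝ (Coord n) F (EuclideanSpace.proj j : Coord n →L[ℝ] ℝ) with hL
  have hc : ∀ j, ContDiffWithinAt ℝ ∞ (fun z => f z (basisVec j)) 𝓗[n] q := fun j =>
    hf.clm_apply contDiffWithinAt_const
  have h1 := JetZero.sum hq Finset.univ
    (fun j => (L j).contDiff.contDiffAt.comp_contDiffWithinAt q (hc j))
    fun j => (h j).clm_comp_left (hc j) hq (L j)
  have e : (fun z => ∑ j, L j (f z (basisVec j))) = f := by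
    funext z
    refine ContinuousLinearMap.ext fun v => ?_
    conv_rhs => rw [coord_eq_sum v, map_sum]
    rw [sum_apply]
    refine Finset.sum_congr rfl fun j _ => ?_
    rw [map_smul]
    rfl
  rw [← e]
  exact h1

end Jets

variable {n : ℕ} [NeZero n] {M : Type*} [TopologicalSpace M]
  [ChartedSpace (EuclideanHalfSpace n) M] [IsManifold (𝓡∂ n) ∞ M]
variable {φ ψ : OpenPartialHomeomorph M (EuclideanHalfSpace n)}
variable {N : ℕ} {G : Subgroup (Mat N)ˣ} {A A' B : Potential n M G} {u : M → G} {x : M}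

/-- `A` and `B` have the same derivatives at `x` in every chart. -/
def SameJetAt (A B : Potential n M G) (x : M) : Prop :=
  ∀ ψ ∈ IsManifold.maximalAtlas (𝓡∂ n) ∞ M, x ∈ ψ.source → ∀ m,
    JetZero m (fun y => potentialIn A ψ y - potentialIn B ψ y) (ext[ψ] x)

theorem smoothOn_potentialIn_sub (hφ : φ ∈ IsManifold.maximalAtlas (𝓡∂ n) ∞ M)
    (A B : Potential n M G) :
    SmoothOn (fun y => potentialIn A φ y - potentialIn B φ y) ext[φ].target :=
  SmoothOn.sub (F := Coord n →L[ℝ] lieAlg G) (smoothOn_potentialIn hφ A) (smoothOn_potentialIn hφ B)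

/-- In another chart the difference of the potentials is composed with the transition map and with
its Jacobian; neither operation creates lower-order terms from a vanishing jet. -/
theorem sameJetAt_of_chart (hφ : φ ∈ IsManifold.maximalAtlas (𝓡∂ n) ∞ M) (hx : x ∈ φ.source)
    (h : ∀ m, JetZero m (fun y => potentialIn A φ y - potentialIn B φ y) (ext[φ] x)) :
    SameJetAt A B x := by
  intro ψ hψ hx' m
  have hT := relOpen_transDom ψ φ
  have hs := (smoothOn_potentialIn_sub hφ A B).mono
    (inter_subset_left : transDom φ ψ ⊆ ext[φ].target)
  have h1 := JetZero.transition hφ hψ hx hx' hs (h m)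
  have hs' : SmoothOn (fun y => potentialIn A φ (transition ψ φ y) -
      potentialIn B φ (transition ψ φ y)) (transDom ψ φ) := fun y hy =>
    (hs _ (transition_mem hy)).comp y (smoothOn_transition hψ hφ y hy) fun z _ => mem_range_self _
  have h2 := JetZero.bilin_left hT
    (ContinuousLinearMap.compL ℝ (Coord n) (Coord n) (lieAlg G)) h1 hs'
    ((smoothOn_transition hψ hφ).fderivWithin hT.1) (mem_transDom hx' hx)
  refine h2.congr ?_ (mem_range_self _)
  filter_upwards [hT.2 _ (mem_transDom hx' hx)] with y hy
  rw [potentialIn_transition hψ hφ A hy, potentialIn_transition hψ hφ B hy]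
  exact (ContinuousLinearMap.sub_comp _ _ _).symm

theorem SameJetAt.symm (h : SameJetAt A B x) : SameJetAt B A x := fun ψ hψ hx m =>
  ((h ψ hψ hx m).neg (mem_range_self _)).congr
    (Eventually.of_forall fun _ => (neg_sub _ _).symm) (mem_range_self _)

theorem SameJetAt.trans {C : Potential n M G} (h : SameJetAt A B x) (h' : SameJetAt B C x) :
    SameJetAt A C x := fun ψ hψ hx m =>
  ((h ψ hψ hx m).add (h' ψ hψ hx m) (smoothOn_potentialIn_sub hψ A B _ (ext_mem_target hx))
    (smoothOn_potentialIn_sub hψ B C _ (ext_mem_target hx)) (mem_range_self _)).congr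
    (Eventually.of_forall fun _ => (sub_add_sub_cancel _ _ _).symm) (mem_range_self _)

theorem sameBoundaryJet_of_sameJetAt (h : ∀ x ∈ (𝓡∂ n).boundary M, SameJetAt A B x) :
    SameBoundaryJet A B := by
  intro p hp φ hφ hx k
  -- Order `k + 1` is needed, as `JetZero` controls derivatives of order strictly below its index.
  have h1 := h p hp φ hφ hx (k + 1) k (Nat.lt_succ_self k)
  have hA := smoothOn_potentialIn hφ A _ (ext_mem_target hx)
  have hB := smoothOn_potentialIn hφ B _ (ext_mem_target hx)
  have h2 := iteratedFDerivWithin_sub_apply (F := Coord n →L[ℝ] lieAlg G) (i := k)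
    (hA.of_le (by exact_mod_cast le_top)) (hB.of_le (by exact_mod_cast le_top)) uniqueDiffOn_half
    (mem_range_self _)
  exact sub_eq_zero.1 (h2.symm.trans h1)

/-- The change of a potential under a gauge, by components. -/
theorem IsBoundaryGauge.sub_eq (h : IsBoundaryGauge u A A')
    (hφ : φ ∈ IsManifold.maximalAtlas (𝓡∂ n) ∞ M) {y : Coord n} (hy : y ∈ ext[φ].target)
    (v : Coord n) :
    fderivWithin ℝ (fun z => gaugeIn u φ z - 1) 𝓗[n] y v =
      (((potentialIn A' φ y v - potentialIn A φ y v : lieAlg G) : Mat N)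
        + (gaugeIn u φ y - 1) * (potentialIn A' φ y v : Mat N))
        - (potentialIn A φ y v : Mat N) * (gaugeIn u φ y - 1) := by
  have h1 := h.mul_potentialIn hφ hy v
  rw [fderivWithin_sub_const, Submodule.coe_sub]
  rw [← sub_eq_iff_eq_add] at h1
  rw [← h1]
  noncomm_ring

theorem smoothOn_potentialIn_apply (hφ : φ ∈ IsManifold.maximalAtlas (𝓡∂ n) ∞ M)
    (A : Potential n M G) (v : Coord n) :
    SmoothOn (fun z => (potentialIn A φ z v : Mat N)) ext[φ].target :=
  SmoothOn.clm_comp_left (lieAlg G).subtypeL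
    (SmoothOn.clm_apply (smoothOn_potentialIn hφ A) (smoothOn_const v _))

theorem smoothOn_gaugeIn_sub_one (hφ : φ ∈ IsManifold.maximalAtlas (𝓡∂ n) ∞ M)
    (hu : SmoothGauge (n := n) u) : SmoothOn (fun z => gaugeIn u φ z - 1) ext[φ].target :=
  (smoothOn_gaugeIn hφ hu).sub (smoothOn_const 1 _)

/-- Flat gauges preserve jets. -/
theorem IsBoundaryGauge.sameJetAt (h : IsBoundaryGauge u A A') (hu : FlatGauge n u x) :
    SameJetAt A' A x := by
  intro φ hφ hx m
  have hT := relOpen_target φ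
  have hxt := ext_mem_target hx
  have hxH : ext[φ] x ∈ 𝓗[n] := mem_range_self _
  obtain ⟨P, hP⟩ := exists_projection_lieAlg G
  have hk := smoothOn_gaugeIn_sub_one hφ h.smoothGauge
  refine jetZero_of_components (smoothOn_potentialIn_sub hφ A' A _ hxt) hxH fun j => ?_
  have ha := smoothOn_potentialIn_apply hφ A (basisVec j)
  have ha' := smoothOn_potentialIn_apply hφ A' (basisVec j)
  have hdk := SmoothOn.clm_apply (hk.fderivWithin hT.1) (smoothOn_const (basisVec j : Coord n) _)
  have j1 : JetZero m (fun z => fderivWithin ℝ (fun z => gaugeIn u φ z - 1) 𝓗[n] z (basisVec j))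
      (ext[φ] x) := ((jetZero_succ_iff hxH).1 (hu φ hφ hx (m + 1))).2.clm_apply_const
    (hk.fderivWithin hT.1 _ hxt) hxH _
  have j2 := (hu φ hφ hx m).bilin_left hT (ContinuousLinearMap.mul ℝ (Mat N)) hk ha' hxt
  have j3 := (hu φ hφ hx m).bilin_right hT (ContinuousLinearMap.mul ℝ (Mat N)) hk ha hxt
  have s2 := (hk.clm_comp_left (ContinuousLinearMap.mul ℝ (Mat N))).clm_apply ha'
  have s3 := (ha.clm_comp_left (ContinuousLinearMap.mul ℝ (Mat N))).clm_apply hk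
  have j4 := (j1.sub j2 (hdk _ hxt) (s2 _ hxt) hxH).add j3 ((hdk.sub s2) _ hxt) (s3 _ hxt) hxH
  have j5 := j4.clm_comp_left (((hdk.sub s2).add s3) _ hxt) hxH P
  refine j5.congr ?_ hxH
  filter_upwards [hT.2 _ hxt] with z hz
  rw [h.sub_eq hφ hz]
  simp only [ContinuousLinearMap.mul_apply']
  rw [← hP ((potentialIn A' φ z - potentialIn A φ z) (basisVec j))]
  congr 1
  rw [sub_apply]
  abel

/-- Gauges between potentials with the same jets are flat. -/
theorem IsBoundaryGauge.flatGauge (h : IsBoundaryGauge u A A') (hx : x ∈ (𝓡∂ n).boundary M)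
    (hA : SameJetAt A' A x) : FlatGauge n u x := by
  intro φ hφ hxφ m
  have hT := relOpen_target φ
  have hxt := ext_mem_target hxφ
  have hxH : ext[φ] x ∈ 𝓗[n] := mem_range_self _
  have hk := smoothOn_gaugeIn_sub_one hφ h.smoothGauge
  -- The relation expresses the differential of `u - 1` through the difference of the potentials and
  -- products with `u - 1` itself, so each order of vanishing yields the next. The start is `u = 1`
  -- at the boundary point.
  induction m with
  | zero => exact fun k hk => absurd hk (Nat.not_lt_zero k)
  | succ m ih =>
    refine (jetZero_succ_iff hxH).2 ⟨?_, jetZero_of_components (hk.fderivWithin hT.1 _ hxt) hxH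
      fun j => ?_⟩
    · rw [gaugeIn, φ.extend_left_inv hxφ, h.boundary x hx]
      simp
    have ha := smoothOn_potentialIn_apply hφ A (basisVec j)
    have ha' := smoothOn_potentialIn_apply hφ A' (basisVec j)
    have hd := smoothOn_potentialIn_sub hφ A' A
    have hd' := SmoothOn.clm_comp_left (lieAlg G).subtypeL
      (SmoothOn.clm_apply hd (smoothOn_const (basisVec j : Coord n) _))
    have j1 : JetZero m (fun z => (lieAlg G).subtypeL
        ((potentialIn A' φ z - potentialIn A φ z) (basisVec j))) (ext[φ] x) :=
      ((hA φ hφ hxφ m).clm_apply_const (hd _ hxt) hxH _).clm_comp_left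
        ((SmoothOn.clm_apply hd (smoothOn_const (basisVec j : Coord n) _)) _ hxt) hxH
        (lieAlg G).subtypeL
    have j2 := ih.bilin_left hT (ContinuousLinearMap.mul ℝ (Mat N)) hk ha' hxt
    have j3 := ih.bilin_right hT (ContinuousLinearMap.mul ℝ (Mat N)) hk ha hxt
    have s2 := (hk.clm_comp_left (ContinuousLinearMap.mul ℝ (Mat N))).clm_apply ha'
    have s3 := (ha.clm_comp_left (ContinuousLinearMap.mul ℝ (Mat N))).clm_apply hk
    have j4 := (j1.add j2 (hd' _ hxt) (s2 _ hxt) hxH).sub j3 ((hd'.add s2) _ hxt) (s3 _ hxt) hxH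
    refine j4.congr ?_ hxH
    filter_upwards [hT.2 _ hxt] with z hz
    exact h.sub_eq hφ hz _

/-- If two gauges agree near `x`, so do the gauged potentials. -/
theorem IsBoundaryGauge.sameJetAt_of_eventuallyEq {A'' : Potential n M G} {w : M → G}
    (h : IsBoundaryGauge u A A') (h' : IsBoundaryGauge w A A'')
    (hφ : φ ∈ IsManifold.maximalAtlas (𝓡∂ n) ∞ M) (hx : x ∈ φ.source) {T : Set (Coord n)}
    (hT : RelOpen T) (hTφ : T ⊆ ext[φ].target) (hxT : ext[φ] x ∈ T)
    (huw : EqOn (gaugeIn u φ) (gaugeIn w φ) T) : SameJetAt A' A'' x := by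
  refine sameJetAt_of_chart hφ hx fun m => (jetZero_zero m _).congr ?_ (mem_range_self _)
  filter_upwards [hT.2 _ hxT] with z hz
  rw [sub_eq_zero]
  refine ContinuousLinearMap.ext fun v => Subtype.ext ?_
  have h1 := h.mul_potentialIn hφ (hTφ hz) v
  have h2 := h'.mul_potentialIn hφ (hTφ hz) v
  have h3 : fderivWithin ℝ (gaugeIn u φ) 𝓗[n] z = fderivWithin ℝ (gaugeIn w φ) 𝓗[n] z :=
    Filter.EventuallyEq.fderivWithin_eq (eventually_of_mem (hT.2 z hz) huw) (huw hz)
  rw [h3, huw hz, ← h2] at h1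
  have h4 := congrArg (fun X => ((w (ext[φ].symm z)).1⁻¹ : (Mat N)ˣ).val * X) h1
  simpa only [gaugeIn, ← mul_assoc, Units.inv_mul, one_mul] using h4

variable [T2Space M]

/-- Every potential is gauge equivalent to one with prescribed normal component near `p`. -/
theorem exists_gauge_normal_component (hG : IsCompact (G : Set (Mat N)ˣ))
    (hφ : φ ∈ IsManifold.maximalAtlas (𝓡∂ n) ∞ M) {p : M} (hp : p ∈ φ.source)
    (hpb : p ∈ (𝓡∂ n).boundary M) (A : Potential n M G) {b : Coord n → lieAlg G}
    (hb : SmoothOn b ext[φ].target) :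
    ∃ (u : M → G) (A' : Potential n M G), IsBoundaryGauge u A A' ∧
      ∀ᶠ z in 𝓝[𝓗[n]] (ext[φ] p), potentialIn A' φ z (basisVec 0) = b z := by
  obtain ⟨u, hu, hu1, hode⟩ := exists_gauge_normal_ode hG hφ hp hpb
    (SmoothOn.clm_apply (smoothOn_potentialIn hφ A) (smoothOn_const (basisVec 0 : Coord n) _)) hb
  obtain ⟨A', h⟩ := exists_isBoundaryGauge A hu hu1
  refine ⟨u, A', h, ?_⟩
  filter_upwards [hode, (relOpen_target φ).2 _ (ext_mem_target hp)] with z hz hzt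
  have h1 := h.mul_potentialIn hφ hzt (basisVec 0)
  change _ = normalD (gaugeIn u φ) z + _ at h1
  rw [hz, sub_add_cancel] at h1
  have h4 := congrArg (fun X => ((u (ext[φ].symm z)).1⁻¹ : (Mat N)ˣ).val * X) h1
  refine Subtype.ext ?_
  simpa only [gaugeIn, ← mul_assoc, Units.inv_mul, one_mul] using h4

variable {g : Metric n M} {κ : AdInvariantInner G} {O : Set (lieAlg G)}
  {W : Set (TangentBundle (𝓡∂ n) M)}

/-- The lens data near a point of the boundary determine the jets of potentials with the same
normal component. -/
theorem SameBoundaryLensDataOn.exists_nhds_normalD_eq_zero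
    (hφ : φ ∈ IsManifold.maximalAtlas (𝓡∂ n) ∞ M)
    (hlens : SameBoundaryLensDataOn g κ O W A B) (hW : IsOpen W) (hO : ContainsBasis O)
    {p : M} (hp : p ∈ φ.source) (hpb : p ∈ (𝓡∂ n).boundary M)
    (hA : StrictlyYMConvexAt g κ O A p) (hB : StrictlyYMConvexAt g κ O B p)
    (hpW : unitBoundaryVectors g p ⊆ W)
    (hab : ∀ᶠ z in 𝓝[𝓗[n]] (ext[φ] p),
      potentialIn A φ z (basisVec 0) = potentialIn B φ z (basisVec 0))
    (htan : ∀ᶠ x in 𝓝 p, x ∈ (𝓡∂ n).boundary M → SamePullbackAt A B x) :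
    ∃ T : Set (Coord n), RelOpen T ∧ T ⊆ ext[φ].target ∧ ext[φ] p ∈ T ∧ ∀ k, ∀ z ∈ T, z 0 = 0 →
      normalD^[k] (fun z => potentialIn A φ z - potentialIn B φ z) z = 0 := by
  have hpt := ext_mem_target hp
  have hsymm : ext[φ].symm (ext[φ] p) = p := φ.extend_left_inv hp
  refine hlens.exists_normalD_eq_zero hφ hW hO hpt ((mem_boundary_iff hφ hp).1 hpb)
    (by rwa [hsymm]) (by rwa [hsymm]) (by rwa [hsymm]) hab ?_
  filter_upwards [(tendsto_symm_half hp).eventually htan, (relOpen_target φ).2 _ hpt]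
    with z hz hzt hz0 v hv
  have hzs := symm_mem_source hzt
  have hzb : ext[φ].symm z ∈ (𝓡∂ n).boundary M := by
    rw [mem_boundary_iff hφ hzs, ext[φ].right_inv hzt, hz0]
  exact hz hzb _ ((isTangentToBoundary_iff hφ hzs hzb _).2 ((congrArg (fun w : Coord n => w 0) (coords_coordVec hφ hzt v)).trans hv))

/-- Normal derivatives in the sense of one-variable calculus. -/
theorem iteratedDerivWithin_line {F : Type*} [NormedAddCommGroup F] [NormedSpace ℝ F]
    {f : Coord n → F} {T : Set (Coord n)} (hT : RelOpen T) (hf : SmoothOn f T) {b : Coord n}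
    (hb0 : b 0 = 0) (k : ℕ) : ∀ s : ℝ, 0 ≤ s → b + s • basisVec 0 ∈ T →
    iteratedDerivWithin k (fun s : ℝ => f (b + s • basisVec 0)) (Ici 0) s =
      normalD^[k] f (b + s • basisVec 0) := by
  induction k with
  | zero => intro s _ _; rw [iteratedDerivWithin_zero]; rfl
  | succ k ih =>
    intro s hs hsT
    have hline : ∀ t : ℝ, 0 ≤ t → b + t • basisVec 0 ∈ 𝓗[n] := fun t ht => by
      rw [mem_half]; simp [hb0, basisVec, ht]
    have hd := hasDerivWithinAt_line (f := normalD^[k] f) hb0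
      ((hf.iterate_normalD hT.1 k).differentiableWithinAt hsT)
    have htend : Tendsto (fun t : ℝ => b + t • (basisVec 0 : Coord n)) (𝓝[Ici 0] s)
        (𝓝[𝓗[n]] (b + s • basisVec 0)) :=
      tendsto_nhdsWithin_iff.2 ⟨((by fun_prop : Continuous fun t : ℝ =>
        b + t • (basisVec 0 : Coord n)).tendsto s).mono_left nhdsWithin_le_nhds,
        eventually_mem_nhdsWithin.mono fun t ht => hline t ht⟩
    have hev : iteratedDerivWithin k (fun s : ℝ => f (b + s • basisVec 0)) (Ici 0)
        =ᶠ[𝓝[Ici 0] s] fun t => normalD^[k] f (b + t • basisVec 0) := by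
      filter_upwards [htend (hT.2 _ hsT), self_mem_nhdsWithin] with t ht ht0 using ih t ht0 ht
    rw [iteratedDerivWithin_succ, hev.derivWithin_eq (ih s hs hsT),
      (hd.derivWithin (uniqueDiffOn_Ici 0 s hs)), Function.iterate_succ_apply']

/-- Connects the one-variable derivatives along the normal line with iterated `normalD`; evaluation
at a basis vector is linear and commutes with differentiation. -/
theorem normalDeriv_eq (hφ : φ ∈ IsManifold.maximalAtlas (𝓡∂ n) ∞ M) {p : M} (hp : p ∈ φ.source)
    (hpb : p ∈ (𝓡∂ n).boundary M) (A : Potential n M G) (k : ℕ) (j : Fin n) :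
    normalDeriv φ p A k j = normalD^[k] (potentialIn A φ) (ext[φ] p) (basisVec j) := by
  have hs := smoothOn_potentialIn hφ A
  have hT := relOpen_target φ
  have hpt := ext_mem_target hp
  have hp0 := (mem_boundary_iff hφ hp).1 hpb
  have h1 := iteratedDerivWithin_line hT
    (SmoothOn.clm_apply hs (smoothOn_const (basisVec j : Coord n) _)) hp0 k 0 le_rfl
    (by simpa using hpt)
  have h2 := iterate_normalD_clm_comp hT
    (ContinuousLinearMap.apply ℝ (lieAlg G) (basisVec j : Coord n)) hs k hpt
  rw [normalDeriv, h1, zero_smul, add_zero]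
  exact h2

/-- Boundary determination of the normal derivatives in normal form. -/
theorem SameBoundaryLensDataOn.normalDeriv_eq (hφ : φ ∈ IsManifold.maximalAtlas (𝓡∂ n) ∞ M)
    (hlens : SameBoundaryLensDataOn g κ O W A B) (hW : IsOpen W) (hO : ContainsBasis O)
    {p : M} (hp : p ∈ φ.source) (hpb : p ∈ (𝓡∂ n).boundary M)
    (hA : StrictlyYMConvexAt g κ O A p) (hB : StrictlyYMConvexAt g κ O B p)
    (hpW : unitBoundaryVectors g p ⊆ W)
    (hA0 : NormalComponentVanishesNear φ p A) (hB0 : NormalComponentVanishesNear φ p B)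
    (htan : ∀ᶠ x in 𝓝 p, x ∈ (𝓡∂ n).boundary M → SamePullbackAt A B x) (k : ℕ) (j : Fin n) :
    normalDeriv φ p A k j = normalDeriv φ p B k j := by
  have hpt := ext_mem_target hp
  have hab : ∀ᶠ z in 𝓝[𝓗[n]] (ext[φ] p),
      potentialIn A φ z (basisVec 0) = potentialIn B φ z (basisVec 0) := by
    filter_upwards [(tendsto_symm_half hp).eventually (hA0.and hB0),
      (relOpen_target φ).2 _ hpt] with z hz hzt
    rw [ext[φ].right_inv hzt] at hz
    rw [hz.1, hz.2]
  obtain ⟨T, hT, hTφ, hpT, h⟩ := hlens.exists_nhds_normalD_eq_zero hφ hW hO hp hpb hA hB hpW hab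
    htan
  have h1 := iterate_normalD_sub hT ((smoothOn_potentialIn hφ A).mono hTφ)
    ((smoothOn_potentialIn hφ B).mono hTφ) k hpT
  rw [h k _ hpT ((mem_boundary_iff hφ hp).1 hpb)] at h1
  rw [YangMills.normalDeriv_eq hφ hp hpb, YangMills.normalDeriv_eq hφ hp hpb,
    sub_eq_zero.1 h1.symm]

/-- Near each point of the boundary the boundary jets agree after a gauge transformation. -/
theorem SameBoundaryLensDataOn.exists_local_sameJetAt (hG : IsCompact (G : Set (Mat N)ˣ))
    (hφ : φ ∈ IsManifold.maximalAtlas (𝓡∂ n) ∞ M)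
    (hlens : SameBoundaryLensDataOn g κ O W A B) (hW : IsOpen W) (hO : ContainsBasis O)
    {p : M} (hp : p ∈ φ.source) (hpb : p ∈ (𝓡∂ n).boundary M)
    (hA : StrictlyYMConvexAt g κ O A p) (hB : StrictlyYMConvexAt g κ O B p)
    (hpW : unitBoundaryVectors g p ⊆ W)
    (htan : ∀ x ∈ (𝓡∂ n).boundary M, SamePullbackAt A B x) :
    ∃ (u : M → G) (A' : Potential n M G), IsBoundaryGauge u A A' ∧ ∃ δ > 0,
      𝓗[n] ∩ Metric.ball (ext[φ] p) δ ⊆ ext[φ].target ∧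
      ∀ x ∈ (𝓡∂ n).boundary M, x ∈ φ.source → ext[φ] x ∈ Metric.ball (ext[φ] p) δ →
        SameJetAt A' B x := by
  -- The normal component of `A` is gauged to that of `B`, not to 0, so `B` remains untouched and
  -- serves as a common reference for all local gauges. The preferred chart need not be boundary
  -- normal.
  obtain ⟨u, A', hu, hab⟩ := exists_gauge_normal_component hG hφ hp hpb A
    (SmoothOn.clm_apply (smoothOn_potentialIn hφ B) (smoothOn_const (basisVec 0 : Coord n) _))
  have hl := hlens.gauge hu (isBoundaryGauge_one B)
  obtain ⟨T, hT, hTφ, hpT, h⟩ := hl.exists_nhds_normalD_eq_zero hφ hW hO hp hpb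
    (hu.strictlyYMConvexAt hpb hA) hB hpW hab
    (Eventually.of_forall fun x hx => (htan x hx).gauge hx hu (isBoundaryGauge_one B))
  obtain ⟨δ, hδ, hsub⟩ := hT.exists_ball hpT
  refine ⟨u, A', hu, δ, hδ, hsub.trans hTφ, fun x hx hxφ hxδ => ?_⟩
  exact sameJetAt_of_chart hφ hxφ fun m => jetZero_of_normalD hT
    ((smoothOn_potentialIn_sub hφ A' B).mono hTφ) (fun k _ => h k)
    (hsub ⟨mem_range_self _, hxδ⟩) ((mem_boundary_iff hφ hxφ).1 hx)

/-- Gauges achieving agreement of jets can be glued. -/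
theorem exists_gauge_union (hφ : φ ∈ IsManifold.maximalAtlas (𝓡∂ n) ∞ M) {w : M → G}
    {C : Potential n M G} (hu : IsBoundaryGauge u A A') (hw : IsBoundaryGauge w A C) {p₀ : Coord n}
    (hp0 : p₀ 0 = 0) {δ : ℝ} (hδ : 0 < δ) (hδT : 𝓗[n] ∩ Metric.ball p₀ δ ⊆ ext[φ].target)
    (h : ∀ x ∈ (𝓡∂ n).boundary M, x ∈ φ.source → ext[φ] x ∈ Metric.ball p₀ δ → SameJetAt A' B x)
    {S : Set M} (hS : ∀ x ∈ (𝓡∂ n).boundary M, x ∈ S → SameJetAt C B x) :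
    ∃ (v : M → G) (D : Potential n M G), IsBoundaryGauge v A D ∧
      ∀ x ∈ (𝓡∂ n).boundary M,
        x ∈ (φ.source ∩ ext[φ] ⁻¹' Metric.ball p₀ (δ / 4)) ∪ S → SameJetAt D B x := by
  -- The quotient gauge leads from `C`, which is good on `S`, to `A'`, which is good near the new
  -- point; its cutoff is applied to `C`.
  have hh := hw.symm.trans hu
  set k : M → G := fun x => (w x)⁻¹ * u x with hk
  obtain ⟨v, hv, hv1, heq, hflat⟩ := exists_gauge_cutoff hφ hp0 hδ hδT
    ((smoothOn_gaugeIn hφ hh.smoothGauge).mono hδT)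
    (fun z hz hz0 => by
      have hzb : ext[φ].symm z ∈ (𝓡∂ n).boundary M := by
        rw [mem_boundary_iff hφ (symm_mem_source (hδT hz)), ext[φ].right_inv (hδT hz), hz0]
      rw [gaugeIn, hh.boundary _ hzb]
      simp)
    (fun z hz => ⟨_, (k (ext[φ].symm z)).2, rfl⟩)
  obtain ⟨D, hD⟩ := exists_isBoundaryGauge C hv hv1
  refine ⟨_, D, hw.trans hD, fun x hx hxm => ?_⟩
  rcases hxm with ⟨hxφ, hxδ⟩ | hxS
  · have h1 := hD.sameJetAt_of_eventuallyEq hh hφ hxφ (relOpen_ball p₀ (δ / 4))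
      ((inter_subset_inter_right _ (Metric.ball_subset_ball (by linarith))).trans hδT)
      ⟨mem_range_self _, hxδ⟩ heq
    exact h1.trans (h x hx hxφ (Metric.ball_subset_ball (by linarith) hxδ))
  -- On the overlap both `A'` and `C` have the jet of `B`, so the quotient is flat there and its
  -- cutoff does not disturb the jets already matched on `S`.
  · have h1 : FlatGauge n v x := hflat x hx fun hxφ hxδ m =>
      hh.flatGauge hx ((h x hx hxφ hxδ).trans (hS x hx hxS).symm) φ hφ hxφ m
    exact (hD.sameJetAt h1).trans (hS x hx hxS)

/-- Boundary determination of the jets up to gauge. -/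
theorem SameBoundaryLensDataOn.exists_sameBoundaryJet [CompactSpace M]
    (hG : IsCompact (G : Set (Mat N)ˣ)) (hO : ContainsBasis O)
    (hlens : SameBoundaryLensDataOn g κ O univ A B)
    (hAB : ∀ x ∈ (𝓡∂ n).boundary M, StrictlyYMConvexAt g κ O A x ∧ StrictlyYMConvexAt g κ O B x)
    (htan : ∀ x ∈ (𝓡∂ n).boundary M, SamePullbackAt A B x) :
    ∃ (u : M → G) (A' : Potential n M G), IsBoundaryGauge u A A' ∧ SameBoundaryJet A' B := by
  classical
  -- The neighbourhood `V` is independent of the set `S` already treated, so a finite cover can be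
  -- chosen first and exhausted by induction.
  have hloc : ∀ p ∈ (𝓡∂ n).boundary M, ∃ V ∈ 𝓝 p, ∀ (S : Set M) (w : M → G) (C : Potential n M G),
      IsBoundaryGauge w A C → (∀ x ∈ (𝓡∂ n).boundary M, x ∈ S → SameJetAt C B x) →
      ∃ (v : M → G) (D : Potential n M G), IsBoundaryGauge v A D ∧
        ∀ x ∈ (𝓡∂ n).boundary M, x ∈ V ∪ S → SameJetAt D B x := fun p hp => by
    set φ := chartAt (EuclideanHalfSpace n) p with hφdef
    have hφ : φ ∈ IsManifold.maximalAtlas (𝓡∂ n) ∞ M := IsManifold.chart_mem_maximalAtlas _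
    have hpφ : p ∈ φ.source := mem_chart_source _ _
    obtain ⟨u, A', hu, δ, hδ, hδT, h⟩ := hlens.exists_local_sameJetAt hG hφ isOpen_univ hO hpφ hp
      (hAB p hp).1 (hAB p hp).2 (subset_univ _) htan
    refine ⟨φ.source ∩ ext[φ] ⁻¹' Metric.ball (ext[φ] p) (δ / 4),
      (φ.isOpen_extend_preimage Metric.isOpen_ball).mem_nhds
        ⟨hpφ, Metric.mem_ball_self (by positivity)⟩, fun S w C hw hS =>
      exists_gauge_union hφ hu hw ((mem_boundary_iff hφ hpφ).1 hp) hδ hδT h hS⟩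
  choose! V hV hstep using hloc
  obtain ⟨t, ht, hcover⟩ := ((𝓡∂ n).isClosed_boundary (n := ∞) (M := M) (by simp)).isCompact.elim_nhds_subcover V hV
  have hfin : ∀ s : Finset M, (∀ p ∈ s, p ∈ (𝓡∂ n).boundary M) →
      ∃ (v : M → G) (D : Potential n M G), IsBoundaryGauge v A D ∧
        ∀ x ∈ (𝓡∂ n).boundary M, x ∈ ⋃ p ∈ s, V p → SameJetAt D B x := by
    intro s
    induction s using Finset.induction_on with
    | empty => exact fun _ => ⟨_, A, isBoundaryGauge_one A, by simp⟩
    | insert p s hps ih =>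
      intro hs
      obtain ⟨w, C, hw, hC⟩ := ih fun q hq => hs q (Finset.mem_insert_of_mem hq)
      obtain ⟨v, D, hv, hD⟩ := hstep p (hs p (Finset.mem_insert_self _ _)) _ w C hw hC
      refine ⟨v, D, hv, fun x hx hxm => hD x hx ?_⟩
      rwa [Finset.set_biUnion_insert] at hxm
  obtain ⟨v, D, hv, hD⟩ := hfin t ht
  exact ⟨v, D, hv, sameBoundaryJet_of_sameJetAt fun x hx => hD x hx (hcover hx)⟩

end YangMills

end

/-! ### The boundary determination theorem -/

theorem mainTheorem4 {n : ℕ} [NeZero n] {M : Type*} [TopologicalSpace M] [T2Space M]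
    [CompactSpace M] [ConnectedSpace M] [ChartedSpace (EuclideanHalfSpace n) M]
    [IsManifold (𝓡∂ n) ∞ M] (g : YangMills.Metric n M)
    {N : ℕ} (G : Subgroup (YangMills.Mat N)ˣ) (hG : IsCompact (G : Set (YangMills.Mat N)ˣ))
    (κ : YangMills.AdInvariantInner G) (O : Set (YangMills.lieAlg G))
    (hO : ∃ ξ₀, O = YangMills.adjointOrbit ξ₀) (hbasis : YangMills.ContainsBasis O) :
    (∀ p ∈ (𝓡∂ n).boundary M, ∀ φ, YangMills.IsBoundaryNormalChart g p φ →
      (∀ A : YangMills.Potential n M G, ∃ (u : M → G) (A' : YangMills.Potential n M G),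
        YangMills.IsBoundaryGauge u A A' ∧ YangMills.NormalComponentVanishesNear φ p A') ∧
      (∀ (A B A' B' : YangMills.Potential n M G) (u w : M → G),
        YangMills.StrictlyYMConvexAt g κ O A p → YangMills.StrictlyYMConvexAt g κ O B p →
        YangMills.IsBoundaryGauge u A A' → YangMills.NormalComponentVanishesNear φ p A' →
        YangMills.IsBoundaryGauge w B B' → YangMills.NormalComponentVanishesNear φ p B' →
        (∃ W : Set (TangentBundle (𝓡∂ n) M), IsOpen W ∧
          YangMills.unitBoundaryVectors g p ⊆ W ∧ YangMills.SameLensDataOn g κ O W A B) →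
        (∀ᶠ x in 𝓝 p, x ∈ (𝓡∂ n).boundary M → YangMills.SamePullbackAt A B x) →
        ∀ (k : ℕ) (j : Fin n), j ≠ 0 →
          YangMills.normalDeriv φ p A' k j = YangMills.normalDeriv φ p B' k j)) ∧
    (∀ A B : YangMills.Potential n M G,
      (∀ x ∈ (𝓡∂ n).boundary M, YangMills.StrictlyYMConvexAt g κ O A x ∧
        YangMills.StrictlyYMConvexAt g κ O B x) →
      YangMills.SameLensDataOn g κ O univ A B →
      (∀ x ∈ (𝓡∂ n).boundary M, YangMills.SamePullbackAt A B x) →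
      ∃ (u : M → G) (A' : YangMills.Potential n M G),
        YangMills.IsBoundaryGauge u A A' ∧ YangMills.SameBoundaryJet A' B) := by
  refine ⟨fun p hp φ hφn => ⟨fun A => ?_,
    fun A B A' B' u w hA hB hu hA0 hw hB0 ⟨W, hW, hpW, hl⟩ htan k j _ => ?_⟩,
    fun A B hAB hlens htan =>
      hlens.boundary.exists_sameBoundaryJet hG hbasis hAB htan⟩
  · obtain ⟨u, A', hu, h⟩ := YangMills.exists_gauge_normal_component hG hφn.mem_atlas
      hφn.mem_source hp A (b := fun _ => 0) (YangMills.smoothOn_const 0 _)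
    exact ⟨u, A', hu, (YangMills.tendsto_ext_half hφn.mem_source).eventually h⟩
  · exact (hl.boundary.gauge hu hw).normalDeriv_eq hφn.mem_atlas hW hbasis hφn.mem_source hp
      (hu.strictlyYMConvexAt hp hA) (hw.strictlyYMConvexAt hp hB) hpW hA0 hB0
      (htan.mono fun x hx hxb => (hx hxb).gauge hxb hu hw) k j
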